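/- Let $\sigma,\vartheta_0,\vartheta_1,\vartheta_2\in\mathbb R$ with $\sigma^2>0$, $\vartheta_2>0$ and $\Gamma+\pi^2>0$, where $\kappa:=\vartheta_1/\vartheta_2$ and $\Gamma:=\frac{\vartheta_1^2}{4\vartheta_2^2}-\frac{\vartheta_0}{\vartheta_2}$. Let $X$ be the stationary solution of the SPDE $$dX_t(x)=\big(\vartheta_2\partial_x^2X_t(x)+\vartheta_1\partial_xX_t(x)+\vartheta_0X_t(x)\big)dt+\sigma\,dW_t(x),\qquad X_t(0)=X_t(1)=0,$$ on $[0,1]$ driven by a cylindrical Brownian motion, that is, $$X_t(x)=\sum_{\ell\ge1}u_\ell(t)e_\ell(x),\qquad e_\ell(x)=\sqrt2\sin(\pi\ell x)e^{-\kappa x/2},\qquad t\ge0,\ x\in[0,1],$$ where $du_\ell(t)=-\lambda_\ell u_\ell(t)\,dt+\sigma\,d\beta_\ell(t)$ with $\lambda_\ell=\vartheta_2(\pi^2\ell^2+\Gamma)$, the $\beta_\ell$ are standard Brownian motions, $u_\ell(0)\sim\mathcal N(0,\sigma^2/(2\lambda_\ell))$, and the family $\{\beta_\ell,u_\ell(0):\ell\ge1\}$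 is independent. Fix $T>0$ and $b\in(0,1/2)$. For $M,N\in\mathbb N$ put $\delta=(1-2b)/M$, $\Delta=T/N$, $y_k=b+k\delta$, $t_i=i\Delta$, $$D_{ik}=X_{t_{i+1}}(y_{k+1})-X_{t_{i+1}}(y_k)-X_{t_i}(y_{k+1})+X_{t_i}(y_k),$$ $$F_{\vartheta_2}(\delta,\Delta)=\sum_{\ell\ge1}\frac{1-e^{-\pi^2\vartheta_2\ell^2\Delta}}{\pi^2\vartheta_2\ell^2}\cos(\pi\ell\delta),\qquad \Phi_\vartheta(\delta,\Delta)=F_{\vartheta_2}(0,\Delta)(1+e^{-\kappa\delta})-2F_{\vartheta_2}(\delta,\Delta)e^{-\kappa\delta/2},$$ $$\mathbb V=\frac{1}{MN\,\Phi_\vartheta(\delta,\Delta)}\sum_{k=0}^{M-1}\sum_{i=0}^{N-1}e^{\kappa y_k}D_{ik}^2 .$$ Further let $$H(x)=\frac1{2\sqrt\pi}\Big(e^{-x^2/4}-x\int_{x/2}^\infty e^{-z^2}dz\Big),\qquad G_h(j,l)=\sqrt{|j|}\,H\Big(\frac{h|l|}{\sqrt{|j|}}\Big)\mathbf 1_{\{j\ne0\}},$$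 $$\Lambda_{j,l}(h)=(D_x^2D_y^2G_h)(|j|-1,|l|-1),\qquad j,l\in\mathbb Z,$$ where $D_x^2f(x,y)=f(x+2,y)+f(x,y)-2f(x+1,y)$ and $D_y^2f(x,y)=f(x,y+2)+f(x,y)-2f(x,y+1)$. Then there is a bounded continuous function $C:[0,\infty]\to\mathbb R$, not depending on the model, with $$C(h)=\frac{2}{\Lambda_{0,0}^2(h)}\sum_{j,l\in\mathbb Z}\Lambda_{j,l}^2(h)\quad\text{for }0<h<\infty$$ (where $\Lambda_{0,0}(h)\neq0$ and the series converges), $$C(0)=3,\qquad C(\infty)=3+\frac32\sum_{J=1}^\infty\big(\sqrt{J-1}+\sqrt{J+1}-2\sqrt J\big)^2<\infty,$$ such that the following holds. If $M,N\to\infty$ in such a way that either $\delta/\sqrt\Delta\to r\in\{0,\infty\}$ or $\delta/\sqrt\Delta\equiv r\in(0,\infty)$, then $$\sqrt{MN}\,(\mathbb V-\sigma^2)\ \xrightarrow{\ \mathcal D\ }\ \mathcal N\big(0,\;C(r/\sqrt{\vartheta_2})\,\sigma^4\big).$$ -/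

import Mathlib

open MeasureTheory ProbabilityTheory Filter Topology
open scoped NNReal ENNReal

noncomputable section

namespace SPDE

/-! ### The differential operator `A = ϑ₂ ∂² + ϑ₁ ∂ + ϑ₀` on `[0,1]`, Dirichlet conditions

Eigenpairs are numbered by `ℓ = 1, 2, …`. -/

/-- `κ = ϑ₁ / ϑ₂`. -/
def kappa (ϑ₂ ϑ₁ : ℝ) : ℝ := ϑ₁ / ϑ₂

/-- `Γ = ϑ₁² / (4 ϑ₂²) - ϑ₀ / ϑ₂`. -/
def Gam (ϑ₂ ϑ₁ ϑ₀ : ℝ) : ℝ := ϑ₁ ^ 2 / (4 * ϑ₂ ^ 2) - ϑ₀ / ϑ₂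

/-- `λ_ℓ = ϑ₂ (π² ℓ² + Γ)`; the eigenvalues of `A` are `-λ_ℓ`. -/
def eigenvalue (ϑ₂ ϑ₁ ϑ₀ : ℝ) (ℓ : ℕ) : ℝ :=
  ϑ₂ * (Real.pi ^ 2 * (ℓ : ℝ) ^ 2 + Gam ϑ₂ ϑ₁ ϑ₀)

/-- `e_ℓ(y) = √2 sin(π ℓ y) exp(-κ y / 2)`. -/
def eigenfunction (ϑ₂ ϑ₁ : ℝ) (ℓ : ℕ) (y : ℝ) : ℝ :=
  √2 * Real.sin (Real.pi * ℓ * y) * Real.exp (-(kappa ϑ₂ ϑ₁ * y / 2))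

/-- The parameter space `Θ`. -/
def Admissible (σ ϑ₂ ϑ₁ ϑ₀ : ℝ) : Prop :=
  0 < σ ^ 2 ∧ 0 < ϑ₂ ∧ 0 < Gam ϑ₂ ϑ₁ ϑ₀ + Real.pi ^ 2

/-! ### The solution field -/

/-- `X` is the stationary solution of `dX = A X dt + σ dW` with Dirichlet boundary conditions, where
the cylindrical Brownian motion is `W_t = ∑_{ℓ ≥ 1} β_ℓ(t) e_ℓ`: the field is
`X_t(x) = ∑_{ℓ ≥ 1} u_ℓ(t) e_ℓ(x)`, where `du_ℓ = -λ_ℓ u_ℓ dt + σ dβ_ℓ`, the `β_ℓ` are standard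
Brownian motions, `u_ℓ(0) ∼ N(0, σ² / (2 λ_ℓ))`, and all the `β_ℓ` and `u_ℓ(0)` are independent.
The mode with number `ℓ` is stored at index `ℓ - 1`: `β n` and `u n` belong to `ℓ = n + 1`. -/
structure IsStationarySolution {Ω : Type*} [MeasurableSpace Ω] (P : Measure Ω)
    (σ ϑ₂ ϑ₁ ϑ₀ : ℝ) (β u : ℕ → ℝ≥0 → Ω → ℝ) (X : ℝ≥0 → ℝ → Ω → ℝ) : Prop where
  measurable_β : ∀ n t, Measurable (β n t)
  measurable_u : ∀ n t, Measurable (u n t)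
  /-- each `β_ℓ` is a standard Brownian motion -/
  brownian : ∀ n, IsBrownianReal (β n) P
  /-- stationary initial distribution -/
  initial : ∀ n, HasLaw (u n 0)
    (gaussianReal 0 (σ ^ 2 / (2 * eigenvalue ϑ₂ ϑ₁ ϑ₀ (n + 1))).toNNReal) P
  /-- the pairs `(u_ℓ(0), β_ℓ)`, `ℓ ≥ 1`, are independent … -/
  indep_modes : iIndepFun (fun n ω ↦ (u n 0 ω, fun t ↦ β n t ω)) P
  /-- … and in each pair the two components are independent -/
  indep_initial : ∀ n, IndepFun (u n 0) (fun ω t ↦ β n t ω) P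
  continuous_u : ∀ n, ∀ᵐ ω ∂P, Continuous (fun t ↦ u n t ω)
  /-- the Ornstein-Uhlenbeck equation, in integrated form -/
  dynamics : ∀ n, ∀ᵐ ω ∂P, ∀ t : ℝ≥0,
    u n t ω = u n 0 ω
      - eigenvalue ϑ₂ ϑ₁ ϑ₀ (n + 1) * (∫ s in (0 : ℝ)..t, u n s.toNNReal ω)
      + σ * β n t ω
  /-- the series expansion of the field -/
  expansion : ∀ t : ℝ≥0, ∀ x ∈ Set.Icc (0 : ℝ) 1, ∀ᵐ ω ∂P,
    Tendsto (fun L : ℕ ↦ ∑ n ∈ Finset.range L, u n t ω * eigenfunction ϑ₂ ϑ₁ (n + 1) x)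
      atTop (𝓝 (X t x ω))

/-! ### Sampling grid and realized space-time quadratic variation -/

/-- spatial mesh `δ = (1 - 2b) / M` -/
def meshSpace (b : ℝ) (M : ℕ) : ℝ := (1 - 2 * b) / M

/-- temporal mesh `Δ = T / N` -/
def meshTime (T : ℝ) (N : ℕ) : ℝ := T / N

/-- `y_k = b + k δ` -/
def gridSpace (b : ℝ) (M k : ℕ) : ℝ := b + k * meshSpace b M

/-- `t_i = i Δ` -/
def gridTime (T : ℝ) (N i : ℕ) : ℝ≥0 := (i * meshTime T N).toNNReal

/-- The double increment `D_{ik}`. -/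
def doubleIncrement {Ω : Type*} (X : ℝ≥0 → ℝ → Ω → ℝ) (b T : ℝ) (M N i k : ℕ) (ω : Ω) : ℝ :=
  X (gridTime T N (i + 1)) (gridSpace b M (k + 1)) ω
    - X (gridTime T N (i + 1)) (gridSpace b M k) ω
    - X (gridTime T N i) (gridSpace b M (k + 1)) ω
    + X (gridTime T N i) (gridSpace b M k) ω

/-- `F_{ϑ₂}(δ, Δ) = ∑_{ℓ ≥ 1} (1 - exp(-π² ϑ₂ ℓ² Δ)) / (π² ϑ₂ ℓ²) · cos(π ℓ δ)`. -/
def F (ϑ₂ δ Δ : ℝ) : ℝ :=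
  ∑' n : ℕ, (1 - Real.exp (-(Real.pi ^ 2 * ϑ₂ * (n + 1 : ℝ) ^ 2 * Δ)))
    / (Real.pi ^ 2 * ϑ₂ * (n + 1 : ℝ) ^ 2) * Real.cos (Real.pi * (n + 1 : ℝ) * δ)

/-- `Φ_ϑ(δ, Δ) = F(0, Δ) (1 + exp(-κ δ)) - 2 F(δ, Δ) exp(-κ δ / 2)`. -/
def Phi (ϑ₂ ϑ₁ δ Δ : ℝ) : ℝ :=
  F ϑ₂ 0 Δ * (1 + Real.exp (-(kappa ϑ₂ ϑ₁ * δ)))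
    - 2 * F ϑ₂ δ Δ * Real.exp (-(kappa ϑ₂ ϑ₁ * δ / 2))

/-- The rescaled realized space-time quadratic variation. -/
def realizedVariation {Ω : Type*} (X : ℝ≥0 → ℝ → Ω → ℝ) (ϑ₂ ϑ₁ b T : ℝ) (M N : ℕ) (ω : Ω) : ℝ :=
  1 / (M * N * Phi ϑ₂ ϑ₁ (meshSpace b M) (meshTime T N)) *
    ∑ k ∈ Finset.range M, ∑ i ∈ Finset.range N,
      Real.exp (kappa ϑ₂ ϑ₁ * gridSpace b M k) * doubleIncrement X b T M N i k ω ^ 2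

/-- The sampling regime with parameter `r ∈ [0, ∞]`, where `ρ n` is the ratio `δ / √Δ`:
either `ρ → r` with `r ∈ {0, ∞}`, or `ρ ≡ r` with `r ∈ (0, ∞)`. -/
def SamplingRegime (ρ : ℕ → ℝ) (r : ℝ≥0∞) : Prop :=
  (r = 0 ∧ Tendsto ρ atTop (𝓝 0)) ∨
  (r = ∞ ∧ Tendsto ρ atTop atTop) ∨
  (∃ r₀ : ℝ, 0 < r₀ ∧ r = ENNReal.ofReal r₀ ∧ ∀ n, ρ n = r₀)

/-! ### The asymptotic variance -/

/-- `H(x) = (exp(-x²/4) - x ∫_{x/2}^∞ exp(-z²) dz) / (2 √π)`. -/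
def H (x : ℝ) : ℝ :=
  1 / (2 * √Real.pi) *
    (Real.exp (-(x ^ 2 / 4)) - x * ∫ z in Set.Ioi (x / 2), Real.exp (-z ^ 2))

/-- `G_h(j, l) = √|j| H(h |l| / √|j|)` for `j ≠ 0`, and `0` for `j = 0`. -/
def G (h : ℝ) (j l : ℤ) : ℝ :=
  if j = 0 then 0 else √(|j| : ℝ) * H (h * |(l : ℝ)| / √(|j| : ℝ))

/-- second difference in the first variable -/
def diffX (f : ℤ → ℤ → ℝ) (x y : ℤ) : ℝ := f (x + 2) y + f x y - 2 * f (x + 1) y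

/-- second difference in the second variable -/
def diffY (f : ℤ → ℤ → ℝ) (x y : ℤ) : ℝ := f x (y + 2) + f x y - 2 * f x (y + 1)

/-- `Λ_{j,l}(h) = (D²ₓ D²ᵧ G_h)(|j| - 1, |l| - 1)`. -/
def Lam (h : ℝ) (j l : ℤ) : ℝ := diffX (diffY (G h)) (|j| - 1) (|l| - 1)

/-- `√(J - 1) + √(J + 1) - 2 √J`, for `J ≥ 1`. -/
def sqrtDiff (J : ℕ) : ℝ := √((J : ℝ) - 1) + √((J : ℝ) + 1) - 2 * √(J : ℝ)

/-- `C` is the asymptotic variance function: bounded and continuous on `[0, ∞]`, equal to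
`2 Λ_{0,0}(h)⁻² ∑_{j,l ∈ ℤ} Λ_{j,l}(h)²` (a convergent series, and `Λ_{0,0}(h) ≠ 0`) for
`0 < h < ∞`, with the stated values at the end points. -/
structure IsAsymptoticVariance (C : ℝ≥0∞ → ℝ) : Prop where
  continuous : Continuous C
  bounded : ∃ K : ℝ, ∀ h, |C h| ≤ K
  ne_zero : ∀ h : ℝ, 0 < h → Lam h 0 0 ≠ 0
  summable : ∀ h : ℝ, 0 < h → Summable (fun p : ℤ × ℤ ↦ Lam h p.1 p.2 ^ 2)
  eq : ∀ h : ℝ, 0 < h →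
    C (ENNReal.ofReal h) = 2 / Lam h 0 0 ^ 2 * ∑' p : ℤ × ℤ, Lam h p.1 p.2 ^ 2
  at_zero : C 0 = 3
  summable_top : Summable (fun n : ℕ ↦ sqrtDiff (n + 1) ^ 2)
  at_top : C ∞ = 3 + 3 / 2 * ∑' n : ℕ, sqrtDiff (n + 1) ^ 2

end SPDE

end

/-! The double increments, rescaled by `exp(κ y_k / 2)`, form a centred Gaussian vector, so `√(MN)
(𝕍 - σ²)` is a squared Gaussian norm minus a constant. Diagonalising its covariance matrix `S` turns
it into a weighted sum of independent centred chi-squares, with the eigenvalues of `S` as weights.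
Such a sum is asymptotically normal as soon as `tr S` is asymptotically the centring constant, `2
‖S‖²` (Frobenius) converges to the limit variance, and the operator norm of `S` vanishes; this is
`tendstoInDistribution_gaussian_quadratic`. Everything else is an analysis of `S`.

Gaussianity comes from an autoregressive approximation of each Ornstein-Uhlenbeck mode whose
finite-dimensional laws are exact at every mesh (`integral_exp_modes`), so no stochastic integral is
needed. The covariance of two increments is then a series over `ℓ` of a second time difference of
`exp(-λ_ℓ t) / λ_ℓ` times a product of sine increments. Replacing `λ_ℓ` by `π² ϑ₂ ℓ²` leaves an
error that is summable over the time lags. The product-to-sum formula splits the remaining series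
into second differences of `F` at `y_k - y_l` and at the reflected point `y_k + y_l + δ`. By Poisson
summation (`hasSum_heat_images`), the time derivative of `F` is a sum of heat kernels over images.
Reflected points stay away from all images because `b > 0`, and differences of grid points see only
the image at the origin as singular. The Brownian scaling of that image produces `-σ² · amplitude ·
Λ_{i-j,k-l}(h)` with `h = δ / √(ϑ₂ Δ)`. These estimates are collected in
`exists_incrementCov_bounds`.

Since `Φ` is asymptotically `-amplitude · Λ₀₀(h)`, the normalised Frobenius norm is a weighted form
of `2 Λ₀₀⁻² ∑ Λ²`, the weights being the proportions of index pairs with a given lag. Away from `h =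
0` dominated convergence applies, including at `h = ∞`. As `h → 0` only the entries with `|j| ≤ 1`
and `l = 0` are of order `h`, and `2 (1 + 1/4 + 1/4) = 3`. The same limit theorem,
`tendsto_weighted_asympVar`, with unit weights gives the continuity of `C`. The operator norm is
controlled by Schur's test on the `Λ` part and by the Frobenius norm on the remainder. For the
trace, two competing bounds for the variance error are needed, one for each side of `δ = √Δ`. -/

/-! ### A central limit theorem for Gaussian quadratic forms -/

section GaussianQuadraticForm

open Complex

/-- The fourth moment of a standard Gaussian variable. -/
lemma integral_pow_four_gaussianReal : ∫ x, x ^ 4 ∂(gaussianReal 0 1) = 3 := by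
  have h0 : mgf id (gaussianReal 0 1) = fun t ↦ Real.exp (t ^ 2 / 2) := by
    rw [mgf_id_gaussianReal]; ext t; simp
  have h := iteratedDeriv_mgf_zero (X := id) (μ := gaussianReal 0 1)
    (by simp [integrableExpSet_id_gaussianReal]) 4
  have hE (t : ℝ) : HasDerivAt (fun t : ℝ ↦ Real.exp (t ^ 2 / 2)) (t * Real.exp (t ^ 2 / 2)) t := by
    have := ((hasDerivAt_pow 2 t).div_const 2).exp
    convert this using 1
    simp; ring
  have d1 : deriv (fun t : ℝ ↦ Real.exp (t ^ 2 / 2)) = fun t ↦ t * Real.exp (t ^ 2 / 2) :=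
    funext fun t ↦ (hE t).deriv
  have d2 : deriv (fun t : ℝ ↦ t * Real.exp (t ^ 2 / 2)) =
      fun t ↦ (1 + t ^ 2) * Real.exp (t ^ 2 / 2) := by
    funext t
    rw [((hasDerivAt_id' t).fun_mul (hE t)).deriv]; ring
  have d3 : deriv (fun t : ℝ ↦ (1 + t ^ 2) * Real.exp (t ^ 2 / 2)) =
      fun t ↦ (3 * t + t ^ 3) * Real.exp (t ^ 2 / 2) := by
    funext t
    rw [(((hasDerivAt_pow 2 t).const_add 1).fun_mul (hE t)).deriv]; simp; ring
  have d4 : deriv (fun t : ℝ ↦ (3 * t + t ^ 3) * Real.exp (t ^ 2 / 2)) 0 = 3 := by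
    rw [((((hasDerivAt_id' (0 : ℝ)).const_mul 3).fun_add (hasDerivAt_pow 3 (0 : ℝ))).fun_mul
      (hE 0)).deriv]
    simp
  rw [h0] at h
  simp only [iteratedDeriv_succ, iteratedDeriv_zero, d1, d2, d3, d4] at h
  simpa using h.symm

lemma integral_sq_gaussianReal : ∫ x, x ^ 2 ∂(gaussianReal 0 1) = 1 := by
  have h := variance_eq_sub (μ := gaussianReal 0 1) (X := id) (memLp_id_gaussianReal 2)
  rw [variance_id_gaussianReal] at h
  simpa [integral_id_gaussianReal] using h.symm

/-- The characteristic function of `Z ^ 2 - 1` for a standard Gaussian `Z`. -/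
noncomputable def chiSqCharFun (s : ℝ) : ℂ :=
  ∫ x, cexp (I * ((s * (x ^ 2 - 1) : ℝ) : ℂ)) ∂(gaussianReal 0 1)

lemma norm_chiSqCharFun_le (s : ℝ) : ‖chiSqCharFun s‖ ≤ 1 := by
  refine (norm_integral_le_integral_norm _).trans ?_
  simp only [mul_comm I, norm_exp_ofReal_mul_I]
  simp

/-- By the second and fourth moments, `(Z² - 1) / √2` is centred with unit variance, so the
second-order Taylor expansion of characteristic functions applies; the substitution `t = √2 s` turns
`1 - t² / 2` into `1 - s²`. -/
lemma chiSqCharFun_isLittleO :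
    (fun s ↦ chiSqCharFun s - (1 - (s : ℂ) ^ 2)) =o[𝓝 0] fun s : ℝ ↦ s ^ 2 := by
  have i4 : Integrable (fun x : ℝ ↦ x ^ 4) (gaussianReal 0 1) :=
    .of_integral_ne_zero (by rw [integral_pow_four_gaussianReal]; norm_num)
  have i2 : Integrable (fun x : ℝ ↦ x ^ 2) (gaussianReal 0 1) :=
    .of_integral_ne_zero (by rw [integral_sq_gaussianReal]; norm_num)
  have h2 : (√2 : ℝ) ^ 2 = 2 := Real.sq_sqrt (by norm_num)
  have hne : (√2 : ℝ) ≠ 0 := by positivity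
  set X : ℝ → ℝ := fun x ↦ (x ^ 2 - 1) / √2
  have hX : Measurable X := by fun_prop
  have e0 : (gaussianReal 0 1)[X] = 0 := by
    simp only [X]
    rw [integral_div, integral_sub i2 (integrable_const _), integral_sq_gaussianReal]
    simp
  have e1 : (gaussianReal 0 1)[X ^ 2] = 1 := by
    have : ∀ x, (X ^ 2) x = (x ^ 4 - 2 * x ^ 2 + 1) / 2 := by
      intro x; simp only [X, Pi.pow_apply, div_pow, h2]; ring
    simp_rw [this]
    have i5 : Integrable (fun x : ℝ ↦ x ^ 4 - 2 * x ^ 2) (gaussianReal 0 1) :=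
      i4.sub (i2.const_mul 2)
    rw [integral_div, integral_add i5 (integrable_const _), integral_sub i4 (i2.const_mul 2),
      integral_const_mul, integral_sq_gaussianReal,
      integral_pow_four_gaussianReal]
    simp; norm_num
  have h := taylor_charFun_two hX.aemeasurable e0 e1
  have hl : Tendsto (fun s : ℝ ↦ √2 * s) (𝓝 0) (𝓝 0) := by
    have : Continuous fun s : ℝ ↦ √2 * s := by fun_prop
    simpa using this.tendsto 0
  have h' := h.comp_tendsto hl
  have hO : ((fun t : ℝ ↦ t ^ 2) ∘ fun s ↦ √2 * s) =O[𝓝 0] fun s : ℝ ↦ s ^ 2 := by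
    refine Asymptotics.IsBigO.of_bound 2 (Eventually.of_forall fun s ↦ ?_)
    simp only [Function.comp, mul_pow, h2]
    simp
  refine (h'.trans_isBigO hO).congr_left fun s ↦ ?_
  simp only [Function.comp, charFun_apply_real, chiSqCharFun]
  rw [integral_map hX.aemeasurable (by fun_prop)]
  congr 1
  · refine integral_congr_ae (ae_of_all _ fun x ↦ ?_)
    simp only [X]
    congr 1
    have : (√2 : ℂ) ≠ 0 := by exact_mod_cast hne
    push_cast
    field_simp
  · push_cast
    rw [mul_pow, ← ofReal_pow, h2]
    push_cast
    ring

variable {ι Ω : Type*} [Fintype ι] [MeasurableSpace Ω]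

/-- A random vector is centred Gaussian with covariance matrix `S`, expressed through the
characteristic functions of its linear combinations. -/
def IsCenteredGaussianVector (P : Measure Ω) (ξ : ι → Ω → ℝ) (S : Matrix ι ι ℝ) : Prop :=
  (∀ i, AEMeasurable (ξ i) P) ∧ ∀ a : ι → ℝ,
    ∫ ω, cexp (I * ((∑ i, a i * ξ i ω : ℝ) : ℂ)) ∂P =
      ((Real.exp (-(1 / 2) * ∑ i, ∑ j, a i * a j * S i j) : ℝ) : ℂ)

/-- A characteristic function has modulus at most one, so its Gaussian exponent cannot be positive.
Positive semidefiniteness therefore never has to be assumed. -/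
lemma IsCenteredGaussianVector.quadraticForm_nonneg {P : Measure Ω} [IsProbabilityMeasure P]
    {ξ : ι → Ω → ℝ} {S : Matrix ι ι ℝ} (h : IsCenteredGaussianVector P ξ S) (a : ι → ℝ) :
    0 ≤ ∑ i, ∑ j, a i * a j * S i j := by
  have h1 : ‖∫ ω, cexp (I * ((∑ i, a i * ξ i ω : ℝ) : ℂ)) ∂P‖ ≤ 1 := by
    refine (norm_integral_le_integral_norm _).trans ?_
    simp only [mul_comm I, norm_exp_ofReal_mul_I]
    simp
  rw [h.2 a, norm_real, Real.norm_eq_abs, abs_of_pos (Real.exp_pos _)] at h1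
  have := Real.exp_le_one_iff.1 h1
  linarith

lemma IsCenteredGaussianVector.posSemidef {P : Measure Ω} [IsProbabilityMeasure P]
    {ξ : ι → Ω → ℝ} {S : Matrix ι ι ℝ} (h : IsCenteredGaussianVector P ξ S)
    (hS : S.IsHermitian) : S.PosSemidef := by
  refine Matrix.PosSemidef.of_dotProduct_mulVec_nonneg hS fun x ↦ ?_
  have := h.quadraticForm_nonneg x
  have e : star x ⬝ᵥ S.mulVec x = ∑ i, ∑ j, x i * x j * S i j := by
    simp only [dotProduct, Matrix.mulVec, Finset.mul_sum, star_trivial]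
    exact Finset.sum_congr rfl fun i _ ↦ Finset.sum_congr rfl fun j _ ↦ by ring
  rwa [e]

variable [DecidableEq ι]

lemma Matrix.IsHermitian.sum_mul_eq_eigenvalues {S : Matrix ι ι ℝ} (hS : S.IsHermitian)
    (t : EuclideanSpace ℝ ι) :
    ∑ i, ∑ j, t i * t j * S i j =
      ∑ k, hS.eigenvalues k * inner ℝ (hS.eigenvectorBasis k) t ^ 2 := by
  set b := hS.eigenvectorBasis
  have h1 : ∑ i, ∑ j, t i * t j * S i j =
      inner ℝ (WithLp.toLp 2 (S.mulVec t)) t := by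
    simp only [PiLp.inner_apply, Matrix.mulVec, dotProduct]
    refine Finset.sum_congr rfl fun i _ ↦ ?_
    simp only [RCLike.inner_apply, conj_trivial, Finset.mul_sum]
    exact Finset.sum_congr rfl fun j _ ↦ by ring
  rw [h1, ← OrthonormalBasis.sum_inner_mul_inner b]
  refine Finset.sum_congr rfl fun k _ ↦ ?_
  have h2 : inner ℝ (WithLp.toLp 2 (S.mulVec t)) (b k) =
      hS.eigenvalues k * inner ℝ (b k) t := by
    have h3 : inner ℝ (WithLp.toLp 2 (S.mulVec t)) (b k) =
        inner ℝ (WithLp.toLp 2 (S.mulVec (b k))) t := by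
      simp only [PiLp.inner_apply, Matrix.mulVec, dotProduct, RCLike.inner_apply, conj_trivial,
        Finset.mul_sum]
      rw [Finset.sum_comm]
      refine Finset.sum_congr rfl fun i _ ↦ Finset.sum_congr rfl fun j _ ↦ ?_
      have : S j i = S i j := by simpa using hS.apply i j
      rw [this]; ring
    rw [h3, hS.mulVec_eigenvectorBasis, WithLp.toLp_smul, real_inner_smul_left]
  rw [h2]; ring

/-- Both sides are the trace of `S²`. -/
lemma Matrix.IsHermitian.sum_sq_eq_sum_eigenvalues_sq {S : Matrix ι ι ℝ} (hS : S.IsHermitian) :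
    ∑ i, ∑ j, S i j ^ 2 = ∑ k, hS.eigenvalues k ^ 2 := by
  have h1 : ∑ i, ∑ j, S i j ^ 2 = (S * S).trace := by
    simp only [Matrix.trace, Matrix.diag, Matrix.mul_apply]
    refine Finset.sum_congr rfl fun i _ ↦ Finset.sum_congr rfl fun j _ ↦ ?_
    have : S j i = S i j := by simpa using hS.apply i j
    rw [this]; ring
  rw [h1]
  conv_lhs => rw [hS.spectral_theorem]
  rw [← map_mul, Matrix.diagonal_mul_diagonal, Unitary.conjStarAlgAut_apply, Matrix.trace_mul_cycle]
  simp [Matrix.trace_diagonal, sq]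

/-- In an eigenbasis the vector has independent coordinates of variance `λ_k`, and the trace is `∑
λ_k`; hence the centred squared norm is distributed as `∑ λ_k (x_k² - 1)` with independent standard
Gaussian `x_k`, and the expectation factorises. -/
lemma IsCenteredGaussianVector.integral_exp_quadratic {P : Measure Ω} [IsProbabilityMeasure P]
    {ξ : ι → Ω → ℝ} {S : Matrix ι ι ℝ} (h : IsCenteredGaussianVector P ξ S)
    (hS : S.IsHermitian) (t : ℝ) :
    ∫ ω, cexp (I * ((t * (∑ i, ξ i ω ^ 2 - S.trace) : ℝ) : ℂ)) ∂P =
      ∏ k, chiSqCharFun (t * hS.eigenvalues k) := by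
  have hpos := h.posSemidef hS
  set b := hS.eigenvectorBasis with hb
  set lam := hS.eigenvalues with hlam
  have hlam0 : ∀ k, 0 ≤ lam k := hpos.eigenvalues_nonneg
  set Y : Ω → EuclideanSpace ℝ ι := fun ω ↦ WithLp.toLp 2 (fun i ↦ ξ i ω) with hY
  have hYm : AEMeasurable Y P := by
    have : AEMeasurable (fun ω i ↦ ξ i ω) P := aemeasurable_pi_lambda _ h.1
    exact (by fun_prop : Measurable (WithLp.toLp 2 : (ι → ℝ) → EuclideanSpace ℝ ι)).comp_aemeasurable
      this
  set π := Measure.pi (fun _ : ι ↦ gaussianReal 0 1) with hπ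
  set A : (ι → ℝ) → EuclideanSpace ℝ ι := fun x ↦ ∑ k, (√(lam k) * x k) • b k with hA
  have hAm : Measurable A := by fun_prop
  -- The law is identified through characteristic functions, so a degenerate `S` needs no separate
  -- treatment.
  have key : P.map Y = π.map A := by
    have : IsProbabilityMeasure (P.map Y) := Measure.isProbabilityMeasure_map hYm
    have : IsProbabilityMeasure (π.map A) := Measure.isProbabilityMeasure_map hAm.aemeasurable
    apply Measure.ext_of_charFun (E := EuclideanSpace ℝ ι)
    ext s
    rw [charFun_apply, charFun_apply, integral_map hYm (by fun_prop),
      integral_map hAm.aemeasurable (by fun_prop)]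
    have e1 : ∀ ω, cexp (inner ℝ (Y ω) s * I) = cexp (I * ((∑ i, s i * ξ i ω : ℝ) : ℂ)) := by
      intro ω
      rw [mul_comm]
      simp [hY, PiLp.inner_apply]
    simp_rw [e1]
    rw [h.2 (fun i ↦ s i), hS.sum_mul_eq_eigenvalues s]
    have e2 : ∀ x, cexp (inner ℝ (A x) s * I) =
        ∏ k, cexp ((√(lam k) * inner ℝ (b k) s : ℝ) * (x k : ℂ) * I) := by
      intro x
      rw [← Complex.exp_sum]
      congr 1
      rw [← Finset.sum_mul]
      congr 1
      simp only [hA, sum_inner, real_inner_smul_left]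
      push_cast
      exact Finset.sum_congr rfl fun k _ ↦ by ring
    simp_rw [e2]
    rw [integral_fintype_prod_eq_prod (μ := fun _ : ι ↦ gaussianReal 0 1)
      (f := fun k (x : ℝ) ↦ cexp ((√(lam k) * inner ℝ (b k) s : ℝ) * (x : ℂ) * I))]
    simp_rw [← charFun_apply_real, charFun_gaussianReal]
    rw [← Complex.exp_sum, ofReal_exp]
    congr 1
    push_cast
    rw [Finset.mul_sum]
    refine Finset.sum_congr rfl fun k _ ↦ ?_
    have : ((√(lam k) : ℂ)) ^ 2 = lam k := by rw [← ofReal_pow, Real.sq_sqrt (hlam0 k)]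
    rw [mul_pow, this]
    ring
  have e3 : ∀ ω, cexp (I * ((t * (∑ i, ξ i ω ^ 2 - S.trace) : ℝ) : ℂ)) =
      (fun y : EuclideanSpace ℝ ι ↦ cexp (I * ((t * (‖y‖ ^ 2 - S.trace) : ℝ) : ℂ))) (Y ω) := by
    intro ω
    simp [hY, EuclideanSpace.real_norm_sq_eq]
  have e5 := integral_map hYm (f := fun y : EuclideanSpace ℝ ι ↦
    cexp (I * ((t * (‖y‖ ^ 2 - S.trace) : ℝ) : ℂ))) (by fun_prop)
  rw [integral_congr_ae (ae_of_all _ e3), ← e5, key, integral_map hAm.aemeasurable (by fun_prop)]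
  have e4 : ∀ x, cexp (I * ((t * (‖A x‖ ^ 2 - S.trace) : ℝ) : ℂ)) =
      ∏ k, cexp (I * ((t * lam k * ((x k) ^ 2 - 1) : ℝ) : ℂ)) := by
    intro x
    rw [← Complex.exp_sum, ← Finset.mul_sum, ← ofReal_sum]
    congr 3
    have hn : ‖A x‖ ^ 2 = ∑ k, lam k * x k ^ 2 := by
      rw [← OrthonormalBasis.sum_sq_norm_inner_right b]
      refine Finset.sum_congr rfl fun k _ ↦ ?_
      simp only [hA]
      rw [b.orthonormal.inner_right_fintype, Real.norm_eq_abs, sq_abs, mul_pow, Real.sq_sqrt (hlam0 k)]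
    have ht : S.trace = ∑ k, lam k := by
      simpa using hS.trace_eq_sum_eigenvalues
    rw [hn, ht, ← Finset.sum_sub_distrib, Finset.mul_sum]
    exact Finset.sum_congr rfl fun k _ ↦ by ring
  simp_rw [e4]
  rw [integral_fintype_prod_eq_prod (μ := fun _ : ι ↦ gaussianReal 0 1)
      (f := fun k x ↦ cexp (I * ((t * lam k * (x ^ 2 - 1) : ℝ) : ℂ)))]
  rfl

/-- Exchange the factors one at a time: each exchange costs one difference, because the other
factors have modulus at most one. -/
lemma norm_prod_sub_prod_le {α : Type*} (s : Finset α) (f g : α → ℂ) (hf : ∀ i ∈ s, ‖f i‖ ≤ 1)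
    (hg : ∀ i ∈ s, ‖g i‖ ≤ 1) :
    ‖∏ i ∈ s, f i - ∏ i ∈ s, g i‖ ≤ ∑ i ∈ s, ‖f i - g i‖ := by
  classical
  induction s using Finset.induction_on with
  | empty => simp
  | insert a s ha ih =>
    rw [Finset.prod_insert ha, Finset.prod_insert ha, Finset.sum_insert ha]
    have ih' := ih (fun i hi ↦ hf i (Finset.mem_insert_of_mem hi))
      (fun i hi ↦ hg i (Finset.mem_insert_of_mem hi))
    have h1 : ‖∏ i ∈ s, f i‖ ≤ 1 := by
      rw [norm_prod]
      exact Finset.prod_le_one (fun _ _ ↦ norm_nonneg _)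
        fun i hi ↦ hf i (Finset.mem_insert_of_mem hi)
    calc ‖f a * ∏ i ∈ s, f i - g a * ∏ i ∈ s, g i‖
        = ‖(f a - g a) * ∏ i ∈ s, f i + g a * (∏ i ∈ s, f i - ∏ i ∈ s, g i)‖ := by
          congr 1; ring
      _ ≤ ‖f a - g a‖ * 1 + 1 * ∑ i ∈ s, ‖f i - g i‖ := by
          refine (norm_add_le _ _).trans ?_
          rw [norm_mul, norm_mul]
          gcongr
          exact hg a (Finset.mem_insert_self _ _)
      _ = _ := by ring

/-- Products of `chiSqCharFun` with negligible factors are asymptotically Gaussian. -/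
lemma tendsto_prod_chiSqCharFun {κ : ℕ → Type*} [∀ n, Fintype (κ n)] (lam : ∀ n, κ n → ℝ)
    {v : ℝ} (hv : Tendsto (fun n ↦ ∑ k, lam n k ^ 2) atTop (𝓝 v)) {ρ : ℕ → ℝ}
    (hρ : Tendsto ρ atTop (𝓝 0)) (hlam : ∀ᶠ n in atTop, ∀ k, |lam n k| ≤ ρ n) (t : ℝ) :
    Tendsto (fun n ↦ ∏ k, chiSqCharFun (t * lam n k)) atTop (𝓝 (cexp (-(t ^ 2 * v : ℝ)))) := by
  have hexp : (fun s : ℝ ↦ (Real.exp (-s ^ 2) : ℂ) - (1 - (s : ℂ) ^ 2)) =o[𝓝 0]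
      fun s : ℝ ↦ s ^ 2 := by
    have h1 : (fun x : ℝ ↦ Real.exp x - (1 + x)) =o[𝓝 0] fun x : ℝ ↦ x := by
      have := (Real.hasDerivAt_exp 0).isLittleO
      simp only [Real.exp_zero, sub_zero, smul_eq_mul, mul_one] at this
      exact this.congr_left fun x ↦ by ring
    have h2 : Tendsto (fun s : ℝ ↦ -s ^ 2) (𝓝 0) (𝓝 0) := by
      have : Continuous fun s : ℝ ↦ -s ^ 2 := by fun_prop
      simpa using this.tendsto 0
    have h3 := (h1.comp_tendsto h2)
    rw [← Asymptotics.isLittleO_norm_left, ← Asymptotics.isLittleO_norm_right] at h3 ⊢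
    refine (h3.congr_left fun s ↦ ?_).congr_right fun s ↦ by simp
    simp only [Function.comp]
    rw [← norm_real]
    congr 1
    push_cast
    ring
  -- Both functions have the expansion `1 - s² + o(s²)`, so chi-square factors may be exchanged for
  -- Gaussian ones at total cost `o(∑ s²)`.
  have hdiff : (fun s : ℝ ↦ chiSqCharFun s - (Real.exp (-s ^ 2) : ℂ)) =o[𝓝 0]
      fun s : ℝ ↦ s ^ 2 :=
    (chiSqCharFun_isLittleO.sub hexp).congr_left fun s ↦ by ring
  have hg : Tendsto (fun n ↦ ∏ k, (Real.exp (-(t * lam n k) ^ 2) : ℂ)) atTop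
      (𝓝 (cexp (-(t ^ 2 * v : ℝ)))) := by
    have h1 : ∀ n, ∏ k, (Real.exp (-(t * lam n k) ^ 2) : ℂ) =
        ((Real.exp (-(t ^ 2 * ∑ k, lam n k ^ 2)) : ℝ) : ℂ) := by
      intro n
      rw [← ofReal_prod, ← Real.exp_sum]
      congr 2
      rw [Finset.mul_sum, ← Finset.sum_neg_distrib]
      exact Finset.sum_congr rfl fun k _ ↦ by ring
    simp_rw [h1]
    rw [← ofReal_neg, ← ofReal_exp]
    exact (continuous_ofReal.tendsto _).comp
      ((Real.continuous_exp.tendsto _).comp (hv.const_mul (t ^ 2)).neg)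
  suffices h : Tendsto (fun n ↦ ∏ k, chiSqCharFun (t * lam n k) -
      ∏ k, (Real.exp (-(t * lam n k) ^ 2) : ℂ)) atTop (𝓝 0) by
    simpa using h.add hg
  rw [Metric.tendsto_nhds]
  intro ε hε
  -- The squared arguments `t λ` eventually sum to at most `t² (|v| + 1)`; the extra `1` makes the
  -- division legitimate at `t = 0` and the final inequality strict.
  have hc : 0 < t ^ 2 * (|v| + 1) + 1 := by positivity
  have hb := hdiff.bound (show 0 < ε / (t ^ 2 * (|v| + 1) + 1) by positivity)
  obtain ⟨η, hη, hη'⟩ := Metric.eventually_nhds_iff.1 hb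
  have hρ' : ∀ᶠ n in atTop, |t| * |ρ n| < η := by
    have : Tendsto (fun n ↦ |t| * |ρ n|) atTop (𝓝 0) := by simpa using (hρ.abs.const_mul |t|)
    exact this.eventually_lt_const hη
  have hv' : ∀ᶠ n in atTop, ∑ k, lam n k ^ 2 < |v| + 1 :=
    hv.eventually_lt_const ((le_abs_self v).trans_lt (lt_add_one _))
  filter_upwards [hlam, hρ', hv'] with n h1 h2 h3
  rw [dist_zero_right]
  calc _ ≤ ∑ k, ‖chiSqCharFun (t * lam n k) - (Real.exp (-(t * lam n k) ^ 2) : ℂ)‖ := by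
        refine norm_prod_sub_prod_le _ _ _ (fun k _ ↦ norm_chiSqCharFun_le _) fun k _ ↦ ?_
        rw [norm_real, Real.norm_eq_abs, abs_of_pos (Real.exp_pos _), Real.exp_le_one_iff]
        nlinarith [sq_nonneg (t * lam n k)]
    _ ≤ ∑ k, ε / (t ^ 2 * (|v| + 1) + 1) * ‖(t * lam n k) ^ 2‖ := by
        refine Finset.sum_le_sum fun k _ ↦ hη' ?_
        rw [dist_zero_right, Real.norm_eq_abs, abs_mul]
        exact (mul_le_mul_of_nonneg_left ((h1 k).trans (le_abs_self _)) (abs_nonneg t)).trans_lt h2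
    _ = ε / (t ^ 2 * (|v| + 1) + 1) * (t ^ 2 * ∑ k, lam n k ^ 2) := by
        rw [← Finset.mul_sum, Finset.mul_sum (f := fun k ↦ lam n k ^ 2)]
        congr 1
        refine Finset.sum_congr rfl fun k _ ↦ ?_
        rw [Real.norm_eq_abs, abs_of_nonneg (sq_nonneg _)]; ring
    _ ≤ ε / (t ^ 2 * (|v| + 1) + 1) * (t ^ 2 * (|v| + 1)) := by gcongr
    _ < ε := by
        rw [div_mul_eq_mul_div, div_lt_iff₀ hc]
        nlinarith

/-- **Central limit theorem for Gaussian quadratic forms**: if the covariance matrices `S n` have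
vanishing operator norm and converging Frobenius norm, the squared norms are asymptotically
normal. -/
theorem tendstoInDistribution_gaussian_quadratic {Ω : Type*} [MeasurableSpace Ω] {P : Measure Ω}
    [IsProbabilityMeasure P] {κ : ℕ → Type*} [∀ n, Fintype (κ n)] [∀ n, DecidableEq (κ n)]
    {ξ : ∀ n, κ n → Ω → ℝ} {S : ∀ n, Matrix (κ n) (κ n) ℝ} {W : ℕ → Ω → ℝ} {s : ℕ → ℝ} {v : ℝ}
    (hWm : ∀ n, AEMeasurable (W n) P)
    (hξ : ∀ᶠ n in atTop, IsCenteredGaussianVector P (ξ n) (S n))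
    (hS : ∀ n, (S n).IsHermitian)
    (hW : ∀ᶠ n in atTop, ∀ ω, W n ω = ∑ i, ξ n i ω ^ 2 - s n)
    (hbias : Tendsto (fun n ↦ (S n).trace - s n) atTop (𝓝 0))
    (hvar : Tendsto (fun n ↦ 2 * ∑ i, ∑ j, S n i j ^ 2) atTop (𝓝 v))
    {ρ : ℕ → ℝ} (hρ : Tendsto ρ atTop (𝓝 0))
    (hop : ∀ᶠ n in atTop, ∀ x : κ n → ℝ, ∑ i, ∑ j, x i * x j * S n i j ≤ ρ n * ∑ i, x i ^ 2) :
    TendstoInDistribution W atTop (id : ℝ → ℝ) (fun _ ↦ P) (gaussianReal 0 v.toNNReal) where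
  forall_aemeasurable := hWm
  aemeasurable_limit := aemeasurable_id
  tendsto := by
    refine ProbabilityMeasure.tendsto_iff_tendsto_charFun.2 fun t ↦ ?_
    have hv0 : 0 ≤ v := ge_of_tendsto' hvar fun n ↦ by positivity
    simp only [ProbabilityMeasure.coe_mk, Measure.map_id]
    rw [charFun_gaussianReal]
    have hlam : Tendsto (fun n ↦ ∑ k, (hS n).eigenvalues k ^ 2) atTop (𝓝 (v / 2)) := by
      refine (hvar.div_const 2).congr fun n ↦ ?_
      rw [← (hS n).sum_sq_eq_sum_eigenvalues_sq]; ring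
    -- Test the bound on the quadratic form on a unit eigenvector.
    have hb : ∀ᶠ n in atTop, ∀ k, |(hS n).eigenvalues k| ≤ ρ n := by
      filter_upwards [hξ, hop] with n h1 h2 k
      rw [abs_of_nonneg ((h1.posSemidef (hS n)).eigenvalues_nonneg k)]
      have h3 := h2 ((hS n).eigenvectorBasis k)
      rw [(hS n).sum_mul_eq_eigenvalues] at h3
      have h4 : ∑ i, (hS n).eigenvectorBasis k i ^ 2 = 1 := by
        rw [← EuclideanSpace.real_norm_sq_eq, ((hS n).eigenvectorBasis).norm_eq_one, one_pow]
      have h5 : ∀ j, (hS n).eigenvalues j *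
          inner ℝ ((hS n).eigenvectorBasis j) ((hS n).eigenvectorBasis k) ^ 2 =
          if j = k then (hS n).eigenvalues j else 0 := by
        intro j
        rw [orthonormal_iff_ite.1 ((hS n).eigenvectorBasis).orthonormal j k]
        split_ifs <;> simp
      rw [h4, Finset.sum_congr rfl fun j _ ↦ h5 j] at h3
      simpa using h3
    have h1 := tendsto_prod_chiSqCharFun (fun n ↦ (hS n).eigenvalues) hlam hρ hb t
    have h2 : Tendsto (fun n ↦ cexp (I * ((t * ((S n).trace - s n) : ℝ) : ℂ))) atTop (𝓝 1) := by
      have : Continuous fun x : ℝ ↦ cexp (I * ((t * x : ℝ) : ℂ)) := by fun_prop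
      simpa [Function.comp_def] using (this.tendsto 0).comp hbias
    have h3 := h1.mul h2
    rw [mul_one] at h3
    have h4 : cexp (-(t ^ 2 * (v / 2) : ℝ)) =
        cexp (t * (0 : ℝ) * I - v.toNNReal * t ^ 2 / 2) := by
      congr 1
      rw [show ((v.toNNReal : ℝ) : ℂ) = v by rw [Real.coe_toNNReal _ hv0]]
      push_cast
      ring
    rw [h4] at h3
    refine h3.congr' ?_
    filter_upwards [hξ, hW] with n h5 h6
    rw [charFun_apply_real, integral_map (hWm n) (by fun_prop),
      ← h5.integral_exp_quadratic (hS n) t, ← integral_mul_const]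
    refine integral_congr_ae (ae_of_all _ fun ω ↦ ?_)
    simp only [h6 ω]
    rw [← Complex.exp_add]
    congr 1
    push_cast
    ring

end GaussianQuadraticForm

/-! ### Autoregressive approximation of the Ornstein-Uhlenbeck equation -/

section Autoregressive

/-- An autoregressive sequence driven by the increments of `B`. -/
noncomputable def autoregressive (q c x₀ : ℝ) (B : ℕ → ℝ) : ℕ → ℝ
  | 0 => x₀
  | k + 1 => q * autoregressive q c x₀ B k + c * (B (k + 1) - B k)

/-- The sum runs over a common range `K` and the coefficients vanish from `k` on, so that several
time points are expanded in one family of increments. -/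
lemma autoregressive_eq (q c x₀ : ℝ) (B : ℕ → ℝ) (K : ℕ) :
    ∀ k ≤ K, autoregressive q c x₀ B k = q ^ k * x₀ +
      ∑ j ∈ Finset.range K, (if j < k then c * q ^ (k - 1 - j) else 0) * (B (j + 1) - B j) := by
  intro k hk
  induction k with
  | zero => simp [autoregressive]
  | succ k ih =>
    rw [autoregressive, ih (by omega), mul_add, ← mul_assoc, ← pow_succ', add_assoc]
    congr 1
    have h1 : c * (B (k + 1) - B k) = ∑ j ∈ Finset.range K,
        (if j = k then c else 0) * (B (j + 1) - B j) := by
      simp only [ite_mul, zero_mul]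
      rw [Finset.sum_ite_eq' (Finset.range K) k, if_pos (Finset.mem_range.2 (by omega))]
    rw [h1, Finset.mul_sum, ← Finset.sum_add_distrib]
    refine Finset.sum_congr rfl fun j _ ↦ ?_
    rw [← mul_assoc, ← add_mul]
    congr 1
    rcases lt_trichotomy j k with h | h | h
    · have e : k + 1 - 1 - j = (k - 1 - j) + 1 := by omega
      simp only [h, h.ne, if_true, if_false, Nat.lt_succ_of_lt h, e, pow_succ]
      ring
    · subst h; simp
    · simp [not_lt.2 h.le, h.ne', show ¬ j < k + 1 by omega]

/-- The stationary autoregressive covariance. -/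
lemma sum_autoregressive_coeff (q c v η : ℝ) (hc : c ^ 2 * η = v * (1 - q ^ 2))
    (K k l : ℕ) (hk : k ≤ K) (hl : l ≤ K) :
    v * (q ^ k * q ^ l) + ∑ j ∈ Finset.range K, η * ((if j < k then c * q ^ (k - 1 - j) else 0) *
      (if j < l then c * q ^ (l - 1 - j) else 0)) = v * q ^ (max k l - min k l) := by
  wlog hkl : k ≤ l generalizing k l
  · have := this l k hl hk (by omega)
    rw [max_comm, min_comm, ← this]
    congr 1
    · ring
    · exact Finset.sum_congr rfl fun j _ ↦ by ring
  rw [max_eq_right hkl, min_eq_left hkl]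
  -- By `hc` each term is `v (1 - q²)` times a power of `q`, that is, a difference of consecutive
  -- values of `v q^(k-n) q^(l-n)`; the sum telescopes.
  have h1 : ∀ n ≤ k, ∑ j ∈ Finset.range n, η * ((if j < k then c * q ^ (k - 1 - j) else 0) *
      (if j < l then c * q ^ (l - 1 - j) else 0)) =
      v * (q ^ (k - n) * q ^ (l - n)) - v * (q ^ k * q ^ l) := by
    intro n hn
    induction n with
    | zero => simp
    | succ n ih =>
      rw [Finset.sum_range_succ, ih (by omega), if_pos (by omega), if_pos (by omega)]
      have e1 : k - n = (k - 1 - n) + 1 := by omega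
      have e2 : l - n = (l - 1 - n) + 1 := by omega
      have e3 : k - (n + 1) = k - 1 - n := by omega
      have e4 : l - (n + 1) = l - 1 - n := by omega
      rw [e1, e2, e3, e4, pow_succ, pow_succ]
      linear_combination (q ^ (k - 1 - n) * q ^ (l - 1 - n)) * hc
  have h2 : ∑ j ∈ Finset.range K, η * ((if j < k then c * q ^ (k - 1 - j) else 0) *
      (if j < l then c * q ^ (l - 1 - j) else 0)) =
      ∑ j ∈ Finset.range k, η * ((if j < k then c * q ^ (k - 1 - j) else 0) *
      (if j < l then c * q ^ (l - 1 - j) else 0)) := by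
    symm
    refine Finset.sum_subset (Finset.range_subset_range.2 hk) fun j _ hj ↦ ?_
    rw [if_neg (by simpa using hj)]
    simp
  rw [h2, h1 k le_rfl]
  simp

/-- The scaling of the noise that makes the autoregressive approximation exactly stationary. -/
noncomputable def noiseScale (lam η : ℝ) : ℝ :=
  √((1 - Real.exp (-(2 * lam * η))) / (2 * lam * η))

lemma noiseScale_sq {lam η : ℝ} (hl : 0 < lam) (hη : 0 < η) :
    noiseScale lam η ^ 2 = (1 - Real.exp (-(2 * lam * η))) / (2 * lam * η) := by
  refine Real.sq_sqrt (div_nonneg ?_ (by positivity))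
  have : Real.exp (-(2 * lam * η)) ≤ 1 := Real.exp_le_one_iff.2 (by nlinarith [mul_pos hl hη])
  linarith

lemma abs_one_sub_exp_sub_le {x : ℝ} (hx : 0 ≤ x) : |1 - Real.exp (-x) - x| ≤ x ^ 2 := by
  have h1 : 1 - x ≤ Real.exp (-x) := by linarith [Real.add_one_le_exp (-x)]
  have h2 : Real.exp (-x) ≤ 1 - x + x ^ 2 := by
    rcases le_or_gt x 1 with h | h
    · have := Real.abs_exp_sub_one_sub_id_le (x := -x) (by rw [abs_neg, abs_of_nonneg hx]; exact h)
      rw [abs_le] at this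
      nlinarith [this.2]
    · have : Real.exp (-x) ≤ 1 := Real.exp_le_one_iff.2 (by linarith)
      nlinarith
  rw [abs_le]
  constructor <;> linarith

lemma abs_one_sub_noiseScale_le {lam η : ℝ} (hl : 0 < lam) (hη : 0 < η) :
    |1 - noiseScale lam η| ≤ 2 * lam * η := by
  have hx : 0 < 2 * lam * η := by positivity
  have h0 : 0 ≤ noiseScale lam η := Real.sqrt_nonneg _
  -- The factor `1 + noiseScale` is at least one, so the square root can be avoided.
  have h1 : |1 - noiseScale lam η| ≤ |1 - noiseScale lam η ^ 2| := by
    rw [show 1 - noiseScale lam η ^ 2 = (1 - noiseScale lam η) * (1 + noiseScale lam η) by ring,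
      abs_mul, abs_of_nonneg (show 0 ≤ 1 + noiseScale lam η by linarith)]
    nlinarith [abs_nonneg (1 - noiseScale lam η)]
  refine h1.trans ?_
  rw [noiseScale_sq hl hη]
  have h2 := abs_one_sub_exp_sub_le hx.le
  rw [show 1 - (1 - Real.exp (-(2 * lam * η))) / (2 * lam * η) =
    -(1 - Real.exp (-(2 * lam * η)) - 2 * lam * η) / (2 * lam * η) by field_simp; ring,
    abs_div, abs_neg, abs_of_pos hx, div_le_iff₀ hx]
  linarith

/-- Pathwise convergence of the autoregressive approximation. -/
lemma tendsto_autoregressive {u B : ℝ → ℝ} (hu : Continuous u) (hB : Continuous B)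
    {lam σ : ℝ} (hl : 0 < lam)
    (h : ∀ t, 0 ≤ t → u t = u 0 - lam * (∫ s in (0 : ℝ)..t, u s) + σ * B t)
    {Δ : ℝ} (hΔ : 0 < Δ) (i : ℕ) :
    Tendsto (fun m : ℕ ↦ autoregressive (Real.exp (-(lam * (Δ / (m + 1)))))
      (noiseScale lam (Δ / (m + 1)) * σ) (u 0) (fun k ↦ B (k * (Δ / (m + 1)))) (i * (m + 1)))
      atTop (𝓝 (u (i * Δ))) := by
  set T : ℝ := i * Δ with hT
  have hT0 : 0 ≤ T := by positivity
  obtain ⟨K, hK⟩ := (isCompact_Icc (a := (0 : ℝ)) (b := T)).exists_bound_of_continuousOn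
    hu.continuousOn
  have hK0 : 0 ≤ K := (norm_nonneg _).trans (hK 0 ⟨le_rfl, hT0⟩)
  have huU := (isCompact_Icc (a := (0 : ℝ)) (b := T)).uniformContinuousOn_of_continuous
    hu.continuousOn
  have huB := (isCompact_Icc (a := (0 : ℝ)) (b := T)).uniformContinuousOn_of_continuous
    hB.continuousOn
  rw [Metric.uniformContinuousOn_iff] at huU huB
  have hη0 : Tendsto (fun m : ℕ ↦ Δ / ((m : ℝ) + 1)) atTop (𝓝 0) :=
    tendsto_const_nhds.div_atTop (tendsto_atTop_add_const_right _ _ tendsto_natCast_atTop_atTop)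
  rw [Metric.tendsto_nhds]
  intro ε hε
  -- `C - 1` is the accumulated error over `[0, T]` per unit of `ε'`, once the mesh and both moduli
  -- of continuity are below `ε'`.
  set C : ℝ := T * (lam ^ 2 * K + lam + 2 * lam * |σ|) + 1 with hC
  have hC0 : 0 < C := by positivity
  set ε' := ε / (2 * C) with hε'
  have hε'0 : 0 < ε' := by positivity
  obtain ⟨d1, hd1, H1⟩ := huU ε' hε'0
  obtain ⟨d2, hd2, H2⟩ := huB ε' hε'0
  filter_upwards [hη0.eventually_lt_const hd1, hη0.eventually_lt_const hd2,
    hη0.eventually_lt_const hε'0] with m h1 h2 h3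
  set η : ℝ := Δ / (m + 1) with hη
  have hηp : 0 < η := by positivity
  set q := Real.exp (-(lam * η)) with hq
  have hq1 : |q| ≤ 1 := by
    rw [abs_of_pos (Real.exp_pos _)]; exact Real.exp_le_one_iff.2 (by nlinarith [mul_pos hl hηp])
  set w := autoregressive q (noiseScale lam η * σ) (u 0) (fun k ↦ B (k * η)) with hw
  -- The error of one step: the remainder of `exp(-λη) = 1 - λη + …`, the oscillation of `u` inside
  -- the drift integral, and the deviation of the noise scale from one times the oscillation of `B`.
  set r : ℝ := (lam * η) ^ 2 * K + lam * η * ε' + 2 * lam * η * |σ| * ε' with hr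
  have hmT : (i * (m + 1) : ℕ) * η = T := by
    rw [hη, hT]; push_cast; field_simp
  -- Because `|q| ≤ 1`, earlier errors are not amplified and the one-step errors simply add up.
  have step : ∀ k : ℕ, k ≤ i * (m + 1) → |u (k * η) - w k| ≤ k * r := by
    intro k hk
    induction k with
    | zero => simp [hw, autoregressive]
    | succ k ih =>
      have ih' := ih (by omega)
      have hs1 : ((k + 1 : ℕ) : ℝ) * η ≤ T := by
        rw [← hmT]; gcongr
      have hs0 : (k : ℝ) * η ≤ ((k + 1 : ℕ) : ℝ) * η := by
        gcongr; simp
      have hsk : 0 ≤ (k : ℝ) * η := by positivity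
      have hd : ((k + 1 : ℕ) : ℝ) * η - k * η = η := by push_cast; ring
      have hmem : ∀ s ∈ Set.Icc ((k : ℝ) * η) (((k + 1 : ℕ) : ℝ) * η), s ∈ Set.Icc 0 T :=
        fun s hs ↦ ⟨hsk.trans hs.1, hs.2.trans hs1⟩
      have e1 : u (((k + 1 : ℕ) : ℝ) * η) = u (k * η)
          - lam * (∫ s in ((k : ℝ) * η)..(((k + 1 : ℕ) : ℝ) * η), u s)
          + σ * (B (((k + 1 : ℕ) : ℝ) * η) - B (k * η)) := by
        have := intervalIntegral.integral_interval_sub_left (hu.intervalIntegrable 0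
          (((k + 1 : ℕ) : ℝ) * η) (μ := volume)) (hu.intervalIntegrable 0 ((k : ℝ) * η))
        rw [h _ (hsk.trans hs0), h _ hsk, ← this]
        ring
      have e2 : |lam * η * u (k * η) -
          lam * (∫ s in ((k : ℝ) * η)..(((k + 1 : ℕ) : ℝ) * η), u s)| ≤ lam * η * ε' := by
        have e3 : lam * η * u (k * η) - lam *
            (∫ s in ((k : ℝ) * η)..(((k + 1 : ℕ) : ℝ) * η), u s) = -lam *
            ∫ s in ((k : ℝ) * η)..(((k + 1 : ℕ) : ℝ) * η), (u s - u (k * η)) := by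
          rw [intervalIntegral.integral_sub (hu.intervalIntegrable _ _) (by simp),
            intervalIntegral.integral_const, hd, smul_eq_mul]
          ring
        have e4 := intervalIntegral.norm_integral_le_of_norm_le_const
          (a := (k : ℝ) * η) (b := ((k + 1 : ℕ) : ℝ) * η) (f := fun s ↦ u s - u (k * η)) (C := ε') ?_
        · rw [hd, abs_of_pos hηp, Real.norm_eq_abs] at e4
          rw [e3, abs_mul, abs_neg, abs_of_pos hl, mul_assoc]
          gcongr
          linarith
        · intro s hs
          rw [Set.uIoc_of_le hs0] at hs
          have hs' : s ∈ Set.Icc ((k : ℝ) * η) (((k + 1 : ℕ) : ℝ) * η) := ⟨hs.1.le, hs.2⟩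
          refine (H1 s (hmem s hs') _ (hmem _ ⟨le_rfl, hs0⟩) ?_).le
          rw [Real.dist_eq, abs_of_nonneg (by linarith [hs.1])]
          linarith [hs.2]
      have e5 : |B (((k + 1 : ℕ) : ℝ) * η) - B (k * η)| ≤ ε' := by
        refine (H2 _ (hmem _ ⟨hs0, le_rfl⟩) _ (hmem _ ⟨le_rfl, hs0⟩) ?_).le
        rw [Real.dist_eq, hd, abs_of_pos hηp]; exact h2
      have e6 : |u (k * η)| ≤ K := hK _ (hmem _ ⟨le_rfl, hs0⟩)
      have e7 := abs_one_sub_exp_sub_le (x := lam * η) (by positivity)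
      have e8 := abs_one_sub_noiseScale_le hl hηp
      have e9 : u (((k + 1 : ℕ) : ℝ) * η) - w (k + 1) = q * (u (k * η) - w k)
          + (1 - q - lam * η) * u (k * η)
          + (lam * η * u (k * η) - lam * (∫ s in ((k : ℝ) * η)..(((k + 1 : ℕ) : ℝ) * η), u s))
          + (1 - noiseScale lam η) * σ * (B (((k + 1 : ℕ) : ℝ) * η) - B (k * η)) := by
        have : w (k + 1) = q * w k + noiseScale lam η * σ *
          (B (((k + 1 : ℕ) : ℝ) * η) - B (k * η)) := by rw [hw, autoregressive]
        rw [this, e1]; ring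
      rw [e9]
      refine (abs_add_le _ _).trans ?_
      refine (add_le_add_left ((abs_add_le _ _).trans (add_le_add_left (abs_add_le _ _) _)) _).trans ?_
      rw [abs_mul, abs_mul, abs_mul, abs_mul]
      have f1 : |q| * |u (k * η) - w k| ≤ k * r := by
        calc _ ≤ 1 * |u (k * η) - w k| := by gcongr
          _ ≤ _ := by linarith
      have f2 : |1 - q - lam * η| * |u (k * η)| ≤ (lam * η) ^ 2 * K := by gcongr
      have f3 : |1 - noiseScale lam η| * |σ| * |B (((k + 1 : ℕ) : ℝ) * η) - B (k * η)| ≤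
          2 * lam * η * |σ| * ε' := by gcongr
      have f4 : ((k + 1 : ℕ) : ℝ) * r = k * r + r := by push_cast; ring
      rw [f4]
      linarith
  have hfin := step (i * (m + 1)) le_rfl
  rw [hmT] at hfin
  rw [dist_comm, Real.dist_eq]
  refine hfin.trans_lt ?_
  have g1 : (i * (m + 1) : ℕ) * r = T * (lam ^ 2 * η * K + lam * ε' + 2 * lam * |σ| * ε') := by
    rw [← hmT, hr]; ring
  rw [g1]
  calc T * (lam ^ 2 * η * K + lam * ε' + 2 * lam * |σ| * ε')
      ≤ T * (lam ^ 2 * ε' * K + lam * ε' + 2 * lam * |σ| * ε') := by gcongr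
    _ = (C - 1) * ε' := by rw [hC]; ring
    _ ≤ C * ε' := by gcongr; linarith
    _ = ε / 2 := by rw [hε']; field_simp
    _ < ε := by linarith

end Autoregressive

/-! ### The Gaussian law of the solution field -/

section FieldLaw

open Complex SPDE

variable {Ω : Type*} [MeasurableSpace Ω] {P : Measure Ω} [IsProbabilityMeasure P]

/-- The characteristic function of a combination of an independent Gaussian variable and
Brownian increments. -/
lemma integral_exp_initial_add_increments {β : ℝ≥0 → Ω → ℝ} (hβ : IsBrownianReal β P)
    (hβm : ∀ t, Measurable (β t)) {x : Ω → ℝ} (hxm : Measurable x) {v : ℝ} (hv : 0 ≤ v)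
    (hx : HasLaw x (gaussianReal 0 v.toNNReal) P) (hind : IndepFun x (fun ω t ↦ β t ω) P)
    {η : ℝ} (hη : 0 < η) (K : ℕ) (α : ℝ) (γ : ℕ → ℝ) :
    ∫ ω, cexp (I * ((α * x ω + ∑ j ∈ Finset.range K, γ j *
      (β ((j + 1 : ℕ) * η).toNNReal ω - β (j * η).toNNReal ω) : ℝ) : ℂ)) ∂P =
      ((Real.exp (-(1 / 2) * (v * α ^ 2 + ∑ j ∈ Finset.range K, η * γ j ^ 2)) : ℝ) : ℂ) := by
  set t : ℕ → ℝ≥0 := fun j ↦ (j * η).toNNReal with ht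
  have htm : Monotone t := by
    intro i j hij
    exact Real.toNNReal_mono (by gcongr)
  have hinc := (hβ.hasIndepIncrements.nat htm).comp (fun j x ↦ γ j * x)
    (fun j ↦ by fun_prop)
  set Z : ℕ → Ω → ℝ := fun j ω ↦ γ j * (β (t (j + 1)) ω - β (t j) ω) with hZ
  have hZm : ∀ j, Measurable (Z j) := fun j ↦
    (((hβm _).sub (hβm _)).const_mul _)
  have hZi : iIndepFun Z P := hinc
  have c1 : ∀ j, charFun (P.map (Z j)) 1 = ((Real.exp (-(1 / 2) * (η * γ j ^ 2)) : ℝ) : ℂ) := by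
    intro j
    have h1 := gaussianReal_const_mul (hβ.hasLaw_sub (t (j + 1)) (t j)) (γ j)
    have h2 : P.map (Z j) = _ := h1.map_eq
    have h3 : ((nndist (t (j + 1)).1 (t j).1 : ℝ≥0) : ℝ) = η := by
      rw [coe_nndist, Real.dist_eq]
      change |((t (j + 1) : ℝ≥0) : ℝ) - t j| = η
      simp only [ht]
      rw [Real.coe_toNNReal _ (by positivity), Real.coe_toNNReal _ (by positivity)]
      push_cast
      rw [show ((j : ℝ) + 1) * η - j * η = η by ring, abs_of_pos hη]
    rw [h2]
    generalize nndist (t (j + 1)).1 (t j).1 = d at h3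
    rw [charFun_gaussianReal, ofReal_exp]
    congr 1
    push_cast
    rw [h3]
    simp
    ring
  have c2 : charFun (P.map (fun ω ↦ ∑ j ∈ Finset.range K, Z j ω)) 1 =
      ∏ j ∈ Finset.range K, charFun (P.map (Z j)) 1 := by
    rw [iIndepFun.charFun_map_fun_finsetSum_eq_prod (fun j _ ↦ (hZm j).aemeasurable)
      (hZi.restrict _), Finset.prod_apply]
  have c3 : charFun (P.map (fun ω ↦ α * x ω)) 1 = ((Real.exp (-(1 / 2) * (v * α ^ 2)) : ℝ) : ℂ) := by
    rw [(gaussianReal_const_mul hx α).map_eq, charFun_gaussianReal, ofReal_exp]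
    congr 1
    have : ((v.toNNReal : ℝ) : ℂ) = v := by rw [Real.coe_toNNReal _ hv]
    push_cast
    rw [this]
    simp
    ring
  have hi : IndepFun (fun ω ↦ α * x ω) (fun ω ↦ ∑ j ∈ Finset.range K, Z j ω) P := by
    refine hind.comp (φ := fun y ↦ α * y)
      (ψ := fun f : ℝ≥0 → ℝ ↦ ∑ j ∈ Finset.range K, γ j * (f (t (j + 1)) - f (t j)))
      (by fun_prop) ?_
    fun_prop
  have hsm : Measurable (fun ω ↦ ∑ j ∈ Finset.range K, Z j ω) :=
    Finset.measurable_sum _ fun j _ ↦ hZm j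
  have c4 : charFun (P.map (fun ω ↦ α * x ω + ∑ j ∈ Finset.range K, Z j ω)) 1 = _ :=
    congrFun (hi.charFun_map_fun_add_eq_mul (hxm.const_mul α).aemeasurable hsm.aemeasurable) 1
  rw [Pi.mul_apply, c2, c3, Finset.prod_congr rfl fun j _ ↦ c1 j, ← ofReal_prod, ← Real.exp_sum,
    ← ofReal_mul, ← Real.exp_add, charFun_apply_real,
    integral_map (show Measurable (fun ω ↦ α * x ω + ∑ j ∈ Finset.range K, Z j ω) from
      (hxm.const_mul α).add hsm).aemeasurable (by fun_prop)] at c4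
  rw [mul_add, Finset.mul_sum, ← c4]
  refine integral_congr_ae (ae_of_all _ fun ω ↦ ?_)
  simp only [ofReal_one, one_mul]
  rw [mul_comm]

lemma eigenvalue_pos {σ ϑ₂ ϑ₁ ϑ₀ : ℝ} (h : Admissible σ ϑ₂ ϑ₁ ϑ₀) (n : ℕ) :
    0 < eigenvalue ϑ₂ ϑ₁ ϑ₀ (n + 1) := by
  have h1 : (1 : ℝ) ≤ ((n + 1 : ℕ) : ℝ) ^ 2 := by
    have : (1 : ℝ) ≤ ((n + 1 : ℕ) : ℝ) := by push_cast; linarith [n.cast_nonneg (α := ℝ)]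
    nlinarith
  have h2 : Real.pi ^ 2 ≤ Real.pi ^ 2 * ((n + 1 : ℕ) : ℝ) ^ 2 :=
    le_mul_of_one_le_right (by positivity) h1
  exact mul_pos h.2.1 (by linarith [h.2.2])

/-- The stationary autocovariance of a mode. -/
noncomputable def modeCov (σ lam Δ : ℝ) (x : ℝ) : ℝ :=
  σ ^ 2 / (2 * lam) * Real.exp (-(lam * Δ * |x|))

variable {σ ϑ₂ ϑ₁ ϑ₀ : ℝ} {β u : ℕ → ℝ≥0 → Ω → ℝ} {X : ℝ≥0 → ℝ → Ω → ℝ}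

/-- Finite-dimensional laws of finitely many modes on an equidistant time grid. -/
lemma SPDE.IsStationarySolution.integral_exp_modes (hadm : Admissible σ ϑ₂ ϑ₁ ϑ₀)
    (h : IsStationarySolution P σ ϑ₂ ϑ₁ ϑ₀ β u X) {Δ : ℝ} (hΔ : 0 < Δ) {τ : Type*} [Fintype τ]
    (b : ℕ → τ → ℝ) (idx : τ → ℕ) (L : ℕ) :
    ∫ ω, cexp (I * ((∑ n ∈ Finset.range L, ∑ x, b n x * u n (idx x * Δ).toNNReal ω : ℝ) : ℂ)) ∂P =
      ((Real.exp (-(1 / 2) * ∑ n ∈ Finset.range L, ∑ x, ∑ y, b n x * b n y *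
        modeCov σ (eigenvalue ϑ₂ ϑ₁ ϑ₀ (n + 1)) Δ ((idx x : ℝ) - idx y)) : ℝ) : ℂ) := by
  set lam : ℕ → ℝ := fun n ↦ eigenvalue ϑ₂ ϑ₁ ϑ₀ (n + 1) with hlam
  have hlam0 : ∀ n, 0 < lam n := eigenvalue_pos hadm
  set η : ℕ → ℝ := fun m ↦ Δ / (m + 1) with hη
  have hη0 : ∀ m, 0 < η m := fun m ↦ by positivity
  set q : ℕ → ℕ → ℝ := fun m n ↦ Real.exp (-(lam n * η m)) with hq
  set c : ℕ → ℕ → ℝ := fun m n ↦ noiseScale (lam n) (η m) * σ with hc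
  set w : ℕ → ℕ → Ω → ℕ → ℝ := fun m n ω ↦ autoregressive (q m n) (c m n) (u n 0 ω)
    (fun k ↦ β n (k * η m).toNNReal ω) with hw
  -- The sum of the time indices bounds each of them, so all observation times fit in one refined
  -- grid.
  set K : ℕ → ℕ := fun m ↦ (∑ x, idx x) * (m + 1) with hK
  have hidx : ∀ m x, idx x * (m + 1) ≤ K m := fun m x ↦ Nat.mul_le_mul_right _
    (Finset.single_le_sum (f := idx) (fun _ _ ↦ Nat.zero_le _) (Finset.mem_univ x))
  set cf : ℕ → ℕ → τ → ℕ → ℝ := fun m n x j ↦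
    if j < idx x * (m + 1) then c m n * q m n ^ (idx x * (m + 1) - 1 - j) else 0 with hcf
  set G : ℕ → ℕ → Ω → ℝ := fun m n ω ↦ (∑ x, b n x * q m n ^ (idx x * (m + 1))) * u n 0 ω +
    ∑ j ∈ Finset.range (K m), (∑ x, b n x * cf m n x j) *
      (β n ((j + 1 : ℕ) * η m).toNNReal ω - β n (j * η m).toNNReal ω) with hG
  have hGw : ∀ m n ω, G m n ω = ∑ x, b n x * w m n ω (idx x * (m + 1)) := by
    intro m n ω
    have : ∀ x, w m n ω (idx x * (m + 1)) = q m n ^ (idx x * (m + 1)) * u n 0 ω +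
        ∑ j ∈ Finset.range (K m), cf m n x j *
          (β n ((j + 1 : ℕ) * η m).toNNReal ω - β n (j * η m).toNNReal ω) := fun x ↦
      autoregressive_eq _ _ _ _ (K m) _ (hidx m x)
    rw [Finset.sum_congr rfl fun x _ ↦ by rw [this x, mul_add], Finset.sum_add_distrib]
    simp only [hG, Finset.sum_mul, Finset.mul_sum]
    congr 1
    · exact Finset.sum_congr rfl fun x _ ↦ by ring
    · rw [Finset.sum_comm]
      exact Finset.sum_congr rfl fun x _ ↦ Finset.sum_congr rfl fun j _ ↦ by ring
  have hGm : ∀ m n, Measurable (G m n) := fun m n ↦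
    ((h.measurable_u n 0).const_mul _).add (Finset.measurable_sum _ fun j _ ↦
      (((h.measurable_β n _).sub (h.measurable_β n _)).const_mul _))
  have hGi : ∀ m, iIndepFun (G m) P := by
    intro m
    refine h.indep_modes.comp (fun n (p : ℝ × (ℝ≥0 → ℝ)) ↦
      (∑ x, b n x * q m n ^ (idx x * (m + 1))) * p.1 +
      ∑ j ∈ Finset.range (K m), (∑ x, b n x * cf m n x j) *
      (p.2 ((j + 1 : ℕ) * η m).toNNReal - p.2 (j * η m).toNNReal)) fun n ↦ ?_
    fun_prop
  set v : ℕ → ℝ := fun n ↦ σ ^ 2 / (2 * lam n) with hv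
  have hv0 : ∀ n, 0 ≤ v n := fun n ↦ by have := hlam0 n; positivity
  -- The right side does not involve `m`: `noiseScale` was chosen so that the approximation has the
  -- Ornstein-Uhlenbeck covariance at every mesh, not only in the limit.
  have hvar : ∀ m n, v n * (∑ x, b n x * q m n ^ (idx x * (m + 1))) ^ 2 +
      ∑ j ∈ Finset.range (K m), η m * (∑ x, b n x * cf m n x j) ^ 2 =
      ∑ x, ∑ y, b n x * b n y * modeCov σ (lam n) Δ ((idx x : ℝ) - idx y) := by
    intro m n
    have e1 : ∀ x y, v n * (q m n ^ (idx x * (m + 1)) * q m n ^ (idx y * (m + 1))) +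
        ∑ j ∈ Finset.range (K m), η m * (cf m n x j * cf m n y j) =
        modeCov σ (lam n) Δ ((idx x : ℝ) - idx y) := by
      intro x y
      have hc2 : c m n ^ 2 * η m = v n * (1 - q m n ^ 2) := by
        simp only [hc, mul_pow, noiseScale_sq (hlam0 n) (hη0 m), hv, hq]
        rw [← Real.exp_nat_mul, show ((2 : ℕ) : ℝ) * -(lam n * η m) = -(2 * lam n * η m) by
          push_cast; ring]
        have := (hlam0 n).ne'
        have := (hη0 m).ne'
        field_simp
      have e2 := sum_autoregressive_coeff (q m n) (c m n) (v n) (η m) hc2 (K m) _ _ (hidx m x)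
        (hidx m y)
      rw [e2, modeCov]
      congr 1
      simp only [hq]
      rw [← Real.exp_nat_mul]
      congr 1
      have e3 : ((max (idx x * (m + 1)) (idx y * (m + 1)) - min (idx x * (m + 1)) (idx y * (m + 1)) : ℕ) : ℝ)
          = |(idx x : ℝ) - idx y| * (m + 1) := by
        rw [Nat.cast_sub (min_le_max), Nat.cast_max, Nat.cast_min, max_sub_min_eq_abs]
        push_cast
        rw [← sub_mul, abs_mul, abs_of_pos (show (0 : ℝ) < m + 1 by positivity), abs_sub_comm]
      rw [e3, hη]
      field_simp
    simp_rw [← e1, mul_add (b n _ * b n _), Finset.sum_add_distrib]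
    congr 1
    · rw [sq, Finset.sum_mul_sum, Finset.mul_sum]
      refine Finset.sum_congr rfl fun x _ ↦ ?_
      rw [Finset.mul_sum]
      exact Finset.sum_congr rfl fun y _ ↦ by ring
    · simp_rw [sq, Finset.sum_mul_sum, Finset.mul_sum]
      rw [Finset.sum_comm]
      refine Finset.sum_congr rfl fun x _ ↦ ?_
      rw [Finset.sum_comm]
      exact Finset.sum_congr rfl fun y _ ↦ Finset.sum_congr rfl fun j _ ↦ by ring
  have hexact : ∀ m, ∫ ω, cexp (I * ((∑ n ∈ Finset.range L, G m n ω : ℝ) : ℂ)) ∂P =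
      ((Real.exp (-(1 / 2) * ∑ n ∈ Finset.range L, ∑ x, ∑ y, b n x * b n y *
        modeCov σ (lam n) Δ ((idx x : ℝ) - idx y)) : ℝ) : ℂ) := by
    intro m
    have c2 : charFun (P.map (fun ω ↦ ∑ n ∈ Finset.range L, G m n ω)) 1 =
        ∏ n ∈ Finset.range L, charFun (P.map (G m n)) 1 := by
      rw [iIndepFun.charFun_map_fun_finsetSum_eq_prod (fun n _ ↦ (hGm m n).aemeasurable)
        ((hGi m).restrict _), Finset.prod_apply]
    have c1 : ∀ n, charFun (P.map (G m n)) 1 = ((Real.exp (-(1 / 2) * ∑ x, ∑ y, b n x * b n y *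
        modeCov σ (lam n) Δ ((idx x : ℝ) - idx y)) : ℝ) : ℂ) := by
      intro n
      have := integral_exp_initial_add_increments (h.brownian n) (h.measurable_β n)
        (h.measurable_u n 0) (hv0 n) (h.initial n) (h.indep_initial n) (hη0 m) (K m)
        (∑ x, b n x * q m n ^ (idx x * (m + 1))) (fun j ↦ ∑ x, b n x * cf m n x j)
      rw [hvar m n] at this
      rw [← this, charFun_apply_real, integral_map (hGm m n).aemeasurable (by fun_prop)]
      refine integral_congr_ae (ae_of_all _ fun ω ↦ ?_)
      simp only [ofReal_one, one_mul]
      rw [mul_comm]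
    rw [Finset.prod_congr rfl fun n _ ↦ c1 n, ← ofReal_prod, ← Real.exp_sum,
      charFun_apply_real, integral_map (Finset.measurable_sum _ fun n _ ↦ hGm m n).aemeasurable
        (by fun_prop)] at c2
    rw [Finset.mul_sum, ← c2]
    refine integral_congr_ae (ae_of_all _ fun ω ↦ ?_)
    simp only [ofReal_one, one_mul]
    rw [mul_comm]
  -- Pathwise convergence of the recursion passes to the bounded exponentials; the sequence of
  -- integrals is constant by `hexact`, which identifies the limit.
  have hlim : Tendsto (fun m ↦ ∫ ω, cexp (I * ((∑ n ∈ Finset.range L, G m n ω : ℝ) : ℂ)) ∂P) atTop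
      (𝓝 (∫ ω, cexp (I * ((∑ n ∈ Finset.range L, ∑ x, b n x * u n (idx x * Δ).toNNReal ω : ℝ) :
        ℂ)) ∂P)) := by
    refine tendsto_integral_of_dominated_convergence (fun _ ↦ 1) ?_ (integrable_const _) ?_ ?_
    · intro m
      have : Measurable (fun ω ↦ ∑ n ∈ Finset.range L, G m n ω) :=
        Finset.measurable_sum _ fun n _ ↦ hGm m n
      exact (by fun_prop : Measurable _).aestronglyMeasurable
    · intro m
      refine ae_of_all _ fun ω ↦ ?_
      rw [mul_comm, norm_exp_ofReal_mul_I]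
    · have a1 : ∀ᵐ ω ∂P, ∀ n, Continuous (fun t ↦ u n t ω) := ae_all_iff.2 h.continuous_u
      have a2 : ∀ᵐ ω ∂P, ∀ n, Continuous (fun t ↦ β n t ω) := ae_all_iff.2 fun n ↦ (h.brownian n).cont
      have a3 := ae_all_iff.2 h.dynamics
      filter_upwards [a1, a2, a3] with ω w1 w2 w3
      refine ((by fun_prop : Continuous fun x : ℝ ↦ cexp (I * (x : ℂ))).tendsto _).comp ?_
      refine tendsto_finsetSum _ fun n _ ↦ ?_
      simp_rw [hGw]
      refine tendsto_finsetSum _ fun x _ ↦ Tendsto.const_mul _ ?_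
      have := tendsto_autoregressive (u := fun t ↦ u n t.toNNReal ω) (B := fun t ↦ β n t.toNNReal ω)
        ((w1 n).comp continuous_real_toNNReal) ((w2 n).comp continuous_real_toNNReal)
        (σ := σ) (hlam0 n) (fun t ht ↦ by
          have := w3 n t.toNNReal
          rw [Real.coe_toNNReal _ ht] at this
          simpa using this) hΔ (idx x)
      simpa [hw, hq, hc, hη] using this
  simp_rw [hexact] at hlim
  exact tendsto_nhds_unique tendsto_const_nhds hlim |>.symm

/-- Gaussian laws of almost sure limits of mode expansions. -/
lemma SPDE.IsStationarySolution.integral_exp_series (hadm : Admissible σ ϑ₂ ϑ₁ ϑ₀)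
    (h : IsStationarySolution P σ ϑ₂ ϑ₁ ϑ₀ β u X) {Δ : ℝ} (hΔ : 0 < Δ) {τ : Type*} [Fintype τ]
    (b : ℕ → τ → ℝ) (idx : τ → ℕ) {Y : Ω → ℝ} {V : ℝ}
    (hY : ∀ᵐ ω ∂P, Tendsto (fun L ↦ ∑ n ∈ Finset.range L, ∑ x, b n x * u n (idx x * Δ).toNNReal ω)
      atTop (𝓝 (Y ω)))
    (hV : HasSum (fun n ↦ ∑ x, ∑ y, b n x * b n y *
        modeCov σ (eigenvalue ϑ₂ ϑ₁ ϑ₀ (n + 1)) Δ ((idx x : ℝ) - idx y)) V) :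
    ∫ ω, cexp (I * ((Y ω : ℝ) : ℂ)) ∂P = ((Real.exp (-(1 / 2) * V) : ℝ) : ℂ) := by
  have h1 : Tendsto (fun L ↦ ∫ ω, cexp (I * ((∑ n ∈ Finset.range L, ∑ x,
      b n x * u n (idx x * Δ).toNNReal ω : ℝ) : ℂ)) ∂P) atTop
      (𝓝 (∫ ω, cexp (I * ((Y ω : ℝ) : ℂ)) ∂P)) := by
    refine tendsto_integral_of_dominated_convergence (fun _ ↦ 1) ?_ (integrable_const _) ?_ ?_
    · intro L
      have : Measurable (fun ω ↦ ∑ n ∈ Finset.range L, ∑ x, b n x * u n (idx x * Δ).toNNReal ω) :=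
        Finset.measurable_sum _ fun n _ ↦ Finset.measurable_sum _ fun x _ ↦
          (h.measurable_u _ _).const_mul _
      exact (by fun_prop : Measurable _).aestronglyMeasurable
    · intro L
      refine ae_of_all _ fun ω ↦ ?_
      rw [mul_comm, norm_exp_ofReal_mul_I]
    · filter_upwards [hY] with ω hω
      exact ((by fun_prop : Continuous fun x : ℝ ↦ cexp (I * (x : ℂ))).tendsto _).comp hω
  simp_rw [h.integral_exp_modes hadm hΔ b idx] at h1
  refine tendsto_nhds_unique h1 ?_
  exact (continuous_ofReal.tendsto _).comp ((Real.continuous_exp.tendsto _).comp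
    (hV.tendsto_sum_nat.const_mul _))

end FieldLaw

/-! ### The Gaussian law and the covariance of the double increments -/

section IncrementLaw

open Complex SPDE

/-- The second central difference with unit step. -/
def secondDiff (f : ℝ → ℝ) (x : ℝ) : ℝ := f (x + 1) + f (x - 1) - 2 * f x

/-- The rescaled spatial increment of an eigenfunction. -/
noncomputable def spaceMode (ϑ₂ ϑ₁ b : ℝ) (M n k : ℕ) : ℝ :=
  Real.exp (kappa ϑ₂ ϑ₁ * gridSpace b M k / 2) *
    (eigenfunction ϑ₂ ϑ₁ (n + 1) (gridSpace b M (k + 1)) -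
      eigenfunction ϑ₂ ϑ₁ (n + 1) (gridSpace b M k))

/-- The covariance of the rescaled double increments. -/
noncomputable def incrementCov (σ ϑ₂ ϑ₁ ϑ₀ b T : ℝ) (M N : ℕ) (i k j l : ℕ) : ℝ :=
  ∑' n : ℕ, -secondDiff (modeCov σ (eigenvalue ϑ₂ ϑ₁ ϑ₀ (n + 1)) (meshTime T N)) ((i : ℝ) - j) *
    (spaceMode ϑ₂ ϑ₁ b M n k * spaceMode ϑ₂ ϑ₁ b M n l)

variable {σ ϑ₂ ϑ₁ ϑ₀ : ℝ}

/-- `Γ` may be negative, but only above `-π²`. The worst case is then `ℓ = 1`, which explains the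
minimum in the constant. -/
lemma exists_le_eigenvalue (h : Admissible σ ϑ₂ ϑ₁ ϑ₀) :
    ∃ c > 0, ∀ n : ℕ, c * ((n : ℝ) + 1) ^ 2 ≤ eigenvalue ϑ₂ ϑ₁ ϑ₀ (n + 1) := by
  obtain ⟨-, h2, h3⟩ := h
  refine ⟨ϑ₂ * min (Real.pi ^ 2) (Gam ϑ₂ ϑ₁ ϑ₀ + Real.pi ^ 2),
    mul_pos h2 (lt_min (by positivity) h3), fun n ↦ ?_⟩
  have h1 : (1 : ℝ) ≤ ((n : ℝ) + 1) ^ 2 := by nlinarith [n.cast_nonneg (α := ℝ)]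
  rw [eigenvalue, mul_assoc]
  refine mul_le_mul_of_nonneg_left ?_ h2.le
  push_cast
  rcases le_total 0 (Gam ϑ₂ ϑ₁ ϑ₀) with h4 | h4
  · have := min_le_left (Real.pi ^ 2) (Gam ϑ₂ ϑ₁ ϑ₀ + Real.pi ^ 2)
    nlinarith [mul_le_mul_of_nonneg_right this (sq_nonneg ((n : ℝ) + 1))]
  · have := min_le_right (Real.pi ^ 2) (Gam ϑ₂ ϑ₁ ϑ₀ + Real.pi ^ 2)
    nlinarith [mul_le_mul_of_nonneg_right this (sq_nonneg ((n : ℝ) + 1)),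
      mul_nonneg (neg_nonneg.2 h4) (sub_nonneg.2 h1)]

lemma summable_one_div_succ_sq : Summable fun n : ℕ ↦ 1 / ((n : ℝ) + 1) ^ 2 := by
  have := (summable_nat_add_iff 1).2 (Real.summable_one_div_nat_pow.2 (one_lt_two))
  simpa using this

lemma summable_inv_eigenvalue (h : Admissible σ ϑ₂ ϑ₁ ϑ₀) :
    Summable fun n : ℕ ↦ 1 / eigenvalue ϑ₂ ϑ₁ ϑ₀ (n + 1) := by
  obtain ⟨c, hc, hle⟩ := exists_le_eigenvalue h
  refine Summable.of_nonneg_of_le (fun n ↦ (one_div_pos.2 (eigenvalue_pos h n)).le) (fun n ↦ ?_)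
    (summable_one_div_succ_sq.mul_left (1 / c))
  rw [one_div_mul_one_div]
  exact one_div_le_one_div_of_le (by positivity) (hle n)

lemma abs_modeCov_le {lam Δ : ℝ} (hl : 0 < lam) (hΔ : 0 ≤ Δ) (x : ℝ) :
    |modeCov σ lam Δ x| ≤ σ ^ 2 / 2 * (1 / lam) := by
  rw [modeCov, abs_mul, abs_of_pos (Real.exp_pos _), abs_of_nonneg (by positivity)]
  have : Real.exp (-(lam * Δ * |x|)) ≤ 1 := Real.exp_le_one_iff.2 (by
    have : 0 ≤ lam * Δ * |x| := by positivity
    linarith)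
  calc σ ^ 2 / (2 * lam) * Real.exp (-(lam * Δ * |x|)) ≤ σ ^ 2 / (2 * lam) * 1 := by gcongr
    _ = _ := by field_simp

lemma abs_secondDiff_modeCov_le {lam Δ : ℝ} (hl : 0 < lam) (hΔ : 0 ≤ Δ) (x : ℝ) :
    |secondDiff (modeCov σ lam Δ) x| ≤ 2 * σ ^ 2 * (1 / lam) := by
  have h1 := abs_le.1 (abs_modeCov_le (σ := σ) hl hΔ (x + 1))
  have h2 := abs_le.1 (abs_modeCov_le (σ := σ) hl hΔ (x - 1))
  have h3 := abs_le.1 (abs_modeCov_le (σ := σ) hl hΔ x)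
  rw [secondDiff, abs_le]
  constructor <;> linarith [h1.1, h1.2, h2.1, h2.2, h3.1, h3.2]

/-- The weight `exp(κ y_k / 2)` cancels the exponential of the eigenfunction at `y_k` and leaves
only `exp(-κ δ / 2)` at `y_{k+1}`, a factor that does not depend on `k`. This is what makes the
covariance almost stationary in space. -/
lemma spaceMode_eq (b : ℝ) (M n k : ℕ) : spaceMode ϑ₂ ϑ₁ b M n k = √2 *
    (Real.exp (-(kappa ϑ₂ ϑ₁ * meshSpace b M / 2)) *
      Real.sin (Real.pi * ((n : ℝ) + 1) * gridSpace b M (k + 1)) -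
      Real.sin (Real.pi * ((n : ℝ) + 1) * gridSpace b M k)) := by
  have e1 : gridSpace b M (k + 1) = gridSpace b M k + meshSpace b M := by
    simp only [gridSpace]; push_cast; ring
  have e2 : Real.exp (-(kappa ϑ₂ ϑ₁ * meshSpace b M / 2)) =
      Real.exp (kappa ϑ₂ ϑ₁ * gridSpace b M k / 2) *
        Real.exp (-(kappa ϑ₂ ϑ₁ * gridSpace b M (k + 1) / 2)) := by
    rw [← Real.exp_add, e1]; congr 1; ring
  have e3 : Real.exp (kappa ϑ₂ ϑ₁ * gridSpace b M k / 2) *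
        Real.exp (-(kappa ϑ₂ ϑ₁ * gridSpace b M k / 2)) = 1 := by
    rw [← Real.exp_add]; simp
  rw [spaceMode, eigenfunction, eigenfunction, e2]
  push_cast
  linear_combination (-√2 * Real.sin (Real.pi * ((n : ℝ) + 1) * gridSpace b M k)) * e3

lemma abs_spaceMode_le (b : ℝ) (M n k : ℕ) : |spaceMode ϑ₂ ϑ₁ b M n k| ≤
    √2 * (Real.exp (-(kappa ϑ₂ ϑ₁ * meshSpace b M / 2)) + 1) := by
  rw [spaceMode_eq, abs_mul, abs_of_nonneg (Real.sqrt_nonneg _)]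
  refine mul_le_mul_of_nonneg_left ((abs_sub _ _).trans (add_le_add ?_ (Real.abs_sin_le_one _)))
    (Real.sqrt_nonneg _)
  rw [abs_mul, abs_of_pos (Real.exp_pos _)]
  exact mul_le_of_le_one_right (Real.exp_pos _).le (Real.abs_sin_le_one _)

lemma summable_incrementCov (h : Admissible σ ϑ₂ ϑ₁ ϑ₀) (b : ℝ) {T : ℝ} (hT : 0 ≤ T)
    (M N : ℕ) (x : ℝ) (k l : ℕ) :
    Summable fun n : ℕ ↦ -secondDiff (modeCov σ (eigenvalue ϑ₂ ϑ₁ ϑ₀ (n + 1)) (meshTime T N)) x *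
    (spaceMode ϑ₂ ϑ₁ b M n k * spaceMode ϑ₂ ϑ₁ b M n l) := by
  set B := √2 * (Real.exp (-(kappa ϑ₂ ϑ₁ * meshSpace b M / 2)) + 1)
  refine Summable.of_norm_bounded
    (((summable_inv_eigenvalue h).mul_left (2 * σ ^ 2)).mul_right (B * B)) fun n ↦ ?_
  rw [Real.norm_eq_abs, abs_mul, abs_neg, abs_mul]
  have := eigenvalue_pos h n
  gcongr
  · exact abs_secondDiff_modeCov_le this (div_nonneg hT (Nat.cast_nonneg _)) _
  · exact abs_spaceMode_le ..
  · exact abs_spaceMode_le ..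

lemma gridSpace_mem {b : ℝ} (hb2 : b < 1 / 2) {M k : ℕ} (hk : k ≤ M) :
    gridSpace b M k ∈ Set.Icc b (1 - b) := by
  rw [gridSpace, meshSpace]
  rcases Nat.eq_zero_or_pos M with h0 | h0
  · subst h0; simp; linarith
  have hM : (0 : ℝ) < M := by exact_mod_cast h0
  have h1 : (k : ℝ) / M ≤ 1 := by rw [div_le_one hM]; exact_mod_cast hk
  have h2 : 0 ≤ (k : ℝ) / M := by positivity
  have e : (k : ℝ) * ((1 - 2 * b) / M) = (k / M) * (1 - 2 * b) := by ring
  rw [e]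
  constructor <;> nlinarith

variable {Ω : Type*} [MeasurableSpace Ω] {P : Measure Ω}
  {β u : ℕ → ℝ≥0 → Ω → ℝ} {X : ℝ≥0 → ℝ → Ω → ℝ}

lemma SPDE.IsStationarySolution.aemeasurable (h : IsStationarySolution P σ ϑ₂ ϑ₁ ϑ₀ β u X)
    (t : ℝ≥0) {x : ℝ} (hx : x ∈ Set.Icc (0 : ℝ) 1) : AEMeasurable (X t x) P :=
  aemeasurable_of_tendsto_metrizable_ae atTop
    (fun L ↦ (Finset.measurable_sum (Finset.range L) fun n _ ↦
      (h.measurable_u n t).mul_const (eigenfunction ϑ₂ ϑ₁ (n + 1) x)).aemeasurable)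
    (h.expansion t x hx)

lemma SPDE.IsStationarySolution.aemeasurable_doubleIncrement
    (h : IsStationarySolution P σ ϑ₂ ϑ₁ ϑ₀ β u X) {b T : ℝ} (hb : 0 < b) (hb2 : b < 1 / 2)
    {M N i k : ℕ} (hk : k < M) : AEMeasurable (doubleIncrement X b T M N i k) P := by
  have h1 : ∀ j ≤ M, gridSpace b M j ∈ Set.Icc (0 : ℝ) 1 := fun j hj ↦ by
    have := gridSpace_mem hb2 hj
    exact ⟨by linarith [this.1], by linarith [this.2]⟩
  exact (((h.aemeasurable _ (h1 _ hk)).sub (h.aemeasurable _ (h1 _ hk.le))).sub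
    (h.aemeasurable _ (h1 _ hk))).add (h.aemeasurable _ (h1 _ hk.le))

/-- The rescaled double increments form a centred Gaussian vector. -/
theorem SPDE.IsStationarySolution.isCenteredGaussianVector [IsProbabilityMeasure P]
    (hadm : Admissible σ ϑ₂ ϑ₁ ϑ₀)
    (h : IsStationarySolution P σ ϑ₂ ϑ₁ ϑ₀ β u X) {b T : ℝ} (hb : 0 < b) (hb2 : b < 1 / 2)
    (hT : 0 < T) {M N : ℕ} (hN : 0 < N) (s : ℝ) :
    IsCenteredGaussianVector P (fun (p : Fin N × Fin M) ω ↦ s *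
      (Real.exp (kappa ϑ₂ ϑ₁ * gridSpace b M p.2 / 2) * doubleIncrement X b T M N p.1 p.2 ω))
      (Matrix.of fun p q : Fin N × Fin M ↦
        s ^ 2 * incrementCov σ ϑ₂ ϑ₁ ϑ₀ b T M N p.1 p.2 q.1 q.2) := by
  have hΔ : 0 < meshTime T N := div_pos hT (by exact_mod_cast hN)
  refine ⟨fun p ↦ ((h.aemeasurable_doubleIncrement hb hb2 p.2.2).const_mul _).const_mul _,
    fun a ↦ ?_⟩
  -- The Boolean selects one of the two times of an increment: `true` is `t_{i+1}` with sign plus,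
  -- `false` is `t_i` with sign minus.
  set bb : ℕ → (Fin N × Fin M) × Bool → ℝ := fun n x ↦
    a x.1 * s * spaceMode ϑ₂ ϑ₁ b M n x.1.2 * (if x.2 then 1 else -1) with hbb
  set idx : (Fin N × Fin M) × Bool → ℕ := fun x ↦ x.1.1 + (if x.2 then 1 else 0) with hidx
  refine h.integral_exp_series hadm hΔ bb idx ?_ ?_
  · have h1 : ∀ j ≤ M, gridSpace b M j ∈ Set.Icc (0 : ℝ) 1 := fun j hj ↦ by
      have := gridSpace_mem hb2 hj
      exact ⟨by linarith [this.1], by linarith [this.2]⟩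
    have h2 : ∀ᵐ ω ∂P, ∀ i : ℕ, ∀ k : Fin (M + 1), Tendsto (fun L : ℕ ↦ ∑ n ∈ Finset.range L,
        u n (gridTime T N i) ω * eigenfunction ϑ₂ ϑ₁ (n + 1) (gridSpace b M k)) atTop
        (𝓝 (X (gridTime T N i) (gridSpace b M k) ω)) :=
      ae_all_iff.2 fun i ↦ ae_all_iff.2 fun k ↦ h.expansion _ _ (h1 _ (Nat.lt_succ_iff.1 k.2))
    filter_upwards [h2] with ω hω
    have h3 : ∀ i k : ℕ, k ≤ M → Tendsto (fun L : ℕ ↦ ∑ n ∈ Finset.range L,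
        u n (gridTime T N i) ω * eigenfunction ϑ₂ ϑ₁ (n + 1) (gridSpace b M k)) atTop
        (𝓝 (X (gridTime T N i) (gridSpace b M k) ω)) :=
      fun i k hk ↦ hω i ⟨k, Nat.lt_succ_of_le hk⟩
    have h4 : ∀ L : ℕ, ∑ n ∈ Finset.range L, ∑ x, bb n x * u n (idx x * meshTime T N).toNNReal ω =
        ∑ p : Fin N × Fin M, a p * (s * (Real.exp (kappa ϑ₂ ϑ₁ * gridSpace b M p.2 / 2) *
        (∑ n ∈ Finset.range L, u n (gridTime T N (p.1 + 1)) ω *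
            eigenfunction ϑ₂ ϑ₁ (n + 1) (gridSpace b M (p.2 + 1))
          - ∑ n ∈ Finset.range L, u n (gridTime T N (p.1 + 1)) ω *
            eigenfunction ϑ₂ ϑ₁ (n + 1) (gridSpace b M p.2)
          - ∑ n ∈ Finset.range L, u n (gridTime T N p.1) ω *
            eigenfunction ϑ₂ ϑ₁ (n + 1) (gridSpace b M (p.2 + 1))
          + ∑ n ∈ Finset.range L, u n (gridTime T N p.1) ω *
            eigenfunction ϑ₂ ϑ₁ (n + 1) (gridSpace b M p.2)))) := by
      intro L
      simp_rw [← Finset.sum_sub_distrib, ← Finset.sum_add_distrib, Finset.mul_sum]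
      rw [Finset.sum_comm (s := Finset.univ)]
      refine Finset.sum_congr rfl fun n _ ↦ ?_
      rw [Fintype.sum_prod_type]
      refine Finset.sum_congr rfl fun p _ ↦ ?_
      simp only [Fintype.sum_bool, hbb, hidx, gridTime, spaceMode, if_true, Bool.false_eq_true,
        if_false, add_zero]
      ring
    simp_rw [h4]
    refine tendsto_finsetSum _ fun p _ ↦ ?_
    refine Tendsto.const_mul _ (Tendsto.const_mul _ (Tendsto.const_mul _ ?_))
    exact (((h3 _ _ p.2.2).sub (h3 _ _ p.2.2.le)).sub (h3 _ _ p.2.2)).add (h3 _ _ p.2.2.le)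
  -- The four sign combinations of the two Booleans assemble into minus the second difference of the
  -- stationary covariance at lag `i - j`.
  · have h5 : ∀ n, ∑ x, ∑ y, bb n x * bb n y * modeCov σ (eigenvalue ϑ₂ ϑ₁ ϑ₀ (n + 1))
        (meshTime T N) ((idx x : ℝ) - idx y) = ∑ p : Fin N × Fin M, ∑ q : Fin N × Fin M,
        a p * a q * (s ^ 2 * (-secondDiff (modeCov σ (eigenvalue ϑ₂ ϑ₁ ϑ₀ (n + 1)) (meshTime T N))
          (((p.1 : ℕ) : ℝ) - ((q.1 : ℕ) : ℝ)) *
          (spaceMode ϑ₂ ϑ₁ b M n p.2 * spaceMode ϑ₂ ϑ₁ b M n q.2))) := by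
      intro n
      rw [Fintype.sum_prod_type]
      refine Finset.sum_congr rfl fun p _ ↦ ?_
      simp only [Fintype.sum_bool]
      rw [← Finset.sum_add_distrib, Fintype.sum_prod_type]
      refine Finset.sum_congr rfl fun q _ ↦ ?_
      simp only [Fintype.sum_bool, hbb, hidx, if_true, Bool.false_eq_true,
        if_false, add_zero, secondDiff]
      push_cast
      rw [show ((p.1 : ℕ) : ℝ) + 1 - (((q.1 : ℕ) : ℝ) + 1) = ((p.1 : ℕ) : ℝ) - ((q.1 : ℕ) : ℝ) by ring,
        show ((p.1 : ℕ) : ℝ) - (((q.1 : ℕ) : ℝ) + 1) = ((p.1 : ℕ) : ℝ) - ((q.1 : ℕ) : ℝ) - 1 by ring,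
        show ((p.1 : ℕ) : ℝ) + 1 - (((q.1 : ℕ) : ℝ)) = ((p.1 : ℕ) : ℝ) - ((q.1 : ℕ) : ℝ) + 1 by ring]
      ring
    simp_rw [h5]
    refine hasSum_sum fun p _ ↦ hasSum_sum fun q _ ↦ HasSum.mul_left _ (HasSum.mul_left _ ?_)
    exact (summable_incrementCov hadm b hT.le M N _ _ _).hasSum

end IncrementLaw

/-! ### The function `H` and the heat kernel -/

section HeatKernel

open SPDE

/-- The Gaussian tail `∫_{x/2}^∞ exp(-z²) dz`. -/
noncomputable def gaussTail (x : ℝ) : ℝ := ∫ z in Set.Ioi (x / 2), Real.exp (-z ^ 2)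

lemma integrable_exp_neg_sq : Integrable fun z : ℝ ↦ Real.exp (-z ^ 2) := by
  simpa using integrable_exp_neg_mul_sq one_pos

lemma gaussTail_eq (x : ℝ) :
    gaussTail x = gaussTail 0 - ∫ z in (0 : ℝ)..(x / 2), Real.exp (-z ^ 2) := by
  have := intervalIntegral.integral_Ioi_sub_Ioi' (a := (0 : ℝ)) (b := x / 2) (μ := volume)
    (f := fun z ↦ Real.exp (-z ^ 2)) integrable_exp_neg_sq.integrableOn
    integrable_exp_neg_sq.integrableOn
  rw [gaussTail, gaussTail, zero_div, ← this]
  ring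

lemma gaussTail_zero : gaussTail 0 = √Real.pi / 2 := by
  have := integral_gaussian_Ioi 1
  simpa [gaussTail] using this

lemma gaussTail_nonneg (x : ℝ) : 0 ≤ gaussTail x :=
  integral_nonneg fun _ ↦ (Real.exp_pos _).le

lemma hasDerivAt_gaussTail (x : ℝ) :
    HasDerivAt gaussTail (-(1 / 2) * Real.exp (-(x ^ 2 / 4))) x := by
  have hc : Continuous fun z : ℝ ↦ Real.exp (-z ^ 2) := by fun_prop
  have h1 : HasDerivAt (fun y ↦ ∫ z in (0 : ℝ)..y, Real.exp (-z ^ 2)) (Real.exp (-(x / 2) ^ 2))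
      (x / 2) := intervalIntegral.integral_hasDerivAt_right (hc.intervalIntegrable _ _)
        (hc.stronglyMeasurableAtFilter _ _) hc.continuousAt
  have h2 := (h1.comp x ((hasDerivAt_id' x).div_const 2)).const_sub (gaussTail 0)
  have h3 : gaussTail = fun x ↦ gaussTail 0 - ∫ z in (0 : ℝ)..(x / 2), Real.exp (-z ^ 2) :=
    funext gaussTail_eq
  rw [h3]
  refine h2.congr_deriv ?_
  rw [show -(x / 2) ^ 2 = -(x ^ 2 / 4) by ring]
  ring

lemma gaussTail_neg (x : ℝ) : gaussTail (-x) = √Real.pi - gaussTail x := by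
  rw [gaussTail_eq (-x), gaussTail_eq x, gaussTail_zero]
  have : ∫ z in (0 : ℝ)..(-x / 2), Real.exp (-z ^ 2) = -∫ z in (0 : ℝ)..(x / 2), Real.exp (-z ^ 2) := by
    have h := intervalIntegral.integral_comp_neg (a := (0 : ℝ)) (b := x / 2)
      (fun z ↦ Real.exp (-z ^ 2))
    simp only [even_two, Even.neg_pow, neg_zero] at h
    rw [h, ← intervalIntegral.integral_symm, neg_div]
  rw [this]
  ring

lemma antitone_gaussTail : Antitone gaussTail := by
  refine antitone_of_hasDerivAt_nonpos hasDerivAt_gaussTail fun x ↦ ?_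
  show _ ≤ (0 : ℝ)
  nlinarith [Real.exp_pos (-(x ^ 2 / 4))]

lemma H_eq (x : ℝ) :
    H x = 1 / (2 * √Real.pi) * (Real.exp (-(x ^ 2 / 4)) - x * gaussTail x) := rfl

lemma H_zero : H 0 = 1 / (2 * √Real.pi) := by simp [H_eq]

/-- `H` is smooth through the origin but not even. The linear defect is exactly the kink created
there by evaluating `H` at `|x|`. -/
lemma H_neg (x : ℝ) : H (-x) = H x + x / 2 := by
  have hp : √Real.pi ≠ 0 := by positivity
  rw [H_eq, H_eq, gaussTail_neg, neg_sq]
  field_simp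
  ring

lemma hasDerivAt_H (x : ℝ) : HasDerivAt H (-(1 / (2 * √Real.pi)) * gaussTail x) x := by
  have h1 : HasDerivAt (fun x : ℝ ↦ Real.exp (-(x ^ 2 / 4)))
      (-(x / 2) * Real.exp (-(x ^ 2 / 4))) x := by
    refine (((hasDerivAt_pow 2 x).div_const 4).fun_neg).exp.congr_deriv ?_
    simp; ring
  have h2 := (h1.fun_sub ((hasDerivAt_id' x).fun_mul (hasDerivAt_gaussTail x))).const_mul
    (1 / (2 * √Real.pi))
  refine h2.congr_deriv ?_
  ring

/-- On the domain of integration `x ≤ 2 z`, and `2 z exp(-z²)` has an explicit primitive. -/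
lemma mul_gaussTail_le (x : ℝ) : x * gaussTail x ≤ Real.exp (-(x ^ 2 / 4)) := by
  have h1 : ∫ z in Set.Ioi (x / 2), 2 * z * Real.exp (-z ^ 2) = Real.exp (-(x ^ 2 / 4)) := by
    have hd : ∀ z ∈ Set.Ici (x / 2), HasDerivAt (fun z : ℝ ↦ -Real.exp (-z ^ 2))
        (2 * z * Real.exp (-z ^ 2)) z := by
      intro z _
      refine ((hasDerivAt_pow 2 z).fun_neg.exp).fun_neg.congr_deriv ?_
      simp; ring
    have hi : IntegrableOn (fun z : ℝ ↦ 2 * z * Real.exp (-z ^ 2)) (Set.Ioi (x / 2)) := by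
      have := (integrable_mul_exp_neg_mul_sq one_pos).const_mul 2
      refine Integrable.integrableOn (this.congr (ae_of_all _ fun z ↦ ?_))
      simp; ring
    have ht : Tendsto (fun z : ℝ ↦ -Real.exp (-z ^ 2)) atTop (𝓝 0) := by
      have : Tendsto (fun z : ℝ ↦ -z ^ 2) atTop atBot :=
        tendsto_neg_atTop_atBot.comp (tendsto_pow_atTop two_ne_zero)
      simpa using (Real.tendsto_exp_atBot.comp this).neg
    rw [integral_Ioi_of_hasDerivAt_of_tendsto' hd hi ht, zero_sub, neg_neg]
    congr 1; ring
  rw [← h1, gaussTail, ← integral_const_mul]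
  refine setIntegral_mono_on (integrable_exp_neg_sq.integrableOn.const_mul x) ?_
    measurableSet_Ioi fun z hz ↦ ?_
  · have := (integrable_mul_exp_neg_mul_sq one_pos).const_mul 2
    refine Integrable.integrableOn (this.congr (ae_of_all _ fun z ↦ ?_))
    simp; ring
  · have : x ≤ 2 * z := by have := Set.mem_Ioi.1 hz; linarith
    gcongr

lemma H_nonneg (x : ℝ) : 0 ≤ H x := by
  rw [H_eq]
  exact mul_nonneg (by positivity) (sub_nonneg.2 (mul_gaussTail_le x))

lemma antitone_H : Antitone H := by
  refine antitone_of_hasDerivAt_nonpos hasDerivAt_H fun x ↦ ?_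
  have := gaussTail_nonneg x
  have : 0 ≤ 1 / (2 * √Real.pi) * gaussTail x := by positivity
  show _ ≤ (0 : ℝ)
  linarith

lemma one_le_sqrt_pi : 1 ≤ √Real.pi := by
  rw [Real.one_le_sqrt]; linarith [Real.pi_gt_three]

lemma H_zero_le : H 0 ≤ 1 := by
  rw [H_zero, div_le_one (by positivity)]
  linarith [one_le_sqrt_pi]

lemma H_le_one {x : ℝ} (hx : 0 ≤ x) : H x ≤ 1 := (antitone_H hx).trans H_zero_le

lemma mul_H_le_one {x : ℝ} (hx : 0 ≤ x) : x * H x ≤ 1 := by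
  have h1 : H x ≤ 1 / 2 * Real.exp (-(x ^ 2 / 4)) := by
    rw [H_eq]
    have h2 : 1 / (2 * √Real.pi) ≤ 1 / 2 :=
      one_div_le_one_div_of_le (by norm_num) (by linarith [one_le_sqrt_pi])
    have h3 : Real.exp (-(x ^ 2 / 4)) - x * gaussTail x ≤ Real.exp (-(x ^ 2 / 4)) := by
      have := mul_nonneg hx (gaussTail_nonneg x)
      linarith
    calc _ ≤ 1 / (2 * √Real.pi) * Real.exp (-(x ^ 2 / 4)) := by gcongr
      _ ≤ _ := by gcongr
  have h4 : x / 2 ≤ Real.exp (x ^ 2 / 4) := by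
    have := Real.add_one_le_exp (x ^ 2 / 4)
    nlinarith [sq_nonneg (x / 2 - 1)]
  calc x * H x ≤ x * (1 / 2 * Real.exp (-(x ^ 2 / 4))) := by gcongr
    _ = (x / 2) * Real.exp (-(x ^ 2 / 4)) := by ring
    _ ≤ Real.exp (x ^ 2 / 4) * Real.exp (-(x ^ 2 / 4)) := by gcongr
    _ = 1 := by rw [← Real.exp_add]; simp

lemma continuous_H : Continuous H :=
  continuous_iff_continuousAt.2 fun x ↦ (hasDerivAt_H x).continuousAt

/-- The heat kernel `p_t(x)` of `∂_t = ∂_x²`. -/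
noncomputable def heat (t x : ℝ) : ℝ := 1 / √(4 * Real.pi * t) * Real.exp (-(x ^ 2 / (4 * t)))

/-- The time-integrated heat kernel `½ ∫_0^t p_s(x) ds`, for `x ≥ 0`. -/
noncomputable def heatInt (t x : ℝ) : ℝ := √t * H (x / √t)

lemma sqrt_four_pi_mul (t : ℝ) : √(4 * Real.pi * t) = 2 * √Real.pi * √t := by
  rw [Real.sqrt_mul (by positivity), Real.sqrt_mul (by norm_num),
    show (4 : ℝ) = 2 ^ 2 by norm_num, Real.sqrt_sq (by norm_num)]

lemma heat_nonneg (t x : ℝ) : 0 ≤ heat t x := by rw [heat]; positivity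

lemma hasDerivAt_heatInt_space {t : ℝ} (ht : 0 < t) (x : ℝ) :
    HasDerivAt (heatInt t) (-(1 / (2 * √Real.pi)) * gaussTail (x / √t)) x := by
  have hs : √t ≠ 0 := by positivity
  have h := ((hasDerivAt_H (x / √t)).comp x ((hasDerivAt_id' x).div_const √t)).const_mul √t
  refine h.congr_deriv ?_
  field_simp

/-- Together with `hasDerivAt_heatInt_time` this says that `heatInt` solves the heat equation on the
whole line, so its second differences in time and in space are both governed by the kernel. -/
lemma hasDerivAt_heatInt_space_deriv {t : ℝ} (ht : 0 < t) (x : ℝ) :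
    HasDerivAt (fun x ↦ -(1 / (2 * √Real.pi)) * gaussTail (x / √t)) (heat t x / 2) x := by
  have hs : √t ≠ 0 := by positivity
  have hp : √Real.pi ≠ 0 := by positivity
  have h := ((hasDerivAt_gaussTail (x / √t)).comp x ((hasDerivAt_id' x).div_const √t)).const_mul
    (-(1 / (2 * √Real.pi)))
  refine h.congr_deriv ?_
  rw [heat, sqrt_four_pi_mul, div_pow, Real.sq_sqrt ht.le,
    show x ^ 2 / t / 4 = x ^ 2 / (4 * t) by ring]
  field_simp

lemma hasDerivAt_heatInt_time {t : ℝ} (ht : 0 < t) (x : ℝ) :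
    HasDerivAt (fun t ↦ heatInt t x) (heat t x / 2) t := by
  have hs : √t ≠ 0 := by positivity
  have hp : √Real.pi ≠ 0 := by positivity
  have h1 := Real.hasDerivAt_sqrt ht.ne'
  have h2 := h1.fun_mul ((hasDerivAt_H (x / √t)).comp t ((hasDerivAt_const t x).fun_div h1 hs))
  refine h2.congr_deriv ?_
  rw [Function.comp_apply, heat, sqrt_four_pi_mul, H_eq, div_pow, Real.sq_sqrt ht.le,
    show x ^ 2 / t / 4 = x ^ 2 / (4 * t) by ring]
  field_simp
  simp
  linear_combination (x * gaussTail (x / √t)) * Real.sq_sqrt ht.le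

/-- The time derivative of the heat kernel. -/
noncomputable def heatDeriv (t x : ℝ) : ℝ := heat t x * (x ^ 2 / (4 * t ^ 2) - 1 / (2 * t))

lemma hasDerivAt_heat_time {t : ℝ} (ht : 0 < t) (x : ℝ) :
    HasDerivAt (fun t ↦ heat t x) (heatDeriv t x) t := by
  have hs : √t ≠ 0 := by positivity
  have hp : √Real.pi ≠ 0 := by positivity
  have e : (fun t ↦ heat t x) = fun t ↦ 1 / (2 * √Real.pi) * ((√t)⁻¹ *
      Real.exp (-(x ^ 2 / 4 * t⁻¹))) := by
    funext t
    rw [heat, sqrt_four_pi_mul, show x ^ 2 / (4 * t) = x ^ 2 / 4 * t⁻¹ by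
      rw [← div_div]; ring, one_div, one_div, mul_inv, mul_assoc]
  rw [e]
  have h1 := ((Real.hasDerivAt_sqrt ht.ne').fun_inv hs)
  have h2 := (((hasDerivAt_inv ht.ne').const_mul (x ^ 2 / 4)).fun_neg).exp
  have h3 := (h1.fun_mul h2).const_mul (1 / (2 * √Real.pi))
  refine h3.congr_deriv ?_
  rw [heatDeriv, heat, sqrt_four_pi_mul, show x ^ 2 / (4 * t) = x ^ 2 / 4 * t⁻¹ by
      rw [← div_div]; ring, Real.sq_sqrt ht.le]
  have hq : √t ^ 2 = t := Real.sq_sqrt ht.le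
  field_simp
  ring

lemma heat_le {t : ℝ} (ht : 0 < t) (x : ℝ) : heat t x ≤ 1 / √t := by
  rw [heat, sqrt_four_pi_mul]
  have h1 : Real.exp (-(x ^ 2 / (4 * t))) ≤ 1 := Real.exp_le_one_iff.2 (by
    have : 0 ≤ x ^ 2 / (4 * t) := by positivity
    linarith)
  have h2 : √t ≤ 2 * √Real.pi * √t := by
    have := one_le_sqrt_pi
    nlinarith [Real.sqrt_nonneg t]
  calc _ ≤ 1 / (2 * √Real.pi * √t) * 1 := by gcongr
    _ ≤ 1 / √t := by rw [mul_one]; exact one_div_le_one_div_of_le (by positivity) h2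

lemma abs_heatDeriv_le {t : ℝ} (ht : 0 < t) (x : ℝ) : |heatDeriv t x| ≤ 1 / (t * √t) := by
  set y := x ^ 2 / (4 * t) with hy
  have hy0 : 0 ≤ y := by positivity
  have e1 : heatDeriv t x = 1 / √(4 * Real.pi * t) * (1 / t) * (Real.exp (-y) * (y - 1 / 2)) := by
    rw [heatDeriv, heat, hy]; field_simp
  have h1 : |Real.exp (-y) * (y - 1 / 2)| ≤ 1 := by
    rw [abs_mul, abs_of_pos (Real.exp_pos _)]
    have : |y - 1 / 2| ≤ Real.exp y := by
      have := Real.add_one_le_exp y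
      rw [abs_le]; constructor <;> linarith
    calc _ ≤ Real.exp (-y) * Real.exp y := by gcongr
      _ = 1 := by rw [← Real.exp_add]; simp
  rw [e1, abs_mul, abs_of_nonneg (by positivity)]
  have h2 : 1 / √(4 * Real.pi * t) ≤ 1 / √t := by
    refine one_div_le_one_div_of_le (by positivity) (Real.sqrt_le_sqrt ?_)
    nlinarith [Real.pi_gt_three]
  calc _ ≤ 1 / √t * (1 / t) * 1 := by gcongr
    _ = _ := by rw [mul_one, one_div_mul_one_div, mul_comm]

/-- Compared with `abs_heatDeriv_le`, a factor `1 / √t` is traded for one power of decay in `x`; the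
two bounds together give the product decay of `Λ` in both lags. -/
lemma mul_abs_heatDeriv_le {t x : ℝ} (ht : 0 < t) (hx : 0 ≤ x) : x * |heatDeriv t x| ≤ 1 / t := by
  set y := x / (2 * √t) with hy
  have hst : 0 < √t := by positivity
  have hq : √t ^ 2 = t := Real.sq_sqrt ht.le
  have hy0 : 0 ≤ y := by positivity
  have hx' : x = 2 * √t * y := by rw [hy]; field_simp
  have e0 : x ^ 2 / (4 * t) = y ^ 2 := by rw [hx', mul_pow, mul_pow, hq]; field_simp; ring
  have e1 : heatDeriv t x = 1 / √(4 * Real.pi * t) * (1 / t) *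
      (Real.exp (-y ^ 2) * (y ^ 2 - 1 / 2)) := by
    rw [heatDeriv, heat, e0, show x ^ 2 / (4 * t ^ 2) = y ^ 2 / t by rw [← e0]; field_simp]
    field_simp
  have h1 : y * |Real.exp (-y ^ 2) * (y ^ 2 - 1 / 2)| ≤ 1 := by
    rw [abs_mul, abs_of_pos (Real.exp_pos _)]
    have h2 : y * |y ^ 2 - 1 / 2| ≤ Real.exp (y ^ 2) := by
      have h3 := Real.quadratic_le_exp_of_nonneg (sq_nonneg y)
      have h4 : |y ^ 2 - 1 / 2| ≤ y ^ 2 + 1 := by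
        rw [abs_le]; constructor <;> nlinarith [sq_nonneg y]
      nlinarith [mul_le_mul_of_nonneg_left h4 hy0, sq_nonneg (y - 1), sq_nonneg (y ^ 2),
        mul_nonneg (sq_nonneg (y - 1)) (by positivity : 0 ≤ y ^ 2 + 1)]
    calc y * (Real.exp (-y ^ 2) * |y ^ 2 - 1 / 2|) = Real.exp (-y ^ 2) * (y * |y ^ 2 - 1 / 2|) := by
          ring
      _ ≤ Real.exp (-y ^ 2) * Real.exp (y ^ 2) := by gcongr
      _ = 1 := by rw [← Real.exp_add]; simp
  rw [e1, abs_mul, abs_of_nonneg (by positivity : 0 ≤ 1 / √(4 * Real.pi * t) * (1 / t))]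
  have h5 : 2 * √t * (1 / √(4 * Real.pi * t)) ≤ 1 := by
    rw [mul_one_div, div_le_one (by positivity), sqrt_four_pi_mul]
    nlinarith [one_le_sqrt_pi]
  calc _ = (2 * √t * (1 / √(4 * Real.pi * t))) * (1 / t) *
      (y * |Real.exp (-y ^ 2) * (y ^ 2 - 1 / 2)|) := by
        nth_rw 1 [hx']; ring
    _ ≤ 1 * (1 / t) * 1 := by gcongr
    _ = _ := by ring

lemma abs_heat_sub_le {s t : ℝ} (hs : 0 < s) (hst : s ≤ t) (x : ℝ) :
    |heat t x - heat s x| ≤ 1 / (s * √s) * (t - s) := by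
  have h := Convex.norm_image_sub_le_of_norm_hasDerivWithin_le (f := fun t ↦ heat t x)
    (f' := fun t ↦ heatDeriv t x) (s := Set.Icc s t) (C := 1 / (s * √s)) (x := s) (y := t)
    (fun r hr ↦ (hasDerivAt_heat_time (hs.trans_le hr.1) x).hasDerivWithinAt)
    (fun r hr ↦ ?_) (convex_Icc s t) ⟨le_rfl, hst⟩ ⟨hst, le_rfl⟩
  · rwa [Real.norm_eq_abs, Real.norm_eq_abs, abs_of_nonneg (sub_nonneg.2 hst)] at h
  · refine (abs_heatDeriv_le (hs.trans_le hr.1) x).trans ?_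
    have : √s ≤ √r := Real.sqrt_le_sqrt hr.1
    have h0 : 0 < √s := by positivity
    exact one_div_le_one_div_of_le (by positivity) (mul_le_mul hr.1 this h0.le (hs.trans_le hr.1).le)

/-- A second difference is controlled by the second derivative. -/
lemma abs_second_difference_le {f f' f'' : ℝ → ℝ} {x a K : ℝ} (ha : 0 ≤ a)
    (h1 : ∀ y ∈ Set.Icc (x - a) (x + a), HasDerivAt f (f' y) y)
    (h2 : ∀ y ∈ Set.Icc (x - a) (x + a), HasDerivAt f' (f'' y) y)
    (h3 : ∀ y ∈ Set.Icc (x - a) (x + a), |f'' y| ≤ K) :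
    |f (x + a) + f (x - a) - 2 * f x| ≤ 2 * K * a ^ 2 := by
  have hK : 0 ≤ K := (abs_nonneg _).trans (h3 x ⟨by linarith, by linarith⟩)
  have hd : ∀ u ∈ Set.Icc 0 a, |f' (x + u) - f' (x - u)| ≤ 2 * K * a := by
    intro u hu
    have h := Convex.norm_image_sub_le_of_norm_hasDerivWithin_le (f := f')
      (f' := f'') (s := Set.Icc (x - a) (x + a)) (C := K) (x := x - u) (y := x + u)
      (fun r hr ↦ (h2 r hr).hasDerivWithinAt) h3 (convex_Icc _ _)
      ⟨by linarith [hu.2], by linarith [hu.1]⟩ ⟨by linarith [hu.1], by linarith [hu.2]⟩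
    rw [Real.norm_eq_abs, Real.norm_eq_abs, show x + u - (x - u) = 2 * u by ring,
      abs_of_nonneg (by linarith [hu.1] : 0 ≤ 2 * u)] at h
    nlinarith [hu.2]
  have hg : ∀ u ∈ Set.Icc 0 a, HasDerivWithinAt (fun u ↦ f (x + u) + f (x - u) - 2 * f x)
      (f' (x + u) - f' (x - u)) (Set.Icc 0 a) u := by
    intro u hu
    have g1 := (h1 (x + u) ⟨by linarith [hu.1], by linarith [hu.2]⟩).comp_const_add x u
    have g2 := (h1 (x - u) ⟨by linarith [hu.2], by linarith [hu.1]⟩).comp_const_sub x u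
    have := (g1.fun_add g2).sub_const (2 * f x)
    exact (this.congr_deriv (by ring)).hasDerivWithinAt
  have h := Convex.norm_image_sub_le_of_norm_hasDerivWithin_le
    (f := fun u ↦ f (x + u) + f (x - u) - 2 * f x)
    (f' := fun u ↦ f' (x + u) - f' (x - u)) (s := Set.Icc 0 a) (C := 2 * K * a) (x := 0) (y := a)
    hg hd (convex_Icc _ _) ⟨le_rfl, ha⟩ ⟨ha, le_rfl⟩
  simp only [add_zero, sub_zero, Real.norm_eq_abs] at h
  rw [abs_of_nonneg ha, show f x + f x - 2 * f x = 0 by ring, sub_zero] at h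
  linarith

end HeatKernel

/-! ### Bounds for `Λ` -/

section LamBounds

open SPDE

/-- If the tail vanished at `x`, monotonicity would make it vanish to the right of `x`,
contradicting its strictly negative derivative. -/
lemma gaussTail_pos (x : ℝ) : 0 < gaussTail x := by
  refine lt_of_le_of_ne (gaussTail_nonneg x) fun h ↦ ?_
  have h1 : ∀ y, x ≤ y → gaussTail y = 0 := fun y hy ↦
    le_antisymm (h ▸ antitone_gaussTail hy) (gaussTail_nonneg y)
  have h2 : HasDerivWithinAt gaussTail 0 (Set.Ici x) x :=
    (hasDerivWithinAt_const x (Set.Ici x) (0 : ℝ)).congr (fun y hy ↦ h1 y hy) (h1 x le_rfl)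
  have h3 := (uniqueDiffWithinAt_Ici x).eq_deriv _ h2 (hasDerivAt_gaussTail x).hasDerivWithinAt
  nlinarith [Real.exp_pos (-(x ^ 2 / 4))]

lemma H_zero_pos : 0 < H 0 := by rw [H_zero]; positivity

/-- The constant in the lower bound for `|Λ₀₀|`. -/
noncomputable def lamConst : ℝ := gaussTail 1 / (2 * √Real.pi)

lemma lamConst_pos : 0 < lamConst := div_pos (gaussTail_pos 1) (by positivity)

/-- The slope of `-H` is a multiple of the decreasing tail, hence at least `lamConst` on `[0, 1]`;
beyond `1` monotonicity of `H` suffices. This keeps `Λ₀₀(h)` away from zero at the rate `min h 1`.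
-/
lemma le_H_zero_sub {x : ℝ} (hx : 0 ≤ x) : lamConst * min x 1 ≤ H 0 - H x := by
  have key : ∀ y ∈ Set.Icc (0 : ℝ) 1, lamConst * y ≤ H 0 - H y := by
    intro y hy
    have h1 : AntitoneOn (fun y ↦ H y + lamConst * y) (Set.Icc 0 1) := by
      refine antitoneOn_of_deriv_nonpos (convex_Icc _ _)
        (continuous_H.add (continuous_const.mul continuous_id)).continuousOn
        (fun z _ ↦ (((hasDerivAt_H z).fun_add ((hasDerivAt_id' z).const_mul
          lamConst)).differentiableAt).differentiableWithinAt) fun z hz ↦ ?_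
      rw [((hasDerivAt_H z).fun_add ((hasDerivAt_id' z).const_mul lamConst)).deriv, lamConst]
      rw [interior_Icc] at hz
      have := antitone_gaussTail hz.2.le
      have h2 : 0 < 1 / (2 * √Real.pi) := by positivity
      have : 1 / (2 * √Real.pi) * gaussTail 1 ≤ 1 / (2 * √Real.pi) * gaussTail z := by gcongr
      have h3 : gaussTail 1 / (2 * √Real.pi) = 1 / (2 * √Real.pi) * gaussTail 1 := by ring
      rw [h3]
      linarith
    have := h1 ⟨le_rfl, zero_le_one⟩ hy hy.1
    simp only [mul_zero, add_zero] at this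
    linarith
  rcases le_total x 1 with h | h
  · rw [min_eq_left h]; exact key x ⟨hx, h⟩
  · rw [min_eq_right h]
    have := key 1 ⟨zero_le_one, le_rfl⟩
    linarith [antitone_H h]

lemma heatInt_zero_left (x : ℝ) : heatInt 0 x = 0 := by simp [heatInt]

lemma heatInt_nonneg (t x : ℝ) : 0 ≤ heatInt t x :=
  mul_nonneg (Real.sqrt_nonneg _) (H_nonneg _)

lemma heatInt_neg {t : ℝ} (ht : 0 < t) (x : ℝ) : heatInt t (-x) = heatInt t x + x / 2 := by
  have : √t ≠ 0 := by positivity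
  rw [heatInt, heatInt, neg_div, H_neg]
  field_simp

lemma heatInt_le {t x : ℝ} (hx : 0 ≤ x) : heatInt t x ≤ √t := by
  rw [heatInt]
  exact mul_le_of_le_one_right (Real.sqrt_nonneg _) (H_le_one (by positivity))

lemma mul_heatInt_le {t x : ℝ} (ht : 0 ≤ t) (hx : 0 ≤ x) : x * heatInt t x ≤ t := by
  rcases ht.eq_or_lt with rfl | ht
  · simp [heatInt_zero_left]
  have hs : 0 < √t := by positivity
  have h1 := mul_H_le_one (x := x / √t) (by positivity)
  have h2 : x * heatInt t x = √t ^ 2 * (x / √t * H (x / √t)) := by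
    rw [heatInt]; field_simp
  rw [h2, Real.sq_sqrt ht.le]
  exact mul_le_of_le_one_right ht.le h1

lemma antitone_heatInt (t : ℝ) : Antitone (heatInt t) := fun x y hxy ↦
  mul_le_mul_of_nonneg_left (antitone_H (by gcongr)) (Real.sqrt_nonneg _)

lemma convexOn_heatInt {t : ℝ} (ht : 0 < t) : ConvexOn ℝ Set.univ (heatInt t) := by
  refine MonotoneOn.convexOn_of_deriv convex_univ
    (fun x _ ↦ (hasDerivAt_heatInt_space ht x).continuousAt.continuousWithinAt)
    (fun x _ ↦ (hasDerivAt_heatInt_space ht x).differentiableAt.differentiableWithinAt) ?_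
  intro x _ y _ hxy
  rw [(hasDerivAt_heatInt_space ht x).deriv, (hasDerivAt_heatInt_space ht y).deriv]
  have := antitone_gaussTail (show x / √t ≤ y / √t by gcongr)
  have h2 : 0 < 1 / (2 * √Real.pi) := by positivity
  nlinarith

/-- The slope of `heatInt` at the origin is `-1/4` for every `t`, and slopes increase to the right.
-/
lemma heatInt_zero_sub_le {t : ℝ} (ht : 0 < t) {x : ℝ} (hx : 0 ≤ x) :
    heatInt t 0 - heatInt t x ≤ x / 4 := by
  have h1 : MonotoneOn (fun y ↦ heatInt t y + 1 / 4 * y) (Set.Ici 0) := by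
    refine monotoneOn_of_deriv_nonneg (convex_Ici _)
      (fun z _ ↦ ((hasDerivAt_heatInt_space ht z).fun_add ((hasDerivAt_id' z).const_mul
        (1 / 4))).continuousAt.continuousWithinAt)
      (fun z _ ↦ (((hasDerivAt_heatInt_space ht z).fun_add ((hasDerivAt_id' z).const_mul
        (1 / 4))).differentiableAt).differentiableWithinAt) fun z hz ↦ ?_
    rw [((hasDerivAt_heatInt_space ht z).fun_add ((hasDerivAt_id' z).const_mul (1 / 4))).deriv]
    rw [interior_Ici] at hz
    have := antitone_gaussTail (show 0 ≤ z / √t from div_nonneg (le_of_lt hz) (Real.sqrt_nonneg _))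
    rw [gaussTail_zero] at this
    have h2 : 0 < 1 / (2 * √Real.pi) := by positivity
    have h3 : 1 / (2 * √Real.pi) * gaussTail (z / √t) ≤ 1 / (2 * √Real.pi) * (√Real.pi / 2) := by
      gcongr
    have h4 : 1 / (2 * √Real.pi) * (√Real.pi / 2) = 1 / 4 := by field_simp; norm_num
    linarith
  have := h1 Set.self_mem_Ici (Set.mem_Ici.2 hx) hx
  simp only [mul_zero, add_zero] at this
  linarith

lemma G_eq (h : ℝ) (j l : ℤ) : G h j l = heatInt |(j : ℝ)| (h * |(l : ℝ)|) := by
  rw [G, heatInt]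
  split_ifs with h0
  · simp [h0]
  · rfl

lemma G_neg_left (h : ℝ) (j l : ℤ) : G h (-j) l = G h j l := by simp [G_eq]

lemma G_neg_right (h : ℝ) (j l : ℤ) : G h j (-l) = G h j l := by simp [G_eq]

/-- The centred second difference of `G` in the second variable. -/
noncomputable def spaceDiff (h : ℝ) (j l : ℤ) : ℝ := G h j (l + 1) + G h j (l - 1) - 2 * G h j l

lemma spaceDiff_neg_left (h : ℝ) (j l : ℤ) : spaceDiff h (-j) l = spaceDiff h j l := by
  simp only [spaceDiff, G_neg_left]

lemma spaceDiff_neg_right (h : ℝ) (j l : ℤ) : spaceDiff h j (-l) = spaceDiff h j l := by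
  simp only [spaceDiff]
  rw [show -l + 1 = -(l - 1) by ring, show -l - 1 = -(l + 1) by ring, G_neg_right, G_neg_right,
    G_neg_right]
  ring

lemma spaceDiff_zero_left (h : ℝ) (l : ℤ) : spaceDiff h 0 l = 0 := by simp [spaceDiff, G]

/-- `G_h` is even in both variables, so the absolute values and the shift by `-1` merely describe
the centred second difference at `(j, l)`. -/
lemma Lam_eq (h : ℝ) (j l : ℤ) :
    Lam h j l = spaceDiff h (j + 1) l + spaceDiff h (j - 1) l - 2 * spaceDiff h j l := by
  have h0 : Lam h j l = spaceDiff h (|j| + 1) |l| + spaceDiff h (|j| - 1) |l|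
      - 2 * spaceDiff h |j| |l| := by
    simp only [Lam, diffX, diffY, spaceDiff]
    rw [show |j| - 1 + 2 = |j| + 1 by ring, show |l| - 1 + 2 = |l| + 1 by ring,
      show |j| - 1 + 1 = |j| by ring, show |l| - 1 + 1 = |l| by ring]
  rw [h0]
  have h1 : ∀ i, spaceDiff h i |l| = spaceDiff h i l := fun i ↦ by
    rcases abs_choice l with e | e <;> rw [e]
    exact spaceDiff_neg_right _ _ _
  rw [h1, h1, h1]
  rcases abs_choice j with e | e <;> rw [e]
  rw [show -j + 1 = -(j - 1) by ring, show -j - 1 = -(j + 1) by ring, spaceDiff_neg_left,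
    spaceDiff_neg_left, spaceDiff_neg_left]
  ring

lemma Lam_abs (h : ℝ) (j l : ℤ) : Lam h |j| |l| = Lam h j l := by simp [Lam]

/-- The centred second difference of `heatInt` in time, at integer times. -/
noncomputable def timeDiff (j : ℤ) (x : ℝ) : ℝ :=
  heatInt |(j : ℝ) + 1| x + heatInt |(j : ℝ) - 1| x - 2 * heatInt |(j : ℝ)| x

lemma Lam_eq_timeDiff (h : ℝ) (j l : ℤ) :
    Lam h j l = timeDiff j (h * |(l : ℝ) + 1|) + timeDiff j (h * |(l : ℝ) - 1|)
      - 2 * timeDiff j (h * |(l : ℝ)|) := by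
  simp only [Lam_eq, spaceDiff, timeDiff, G_eq]
  push_cast
  ring

/-- For `|j| ≥ 2` the time window avoids the singularity at `t = 0`, and the second difference is
controlled by `heatDeriv / 2`; for `|j| ≤ 1` the values of `heatInt` are bounded directly. The
constant is not optimised. -/
lemma abs_timeDiff_le (j : ℤ) {x : ℝ} (hx : 0 ≤ x) :
    |timeDiff j x| ≤ 16 / ((|(j : ℝ)| + 1) * (1 + x)) := by
  have heven : timeDiff (|j|) x = timeDiff j x := by
    rcases abs_choice j with e | e <;> rw [e]
    simp only [timeDiff]
    push_cast
    rw [show -(j : ℝ) + 1 = -(j - 1) by ring, show -(j : ℝ) - 1 = -(j + 1) by ring, abs_neg,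
      abs_neg, abs_neg]
    ring
  have hb : ∀ t : ℝ, 0 ≤ t → (1 + x) * heatInt t x ≤ √t + t := fun t ht ↦ by
    have := heatInt_le (t := t) hx
    have := mul_heatInt_le ht hx
    linarith
  rw [le_div_iff₀ (by positivity), ← heven, ← Int.cast_abs]
  obtain ⟨m, hm⟩ := Int.eq_ofNat_of_zero_le (abs_nonneg j)
  rw [hm]
  rcases m with _ | _ | m
  · have h1 := hb 1 zero_le_one
    have : timeDiff ((0 : ℕ) : ℤ) x = 2 * heatInt 1 x := by
      simp only [timeDiff]
      norm_num
      rw [heatInt_zero_left]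
      ring
    rw [this, abs_of_nonneg (by have := heatInt_nonneg 1 x; linarith)]
    simp only [Real.sqrt_one] at h1
    simp
    linarith
  · have h1 := hb 1 zero_le_one
    have h2 := hb 2 zero_le_two
    have : timeDiff ((0 + 1 : ℕ) : ℤ) x = heatInt 2 x - 2 * heatInt 1 x := by
      simp only [timeDiff]
      norm_num
      rw [heatInt_zero_left]
    have h3 : √(2 : ℝ) ≤ 2 := by
      rw [Real.sqrt_le_left (by norm_num)]; norm_num
    have h4 : |heatInt 2 x - 2 * heatInt 1 x| ≤ heatInt 2 x + 2 * heatInt 1 x := by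
      have := heatInt_nonneg 1 x
      have := heatInt_nonneg 2 x
      rw [abs_le]; constructor <;> linarith
    rw [this]
    simp only [Real.sqrt_one] at h1
    simp only [zero_add, Nat.cast_one, Int.cast_one]
    have := mul_le_mul_of_nonneg_right h4 (by linarith : 0 ≤ 1 + x)
    nlinarith
  · have hs : (0 : ℝ) < m + 1 := by positivity
    have e : timeDiff ((m + 1 + 1 : ℕ) : ℤ) x = heatInt ((m : ℝ) + 2 + 1) x
        + heatInt ((m : ℝ) + 2 - 1) x - 2 * heatInt ((m : ℝ) + 2) x := by
      simp only [timeDiff]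
      push_cast
      rw [abs_of_nonneg (by positivity), abs_of_nonneg (by linarith), abs_of_nonneg (by positivity)]
      ring_nf
    have h1 := abs_second_difference_le (f := fun t ↦ heatInt t x) (f' := fun t ↦ heat t x / 2)
      (f'' := fun t ↦ heatDeriv t x / 2) (x := (m : ℝ) + 2) (a := 1) (K := 1 / ((m + 1) * (1 + x)))
      zero_le_one (fun y hy ↦ hasDerivAt_heatInt_time (by linarith [hy.1]) x)
      (fun y hy ↦ (hasDerivAt_heat_time (by linarith [hy.1]) x).div_const 2) (fun y hy ↦ ?_)
    · rw [e]
      simp only [Int.cast_natCast]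
      push_cast
      calc _ ≤ 2 * (1 / (((m : ℝ) + 1) * (1 + x))) * 1 ^ 2 * (((m : ℝ) + 1 + 1 + 1) * (1 + x)) := by
            gcongr
        _ = 2 * (m + 3) / (m + 1) := by field_simp; ring
        _ ≤ 16 := by rw [div_le_iff₀ hs]; nlinarith
    · have hy1 : (m : ℝ) + 1 ≤ y := by linarith [hy.1]
      have hy0 : 0 < y := hs.trans_le hy1
      have g1 := abs_heatDeriv_le hy0 x
      have g2 := mul_abs_heatDeriv_le hy0 hx
      have g3 : 1 ≤ √y := Real.one_le_sqrt.2 (by linarith [(Nat.cast_nonneg m : (0 : ℝ) ≤ m)])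
      have g4 : 1 / (y * √y) ≤ 1 / (m + 1) :=
        one_div_le_one_div_of_le hs (hy1.trans (le_mul_of_one_le_right hy0.le g3))
      have g5 : 1 / y ≤ 1 / ((m : ℝ) + 1) := one_div_le_one_div_of_le hs hy1
      rw [abs_div, abs_two, ← div_div, div_le_div_iff₀ two_pos (by positivity)]
      linarith

/-- The bound is square-summable over both lags and uniform for `h ≥ h₀`, as dominated convergence
requires. It says nothing near `h = 0`, where a separate analysis is made. -/
lemma abs_Lam_le {h₀ h : ℝ} (h0 : 0 < h₀) (hh : h₀ ≤ h) (j l : ℤ) :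
    |Lam h j l| ≤ 128 / min 1 h₀ * ((1 / (|(j : ℝ)| + 1)) * (1 / (|(l : ℝ)| + 1))) := by
  have hm : 0 < min 1 h₀ := lt_min one_pos h0
  have hm1 : min 1 h₀ ≤ 1 := min_le_left _ _
  have hmh : min 1 h₀ ≤ h := (min_le_right _ _).trans hh
  have hh0 : 0 < h := h0.trans_le hh
  have key : ∀ y : ℝ, |(l : ℝ)| ≤ |y| + 1 → |timeDiff j (h * |y|)| ≤
      32 / min 1 h₀ * ((1 / (|(j : ℝ)| + 1)) * (1 / (|(l : ℝ)| + 1))) := by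
    intro y hy
    refine (abs_timeDiff_le j (by positivity)).trans ?_
    have h1 : min 1 h₀ * (|(l : ℝ)| + 1) ≤ 2 * (1 + h * |y|) := by
      have : min 1 h₀ * |y| ≤ h * |y| := by gcongr
      nlinarith [abs_nonneg y]
    calc 16 / ((|(j : ℝ)| + 1) * (1 + h * |y|)) = 32 / ((|(j : ℝ)| + 1) * (2 * (1 + h * |y|))) := by
          field_simp; ring
      _ ≤ 32 / ((|(j : ℝ)| + 1) * (min 1 h₀ * (|(l : ℝ)| + 1))) := by gcongr
      _ = _ := by field_simp
  have k1 := key (l + 1) (by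
    have := abs_sub_abs_le_abs_sub (l : ℝ) (-1); simp at this; linarith)
  have k2 := key (l - 1) (by
    have := abs_sub_abs_le_abs_sub (l : ℝ) 1; simp at this; linarith)
  have k3 := key l (by linarith)
  rw [Lam_eq_timeDiff]
  have e : 128 / min 1 h₀ * ((1 / (|(j : ℝ)| + 1)) * (1 / (|(l : ℝ)| + 1))) =
    4 * (32 / min 1 h₀ * ((1 / (|(j : ℝ)| + 1)) * (1 / (|(l : ℝ)| + 1)))) := by ring
  rw [e]
  rw [abs_le] at k1 k2 k3 ⊢
  constructor <;> linarith [k1.1, k1.2, k2.1, k2.2, k3.1, k3.2]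

lemma spaceDiff_natCast_eq {h : ℝ} (j n : ℕ) :
    spaceDiff h j (n + 1) = heatInt j (h * (n + 2)) + heatInt j (h * n)
      - 2 * heatInt j (h * (n + 1)) := by
  simp only [spaceDiff, G_eq]
  push_cast
  rw [abs_of_nonneg (by positivity), abs_of_nonneg (by positivity), add_sub_cancel_right,
    abs_of_nonneg (by positivity), abs_of_nonneg (by positivity),
    show (n : ℝ) + 1 + 1 = n + 2 by ring]

lemma spaceDiff_zero_right {h : ℝ} (j : ℕ) :
    spaceDiff h j 0 = -(2 * (heatInt j 0 - heatInt j h)) := by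
  simp [spaceDiff, G_eq]
  ring

/-- Convexity of `heatInt` in space. -/
lemma spaceDiff_succ_nonneg {h : ℝ} (j n : ℕ) : 0 ≤ spaceDiff h j (n + 1) := by
  rw [spaceDiff_natCast_eq]
  rcases j with _ | j
  · simp [heatInt_zero_left]
  have h1 := (convexOn_heatInt (t := ((j + 1 : ℕ) : ℝ)) (by positivity)).2
    (Set.mem_univ (h * ((n : ℝ) + 2))) (Set.mem_univ (h * n))
    (by norm_num : (0 : ℝ) ≤ 1 / 2) (by norm_num : (0 : ℝ) ≤ 1 / 2) (by norm_num)
  simp only [smul_eq_mul] at h1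
  rw [show 1 / 2 * (h * ((n : ℝ) + 2)) + 1 / 2 * (h * n) = h * (n + 1) by ring] at h1
  linarith

/-- The second differences are negative at `l = 0` and non-negative elsewhere, so the sum of
absolute values telescopes to first differences. -/
lemma sum_abs_spaceDiff {h : ℝ} (hh : 0 ≤ h) (j n : ℕ) :
    ∑ l ∈ Finset.Icc (-(n : ℤ)) n, |spaceDiff h j l| = 4 * (heatInt j 0 - heatInt j h)
      - 2 * (heatInt j (h * n) - heatInt j (h * (n + 1))) := by
  induction n with
  | zero =>
    have := antitone_heatInt j hh
    simp [spaceDiff_zero_right, abs_of_nonneg (sub_nonneg.2 this)]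
    ring
  | succ n ih =>
    have e : Finset.Icc (-((n + 1 : ℕ) : ℤ)) ((n + 1 : ℕ) : ℤ) =
        insert (-((n + 1 : ℕ) : ℤ)) (insert ((n + 1 : ℕ) : ℤ) (Finset.Icc (-(n : ℤ)) n)) := by
      ext a; simp only [Finset.mem_Icc, Finset.mem_insert]; push_cast; omega
    rw [e, Finset.sum_insert (by simp only [Finset.mem_insert, Finset.mem_Icc]; push_cast; omega),
      Finset.sum_insert (by simp only [Finset.mem_Icc]; push_cast; omega), ih, spaceDiff_neg_right]
    push_cast
    rw [abs_of_nonneg (spaceDiff_succ_nonneg j n), spaceDiff_natCast_eq,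
      show (n : ℝ) + 1 + 1 = n + 2 by ring]
    ring

lemma spaceDiff_natAbs (h : ℝ) (j l : ℤ) : spaceDiff h j.natAbs l = spaceDiff h j l := by
  rw [Int.natCast_natAbs]
  rcases abs_choice j with e | e <;> rw [e]
  exact spaceDiff_neg_left _ _ _

lemma sum_abs_spaceDiff_le {h : ℝ} (hh : 0 ≤ h) (j : ℤ) (s : Finset ℤ) :
    ∑ l ∈ s, |spaceDiff h j l| ≤ h := by
  obtain ⟨n, hn⟩ : ∃ n : ℕ, s ⊆ Finset.Icc (-(n : ℤ)) n := by
    refine ⟨s.sup Int.natAbs, fun a ha ↦ ?_⟩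
    have := Finset.le_sup (f := Int.natAbs) ha
    rw [Finset.mem_Icc]; omega
  refine (Finset.sum_le_sum_of_subset_of_nonneg hn fun _ _ _ ↦ abs_nonneg _).trans ?_
  simp_rw [← spaceDiff_natAbs h j]
  rw [sum_abs_spaceDiff hh]
  rcases Nat.eq_zero_or_pos j.natAbs with h0 | h0
  · rw [h0]; simpa [heatInt_zero_left] using hh
  have h1 := heatInt_zero_sub_le (t := (j.natAbs : ℝ)) (by exact_mod_cast h0) hh
  have h2 := antitone_heatInt (j.natAbs : ℝ) (show h * (n : ℝ) ≤ h * (n + 1) by nlinarith)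
  linarith

/-- For `l ≠ 0` the three points lie on one side of the kink at the origin, where the function is
smooth; at `l = 0` the kink leaves only order `h`. -/
lemma abs_spaceDiff_le_of_ne {h : ℝ} (hh : 0 ≤ h) (j : ℤ) {l : ℤ} (hl : l ≠ 0) :
    |spaceDiff h j l| ≤ h ^ 2 := by
  have e1 : spaceDiff h j l = spaceDiff h j.natAbs l.natAbs := by
    rw [spaceDiff_natAbs, Int.natCast_natAbs]
    rcases abs_choice l with e | e <;> rw [e]
    exact (spaceDiff_neg_right _ _ _).symm
  obtain ⟨n, hn⟩ : ∃ n : ℕ, l.natAbs = n + 1 := ⟨l.natAbs - 1, by omega⟩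
  rw [e1, hn, Nat.cast_add, Nat.cast_one]
  rcases Nat.eq_zero_or_pos j.natAbs with h0 | h0
  · rw [h0, Nat.cast_zero, spaceDiff_zero_left]; simpa using sq_nonneg h
  have ht : (1 : ℝ) ≤ j.natAbs := by exact_mod_cast h0
  rw [spaceDiff_natCast_eq]
  have h1 := abs_second_difference_le (f := heatInt j.natAbs)
    (x := h * ((n : ℝ) + 1)) (a := h) (K := 1 / 2) hh
    (fun y _ ↦ hasDerivAt_heatInt_space (by linarith) y)
    (fun y _ ↦ hasDerivAt_heatInt_space_deriv (by linarith) y) (fun y _ ↦ ?_)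
  · rw [show h * ((n : ℝ) + 1) + h = h * (n + 2) by ring,
      show h * ((n : ℝ) + 1) - h = h * n by ring] at h1
    linarith
  · rw [abs_of_nonneg (by have := heat_nonneg j.natAbs y; linarith)]
    have h2 := heat_le (t := (j.natAbs : ℝ)) (by linarith) y
    have h3 : 1 / √(j.natAbs : ℝ) ≤ 1 := by
      rw [div_le_one (by positivity)]; exact Real.one_le_sqrt.2 ht
    linarith

/-- The kink of `heatInt t |x|` at the origin does not depend on `t`, so it cancels in a time
difference at positive times. The smooth bound `h²` therefore holds even at `l = 0`, with an extra
decay `j^(-3/2)` from the time derivative of the heat kernel. -/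
lemma abs_spaceDiff_succ_sub_le {h : ℝ} (hh : 0 ≤ h) {j : ℕ} (hj : 0 < j) (l : ℤ) :
    |spaceDiff h (j + 1) l - spaceDiff h j l| ≤ h ^ 2 * (1 / (j * √j)) := by
  have hj0 : (0 : ℝ) < j := by exact_mod_cast hj
  have heven : ∀ m : ℤ, heatInt (j + 1) (h * |(m : ℝ)|) - heatInt j (h * |(m : ℝ)|) =
      heatInt (j + 1) (h * m) - heatInt j (h * m) := by
    intro m
    rcases abs_choice (m : ℝ) with e | e <;> rw [e]
    rw [mul_neg, heatInt_neg (by linarith), heatInt_neg hj0]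
    ring
  have h1 := abs_second_difference_le (f := fun x ↦ heatInt (j + 1) x - heatInt j x)
    (x := h * l) (a := h) (K := 1 / 2 * (1 / (j * √j))) hh
    (fun y _ ↦ (hasDerivAt_heatInt_space (t := (j : ℝ) + 1) (by linarith) y).fun_sub
      (hasDerivAt_heatInt_space hj0 y))
    (fun y _ ↦ (hasDerivAt_heatInt_space_deriv (t := (j : ℝ) + 1) (by linarith) y).fun_sub
      (hasDerivAt_heatInt_space_deriv hj0 y)) (fun y _ ↦ ?_)
  · have e1 := heven (l + 1)
    have e2 := heven (l - 1)
    have e3 := heven l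
    push_cast at e1 e2
    rw [show h * ((l : ℝ) + 1) = h * l + h by ring] at e1
    rw [show h * ((l : ℝ) - 1) = h * l - h by ring] at e2
    rw [← e1, ← e2, ← e3] at h1
    simp only [spaceDiff, G_eq]
    push_cast
    rw [abs_of_nonneg (by linarith : (0 : ℝ) ≤ (j : ℝ) + 1), abs_of_nonneg hj0.le]
    refine le_trans (le_of_eq ?_) (h1.trans (le_of_eq ?_))
    · congr 1; ring
    · ring
  · have := abs_heat_sub_le hj0 (by linarith : (j : ℝ) ≤ j + 1) y
    rw [← sub_div, abs_div, abs_two]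
    have e : (j : ℝ) + 1 - j = 1 := by ring
    rw [e] at this
    linarith

lemma abs_Lam_le_of_two_le {h : ℝ} (hh : 0 ≤ h) (j : ℕ) (l : ℤ) :
    |Lam h (j + 2) l| ≤ 2 * h ^ 2 * (1 / ((j + 1) * √(j + 1))) := by
  have h1 := abs_spaceDiff_succ_sub_le hh (Nat.succ_pos j) l
  have h2 := abs_spaceDiff_succ_sub_le hh (Nat.succ_pos (j + 1)) l
  have h3 : 1 / (((j + 1 : ℕ) + 1 : ℝ) * √((j + 1 : ℕ) + 1 : ℝ)) ≤
      1 / (((j : ℝ) + 1) * √((j : ℝ) + 1)) := by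
    push_cast
    gcongr <;> linarith
  have h4 := mul_le_mul_of_nonneg_left h3 (sq_nonneg h)
  rw [Lam_eq]
  push_cast at h1 h2 h4 ⊢
  rw [show (j : ℤ) + 2 + 1 = j + 1 + 1 + 1 by ring, show (j : ℤ) + 2 - 1 = j + 1 by ring,
    show (j : ℤ) + 2 = j + 1 + 1 by ring]
  rw [abs_le] at h1 h2 ⊢
  constructor <;> linarith [h1.1, h1.2, h2.1, h2.2]

lemma abs_Lam_le_of_ne {h : ℝ} (hh : 0 ≤ h) (j : ℤ) {l : ℤ} (hl : l ≠ 0) :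
    |Lam h j l| ≤ 4 * h ^ 2 := by
  have h1 := abs_spaceDiff_le_of_ne hh (j + 1) hl
  have h2 := abs_spaceDiff_le_of_ne hh (j - 1) hl
  have h3 := abs_spaceDiff_le_of_ne hh j hl
  rw [Lam_eq]
  rw [abs_le] at h1 h2 h3 ⊢
  constructor <;> linarith [h1.1, h1.2, h2.1, h2.2, h3.1, h3.2]

lemma sum_abs_Lam_le {h : ℝ} (hh : 0 ≤ h) (j : ℤ) (s : Finset ℤ) :
    ∑ l ∈ s, |Lam h j l| ≤ 4 * h := by
  have h1 := sum_abs_spaceDiff_le hh (j + 1) s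
  have h2 := sum_abs_spaceDiff_le hh (j - 1) s
  have h3 := sum_abs_spaceDiff_le hh j s
  calc ∑ l ∈ s, |Lam h j l| ≤ ∑ l ∈ s, (|spaceDiff h (j + 1) l| + |spaceDiff h (j - 1) l|
        + 2 * |spaceDiff h j l|) := by
        refine Finset.sum_le_sum fun l _ ↦ ?_
        rw [Lam_eq]
        refine (abs_sub _ _).trans ?_
        rw [abs_mul, abs_two]
        gcongr
        exact abs_add_le _ _
    _ ≤ _ := by
      rw [Finset.sum_add_distrib, Finset.sum_add_distrib, ← Finset.mul_sum]
      linarith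

lemma Lam_zero_zero (h : ℝ) : Lam h 0 0 = -(4 * (H 0 - H h)) := by
  have h1 := spaceDiff_zero_right (h := h) 1
  rw [Lam_eq, zero_add, zero_sub, spaceDiff_neg_left, spaceDiff_zero_left]
  simp only [heatInt, Nat.cast_one, Real.sqrt_one, div_one, one_mul] at h1
  rw [h1]
  ring

lemma le_neg_Lam_zero_zero {h : ℝ} (hh : 0 ≤ h) : 4 * lamConst * min h 1 ≤ -Lam h 0 0 := by
  rw [Lam_zero_zero]
  have := le_H_zero_sub hh
  linarith

lemma Lam_zero_zero_ne_zero {h : ℝ} (hh : 0 < h) : Lam h 0 0 ≠ 0 := by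
  have h1 := le_neg_Lam_zero_zero hh.le
  have : 0 < 4 * lamConst * min h 1 := by
    have := lamConst_pos
    have := lt_min hh one_pos
    positivity
  intro h0
  rw [h0] at h1
  linarith

end LamBounds

/-! ### The asymptotic variance function -/

section AsymptoticVariance

open SPDE

/-- The extension of `H` to `[0, ∞]`. -/
noncomputable def HE (x : ℝ≥0∞) : ℝ := if x = ∞ then 0 else H x.toReal

lemma HE_top : HE ∞ = 0 := by simp [HE]

lemma HE_ofReal {x : ℝ} (hx : 0 ≤ x) : HE (ENNReal.ofReal x) = H x := by
  simp [HE, ENNReal.toReal_ofReal hx]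

/-- At infinity the decay `x H(x) ≤ 1` squeezes `H` below `1 / x`. -/
lemma continuous_HE : Continuous HE := by
  rw [continuous_iff_continuousAt]
  intro x
  rcases eq_or_ne x ∞ with rfl | hx
  · rw [ContinuousAt, HE_top]
    have h1 : Tendsto (fun x : ℝ≥0∞ ↦ (x⁻¹).toReal) (𝓝 ∞) (𝓝 0) := by
      have := (ENNReal.tendsto_toReal (a := ∞⁻¹) (by simp)).comp
        ((continuous_inv (G := ℝ≥0∞)).tendsto ∞)
      simpa [Function.comp_def] using this
    refine tendsto_of_tendsto_of_tendsto_of_le_of_le' tendsto_const_nhds h1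
      (Eventually.of_forall fun x ↦ ?_) ?_
    · rw [HE]; split_ifs
      · exact le_rfl
      · exact H_nonneg _
    · filter_upwards [eventually_gt_nhds (ENNReal.zero_lt_top)] with x hx
      rw [HE]; split_ifs with h
      · simp
      · have h0 : 0 < x.toReal := ENNReal.toReal_pos hx.ne' h
        rw [ENNReal.toReal_inv, ← one_div, le_div_iff₀ h0, mul_comm]
        exact mul_H_le_one h0.le
  · have h1 : HE =ᶠ[𝓝 x] fun x ↦ H x.toReal := by
      filter_upwards [eventually_ne_nhds hx] with y hy
      simp [HE, hy]
    exact ((continuous_H.continuousAt).comp (ENNReal.tendsto_toReal hx)).congr h1.symm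

/-- The extension of `G_h` to `h ∈ [0, ∞]`. -/
noncomputable def GE (x : ℝ≥0∞) (j l : ℤ) : ℝ :=
  √|(j : ℝ)| * HE (ENNReal.ofReal (|(l : ℝ)| / √|(j : ℝ)|) * x)

lemma GE_ofReal {h : ℝ} (hh : 0 ≤ h) : GE (ENNReal.ofReal h) = G h := by
  funext j l
  rw [G_eq, GE, ← ENNReal.ofReal_mul (by positivity), HE_ofReal (by positivity), heatInt]
  congr 2
  ring

lemma continuous_GE (j l : ℤ) : Continuous fun x ↦ GE x j l :=
  continuous_const.mul (continuous_HE.comp (ENNReal.continuous_const_mul ENNReal.ofReal_ne_top))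

/-- The extension of `Λ(h)` to `h ∈ [0, ∞]`. -/
noncomputable def LamE (x : ℝ≥0∞) (j l : ℤ) : ℝ := diffX (diffY (GE x)) (|j| - 1) (|l| - 1)

lemma LamE_ofReal {h : ℝ} (hh : 0 ≤ h) : LamE (ENNReal.ofReal h) = Lam h := by
  funext j l
  rw [LamE, GE_ofReal hh, Lam]

lemma continuous_LamE (j l : ℤ) : Continuous fun x ↦ LamE x j l := by
  have := continuous_GE
  simp only [LamE, diffX, diffY]
  fun_prop

/-- The bound is uniform in finite `h ≥ h₀`, so continuity of each entry carries it to `h = ∞`. -/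
lemma abs_LamE_le {h₀ : ℝ} (h0 : 0 < h₀) {x : ℝ≥0∞} (hx : ENNReal.ofReal h₀ ≤ x) (j l : ℤ) :
    |LamE x j l| ≤ 128 / min 1 h₀ * ((1 / (|(j : ℝ)| + 1)) * (1 / (|(l : ℝ)| + 1))) := by
  have key : ∀ h : ℝ, h₀ ≤ h → |LamE (ENNReal.ofReal h) j l| ≤
      128 / min 1 h₀ * ((1 / (|(j : ℝ)| + 1)) * (1 / (|(l : ℝ)| + 1))) := fun h hh ↦ by
    rw [LamE_ofReal (h0.le.trans hh)]
    exact abs_Lam_le h0 hh j l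
  rcases eq_or_ne x ∞ with rfl | hx'
  · have h1 : Tendsto (fun h : ℝ ↦ |LamE (ENNReal.ofReal h) j l|) atTop (𝓝 |LamE ∞ j l|) :=
      (((continuous_LamE j l).tendsto ∞).comp ENNReal.tendsto_ofReal_atTop).abs
    refine le_of_tendsto h1 ?_
    filter_upwards [eventually_ge_atTop h₀] with h hh using key h hh
  · rw [← ENNReal.ofReal_toReal hx']
    exact key _ ((ENNReal.ofReal_le_iff_le_toReal hx').1 hx)

lemma summable_int_of_natAbs {f : ℕ → ℝ} (hf : Summable f) :
    Summable fun j : ℤ ↦ f j.natAbs :=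
  Summable.of_nat_of_neg (by simpa using hf) (by simpa using hf)

lemma abs_intCast_eq (j : ℤ) : |(j : ℝ)| = (j.natAbs : ℝ) := by
  rw [Nat.cast_natAbs, Int.cast_abs]

lemma summable_int_inv_sq : Summable fun j : ℤ ↦ (1 / (|(j : ℝ)| + 1)) ^ 2 := by
  have := summable_int_of_natAbs (f := fun n ↦ (1 / ((n : ℝ) + 1)) ^ 2)
    (by simpa [div_pow] using summable_one_div_succ_sq)
  simpa only [abs_intCast_eq] using this

lemma summable_prod_inv_sq (c : ℝ) : Summable fun p : ℤ × ℤ ↦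
    (c * ((1 / (|(p.1 : ℝ)| + 1)) * (1 / (|(p.2 : ℝ)| + 1)))) ^ 2 := by
  have := (summable_int_inv_sq.mul_of_nonneg summable_int_inv_sq (fun _ ↦ sq_nonneg _)
    (fun _ ↦ sq_nonneg _)).mul_left (c ^ 2)
  refine this.congr fun p ↦ ?_
  ring

lemma LamE_sq_le {h₀ : ℝ} (h0 : 0 < h₀) {x : ℝ≥0∞} (hx : ENNReal.ofReal h₀ ≤ x) (p : ℤ × ℤ) :
    LamE x p.1 p.2 ^ 2 ≤
      (128 / min 1 h₀ * ((1 / (|(p.1 : ℝ)| + 1)) * (1 / (|(p.2 : ℝ)| + 1)))) ^ 2 := by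
  rw [← sq_abs (LamE _ _ _)]
  exact pow_le_pow_left₀ (abs_nonneg _) (abs_LamE_le h0 hx _ _) 2

lemma exists_ofReal_le {x : ℝ≥0∞} (hx : x ≠ 0) : ∃ h₀ : ℝ, 0 < h₀ ∧ ENNReal.ofReal h₀ < x := by
  obtain ⟨y, hy0, hy⟩ := exists_between (pos_iff_ne_zero.2 hx)
  refine ⟨y.toReal, ENNReal.toReal_pos hy0.ne' (hy.ne_top), ?_⟩
  rwa [ENNReal.ofReal_toReal hy.ne_top]

lemma summable_LamE_sq {x : ℝ≥0∞} (hx : x ≠ 0) :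
    Summable fun p : ℤ × ℤ ↦ LamE x p.1 p.2 ^ 2 := by
  obtain ⟨h₀, h0, hx0⟩ := exists_ofReal_le hx
  exact Summable.of_nonneg_of_le (fun _ ↦ sq_nonneg _) (LamE_sq_le h0 hx0.le)
    (summable_prod_inv_sq _)

lemma summable_Lam_sq {h : ℝ} (hh : 0 < h) : Summable fun p : ℤ × ℤ ↦ Lam h p.1 p.2 ^ 2 := by
  rw [← LamE_ofReal hh.le]
  exact summable_LamE_sq (by simpa using hh)

/-- The weights stand for the proportions of index pairs with a given lag on a finite grid; being at
most one, they do not disturb the dominating series. -/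
lemma tendsto_tsum_LamE_sq {ι : Type*} {𝓕 : Filter ι} {x : ι → ℝ≥0∞} {x₀ : ℝ≥0∞}
    (hx : Tendsto x 𝓕 (𝓝 x₀)) (hx0 : x₀ ≠ 0) {w : ι → ℤ × ℤ → ℝ}
    (hw : ∀ i p, 0 ≤ w i p ∧ w i p ≤ 1) (hw1 : ∀ p, Tendsto (fun i ↦ w i p) 𝓕 (𝓝 1)) :
    Tendsto (fun i ↦ ∑' p : ℤ × ℤ, w i p * LamE (x i) p.1 p.2 ^ 2) 𝓕
      (𝓝 (∑' p : ℤ × ℤ, LamE x₀ p.1 p.2 ^ 2)) := by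
  obtain ⟨h₀, h0, hx1⟩ := exists_ofReal_le hx0
  refine tendsto_tsum_of_dominated_convergence (summable_prod_inv_sq (128 / min 1 h₀))
    (fun p ↦ ?_) ?_
  · have := (hw1 p).mul ((((continuous_LamE p.1 p.2).tendsto x₀).comp hx).pow 2)
    simpa using this
  · filter_upwards [hx.eventually (eventually_gt_nhds hx1)] with i hi p
    rw [Real.norm_eq_abs, abs_of_nonneg (mul_nonneg (hw i p).1 (sq_nonneg _))]
    exact (mul_le_of_le_one_left (sq_nonneg _) (hw i p).2).trans (LamE_sq_le h0 hi.le p)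

/-- The sequence dominating the rows of `Λ(h) / h²`. -/
noncomputable def rowBound (j : ℤ) : ℝ := 12 / ((|(j : ℝ)| + 1) * √(|(j : ℝ)| + 1))

lemma rowBound_nonneg (j : ℤ) : 0 ≤ rowBound j := by rw [rowBound]; positivity

lemma summable_rowBound : Summable rowBound := by
  have h1 : Summable fun n : ℕ ↦ 1 / ((n + 1 : ℕ) : ℝ) ^ (3 / 2 : ℝ) :=
    (summable_nat_add_iff 1).2 (Real.summable_one_div_nat_rpow.2 (by norm_num))
  have h2 := summable_int_of_natAbs (h1.mul_left 12)
  refine h2.congr fun j ↦ ?_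
  rw [rowBound, abs_intCast_eq, show (3 / 2 : ℝ) = 1 + 1 / 2 by norm_num,
    Real.rpow_add (by positivity), Real.rpow_one, ← Real.sqrt_eq_rpow]
  push_cast
  ring

/-- Only the three entries with `|j| ≤ 1` and `l = 0` feel the spatial kink, because for `|j| ≥ 2`
the time difference has removed it. All others gain a full factor `h²` with a summable dependence on
`j`. -/
lemma abs_Lam_le_rowBound {h : ℝ} (hh : 0 ≤ h) {j l : ℤ} (hjl : 1 < |j| ∨ l ≠ 0) :
    |Lam h j l| ≤ h ^ 2 * rowBound j := by
  rcases lt_or_ge 1 |j| with hj | hj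
  · obtain ⟨n, hn⟩ : ∃ n : ℕ, |j| = n + 2 := ⟨(|j| - 2).toNat, by omega⟩
    have h1 := abs_Lam_le_of_two_le hh n |l|
    rw [← hn, Lam_abs] at h1
    refine h1.trans ?_
    have e : |(j : ℝ)| = n + 2 := by rw [← Int.cast_abs, hn]; push_cast; ring
    have h2 : √((n : ℝ) + 2 + 1) ≤ 2 * √((n : ℝ) + 1) := by
      rw [Real.sqrt_le_left (by positivity), mul_pow, Real.sq_sqrt (by positivity)]
      linarith
    rw [rowBound, e, mul_comm 2 (h ^ 2), mul_assoc]
    refine mul_le_mul_of_nonneg_left ?_ (sq_nonneg h)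
    rw [mul_one_div, div_le_div_iff₀ (by positivity) (by positivity)]
    have h3 : ((n : ℝ) + 2 + 1) ≤ 3 * (n + 1) := by linarith [(Nat.cast_nonneg n : (0 : ℝ) ≤ n)]
    calc 2 * (((n : ℝ) + 2 + 1) * √((n : ℝ) + 2 + 1))
        ≤ 2 * ((3 * (n + 1)) * (2 * √((n : ℝ) + 1))) := by gcongr
      _ = _ := by ring
  · have hl : l ≠ 0 := hjl.resolve_left (not_lt.2 hj)
    refine (abs_Lam_le_of_ne hh j hl).trans ?_
    rw [mul_comm]
    refine mul_le_mul_of_nonneg_left ?_ (sq_nonneg h)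
    have hj' : |(j : ℝ)| ≤ 1 := by rw [← Int.cast_abs]; exact_mod_cast hj
    rw [rowBound, le_div_iff₀ (by positivity)]
    have h2 : √(|(j : ℝ)| + 1) ≤ 3 / 2 := by
      rw [Real.sqrt_le_left (by norm_num)]; linarith
    calc 4 * ((|(j : ℝ)| + 1) * √(|(j : ℝ)| + 1)) ≤ 4 * ((1 + 1) * (3 / 2)) := by gcongr
      _ = 12 := by norm_num

/-- In each remaining square, one factor is bounded by `h² rowBound` and the other is summed over
`l`, which gives at most `4 h`. The total is of order `h³`, negligible against `Λ₀₀² ~ h²`. -/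
lemma abs_tsum_Lam_sq_sub_le {h : ℝ} (hh : 0 < h) {w : ℤ × ℤ → ℝ}
    (hw : ∀ p, 0 ≤ w p ∧ w p ≤ 1) :
    |∑' p : ℤ × ℤ, w p * Lam h p.1 p.2 ^ 2 - (w (0, 0) * Lam h 0 0 ^ 2 + w (1, 0) * Lam h 1 0 ^ 2
      + w (-1, 0) * Lam h (-1) 0 ^ 2)| ≤ 4 * (∑' j, rowBound j) * h ^ 3 := by
  classical
  set S : Finset (ℤ × ℤ) := {(0, 0), (1, 0), (-1, 0)} with hS
  set f : ℤ × ℤ → ℝ := fun p ↦ w p * Lam h p.1 p.2 ^ 2 with hf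
  have hf0 : ∀ p, 0 ≤ f p := fun p ↦ mul_nonneg (hw p).1 (sq_nonneg _)
  have hfs : Summable f := Summable.of_nonneg_of_le hf0
    (fun p ↦ mul_le_of_le_one_left (sq_nonneg _) (hw p).2) (summable_Lam_sq hh)
  have h1 := hfs.sum_add_tsum_compl (s := S)
  have h2 : ∑ p ∈ S, f p = w (0, 0) * Lam h 0 0 ^ 2 + w (1, 0) * Lam h 1 0 ^ 2
      + w (-1, 0) * Lam h (-1) 0 ^ 2 := by
    rw [hS, Finset.sum_insert (by simp), Finset.sum_insert (by simp), Finset.sum_singleton]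
    simp only [hf]
    ring
  rw [← h2, ← h1, add_sub_cancel_left, abs_of_nonneg (tsum_nonneg fun p ↦ hf0 _)]
  refine Real.tsum_le_of_sum_le (fun p ↦ hf0 _) fun u ↦ ?_
  set U : Finset (ℤ × ℤ) := u.map (Function.Embedding.subtype _) with hU
  have hUS : ∀ p ∈ U, p ∉ S := by
    intro p hp
    rw [hU, Finset.mem_map] at hp
    obtain ⟨q, -, rfl⟩ := hp
    exact q.2
  have e1 : ∑ p ∈ u, f p = ∑ p ∈ U, f p := by rw [hU, Finset.sum_map]; rfl
  rw [e1]
  have hS' : ∀ p ∉ S, 1 < |p.1| ∨ p.2 ≠ 0 := by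
    rintro ⟨a, b⟩ hp
    by_contra! hc
    apply hp
    simp only [hS, Finset.mem_insert, Finset.mem_singleton, Prod.mk.injEq]
    have h3 := hc.1
    rw [abs_le] at h3
    have := hc.2
    simp only at h3 this
    omega
  calc ∑ p ∈ U, f p ≤ ∑ p ∈ U, h ^ 2 * rowBound p.1 * |Lam h p.1 p.2| := by
        refine Finset.sum_le_sum fun p hp ↦ ?_
        refine (mul_le_of_le_one_left (sq_nonneg _) (hw p).2).trans ?_
        rw [← sq_abs, sq]
        exact mul_le_mul_of_nonneg_right (abs_Lam_le_rowBound hh.le (hS' p (hUS p hp)))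
          (abs_nonneg _)
    _ ≤ ∑ p ∈ U.image Prod.fst ×ˢ U.image Prod.snd, h ^ 2 * rowBound p.1 * |Lam h p.1 p.2| := by
        refine Finset.sum_le_sum_of_subset_of_nonneg Finset.subset_product fun p _ _ ↦ ?_
        have := rowBound_nonneg p.1
        positivity
    _ = ∑ j ∈ U.image Prod.fst, h ^ 2 * rowBound j * ∑ l ∈ U.image Prod.snd, |Lam h j l| := by
        rw [Finset.sum_product]
        simp only [Finset.mul_sum]
    _ ≤ ∑ j ∈ U.image Prod.fst, h ^ 2 * rowBound j * (4 * h) := by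
        refine Finset.sum_le_sum fun j _ ↦ ?_
        have := rowBound_nonneg j
        have := sum_abs_Lam_le hh.le j (U.image Prod.snd)
        gcongr
    _ = 4 * h ^ 3 * ∑ j ∈ U.image Prod.fst, rowBound j := by
        rw [Finset.mul_sum]
        refine Finset.sum_congr rfl fun j _ ↦ ?_
        ring
    _ ≤ 4 * h ^ 3 * ∑' j, rowBound j := by
        gcongr
        exact summable_rowBound.sum_le_tsum _ fun j _ ↦ rowBound_nonneg j
    _ = _ := by ring

lemma tendsto_heatInt_slope {t : ℝ} (ht : 0 < t) :
    Tendsto (fun h ↦ (heatInt t 0 - heatInt t h) / h) (𝓝[>] 0) (𝓝 (1 / 4)) := by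
  have h1 := (hasDerivAt_heatInt_space ht 0).tendsto_slope_zero_right
  rw [zero_div, gaussTail_zero] at h1
  have h2 := h1.neg
  have e : -(-(1 / (2 * √Real.pi)) * (√Real.pi / 2)) = 1 / 4 := by
    have : √Real.pi ≠ 0 := by positivity
    field_simp; norm_num
  rw [e] at h2
  refine h2.congr fun h ↦ ?_
  simp only [zero_add, smul_eq_mul]
  ring

lemma tendsto_Lam_zero_zero_div : Tendsto (fun h ↦ Lam h 0 0 / h) (𝓝[>] 0) (𝓝 (-1)) := by
  have h1 := (tendsto_heatInt_slope one_pos).const_mul (-4)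
  rw [show (-4 : ℝ) * (1 / 4) = -1 by norm_num] at h1
  refine h1.congr fun h ↦ ?_
  rw [Lam_zero_zero]
  simp only [heatInt, Real.sqrt_one, div_one, one_mul]
  ring

lemma Lam_one_zero (h : ℝ) : Lam h 1 0 =
    4 * (heatInt 1 0 - heatInt 1 h) - 2 * (heatInt 2 0 - heatInt 2 h) := by
  have h1 := spaceDiff_zero_right (h := h) 1
  have h2 := spaceDiff_zero_right (h := h) 2
  rw [Lam_eq, sub_self, spaceDiff_zero_left]
  norm_num at h1 h2 ⊢
  rw [h1, h2]
  ring

lemma Lam_neg_one_zero (h : ℝ) : Lam h (-1) 0 = Lam h 1 0 := by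
  rw [← Lam_abs h (-1) 0]
  simp

lemma tendsto_Lam_one_zero_div : Tendsto (fun h ↦ Lam h 1 0 / h) (𝓝[>] 0) (𝓝 (1 / 2)) := by
  have h1 := ((tendsto_heatInt_slope one_pos).const_mul 4).sub
    ((tendsto_heatInt_slope two_pos).const_mul 2)
  rw [show (4 : ℝ) * (1 / 4) - 2 * (1 / 4) = 1 / 2 by norm_num] at h1
  refine h1.congr fun h ↦ ?_
  rw [Lam_one_zero]
  ring

/-- The asymptotic variance function. -/
noncomputable def asympVar (x : ℝ≥0∞) : ℝ :=
  if x = 0 then 3 else 2 / LamE x 0 0 ^ 2 * ∑' p : ℤ × ℤ, LamE x p.1 p.2 ^ 2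

/-- Near zero `Λ₀₀ ~ -h` and `Λ_{±1,0} ~ h / 2`, while the rest of the series is `O(h³)`; hence the
limit `2 (1 + 1/4 + 1/4)`. -/
lemma tendsto_weighted_Lam_zero {ι : Type*} {𝓕 : Filter ι} {h : ι → ℝ}
    (hh : Tendsto h 𝓕 (𝓝[>] 0)) {w : ι → ℤ × ℤ → ℝ}
    (hw : ∀ i p, 0 ≤ w i p ∧ w i p ≤ 1) (hw1 : ∀ p, Tendsto (fun i ↦ w i p) 𝓕 (𝓝 1)) :
    Tendsto (fun i ↦ 2 / Lam (h i) 0 0 ^ 2 * ∑' p : ℤ × ℤ, w i p * Lam (h i) p.1 p.2 ^ 2) 𝓕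
      (𝓝 3) := by
  have h0 : Tendsto h 𝓕 (𝓝 0) := hh.mono_right nhdsWithin_le_nhds
  have hpos : ∀ᶠ i in 𝓕, 0 < h i := hh.eventually self_mem_nhdsWithin
  set R : ι → ℝ := fun i ↦ ∑' p : ℤ × ℤ, w i p * Lam (h i) p.1 p.2 ^ 2
    - (w i (0, 0) * Lam (h i) 0 0 ^ 2 + w i (1, 0) * Lam (h i) 1 0 ^ 2
      + w i (-1, 0) * Lam (h i) (-1) 0 ^ 2) with hR
  have hR0 : Tendsto (fun i ↦ R i / h i ^ 2) 𝓕 (𝓝 0) := by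
    have h1 : Tendsto (fun i ↦ 4 * (∑' j, rowBound j) * h i) 𝓕 (𝓝 0) := by
      simpa using h0.const_mul (4 * ∑' j, rowBound j)
    refine squeeze_zero_norm' ?_ h1
    filter_upwards [hpos] with i hi
    rw [Real.norm_eq_abs, abs_div, abs_of_pos (pow_pos hi 2), div_le_iff₀ (by positivity)]
    refine (abs_tsum_Lam_sq_sub_le hi (hw i)).trans (le_of_eq ?_)
    ring
  have a0 := tendsto_Lam_zero_zero_div.comp hh
  have a1 := tendsto_Lam_one_zero_div.comp hh
  have key := (((((hw1 (0, 0)).mul (a0.pow 2)).add ((hw1 (1, 0)).mul (a1.pow 2))).add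
    ((hw1 (-1, 0)).mul (a1.pow 2))).add hR0).const_mul 2 |>.div (a0.pow 2) (by norm_num)
  rw [show (2 * (1 * (-1) ^ 2 + 1 * (1 / 2) ^ 2 + 1 * (1 / 2) ^ 2 + 0) / (-1) ^ 2 : ℝ) = 3 by
    norm_num] at key
  refine key.congr' ?_
  filter_upwards [hpos] with i hi
  have hL := Lam_zero_zero_ne_zero hi
  have e : ∑' p : ℤ × ℤ, w i p * Lam (h i) p.1 p.2 ^ 2 = R i
      + (w i (0, 0) * Lam (h i) 0 0 ^ 2 + w i (1, 0) * Lam (h i) 1 0 ^ 2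
      + w i (-1, 0) * Lam (h i) 1 0 ^ 2) := by
    simp only [hR, Lam_neg_one_zero]; ring
  rw [e]
  simp only [Function.comp_apply, Pi.div_apply]
  field_simp
  ring

/-- At `h = ∞` the kernel `G` lives on `l = 0` alone, so the array factorises into the temporal
second difference of `√|j| H(0)` and the stencil `(1, -2, 1)` in `l`. -/
lemma LamE_top (j l : ℤ) : LamE ∞ j l = timeDiff j 0 *
    ((if |l| + 1 = 0 then 1 else 0) + (if |l| - 1 = 0 then 1 else 0)
      - 2 * (if |l| = 0 then 1 else 0)) := by
  -- The convention `0 · ∞ = 0` in `ℝ≥0∞` is what keeps the value `H 0` at `m = 0`; for `i = 0` the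
  -- prefactor vanishes whatever the argument.
  have hG : ∀ i m : ℤ, GE ∞ i m = heatInt |(i : ℝ)| 0 * (if m = 0 then 1 else 0) := by
    intro i m
    rw [GE, heatInt, zero_div]
    split_ifs with hm
    · simp [hm, HE]
    · rcases eq_or_ne i 0 with rfl | hi
      · simp
      · rw [ENNReal.mul_top, HE_top]
        · simp
        · simp only [ne_eq, ENNReal.ofReal_eq_zero, not_le]
          have : (i : ℝ) ≠ 0 := by exact_mod_cast hi
          have : (m : ℝ) ≠ 0 := by exact_mod_cast hm
          positivity
  have he : timeDiff j 0 = heatInt |((|j| + 1 : ℤ) : ℝ)| 0 + heatInt |((|j| - 1 : ℤ) : ℝ)| 0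
      - 2 * heatInt |((|j| : ℤ) : ℝ)| 0 := by
    rcases abs_choice j with e | e <;> rw [e] <;> simp only [timeDiff] <;> push_cast
    · rfl
    · rw [show -(j : ℝ) + 1 = -(j - 1) by ring, show -(j : ℝ) - 1 = -(j + 1) by ring, abs_neg,
        abs_neg, abs_neg]
      ring
  rw [he]
  simp only [LamE, diffX, diffY, hG]
  rw [show |j| - 1 + 2 = |j| + 1 by ring, show |l| - 1 + 2 = |l| + 1 by ring,
    show |j| - 1 + 1 = |j| by ring, show |l| - 1 + 1 = |l| by ring]
  ring

lemma LamE_zero_zero_ne_zero {x : ℝ≥0∞} (hx : x ≠ 0) : LamE x 0 0 ≠ 0 := by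
  rcases eq_or_ne x ∞ with rfl | hx'
  · rw [LamE_top]
    simp [timeDiff, heatInt_zero_left]
    simp [heatInt, H_zero_pos.ne']
  · rw [← ENNReal.ofReal_toReal hx', LamE_ofReal ENNReal.toReal_nonneg]
    exact Lam_zero_zero_ne_zero (ENNReal.toReal_pos hx hx')

/-- One statement serves twice: with unit weights it is the continuity of the variance function,
with pair proportions it is the convergence of the Frobenius norms. The points `x i` must avoid zero
since `Λ₀₀(0) = 0`. -/
theorem tendsto_weighted_asympVar {ι : Type*} {𝓕 : Filter ι} {x : ι → ℝ≥0∞} {x₀ : ℝ≥0∞}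
    (hx : Tendsto x 𝓕 (𝓝 x₀)) (hx0 : ∀ᶠ i in 𝓕, x i ≠ 0) {w : ι → ℤ × ℤ → ℝ}
    (hw : ∀ i p, 0 ≤ w i p ∧ w i p ≤ 1) (hw1 : ∀ p, Tendsto (fun i ↦ w i p) 𝓕 (𝓝 1)) :
    Tendsto (fun i ↦ 2 / LamE (x i) 0 0 ^ 2 * ∑' p : ℤ × ℤ, w i p * LamE (x i) p.1 p.2 ^ 2) 𝓕
      (𝓝 (asympVar x₀)) := by
  rcases eq_or_ne x₀ 0 with rfl | h0
  · have h1 : Tendsto (fun i ↦ (x i).toReal) 𝓕 (𝓝[>] 0) := by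
      refine tendsto_nhdsWithin_iff.2 ⟨?_, ?_⟩
      · simpa [Function.comp_def] using (ENNReal.tendsto_toReal ENNReal.zero_ne_top).comp hx
      · filter_upwards [hx0, hx.eventually (eventually_lt_nhds ENNReal.zero_lt_top)] with i h1 h2
        exact ENNReal.toReal_pos h1 h2.ne
    have h2 := tendsto_weighted_Lam_zero h1 hw hw1
    rw [asympVar, if_pos rfl]
    refine h2.congr' ?_
    filter_upwards [hx.eventually (eventually_lt_nhds ENNReal.zero_lt_top)] with i hi
    rw [← LamE_ofReal ENNReal.toReal_nonneg, ENNReal.ofReal_toReal hi.ne]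
  · rw [asympVar, if_neg h0]
    exact (tendsto_const_nhds.div ((((continuous_LamE 0 0).tendsto x₀).comp hx).pow 2)
      (pow_ne_zero 2 (LamE_zero_zero_ne_zero h0))).mul (tendsto_tsum_LamE_sq hx h0 hw hw1)

lemma continuous_asympVar : Continuous asympVar := by
  rw [continuous_iff_continuousAt]
  intro x₀
  -- The series formula defines the function only off zero, so continuity at zero is tested on a
  -- punctured neighbourhood.
  rw [continuousAt_iff_punctured_nhds]
  have key : ∀ 𝓕 : Filter ℝ≥0∞, 𝓕 ≤ 𝓝 x₀ → (∀ᶠ x in 𝓕, x ≠ 0) →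
      Tendsto asympVar 𝓕 (𝓝 (asympVar x₀)) := by
    intro 𝓕 h1 h2
    have := tendsto_weighted_asympVar (w := fun _ _ ↦ 1) (tendsto_id.mono_right h1) h2
      (fun _ _ ↦ ⟨zero_le_one, le_rfl⟩) (fun _ ↦ tendsto_const_nhds)
    refine this.congr' ?_
    filter_upwards [h2] with x hx
    simp [asympVar, hx]
  rcases eq_or_ne x₀ 0 with rfl | h0
  · exact key _ nhdsWithin_le_nhds self_mem_nhdsWithin
  · exact key _ nhdsWithin_le_nhds (nhdsWithin_le_nhds (eventually_ne_nhds h0))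

lemma timeDiff_succ_zero (n : ℕ) : timeDiff ((n : ℤ) + 1) 0 = H 0 * sqrtDiff (n + 1) := by
  simp only [timeDiff, heatInt, sqrtDiff, zero_div]
  push_cast
  rw [abs_of_nonneg (by positivity), add_sub_cancel_right, abs_of_nonneg (by positivity),
    abs_of_nonneg (by positivity)]
  ring

lemma timeDiff_neg (j : ℤ) (x : ℝ) : timeDiff (-j) x = timeDiff j x := by
  simp only [timeDiff]
  push_cast
  rw [show -(j : ℝ) + 1 = -(j - 1) by ring, show -(j : ℝ) - 1 = -(j + 1) by ring, abs_neg,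
    abs_neg, abs_neg]
  ring

lemma summable_timeDiff_zero_sq : Summable fun j : ℤ ↦ timeDiff j 0 ^ 2 := by
  refine Summable.of_nonneg_of_le (fun _ ↦ sq_nonneg _) (fun j ↦ ?_)
    (summable_int_inv_sq.mul_left (16 ^ 2))
  rw [← sq_abs, ← mul_pow]
  refine pow_le_pow_left₀ (abs_nonneg _) ((abs_timeDiff_le j le_rfl).trans (le_of_eq ?_)) 2
  ring

lemma summable_sqrtDiff_sq : Summable fun n : ℕ ↦ sqrtDiff (n + 1) ^ 2 := by
  have h1 : Summable fun n : ℕ ↦ timeDiff ((n : ℤ) + 1) 0 ^ 2 :=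
    summable_timeDiff_zero_sq.comp_injective (i := fun n : ℕ ↦ (n : ℤ) + 1)
      (fun a b h ↦ by simpa using h)
  simp only [timeDiff_succ_zero, mul_pow] at h1
  exact (summable_mul_left_iff (pow_ne_zero 2 H_zero_pos.ne')).1 h1

lemma tsum_timeDiff_zero_sq : ∑' j : ℤ, timeDiff j 0 ^ 2 =
    H 0 ^ 2 * (4 + 2 * ∑' n : ℕ, sqrtDiff (n + 1) ^ 2) := by
  have hs : Summable fun n : ℕ ↦ timeDiff ((n : ℤ) + 1) 0 ^ 2 := by
    simp only [timeDiff_succ_zero, mul_pow]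
    exact summable_sqrtDiff_sq.mul_left _
  have hn : HasSum (fun n : ℕ ↦ timeDiff (n : ℤ) 0 ^ 2)
      (4 * H 0 ^ 2 + H 0 ^ 2 * ∑' n : ℕ, sqrtDiff (n + 1) ^ 2) := by
    have h0 : timeDiff 0 0 ^ 2 = 4 * H 0 ^ 2 := by
      simp [timeDiff, heatInt]; ring
    have h1 : Summable fun n : ℕ ↦ timeDiff (n : ℤ) 0 ^ 2 := by
      refine (summable_nat_add_iff 1).1 ?_
      simpa only [Nat.cast_add, Nat.cast_one] using hs
    have h2 := h1.tsum_eq_zero_add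
    simp only [Nat.cast_add, Nat.cast_one, Nat.cast_zero, h0, timeDiff_succ_zero, mul_pow,
      tsum_mul_left] at h2
    rw [← h2]
    exact h1.hasSum
  have hm : HasSum (fun n : ℕ ↦ timeDiff (-((n : ℤ) + 1)) 0 ^ 2)
      (H 0 ^ 2 * ∑' n : ℕ, sqrtDiff (n + 1) ^ 2) := by
    simp only [timeDiff_neg, timeDiff_succ_zero, mul_pow]
    exact summable_sqrtDiff_sq.hasSum.mul_left _
  rw [(HasSum.of_nat_of_neg_add_one (f := fun j : ℤ ↦ timeDiff j 0 ^ 2) hn hm).tsum_eq]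
  ring

/-- The stencil `(1, -2, 1)` has squared norm `6`, the temporal factor contributes `H(0)² (4 + 2 S)`
with `S` the series of squared root differences, and `Λ₀₀² = 16 H(0)²`; thus `(2 / 16) · 6 · (4 + 2
S) = 3 + (3 / 2) S`. -/
lemma asympVar_top : asympVar ∞ = 3 + 3 / 2 * ∑' n : ℕ, sqrtDiff (n + 1) ^ 2 := by
  set d : ℤ → ℝ := fun l ↦ (if |l| + 1 = 0 then 1 else 0) + (if |l| - 1 = 0 then 1 else 0)
      - 2 * (if |l| = 0 then 1 else 0) with hd
  have hd0 : ∀ l ∉ ({0, 1, -1} : Finset ℤ), d l ^ 2 = 0 := by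
    intro l hl
    simp only [Finset.mem_insert, Finset.mem_singleton, not_or] at hl
    have h1 : |l| + 1 ≠ 0 := by have := abs_nonneg l; omega
    have h2 : |l| - 1 ≠ 0 := by
      intro h; rcases abs_choice l with e | e <;> omega
    have h3 : |l| ≠ 0 := by simpa using hl.1
    simp [hd, h1, h2]
    exact hl.1
  have hdsum : HasSum (fun l ↦ d l ^ 2) 6 := by
    have h1 : HasSum (fun l ↦ d l ^ 2) (∑ l ∈ {0, 1, -1}, d l ^ 2) :=
      hasSum_sum_of_ne_finset_zero hd0
    rw [Finset.sum_insert (by decide), Finset.sum_insert (by decide), Finset.sum_singleton] at h1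
    convert h1 using 1
    norm_num [hd]
  have h1 : ∑' p : ℤ × ℤ, LamE ∞ p.1 p.2 ^ 2 = (∑' j : ℤ, timeDiff j 0 ^ 2) * 6 := by
    have h2 := HasSum.mul summable_timeDiff_zero_sq.hasSum hdsum
      (summable_timeDiff_zero_sq.mul_of_nonneg hdsum.summable (fun _ ↦ sq_nonneg _)
        (fun _ ↦ sq_nonneg _))
    rw [← h2.tsum_eq]
    refine tsum_congr fun p ↦ ?_
    rw [LamE_top, mul_pow]
  have h3 : LamE ∞ 0 0 = -4 * H 0 := by
    rw [LamE_top]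
    simp [timeDiff, heatInt]
    ring
  rw [asympVar, if_neg ENNReal.top_ne_zero, h1, tsum_timeDiff_zero_sq, h3]
  have := H_zero_pos.ne'
  field_simp
  ring

theorem isAsymptoticVariance_asympVar : IsAsymptoticVariance asympVar where
  continuous := continuous_asympVar
  bounded := by
    obtain ⟨K, hK⟩ := isCompact_univ.exists_bound_of_continuousOn continuous_asympVar.continuousOn
    exact ⟨K, fun h ↦ hK h (Set.mem_univ h)⟩
  ne_zero h hh := Lam_zero_zero_ne_zero hh
  summable h hh := summable_Lam_sq hh
  eq h hh := by
    rw [asympVar, if_neg (by simpa using hh), LamE_ofReal hh.le]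
  at_zero := by simp [asympVar]
  summable_top := summable_sqrtDiff_sq
  at_top := asympVar_top

end AsymptoticVariance

/-! ### The function `F` and the theta function -/

section Theta

open SPDE

/-- The time derivative `∑_{ℓ ≥ 1} exp(-π² ϑ ℓ² t) cos(π ℓ z)` of `F_ϑ(z, t)`. -/
noncomputable def theta (ϑ t z : ℝ) : ℝ :=
  ∑' n : ℕ, Real.exp (-(Real.pi ^ 2 * ϑ * (n + 1 : ℝ) ^ 2 * t)) * Real.cos (Real.pi * (n + 1 : ℝ) * z)

/-- Poisson summation: the theta function as a sum over images of the heat kernel. -/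
lemma hasSum_heat_images {ϑ t : ℝ} (hϑ : 0 < ϑ) (ht : 0 < t) (z : ℝ) :
    HasSum (fun n : ℤ ↦ heat (ϑ * t) (z + 2 * n)) (theta ϑ t z + 1 / 2) := by
  have hp := Real.pi_pos
  -- With this parameter the cosine kernel at `1 / x` has exponents `π² ϑ ℓ² t`. The term `1 / 2` in
  -- the conclusion is the mode `ℓ = 0`, which `theta` omits.
  set x : ℝ := 1 / (Real.pi * (ϑ * t)) with hx
  have hx0 : 0 < x := by positivity
  have h1 := HurwitzZeta.hasSum_int_evenKernel (z / 2) hx0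
  have h2 := HurwitzZeta.hasSum_nat_cosKernel₀ (z / 2) (t := 1 / x) (by positivity)
  have h3 := HurwitzZeta.evenKernel_functional_equation ((z / 2 : ℝ) : UnitAddCircle) x
  have h4 : theta ϑ t z = (HurwitzZeta.cosKernel ((z / 2 : ℝ) : UnitAddCircle) (1 / x) - 1) / 2 := by
    have := h2.div_const 2
    rw [← this.tsum_eq, theta]
    refine tsum_congr fun n ↦ ?_
    rw [show 2 * Real.pi * (z / 2) * ((n : ℝ) + 1) = Real.pi * (n + 1) * z by ring,
      show -Real.pi * ((n : ℝ) + 1) ^ 2 * (1 / x) = -(Real.pi ^ 2 * ϑ * (n + 1 : ℝ) ^ 2 * t) by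
        rw [hx]; field_simp]
    ring
  have h5 := h1.mul_left (1 / √(4 * Real.pi * (ϑ * t)))
  have e2 : 1 / √(4 * Real.pi * (ϑ * t)) * HurwitzZeta.evenKernel ((z / 2 : ℝ) : UnitAddCircle) x =
      theta ϑ t z + 1 / 2 := by
    have hs : √(4 * Real.pi * (ϑ * t)) * √x = 2 := by
      rw [← Real.sqrt_mul (by positivity), hx,
        show 4 * Real.pi * (ϑ * t) * (1 / (Real.pi * (ϑ * t))) = 2 ^ 2 by field_simp; norm_num,
        Real.sqrt_sq (by norm_num)]
    rw [h3, h4, ← Real.sqrt_eq_rpow, ← mul_assoc, one_div_mul_one_div, hs]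
    ring
  rw [e2] at h5
  refine h5.congr_fun fun n ↦ ?_
  rw [heat]
  congr 2
  rw [hx]
  field_simp
  ring

lemma summable_exp_neg_sq {c : ℝ} (hc : 0 < c) :
    Summable fun n : ℕ ↦ Real.exp (-(c * (n + 1 : ℝ) ^ 2)) := by
  refine Summable.of_nonneg_of_le (fun _ ↦ (Real.exp_pos _).le) (fun n ↦ ?_)
    (summable_one_div_succ_sq.mul_left (1 / c))
  have h0 : 0 < c * ((n : ℝ) + 1) ^ 2 := by positivity
  rw [one_div_mul_one_div, Real.exp_neg, ← one_div]
  exact one_div_le_one_div_of_le h0 (by linarith [Real.add_one_le_exp (c * ((n : ℝ) + 1) ^ 2)])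

lemma abs_F_term_le {ϑ t : ℝ} (hϑ : 0 < ϑ) (ht : 0 ≤ t) (z : ℝ) (n : ℕ) :
    |(1 - Real.exp (-(Real.pi ^ 2 * ϑ * (n + 1 : ℝ) ^ 2 * t)))
      / (Real.pi ^ 2 * ϑ * (n + 1 : ℝ) ^ 2) * Real.cos (Real.pi * (n + 1 : ℝ) * z)| ≤
      1 / (Real.pi ^ 2 * ϑ) * (1 / ((n : ℝ) + 1) ^ 2) := by
  have hp := Real.pi_pos
  have h1 : Real.exp (-(Real.pi ^ 2 * ϑ * (n + 1 : ℝ) ^ 2 * t)) ≤ 1 :=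
    Real.exp_le_one_iff.2 (by
      have : 0 ≤ Real.pi ^ 2 * ϑ * (n + 1 : ℝ) ^ 2 * t := by positivity
      linarith)
  have h2 := Real.exp_pos (-(Real.pi ^ 2 * ϑ * (n + 1 : ℝ) ^ 2 * t))
  rw [abs_mul, abs_div, abs_of_nonneg (by linarith), abs_of_pos (by positivity),
    one_div_mul_one_div]
  refine (mul_le_of_le_one_right ?_ (Real.abs_cos_le_one _)).trans ?_
  · exact div_nonneg (by linarith) (by positivity)
  · gcongr
    linarith

lemma summable_F {ϑ t : ℝ} (hϑ : 0 < ϑ) (ht : 0 ≤ t) (z : ℝ) :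
    Summable fun n : ℕ ↦ (1 - Real.exp (-(Real.pi ^ 2 * ϑ * (n + 1 : ℝ) ^ 2 * t)))
      / (Real.pi ^ 2 * ϑ * (n + 1 : ℝ) ^ 2) * Real.cos (Real.pi * (n + 1 : ℝ) * z) :=
  Summable.of_norm_bounded (summable_one_div_succ_sq.mul_left (1 / (Real.pi ^ 2 * ϑ)))
    (abs_F_term_le hϑ ht z)

lemma continuousOn_F {ϑ : ℝ} (hϑ : 0 < ϑ) (z : ℝ) :
    ContinuousOn (fun t ↦ F ϑ z t) (Set.Ici 0) :=
  continuousOn_tsum (fun n ↦ by fun_prop)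
    (summable_one_div_succ_sq.mul_left (1 / (Real.pi ^ 2 * ϑ)))
    (fun n t ht ↦ abs_F_term_le hϑ ht z n)

lemma hasDerivAt_F {ϑ t : ℝ} (hϑ : 0 < ϑ) (ht : 0 < t) (z : ℝ) :
    HasDerivAt (fun t ↦ F ϑ z t) (theta ϑ t z) t := by
  have hp := Real.pi_pos
  -- Differentiation under the sum is dominated on `(t / 2, ∞)`; no uniform bound holds down to `t =
  -- 0`.
  have hu : Summable fun n : ℕ ↦ Real.exp (-(Real.pi ^ 2 * ϑ * (t / 2) * (n + 1 : ℝ) ^ 2)) :=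
    summable_exp_neg_sq (by positivity)
  refine hasDerivAt_tsum_of_isPreconnected (t := Set.Ioi (t / 2)) hu isOpen_Ioi isPreconnected_Ioi
    (g' := fun (n : ℕ) (t : ℝ) ↦ Real.exp (-(Real.pi ^ 2 * ϑ * (n + 1 : ℝ) ^ 2 * t))
      * Real.cos (Real.pi * (n + 1 : ℝ) * z)) (fun n y _ ↦ ?_) (fun n y hy ↦ ?_)
    (show t ∈ Set.Ioi (t / 2) from half_lt_self ht) (summable_F hϑ ht.le z) (half_lt_self ht)
  · have h0 : Real.pi ^ 2 * ϑ * (n + 1 : ℝ) ^ 2 ≠ 0 := by positivity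
    have h1 := ((((hasDerivAt_id' y).const_mul (Real.pi ^ 2 * ϑ * (n + 1 : ℝ) ^ 2)).fun_neg.exp
      ).const_sub 1).div_const (Real.pi ^ 2 * ϑ * (n + 1 : ℝ) ^ 2)
    refine (h1.mul_const (Real.cos (Real.pi * (n + 1 : ℝ) * z))).congr_deriv ?_
    field_simp
  · rw [Real.norm_eq_abs, abs_mul, Real.abs_exp]
    refine (mul_le_of_le_one_right (Real.exp_pos _).le (Real.abs_cos_le_one _)).trans ?_
    refine Real.exp_le_exp.2 (neg_le_neg ?_)
    have : t / 2 ≤ y := le_of_lt hy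
    calc Real.pi ^ 2 * ϑ * (t / 2) * (n + 1 : ℝ) ^ 2
        = Real.pi ^ 2 * ϑ * (n + 1 : ℝ) ^ 2 * (t / 2) := by ring
      _ ≤ _ := by gcongr

lemma F_zero_right (ϑ z : ℝ) : F ϑ z 0 = 0 := by simp [F]

/-! ### Far images of the heat kernel -/

lemma hasDerivAt_heat_space {t : ℝ} (ht : 0 < t) (x : ℝ) :
    HasDerivAt (heat t) (-(x / (2 * t)) * heat t x) x := by
  have h := ((((hasDerivAt_pow 2 x).div_const (4 * t)).fun_neg).exp).const_mul
    (1 / √(4 * Real.pi * t))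
  refine h.congr_deriv ?_
  rw [heat]
  push_cast
  field_simp
  ring

lemma hasDerivAt_heat_space_deriv {t : ℝ} (ht : 0 < t) (x : ℝ) :
    HasDerivAt (fun x ↦ -(x / (2 * t)) * heat t x) (heatDeriv t x) x := by
  have h := (((hasDerivAt_id' x).div_const (2 * t)).fun_neg).fun_mul (hasDerivAt_heat_space ht x)
  refine h.congr_deriv ?_
  rw [heatDeriv]
  field_simp
  ring

/-- At distance at least `c` from the origin, `(1 + y) exp(-y) ≤ 8 / y²` with `y = x² / (4 t)` beats
every negative power of `t` that occurs. The kernel and its first two space derivatives are thus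
bounded uniformly for `t ≤ T`, with a tail `1 / x²` that is summable over the images. -/
lemma heat_far_bounds {T c t x : ℝ} (ht : 0 < t) (htT : t ≤ T) (hc : 0 < c) (hx : c ≤ |x|) :
    |heat t x| ≤ 128 * (1 + T) ^ 2 / c ^ 2 / x ^ 2 ∧
    |-(x / (2 * t)) * heat t x| ≤ 128 * (1 + T) ^ 2 / c ^ 2 / x ^ 2 ∧
    |heatDeriv t x| ≤ 128 * (1 + T) ^ 2 / c ^ 2 / x ^ 2 := by
  have hT : 0 < T := ht.trans_le htT
  have hxp : 0 < |x| := hc.trans_le hx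
  have hx2 : 0 < x ^ 2 := by rw [← sq_abs]; positivity
  have hcx : c ^ 2 ≤ x ^ 2 := by rw [← sq_abs x]; gcongr
  set y := x ^ 2 / (4 * t) with hy
  have hy0 : 0 < y := by positivity
  have hst : 0 < √t := by positivity
  have hsq : √t ^ 2 = t := Real.sq_sqrt ht.le
  set B := 1 / (t * √t) * ((1 + y) * Real.exp (-y)) with hB
  have hexp : (1 + y) * Real.exp (-y) ≤ 8 / y ^ 2 := by
    have h1 : y ^ 2 * (1 + y) ≤ 8 * Real.exp y := by
      have := Real.sum_le_exp_of_nonneg hy0.le 4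
      simp [Finset.sum_range_succ, Nat.factorial] at this
      nlinarith [sq_nonneg y]
    rw [le_div_iff₀ (by positivity), Real.exp_neg]
    rw [show (1 + y) * (Real.exp y)⁻¹ * y ^ 2 = y ^ 2 * (1 + y) / Real.exp y by ring,
      div_le_iff₀ (Real.exp_pos _)]
    exact h1
  have hfin : (1 + T) * B ≤ 128 * (1 + T) ^ 2 / c ^ 2 / x ^ 2 := by
    have h1 : B ≤ 128 * √t / x ^ 4 := by
      calc B ≤ 1 / (t * √t) * (8 / y ^ 2) := by rw [hB]; gcongr
        _ = 128 * √t / x ^ 4 := by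
          rw [hy]
          field_simp
          rw [hsq]
          ring
    have h2 : √t ≤ 1 + T := by
      rw [Real.sqrt_le_left (by linarith)]; nlinarith
    calc (1 + T) * B ≤ (1 + T) * (128 * (1 + T) / (c ^ 2 * x ^ 2)) := by
          gcongr
          refine h1.trans ?_
          rw [show x ^ 4 = x ^ 2 * x ^ 2 by ring]
          gcongr
      _ = _ := by field_simp
  have hh : heat t x ≤ t * B := by
    have h1 : 1 / √(4 * Real.pi * t) ≤ 1 / √t := by
      refine one_div_le_one_div_of_le hst (Real.sqrt_le_sqrt ?_)
      nlinarith [Real.pi_gt_three]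
    calc heat t x ≤ 1 / √t * Real.exp (-y) := by rw [heat]; gcongr
      _ ≤ 1 / √t * ((1 + y) * Real.exp (-y)) := by
        gcongr
        exact le_mul_of_one_le_left (Real.exp_pos _).le (by linarith)
      _ = t * B := by rw [hB]; field_simp
  have hh' : heat t x ≤ 1 / √t * Real.exp (-y) := by
    rw [heat]
    have h1 : 1 / √(4 * Real.pi * t) ≤ 1 / √t := by
      refine one_div_le_one_div_of_le hst (Real.sqrt_le_sqrt ?_)
      nlinarith [Real.pi_gt_three]
    gcongr
  have hB0 : 0 ≤ B := by positivity
  refine ⟨?_, ?_, ?_⟩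
  · rw [abs_of_nonneg (heat_nonneg t x)]
    refine hh.trans (le_trans ?_ hfin)
    gcongr
    linarith
  · refine le_trans ?_ hfin
    rw [abs_mul, abs_neg, abs_of_nonneg (heat_nonneg t x), abs_div, abs_of_pos (by positivity : 0 < 2 * t)]
    have h1 : |x| / (2 * t) ≤ (1 + y) / √t := by
      rw [div_le_div_iff₀ (by positivity) hst]
      have h2 : |x| * √t = 2 * t * (|x| / (2 * √t)) := by field_simp; rw [hsq]
      rw [h2, mul_comm (1 + y)]
      gcongr
      have h3 : y = (|x| / (2 * √t)) ^ 2 := by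
        rw [hy, div_pow, mul_pow, hsq, sq_abs]; ring
      rw [h3]
      nlinarith [sq_nonneg (|x| / (2 * √t) - 1)]
    calc |x| / (2 * t) * heat t x ≤ (1 + y) / √t * (1 / √t * Real.exp (-y)) := by
          gcongr
          exact heat_nonneg t x
      _ = √t * B := by rw [hB]; field_simp; exact hsq.symm
      _ ≤ (1 + T) * B := by
        gcongr
        rw [Real.sqrt_le_left (by linarith)]; nlinarith
  · refine le_trans ?_ hfin
    rw [heatDeriv, abs_mul, abs_of_nonneg (heat_nonneg t x)]
    have h1 : |x ^ 2 / (4 * t ^ 2) - 1 / (2 * t)| ≤ (1 + y) / t := by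
      rw [show x ^ 2 / (4 * t ^ 2) - 1 / (2 * t) = (y - 1 / 2) / t by rw [hy]; field_simp,
        abs_div, abs_of_pos ht]
      gcongr
      rw [abs_le]; constructor <;> linarith
    calc heat t x * |x ^ 2 / (4 * t ^ 2) - 1 / (2 * t)|
        ≤ 1 / √t * Real.exp (-y) * ((1 + y) / t) := by gcongr
      _ = B := by rw [hB]; field_simp
      _ ≤ (1 + T) * B := by nlinarith

/-- A linear combination of the values of `g` at `z - δ`, `z`, `z + δ`. -/
noncomputable def stencil (p q r δ : ℝ) (g : ℝ → ℝ) (z : ℝ) : ℝ :=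
  p * (g (z + δ) + g (z - δ) - 2 * g z) + q * (g (z + δ) - g (z - δ)) + r * g z

/-- The combination `|p| δ² + |q| δ + |r|` is the relevant size: in the application `p`, `q`, `r`
are of orders `1`, `δ`, `δ²`, so all three contributions are of order `δ²`. -/
lemma abs_stencil_le {p q r δ z A : ℝ} (hδ : 0 ≤ δ) {g g' g'' : ℝ → ℝ}
    (h1 : ∀ y ∈ Set.Icc (z - δ) (z + δ), HasDerivAt g (g' y) y)
    (h2 : ∀ y ∈ Set.Icc (z - δ) (z + δ), HasDerivAt g' (g'' y) y)
    (b0 : |g z| ≤ A) (b1 : ∀ y ∈ Set.Icc (z - δ) (z + δ), |g' y| ≤ A)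
    (b2 : ∀ y ∈ Set.Icc (z - δ) (z + δ), |g'' y| ≤ A) :
    |stencil p q r δ g z| ≤ 2 * A * (|p| * δ ^ 2 + |q| * δ + |r|) := by
  have hA : 0 ≤ A := (abs_nonneg _).trans b0
  have e1 := abs_second_difference_le hδ h1 h2 b2
  have e2 := Convex.norm_image_sub_le_of_norm_hasDerivWithin_le (f := g)
      (f' := g') (s := Set.Icc (z - δ) (z + δ)) (C := A) (x := z - δ) (y := z + δ)
      (fun r hr ↦ (h1 r hr).hasDerivWithinAt) b1 (convex_Icc _ _)
      ⟨by linarith, by linarith⟩ ⟨by linarith, by linarith⟩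
  rw [Real.norm_eq_abs, Real.norm_eq_abs, show z + δ - (z - δ) = 2 * δ by ring,
      abs_of_nonneg (by linarith : 0 ≤ 2 * δ)] at e2
  rw [stencil]
  calc _ ≤ |p * (g (z + δ) + g (z - δ) - 2 * g z)| + |q * (g (z + δ) - g (z - δ))| + |r * g z| :=
        abs_add_three _ _ _
    _ = |p| * |g (z + δ) + g (z - δ) - 2 * g z| + |q| * |g (z + δ) - g (z - δ)| + |r| * |g z| := by
        rw [abs_mul, abs_mul, abs_mul]
    _ ≤ |p| * (2 * A * δ ^ 2) + |q| * (A * (2 * δ)) + |r| * A := by gcongr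
    _ ≤ _ := by nlinarith [mul_nonneg (abs_nonneg r) hA]

lemma abs_stencil_heat_le {p q r δ z T c t : ℝ} (hδ : 0 ≤ δ) (ht : 0 < t) (htT : t ≤ T)
    (hc : 0 < c) {n : ℤ}
    (hn : ∀ y ∈ Set.Icc (z - δ) (z + δ), c * (|(n : ℝ)| + 1) ≤ |y + 2 * n|) :
    |stencil p q r δ (fun y ↦ heat t (y + 2 * n)) z| ≤
      256 * (1 + T) ^ 2 / c ^ 4 * (|p| * δ ^ 2 + |q| * δ + |r|) * (1 / (|(n : ℝ)| + 1)) ^ 2 := by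
  have hb : ∀ y ∈ Set.Icc (z - δ) (z + δ), 128 * (1 + T) ^ 2 / c ^ 2 / (y + 2 * n) ^ 2 ≤
      128 * (1 + T) ^ 2 / c ^ 4 * (1 / (|(n : ℝ)| + 1)) ^ 2 := by
    intro y hy
    have h1 := pow_le_pow_left₀ (by positivity) (hn y hy) 2
    rw [sq_abs, mul_pow] at h1
    calc _ ≤ 128 * (1 + T) ^ 2 / c ^ 2 / (c ^ 2 * (|(n : ℝ)| + 1) ^ 2) := by gcongr
      _ = _ := by field_simp
  have hcn : ∀ y ∈ Set.Icc (z - δ) (z + δ), c ≤ |y + 2 * n| := fun y hy ↦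
    le_trans (le_mul_of_one_le_right hc.le (by linarith [abs_nonneg (n : ℝ)])) (hn y hy)
  have hz : z ∈ Set.Icc (z - δ) (z + δ) := ⟨by linarith, by linarith⟩
  have := abs_stencil_le (p := p) (q := q) (r := r) hδ (g := fun y ↦ heat t (y + 2 * n))
    (A := 128 * (1 + T) ^ 2 / c ^ 4 * (1 / (|(n : ℝ)| + 1)) ^ 2)
    (fun y _ ↦ (hasDerivAt_heat_space ht (y + 2 * n)).comp_add_const y (2 * (n : ℝ)))
    (fun y _ ↦ (hasDerivAt_heat_space_deriv ht (y + 2 * n)).comp_add_const y (2 * (n : ℝ)))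
    ((heat_far_bounds ht htT hc (hcn z hz)).1.trans (hb z hz))
    (fun y hy ↦ (heat_far_bounds ht htT hc (hcn y hy)).2.1.trans (hb y hy))
    (fun y hy ↦ (heat_far_bounds ht htT hc (hcn y hy)).2.2.trans (hb y hy))
  refine this.trans (le_of_eq ?_)
  ring

lemma abs_stencil_tsum_le {p q r δ z B : ℝ} {g : ℝ → ℝ} {u : ℤ → ℝ → ℝ}
    (hg : ∀ y, HasSum (fun n ↦ u n y) (g y))
    (hb : ∀ n, |stencil p q r δ (u n) z| ≤ B * (1 / (|(n : ℝ)| + 1)) ^ 2) :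
    |stencil p q r δ g z| ≤ B * ∑' n : ℤ, (1 / (|(n : ℝ)| + 1)) ^ 2 := by
  have h1 : HasSum (fun n ↦ stencil p q r δ (u n) z) (stencil p q r δ g z) :=
    (((((hg (z + δ)).add (hg (z - δ))).sub ((hg z).mul_left 2)).mul_left p).add
      (((hg (z + δ)).sub (hg (z - δ))).mul_left q)).add ((hg z).mul_left r)
  rw [← h1.tsum_eq, ← tsum_mul_left, ← Real.norm_eq_abs]
  exact tsum_of_norm_bounded (summable_int_inv_sq.mul_left B).hasSum hb

lemma stencil_const (p q r δ a z : ℝ) : stencil p q r δ (fun _ ↦ a) z = r * a := by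
  simp only [stencil]; ring

/-- The constant in the bounds for the far images. -/
noncomputable def farConst (ϑ T c : ℝ) : ℝ :=
  256 * (1 + ϑ * T) ^ 2 / (c / 2) ^ 4 * ∑' n : ℤ, (1 / (|(n : ℝ)| + 1)) ^ 2 + 1

/-- With the image at the origin removed, every other image stays at distance at least `(c / 2) (|n|
+ 1)` from the stencil window. The constant mode `1 / 2` is seen only by the coefficient `r`, and
the `+ 1` in `farConst` absorbs it. -/
lemma abs_stencil_theta_near_le {ϑ T c t p q r δ z : ℝ} (hϑ : 0 < ϑ) (ht : 0 < t) (htT : t ≤ T)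
    (hc : 0 < c) (hδ : 0 ≤ δ) (hz : |z| + δ ≤ 2 - c) :
    |stencil p q r δ (fun y ↦ theta ϑ t y - heat (ϑ * t) y) z| ≤
      farConst ϑ T c * (|p| * δ ^ 2 + |q| * δ + |r|) := by
  have h1 : |stencil p q r δ (fun y ↦ theta ϑ t y + 1 / 2 - heat (ϑ * t) y) z| ≤
      256 * (1 + ϑ * T) ^ 2 / (c / 2) ^ 4 * (|p| * δ ^ 2 + |q| * δ + |r|) *
        ∑' n : ℤ, (1 / (|(n : ℝ)| + 1)) ^ 2 := by
    refine abs_stencil_tsum_le (u := fun n y ↦ if n = 0 then 0 else heat (ϑ * t) (y + 2 * n))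
      (fun y ↦ ?_) (fun n ↦ ?_)
    · have := hasSum_ite_sub_hasSum (hasSum_heat_images hϑ ht y) 0
      simpa using this
    · rcases eq_or_ne n 0 with rfl | hn
      · simp only [if_true, stencil_const, mul_zero, abs_zero]
        positivity
      · simp only [hn, if_false]
        refine abs_stencil_heat_le hδ (by positivity) (by gcongr) (by positivity) fun y hy ↦ ?_
        have h2 : |y| ≤ 2 - c := by
          have := abs_le.1 (le_refl |z|)
          rw [abs_le]; constructor <;> linarith [hy.1, hy.2]
        have h3 : (1 : ℝ) ≤ |(n : ℝ)| := by
          rw [← Int.cast_abs]; exact_mod_cast Int.one_le_abs hn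
        have h4 : 2 * |(n : ℝ)| - |y| ≤ |y + 2 * n| := by
          have := abs_sub_abs_le_abs_sub (2 * (n : ℝ)) (-y)
          rw [abs_neg, abs_mul, abs_two, sub_neg_eq_add, add_comm (2 * (n : ℝ))] at this
          exact this
        have h5 : 0 ≤ 2 - c := (abs_nonneg y).trans h2
        nlinarith
  have e : stencil p q r δ (fun y ↦ theta ϑ t y - heat (ϑ * t) y) z =
      stencil p q r δ (fun y ↦ theta ϑ t y + 1 / 2 - heat (ϑ * t) y) z - r * (1 / 2) := by
    simp only [stencil]; ring
  rw [e]
  refine (abs_sub _ _).trans ?_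
  rw [abs_mul, abs_of_nonneg (by norm_num : (0 : ℝ) ≤ 1 / 2), farConst]
  have h6 : |r| * (1 / 2) ≤ |p| * δ ^ 2 + |q| * δ + |r| := by
    have : 0 ≤ |p| * δ ^ 2 + |q| * δ := by positivity
    linarith [abs_nonneg r]
  linarith

/-- Here the window lies in `[c, 2 - c]`, away from all even integers, so no image is singular. This
is the situation of the reflected arguments. -/
lemma abs_stencil_theta_le {ϑ T c t p q r δ z : ℝ} (hϑ : 0 < ϑ) (ht : 0 < t) (htT : t ≤ T)
    (hc : 0 < c) (hδ : 0 ≤ δ) (hz1 : c ≤ z - δ) (hz2 : z + δ ≤ 2 - c) :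
    |stencil p q r δ (theta ϑ t) z| ≤ farConst ϑ T c * (|p| * δ ^ 2 + |q| * δ + |r|) := by
  have h1 : |stencil p q r δ (fun y ↦ theta ϑ t y + 1 / 2) z| ≤
      256 * (1 + ϑ * T) ^ 2 / (c / 2) ^ 4 * (|p| * δ ^ 2 + |q| * δ + |r|) *
        ∑' n : ℤ, (1 / (|(n : ℝ)| + 1)) ^ 2 := by
    refine abs_stencil_tsum_le (u := fun n y ↦ heat (ϑ * t) (y + 2 * n))
      (fun y ↦ hasSum_heat_images hϑ ht y) (fun n ↦ ?_)
    refine abs_stencil_heat_le hδ (by positivity) (by gcongr) (by positivity) fun y hy ↦ ?_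
    have hy1 : c ≤ y := hz1.trans hy.1
    have hy2 : y ≤ 2 - c := hy.2.trans hz2
    rcases le_or_gt 0 n with hn | hn
    · have h3 : (0 : ℝ) ≤ n := by exact_mod_cast hn
      rw [abs_of_nonneg h3, abs_of_nonneg (by linarith)]
      nlinarith
    · have h3 : (n : ℝ) ≤ -1 := by exact_mod_cast (by omega : n ≤ -1)
      rw [abs_of_nonpos (by linarith : (n : ℝ) ≤ 0), abs_of_nonpos (by linarith)]
      nlinarith
  have e : stencil p q r δ (theta ϑ t) z =
      stencil p q r δ (fun y ↦ theta ϑ t y + 1 / 2) z - r * (1 / 2) := by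
    simp only [stencil]; ring
  rw [e]
  refine (abs_sub _ _).trans ?_
  rw [abs_mul, abs_of_nonneg (by norm_num : (0 : ℝ) ≤ 1 / 2), farConst]
  have h6 : |r| * (1 / 2) ≤ |p| * δ ^ 2 + |q| * δ + |r| := by
    have : 0 ≤ |p| * δ ^ 2 + |q| * δ := by positivity
    linarith [abs_nonneg r]
  linarith

/-- The functions in question are differentiable only for positive times but continuous at zero,
which the mean value theorem permits. -/
lemma abs_sub_le_of_hasDerivAt {f f' : ℝ → ℝ} {K T : ℝ} (hc : ContinuousOn f (Set.Ici 0))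
    (hd : ∀ t, 0 < t → HasDerivAt f (f' t) t) (hb : ∀ t, 0 < t → t ≤ T → |f' t| ≤ K)
    {t₁ t₂ : ℝ} (h0 : 0 ≤ t₁) (h12 : t₁ ≤ t₂) (h2 : t₂ ≤ T) :
    |f t₂ - f t₁| ≤ K * (t₂ - t₁) := by
  rcases h12.eq_or_lt with rfl | h
  · simp
  obtain ⟨s, hs, hs'⟩ := exists_hasDerivAt_eq_slope f f' h
    (hc.mono fun x hx ↦ h0.trans hx.1) (fun x hx ↦ hd x (h0.trans_lt hx.1))
  have h3 := hb s (h0.trans_lt hs.1) (hs.2.le.trans h2)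
  rw [hs', abs_div, abs_of_pos (sub_pos.2 h), div_le_iff₀ (sub_pos.2 h)] at h3
  exact h3

lemma continuousOn_heatInt_time {x : ℝ} (hx : 0 ≤ x) :
    ContinuousOn (fun t ↦ heatInt t x) (Set.Ici 0) := by
  intro t ht
  rcases (Set.mem_Ici.1 ht).eq_or_lt with rfl | h
  · rw [ContinuousWithinAt, heatInt_zero_left]
    have h1 : Tendsto (fun t : ℝ ↦ √t) (𝓝[Set.Ici 0] 0) (𝓝 0) := by
      have := (Real.continuous_sqrt.tendsto 0).mono_left (nhdsWithin_le_nhds (s := Set.Ici 0))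
      simpa using this
    exact squeeze_zero (fun t ↦ heatInt_nonneg t x) (fun t ↦ heatInt_le hx) h1
  · exact (hasDerivAt_heatInt_time h x).continuousAt.continuousWithinAt

/-- `F` without its singular part. -/
noncomputable def smoothPart (ϑ t z : ℝ) : ℝ := F ϑ z t - 2 / ϑ * heatInt (ϑ * t) |z|

lemma continuousOn_smoothPart {ϑ : ℝ} (hϑ : 0 < ϑ) (z : ℝ) :
    ContinuousOn (fun t ↦ smoothPart ϑ t z) (Set.Ici 0) := by
  refine (continuousOn_F hϑ z).sub (continuousOn_const.mul ?_)
  exact (continuousOn_heatInt_time (abs_nonneg z)).comp (by fun_prop)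
    fun t ht ↦ mul_nonneg hϑ.le (Set.mem_Ici.1 ht)

lemma hasDerivAt_smoothPart {ϑ t : ℝ} (hϑ : 0 < ϑ) (ht : 0 < t) (z : ℝ) :
    HasDerivAt (fun t ↦ smoothPart ϑ t z) (theta ϑ t z - heat (ϑ * t) z) t := by
  have h1 := (hasDerivAt_heatInt_time (t := ϑ * t) (by positivity) |z|).comp t
    ((hasDerivAt_id' t).const_mul ϑ)
  refine ((hasDerivAt_F hϑ ht z).fun_sub (h1.const_mul (2 / ϑ))).congr_deriv ?_
  rw [heat, heat, sq_abs]
  field_simp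

lemma abs_stencil_smoothPart_sub_le {ϑ T c t₁ t₂ p q r δ z : ℝ} (hϑ : 0 < ϑ) (hc : 0 < c)
    (hδ : 0 ≤ δ) (hz : |z| + δ ≤ 2 - c) (h0 : 0 ≤ t₁) (h12 : t₁ ≤ t₂) (h2 : t₂ ≤ T) :
    |stencil p q r δ (smoothPart ϑ t₂) z - stencil p q r δ (smoothPart ϑ t₁) z| ≤
      farConst ϑ T c * (|p| * δ ^ 2 + |q| * δ + |r|) * (t₂ - t₁) := by
  have hcont := continuousOn_smoothPart hϑ
  have hder : ∀ z t, 0 < t → HasDerivAt (fun t ↦ smoothPart ϑ t z) _ t :=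
    fun z t ht ↦ hasDerivAt_smoothPart hϑ ht z
  refine abs_sub_le_of_hasDerivAt (f := fun t ↦ stencil p q r δ (smoothPart ϑ t) z)
    (f' := fun t ↦ stencil p q r δ (fun y ↦ theta ϑ t y - heat (ϑ * t) y) z) ?_ (fun t ht ↦ ?_)
    (fun t ht htT ↦ abs_stencil_theta_near_le hϑ ht htT hc hδ hz) h0 h12 h2
  · simp only [stencil]
    exact ((continuousOn_const.mul (((hcont _).add (hcont _)).sub
      (continuousOn_const.mul (hcont _)))).add (continuousOn_const.mul ((hcont _).sub
      (hcont _)))).add (continuousOn_const.mul (hcont _))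
  · exact (((((hder _ t ht).fun_add (hder _ t ht)).fun_sub ((hder _ t ht).const_mul 2)).const_mul
      p).fun_add (((hder _ t ht).fun_sub (hder _ t ht)).const_mul q)).fun_add
      ((hder _ t ht).const_mul r)

lemma abs_stencil_F_sub_le {ϑ T c t₁ t₂ p q r δ z : ℝ} (hϑ : 0 < ϑ) (hc : 0 < c)
    (hδ : 0 ≤ δ) (hz1 : c ≤ z - δ) (hz2 : z + δ ≤ 2 - c) (h0 : 0 ≤ t₁) (h12 : t₁ ≤ t₂)
    (h2 : t₂ ≤ T) :
    |stencil p q r δ (fun y ↦ F ϑ y t₂) z - stencil p q r δ (fun y ↦ F ϑ y t₁) z| ≤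
      farConst ϑ T c * (|p| * δ ^ 2 + |q| * δ + |r|) * (t₂ - t₁) := by
  have hcont := continuousOn_F hϑ
  have hder : ∀ z t, 0 < t → HasDerivAt (fun t ↦ F ϑ z t) _ t :=
    fun z t ht ↦ hasDerivAt_F hϑ ht z
  refine abs_sub_le_of_hasDerivAt (f := fun t ↦ stencil p q r δ (fun y ↦ F ϑ y t) z)
    (f' := fun t ↦ stencil p q r δ (theta ϑ t) z) ?_ (fun t ht ↦ ?_)
    (fun t ht htT ↦ abs_stencil_theta_le hϑ ht htT hc hδ hz1 hz2) h0 h12 h2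
  · simp only [stencil]
    exact ((continuousOn_const.mul (((hcont _).add (hcont _)).sub
      (continuousOn_const.mul (hcont _)))).add (continuousOn_const.mul ((hcont _).sub
      (hcont _)))).add (continuousOn_const.mul (hcont _))
  · exact (((((hder _ t ht).fun_add (hder _ t ht)).fun_sub ((hder _ t ht).const_mul 2)).const_mul
      p).fun_add (((hder _ t ht).fun_sub (hder _ t ht)).const_mul q)).fun_add
      ((hder _ t ht).const_mul r)

end Theta

/-! ### Temporal covariance kernels and their dependence on the eigenvalue -/

section TimeKernel

open SPDE

/-- `∫_0^t exp(-λ s) ds`. -/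
noncomputable def expAvg (lam t : ℝ) : ℝ := (1 - Real.exp (-(lam * t))) / lam

/-- The second difference of `t ↦ ∫_0^t exp(-λ s) ds`, evenly extended, on a grid of mesh `Δ`. -/
noncomputable def timeKernel (lam Δ : ℝ) (J : ℤ) : ℝ :=
  expAvg lam (Δ * |(J : ℝ) + 1|) + expAvg lam (Δ * |(J : ℝ) - 1|) - 2 * expAvg lam (Δ * |(J : ℝ)|)

/-- Since `exp(-λ t) = 1 - λ ∫_0^t exp(-λ s) ds`, and second differences annihilate constants, the
covariance is expressed by the same integrals that make up `F`. -/
lemma neg_secondDiff_modeCov {σ lam : ℝ} (hl : lam ≠ 0) (Δ : ℝ) (J : ℤ) :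
    -secondDiff (modeCov σ lam Δ) (J : ℝ) = σ ^ 2 / 2 * timeKernel lam Δ J := by
  simp only [secondDiff, modeCov, timeKernel, expAvg, mul_assoc]
  field_simp
  ring

lemma expAvg_nonneg {lam t : ℝ} (hl : 0 < lam) (ht : 0 ≤ t) : 0 ≤ expAvg lam t := by
  refine div_nonneg (sub_nonneg.2 (Real.exp_le_one_iff.2 ?_)) hl.le
  have := mul_nonneg hl.le ht
  linarith

/-- Convexity of the exponential on the segment from `0` to `s v`; the signs `s = -1` and `s = 1`
give the two comparisons of `expAvg` below. -/
lemma exp_neg_le_secant {u v : ℝ} (hu : 0 ≤ u) (huv : u ≤ v) (hv : 0 < v) (s : ℝ) :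
    Real.exp (s * u) ≤ 1 - u / v + u / v * Real.exp (s * v) := by
  have h := convexOn_exp.2 (Set.mem_univ 0) (Set.mem_univ (s * v))
    (sub_nonneg.2 ((div_le_one hv).2 huv)) (div_nonneg hu hv.le) (by ring)
  simp only [smul_eq_mul, mul_zero, zero_add, Real.exp_zero, mul_one] at h
  rwa [show u / v * (s * v) = s * u by field_simp] at h

section Comparison

variable {lam mu t : ℝ}

lemma expAvg_anti (hl : 0 < lam) (hlm : lam ≤ mu) (ht : 0 < t) : expAvg mu t ≤ expAvg lam t := by
  have hm : 0 < mu := hl.trans_le hlm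
  have h := exp_neg_le_secant (u := lam * t) (v := mu * t) (by positivity) (by gcongr)
    (by positivity) (-1)
  rw [mul_div_mul_right _ _ ht.ne', neg_one_mul, neg_one_mul] at h
  rw [expAvg, expAvg, div_le_div_iff₀ hm hl]
  have e : lam = lam / mu * mu := by field_simp
  have h2 : (1 - Real.exp (-(mu * t))) * (lam / mu) ≤ 1 - Real.exp (-(lam * t)) := by linarith
  calc (1 - Real.exp (-(mu * t))) * lam = (1 - Real.exp (-(mu * t))) * (lam / mu) * mu := by
        rw [mul_assoc, ← e]
    _ ≤ _ := by gcongr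

lemma mul_expAvg_mono (hl : 0 < lam) (hlm : lam ≤ mu) (ht : 0 ≤ t) :
    lam * expAvg lam t ≤ mu * expAvg mu t := by
  have hm : 0 < mu := hl.trans_le hlm
  rw [expAvg, expAvg, mul_div_cancel₀ _ hl.ne', mul_div_cancel₀ _ hm.ne']
  have : Real.exp (-(mu * t)) ≤ Real.exp (-(lam * t)) := by gcongr
  linarith

lemma expAvg_sub_le (hl : 0 < lam) (hlm : lam ≤ mu) (ht : 0 ≤ t) :
    expAvg lam t - expAvg mu t ≤ expAvg lam t * ((mu - lam) / mu) := by
  have hm : 0 < mu := hl.trans_le hlm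
  have h := mul_expAvg_mono hl hlm ht
  have e : expAvg lam t * ((mu - lam) / mu) = expAvg lam t - lam * expAvg lam t / mu := by
    field_simp
  rw [e]
  have : lam * expAvg lam t / mu ≤ expAvg mu t := by
    rw [div_le_iff₀ hm]; linarith
  linarith

/-- Here the cost is the absolute gap times `t`, instead of the relative gap of `expAvg_sub_le`.
Multiplying the secant inequality by `exp(-μ t)` gives `expAvg lam t · exp(-(μ - λ) t) ≤ expAvg mu
t`, and `exp(-x) ≥ 1 - x` finishes. -/
lemma expAvg_sub_le' (hl : 0 < lam) (hlm : lam ≤ mu) (ht : 0 < t) :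
    expAvg lam t - expAvg mu t ≤ expAvg lam t * (t * (mu - lam)) := by
  have hm : 0 < mu := hl.trans_le hlm
  have h := exp_neg_le_secant (u := lam * t) (v := mu * t) (by positivity) (by gcongr)
    (by positivity) 1
  rw [mul_div_mul_right _ _ ht.ne', one_mul, one_mul] at h
  have h1 : expAvg lam t * Real.exp (-((mu - lam) * t)) ≤ expAvg mu t := by
    have h2 := mul_le_mul_of_nonneg_right h (Real.exp_pos (-(mu * t))).le
    have e1 : Real.exp (lam * t) * Real.exp (-(mu * t)) = Real.exp (-((mu - lam) * t)) := by
      rw [← Real.exp_add]; congr 1; ring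
    have e2 : Real.exp (mu * t) * Real.exp (-(mu * t)) = 1 := by rw [← Real.exp_add]; simp
    have e3 : Real.exp (-(lam * t)) * Real.exp (-((mu - lam) * t)) = Real.exp (-(mu * t)) := by
      rw [← Real.exp_add]; congr 1; ring
    rw [expAvg, expAvg, div_mul_eq_mul_div, div_le_div_iff₀ hl hm, sub_mul, one_mul, e3]
    have h3 : Real.exp (-((mu - lam) * t)) - Real.exp (-(mu * t)) ≤
        lam / mu * (1 - Real.exp (-(mu * t))) := by
      rw [e1] at h2
      calc _ ≤ (1 - lam / mu + lam / mu * Real.exp (mu * t)) * Real.exp (-(mu * t))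
            - Real.exp (-(mu * t)) := by linarith
        _ = lam / mu * (Real.exp (mu * t) * Real.exp (-(mu * t)) - Real.exp (-(mu * t))) := by ring
        _ = _ := by rw [e2]
    calc _ ≤ lam / mu * (1 - Real.exp (-(mu * t))) * mu := by gcongr
      _ = _ := by field_simp
  have h2 : 1 - (mu - lam) * t ≤ Real.exp (-((mu - lam) * t)) := by
    linarith [Real.add_one_le_exp (-((mu - lam) * t))]
  have h3 := mul_le_mul_of_nonneg_left h2 (expAvg_nonneg hl ht.le)
  nlinarith

end Comparison

lemma timeKernel_neg (lam Δ : ℝ) (J : ℤ) : timeKernel lam Δ (-J) = timeKernel lam Δ J := by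
  simp only [timeKernel]
  push_cast
  rw [show -(J : ℝ) + 1 = -(J - 1) by ring, show -(J : ℝ) - 1 = -(J + 1) by ring, abs_neg,
    abs_neg, abs_neg]
  ring

lemma timeKernel_zero (lam Δ : ℝ) : timeKernel lam Δ 0 = 2 * expAvg lam Δ := by
  simp [timeKernel, expAvg]
  ring

/-- Off the diagonal the kernel is negative and geometric in the lag, so its absolute values sum to
exactly the diagonal value as the lags exhaust `ℤ` without zero. -/
lemma timeKernel_succ (lam Δ : ℝ) (m : ℕ) : timeKernel lam Δ ((m : ℤ) + 1) =
    -(expAvg lam Δ * ((1 - Real.exp (-(lam * Δ))) * Real.exp (-(lam * Δ)) ^ m)) := by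
  simp only [timeKernel, expAvg]
  push_cast
  rw [abs_of_nonneg (by positivity), add_sub_cancel_right, abs_of_nonneg (by positivity),
    abs_of_nonneg (by positivity)]
  have e : ∀ n : ℕ, Real.exp (-(lam * (Δ * (n : ℝ)))) = Real.exp (-(lam * Δ)) ^ n := fun n ↦ by
    rw [← Real.exp_nat_mul]; congr 1; ring
  have e1 := e m
  have e2 := e (m + 1)
  have e3 := e (m + 1 + 1)
  push_cast at e2 e3
  rw [e1, e2, e3]
  ring

lemma sum_int_even_le {f : ℤ → ℝ} (h0 : ∀ j, 0 ≤ f j) (hf : ∀ j, f (-j) = f j) {B : ℝ}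
    (hB : ∀ n, ∑ m ∈ Finset.range n, f ((m : ℤ) + 1) ≤ B) (s : Finset ℤ) :
    ∑ j ∈ s, f j ≤ f 0 + 2 * B := by
  obtain ⟨n, hn⟩ : ∃ n : ℕ, s ⊆ Finset.Icc (-(n : ℤ)) n := by
    refine ⟨s.sup Int.natAbs, fun a ha ↦ ?_⟩
    have := Finset.le_sup (f := Int.natAbs) ha
    rw [Finset.mem_Icc]; omega
  refine (Finset.sum_le_sum_of_subset_of_nonneg hn fun _ _ _ ↦ h0 _).trans ?_
  have key : ∑ j ∈ Finset.Icc (-(n : ℤ)) n, f j =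
      f 0 + 2 * ∑ m ∈ Finset.range n, f ((m : ℤ) + 1) := by
    clear hn
    induction n with
    | zero => simp
    | succ n ih =>
      have e : Finset.Icc (-((n + 1 : ℕ) : ℤ)) ((n + 1 : ℕ) : ℤ) =
          insert (-((n + 1 : ℕ) : ℤ)) (insert ((n + 1 : ℕ) : ℤ) (Finset.Icc (-(n : ℤ)) n)) := by
        ext a; simp only [Finset.mem_Icc, Finset.mem_insert]; push_cast; omega
      rw [e, Finset.sum_insert (by simp only [Finset.mem_insert, Finset.mem_Icc]; push_cast; omega),
        Finset.sum_insert (by simp only [Finset.mem_Icc]; push_cast; omega), ih, hf,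
        Finset.sum_range_succ]
      push_cast
      ring
  rw [key]
  linarith [hB n]

section KernelSums

variable {lam mu Δ : ℝ}

lemma sum_geometric_le {q : ℝ} (hq0 : 0 ≤ q) (hq1 : q < 1) (n : ℕ) :
    ∑ m ∈ Finset.range n, q ^ m ≤ 1 / (1 - q) := by
  rw [one_div, ← tsum_geometric_of_lt_one hq0 hq1]
  exact (summable_geometric_of_lt_one hq0 hq1).sum_le_tsum _ fun _ _ ↦ pow_nonneg hq0 _

lemma sum_abs_timeKernel_le (hl : 0 < lam) (hΔ : 0 < Δ) (s : Finset ℤ) :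
    ∑ J ∈ s, |timeKernel lam Δ J| ≤ 4 * expAvg lam Δ := by
  have ha := expAvg_nonneg hl hΔ.le
  have hq1 : Real.exp (-(lam * Δ)) < 1 := Real.exp_lt_one_iff.2 (by
    have : 0 < lam * Δ := by positivity
    linarith)
  have h := sum_int_even_le (f := fun J ↦ |timeKernel lam Δ J|) (fun _ ↦ abs_nonneg _)
    (fun J ↦ by rw [timeKernel_neg]) (B := expAvg lam Δ) (fun n ↦ ?_) s
  · rw [timeKernel_zero, abs_of_nonneg (by linarith)] at h
    linarith
  · set q := Real.exp (-(lam * Δ)) with hq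
    have h1 : ∀ m : ℕ, |timeKernel lam Δ ((m : ℤ) + 1)| = expAvg lam Δ * (1 - q) * q ^ m := by
      intro m
      have : 0 ≤ expAvg lam Δ * ((1 - q) * q ^ m) :=
        mul_nonneg ha (mul_nonneg (by linarith) (by positivity))
      rw [timeKernel_succ, abs_neg, abs_of_nonneg this]
      ring
    simp only [h1]
    rw [← Finset.mul_sum]
    calc _ ≤ expAvg lam Δ * (1 - q) * (1 / (1 - q)) := by
          refine mul_le_mul_of_nonneg_left (sum_geometric_le (by positivity) hq1 n)
            (mul_nonneg ha (by linarith))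
      _ = _ := by
        have : 1 - q ≠ 0 := by linarith
        field_simp

/-- The difference of two geometric kernels splits into the change of amplitude, the change of `1 -
q`, and the change of the ratio. Each sums geometrically, and `(q - p) / (1 - q) ≤ (μ - λ) / λ`
keeps the result proportional to the relative gap, uniformly in `Δ`. -/
lemma sum_abs_timeKernel_sub_le_of_le (hl : 0 < lam) (hlm : lam ≤ mu) (hΔ : 0 < Δ) (s : Finset ℤ) :
    ∑ J ∈ s, |timeKernel lam Δ J - timeKernel mu Δ J| ≤
      8 * (expAvg lam Δ * ((mu - lam) / lam)) := by
  have hm : 0 < mu := hl.trans_le hlm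
  have ha := expAvg_nonneg hl hΔ.le
  have hb := expAvg_nonneg hm hΔ.le
  have hab := expAvg_anti hl hlm hΔ
  set a := expAvg lam Δ
  set b := expAvg mu Δ
  set q := Real.exp (-(lam * Δ)) with hq
  set p := Real.exp (-(mu * Δ)) with hp
  have hq0 : 0 < q := Real.exp_pos _
  have hp0 : 0 < p := Real.exp_pos _
  have hq1 : q < 1 := Real.exp_lt_one_iff.2 (by
    have : 0 < lam * Δ := by positivity
    linarith)
  have hpq : p ≤ q := by rw [hp, hq]; gcongr
  have hp1 : p < 1 := hpq.trans_lt hq1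
  have hqp : (q - p) / (1 - q) ≤ (mu - lam) / lam := by
    have h1 : q - p ≤ q * (Δ * (mu - lam)) := by
      have e : p = q * Real.exp (-(Δ * (mu - lam))) := by
        rw [hp, hq, ← Real.exp_add]; congr 1; ring
      have := Real.add_one_le_exp (-(Δ * (mu - lam)))
      nlinarith
    have h2 : q * (lam * Δ) ≤ 1 - q := by
      have h3 : q * Real.exp (lam * Δ) = 1 := by rw [hq, ← Real.exp_add]; simp
      have := mul_le_mul_of_nonneg_left (Real.add_one_le_exp (lam * Δ)) hq0.le
      rw [h3] at this
      linarith
    rw [div_le_div_iff₀ (by linarith) hl]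
    nlinarith [mul_le_mul_of_nonneg_left h2 (sub_nonneg.2 hlm)]
  have h1 : ∀ m : ℕ, |timeKernel lam Δ ((m : ℤ) + 1) - timeKernel mu Δ ((m : ℤ) + 1)| ≤
      ((a - b) * (1 - q) + b * (q - p)) * q ^ m + b * (1 - p) * (q ^ m - p ^ m) := by
    intro m
    have hpm : p ^ m ≤ q ^ m := pow_le_pow_left₀ hp0.le hpq m
    have hqm : 0 ≤ q ^ m := by positivity
    rw [timeKernel_succ, timeKernel_succ]
    have e : -(a * ((1 - q) * q ^ m)) - -(b * ((1 - p) * p ^ m)) =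
        -((a - b) * (1 - q) * q ^ m) + b * (q - p) * q ^ m - b * (1 - p) * (q ^ m - p ^ m) := by ring
    rw [e]
    have t1 : 0 ≤ (a - b) * (1 - q) * q ^ m :=
      mul_nonneg (mul_nonneg (by linarith) (by linarith)) hqm
    have t2 : 0 ≤ b * (q - p) * q ^ m := mul_nonneg (mul_nonneg hb (by linarith)) hqm
    have t3 : 0 ≤ b * (1 - p) * (q ^ m - p ^ m) :=
      mul_nonneg (mul_nonneg hb (by linarith)) (by linarith)
    rw [abs_le]
    constructor <;> nlinarith
  have h2 : ∀ n, ∑ m ∈ Finset.range n, |timeKernel lam Δ ((m : ℤ) + 1)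
      - timeKernel mu Δ ((m : ℤ) + 1)| ≤ (a - b) + 2 * (b * ((mu - lam) / lam)) := by
    intro n
    have hs1 := sum_geometric_le hq0.le hq1 n
    have hs2 : ∑ m ∈ Finset.range n, (q ^ m - p ^ m) ≤ 1 / (1 - q) - 1 / (1 - p) := by
      have sq := summable_geometric_of_lt_one hq0.le hq1
      have sp := summable_geometric_of_lt_one hp0.le hp1
      rw [one_div, one_div, ← tsum_geometric_of_lt_one hq0.le hq1,
        ← tsum_geometric_of_lt_one hp0.le hp1, ← sq.tsum_sub sp]
      exact (sq.sub sp).sum_le_tsum _ fun m _ ↦ sub_nonneg.2 (pow_le_pow_left₀ hp0.le hpq m)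
    have hq' : 1 - q ≠ 0 := by linarith
    have hp' : 1 - p ≠ 0 := by linarith
    calc _ ≤ ∑ m ∈ Finset.range n, (((a - b) * (1 - q) + b * (q - p)) * q ^ m
            + b * (1 - p) * (q ^ m - p ^ m)) := Finset.sum_le_sum fun m _ ↦ h1 m
      _ = ((a - b) * (1 - q) + b * (q - p)) * ∑ m ∈ Finset.range n, q ^ m
          + b * (1 - p) * ∑ m ∈ Finset.range n, (q ^ m - p ^ m) := by
          rw [Finset.sum_add_distrib, ← Finset.mul_sum, ← Finset.mul_sum]
      _ ≤ ((a - b) * (1 - q) + b * (q - p)) * (1 / (1 - q))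
          + b * (1 - p) * (1 / (1 - q) - 1 / (1 - p)) := by
          refine add_le_add (mul_le_mul_of_nonneg_left hs1 ?_) (mul_le_mul_of_nonneg_left hs2 ?_)
          · exact add_nonneg (mul_nonneg (by linarith) (by linarith)) (mul_nonneg hb (by linarith))
          · exact mul_nonneg hb (by linarith)
      _ = (a - b) + 2 * (b * ((q - p) / (1 - q))) := by field_simp; ring
      _ ≤ _ := by gcongr
  have h := sum_int_even_le (f := fun J ↦ |timeKernel lam Δ J - timeKernel mu Δ J|)
    (fun _ ↦ abs_nonneg _) (fun J ↦ by rw [timeKernel_neg, timeKernel_neg]) h2 s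
  rw [timeKernel_zero, timeKernel_zero, ← mul_sub, abs_of_nonneg (by linarith)] at h
  have h3 := expAvg_sub_le hl hlm hΔ.le
  have h4 : (mu - lam) / mu ≤ (mu - lam) / lam :=
    div_le_div_of_nonneg_left (by linarith) hl hlm
  have h5 : a * ((mu - lam) / mu) ≤ a * ((mu - lam) / lam) := by gcongr
  have h6 : b * ((mu - lam) / lam) ≤ a * ((mu - lam) / lam) := by
    have : 0 ≤ (mu - lam) / lam := div_nonneg (by linarith) hl.le
    gcongr
  linarith

/-- Comparison of two kernels whose eigenvalues are at least `ρ μ`. -/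
lemma expAvg_le_of_mul_le {ρ : ℝ} (hρ : 0 < ρ) (hρ1 : ρ ≤ 1) (hm : 0 < mu) (h : ρ * mu ≤ lam)
    (hΔ : 0 < Δ) : expAvg lam Δ ≤ expAvg mu Δ / ρ := by
  have h0 : 0 < ρ * mu := by positivity
  refine (expAvg_anti h0 h hΔ).trans ?_
  rw [le_div_iff₀ hρ]
  have := mul_expAvg_mono h0 (mul_le_of_le_one_left hm.le hρ1) hΔ.le
  have h2 : mu * (expAvg (ρ * mu) Δ * ρ) ≤ mu * expAvg mu Δ := by linarith
  exact le_of_mul_le_mul_left h2 hm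

lemma sum_abs_timeKernel_sub_le {ρ : ℝ} (hρ : 0 < ρ) (hρ1 : ρ ≤ 1) (hm : 0 < mu)
    (h : ρ * mu ≤ lam) (hΔ : 0 < Δ) (s : Finset ℤ) :
    ∑ J ∈ s, |timeKernel lam Δ J - timeKernel mu Δ J| ≤
      8 / ρ ^ 2 * (expAvg mu Δ * (|lam - mu| / mu)) := by
  have h0 : 0 < ρ * mu := by positivity
  have hl : 0 < lam := h0.trans_le h
  have hb := expAvg_nonneg hm hΔ.le
  rcases le_total lam mu with hlm | hlm
  · refine (sum_abs_timeKernel_sub_le_of_le hl hlm hΔ s).trans ?_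
    have h1 := expAvg_le_of_mul_le hρ hρ1 hm h hΔ
    rw [abs_of_nonpos (by linarith), neg_sub]
    have h2 : (mu - lam) / lam ≤ (mu - lam) / (ρ * mu) :=
      div_le_div_of_nonneg_left (by linarith) h0 h
    have h3 : 0 ≤ (mu - lam) / lam := div_nonneg (by linarith) hl.le
    calc 8 * (expAvg lam Δ * ((mu - lam) / lam))
        ≤ 8 * (expAvg mu Δ / ρ * ((mu - lam) / (ρ * mu))) := by gcongr
      _ = _ := by field_simp
  · simp_rw [abs_sub_comm (timeKernel lam Δ _)]
    refine (sum_abs_timeKernel_sub_le_of_le hm hlm hΔ s).trans ?_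
    rw [abs_of_nonneg (by linarith)]
    have h3 : 0 ≤ (lam - mu) / mu := div_nonneg (by linarith) hm.le
    have h4 : (8 : ℝ) ≤ 8 / ρ ^ 2 := by
      rw [le_div_iff₀ (by positivity)]
      nlinarith
    gcongr

lemma abs_expAvg_sub_le {ρ : ℝ} (hρ : 0 < ρ) (hρ1 : ρ ≤ 1) (hm : 0 < mu)
    (h : ρ * mu ≤ lam) (hΔ : 0 < Δ) :
    |expAvg lam Δ - expAvg mu Δ| ≤ expAvg mu Δ / ρ * (Δ * |lam - mu|) := by
  have h0 : 0 < ρ * mu := by positivity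
  have hl : 0 < lam := h0.trans_le h
  have hb := expAvg_nonneg hm hΔ.le
  rcases le_total lam mu with hlm | hlm
  · rw [abs_of_nonneg (sub_nonneg.2 (expAvg_anti hl hlm hΔ)), abs_of_nonpos (by linarith), neg_sub]
    refine (expAvg_sub_le' hl hlm hΔ).trans ?_
    have := expAvg_le_of_mul_le hρ hρ1 hm h hΔ
    have h3 : 0 ≤ mu - lam := by linarith
    gcongr
  · rw [abs_of_nonpos (sub_nonpos.2 (expAvg_anti hm hlm hΔ)), neg_sub, abs_of_nonneg (by linarith)]
    refine (expAvg_sub_le' hm hlm hΔ).trans ?_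
    have h3 : 0 ≤ lam - mu := by linarith
    have h4 : expAvg mu Δ ≤ expAvg mu Δ / ρ := le_div_self hb hρ hρ1
    gcongr

end KernelSums

/-! ### Size of `F(0, Δ)` -/

/-- The degenerate stencil with `δ = 0`, `p = q = 0` and `r = 1` reduces this to the general
estimate, started at time zero where the smooth part vanishes. -/
lemma abs_smoothPart_le {ϑ T t z : ℝ} (hϑ : 0 < ϑ) (ht : 0 ≤ t) (htT : t ≤ T) (hz : |z| ≤ 1) :
    |smoothPart ϑ t z| ≤ farConst ϑ T 1 * t := by
  have h := abs_stencil_smoothPart_sub_le (p := 0) (q := 0) (r := 1) (δ := 0) (z := z) (c := 1) hϑ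
    one_pos le_rfl (by linarith) le_rfl ht htT
  have e : smoothPart ϑ 0 z = 0 := by simp [smoothPart, F_zero_right, heatInt_zero_left]
  simpa [stencil, e] using h

lemma F_zero_le {ϑ T t : ℝ} (hϑ : 0 < ϑ) (ht : 0 ≤ t) (htT : t ≤ T) :
    F ϑ 0 t ≤ (2 / ϑ * √ϑ + farConst ϑ T 1 * √T) * √t := by
  have h1 := (abs_le.1 (abs_smoothPart_le (z := 0) hϑ ht htT (by simp))).2
  rw [smoothPart, abs_zero] at h1
  have h2 := heatInt_le (t := ϑ * t) (le_refl (0 : ℝ))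
  rw [Real.sqrt_mul hϑ.le] at h2
  have h3 : t ≤ √T * √t := by
    calc t = √t * √t := (Real.mul_self_sqrt ht).symm
      _ ≤ √T * √t := by gcongr
  have h4 : 0 ≤ farConst ϑ T 1 := by
    rw [farConst]
    have : 0 ≤ ∑' n : ℤ, (1 / (|(n : ℝ)| + 1)) ^ 2 := tsum_nonneg fun _ ↦ sq_nonneg _
    positivity
  have h5 := mul_le_mul_of_nonneg_left h3 h4
  have h6 : 2 / ϑ * heatInt (ϑ * t) 0 ≤ 2 / ϑ * (√ϑ * √t) := by gcongr
  nlinarith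

end TimeKernel

/-! ### Decomposition of the covariance of the double increments -/

section Decomposition

open SPDE

/-- `π² ϑ ℓ²` with `ℓ = n + 1`. -/
noncomputable def baseEigen (ϑ : ℝ) (n : ℕ) : ℝ := Real.pi ^ 2 * ϑ * ((n : ℝ) + 1) ^ 2

/-- `cos(π ℓ z)` with `ℓ = n + 1`. -/
noncomputable def cosMode (n : ℕ) (z : ℝ) : ℝ := Real.cos (Real.pi * ((n : ℝ) + 1) * z)

/-- `exp(-κ δ / 2)`. -/
noncomputable def decay (ϑ₂ ϑ₁ b : ℝ) (M : ℕ) : ℝ :=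
  Real.exp (-(kappa ϑ₂ ϑ₁ * meshSpace b M / 2))

/-- The second difference on the time grid of mesh `Δ` of a function extended evenly. -/
noncomputable def gridDiff (Δ : ℝ) (J : ℤ) (f : ℝ → ℝ) : ℝ :=
  f (Δ * |(J : ℝ) + 1|) + f (Δ * |(J : ℝ) - 1|) - 2 * f (Δ * |(J : ℝ)|)

lemma baseEigen_pos {ϑ : ℝ} (hϑ : 0 < ϑ) (n : ℕ) : 0 < baseEigen ϑ n := by
  have := Real.pi_pos
  rw [baseEigen]; positivity

lemma abs_cosMode_le (n : ℕ) (z : ℝ) : |cosMode n z| ≤ 1 := Real.abs_cos_le_one _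

lemma hasSum_F {ϑ t : ℝ} (hϑ : 0 < ϑ) (ht : 0 ≤ t) (z : ℝ) :
    HasSum (fun n : ℕ ↦ expAvg (baseEigen ϑ n) t * cosMode n z) (F ϑ z t) :=
  (summable_F hϑ ht z).hasSum

lemma hasSum_F_zero {ϑ t : ℝ} (hϑ : 0 < ϑ) (ht : 0 ≤ t) :
    HasSum (fun n : ℕ ↦ expAvg (baseEigen ϑ n) t) (F ϑ 0 t) := by
  simpa [cosMode] using hasSum_F hϑ ht 0

lemma F_neg (ϑ z t : ℝ) : F ϑ (-z) t = F ϑ z t := by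
  simp [F]

lemma hasSum_stencil_F {ϑ t : ℝ} (hϑ : 0 < ϑ) (ht : 0 ≤ t) (p q r δ z : ℝ) :
    HasSum (fun n : ℕ ↦ expAvg (baseEigen ϑ n) t * stencil p q r δ (cosMode n) z)
      (stencil p q r δ (fun y ↦ F ϑ y t) z) := by
  have h := hasSum_F (t := t) hϑ ht
  refine ((((((h (z + δ)).add (h (z - δ))).sub ((h z).mul_left 2)).mul_left p).add
      (((h (z + δ)).sub (h (z - δ))).mul_left q)).add ((h z).mul_left r)).congr_fun fun n ↦ ?_
  simp only [stencil]
  ring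

lemma hasSum_gridDiff_stencil_F {ϑ Δ : ℝ} (hϑ : 0 < ϑ) (hΔ : 0 ≤ Δ) (J : ℤ) (p q r δ z : ℝ) :
    HasSum (fun n : ℕ ↦ timeKernel (baseEigen ϑ n) Δ J * stencil p q r δ (cosMode n) z)
      (gridDiff Δ J fun t ↦ stencil p q r δ (fun y ↦ F ϑ y t) z) := by
  have h : ∀ x : ℝ, HasSum (fun n : ℕ ↦ expAvg (baseEigen ϑ n) (Δ * |x|)
      * stencil p q r δ (cosMode n) z) (stencil p q r δ (fun y ↦ F ϑ y (Δ * |x|)) z) :=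
    fun x ↦ hasSum_stencil_F hϑ (by positivity) p q r δ z
  refine (((h (J + 1)).add (h (J - 1))).sub ((h J).mul_left 2)).congr_fun fun n ↦ ?_
  simp only [timeKernel]
  ring

/-- A second difference is a sum of two first differences, and `| |J ± 1| - |J| | ≤ 1`; only a
Lipschitz bound in time is needed. -/
lemma abs_gridDiff_le {f : ℝ → ℝ} {B T Δ : ℝ} (hΔ : 0 ≤ Δ)
    (hf : ∀ t₁ t₂, 0 ≤ t₁ → t₁ ≤ t₂ → t₂ ≤ T → |f t₂ - f t₁| ≤ B * (t₂ - t₁)) (hB : 0 ≤ B) {J : ℤ}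
    (hJ : Δ * (|(J : ℝ)| + 1) ≤ T) : |gridDiff Δ J f| ≤ 2 * B * Δ := by
  have key : ∀ x : ℝ, |x| ≤ |(J : ℝ)| + 1 → |(J : ℝ)| ≤ |x| + 1 →
      |f (Δ * |x|) - f (Δ * |(J : ℝ)|)| ≤ B * Δ := by
    intro x h1 h2
    have hx : Δ * |x| ≤ T := le_trans (by gcongr) hJ
    have hj : Δ * |(J : ℝ)| ≤ T := le_trans (by gcongr; linarith) hJ
    rcases le_total |x| |(J : ℝ)| with h | h
    · rw [abs_sub_comm]
      refine (hf _ _ (by positivity) (by gcongr) hj).trans ?_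
      rw [← mul_sub]
      gcongr
      exact mul_le_of_le_one_right hΔ (by linarith)
    · refine (hf _ _ (by positivity) (by gcongr) hx).trans ?_
      rw [← mul_sub]
      gcongr
      exact mul_le_of_le_one_right hΔ (by linarith)
  have k1 := key (J + 1) (by simpa using abs_add_le (J : ℝ) 1) (by
    have := abs_sub_abs_le_abs_sub (J : ℝ) (-1); simp at this; linarith)
  have k2 := key (J - 1) (by simpa using abs_sub (J : ℝ) 1) (by
    have := abs_sub_abs_le_abs_sub (J : ℝ) 1; simp at this; linarith)
  have e : gridDiff Δ J f = (f (Δ * |(J : ℝ) + 1|) - f (Δ * |(J : ℝ)|))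
      + (f (Δ * |(J : ℝ) - 1|) - f (Δ * |(J : ℝ)|)) := by rw [gridDiff]; ring
  rw [e]
  exact (abs_add_le _ _).trans (by linarith)

section Modes

variable {ϑ₂ ϑ₁ b : ℝ} {M : ℕ}

/-- The formula `2 sin u sin v = cos(u - v) - cos(u + v)` separates the translation-invariant part,
a stencil at `y_k - y_l`, from the boundary part, a stencil at `y_k + y_l + δ`. -/
lemma spaceMode_mul_spaceMode (n k l : ℕ) :
    spaceMode ϑ₂ ϑ₁ b M n k * spaceMode ϑ₂ ϑ₁ b M n l =
      stencil (-decay ϑ₂ ϑ₁ b M) 0 ((1 - decay ϑ₂ ϑ₁ b M) ^ 2) (meshSpace b M) (cosMode n)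
        (gridSpace b M k - gridSpace b M l) -
      stencil ((1 + decay ϑ₂ ϑ₁ b M ^ 2) / 2) ((decay ϑ₂ ϑ₁ b M ^ 2 - 1) / 2)
        ((1 - decay ϑ₂ ϑ₁ b M) ^ 2) (meshSpace b M) (cosMode n)
        (gridSpace b M k + gridSpace b M l + meshSpace b M) := by
  have e1 : ∀ k, gridSpace b M (k + 1) = gridSpace b M k + meshSpace b M := fun k ↦ by
    simp only [gridSpace]; push_cast; ring
  rw [spaceMode_eq, spaceMode_eq, e1, e1]
  change √2 * (decay ϑ₂ ϑ₁ b M * _ - _) * (√2 * (decay ϑ₂ ϑ₁ b M * _ - _)) = _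
  set ε := decay ϑ₂ ϑ₁ b M
  set δ := meshSpace b M
  set y := gridSpace b M k
  set z := gridSpace b M l
  set c : ℝ := Real.pi * ((n : ℝ) + 1) with hc
  have h : ∀ u v : ℝ, 2 * Real.sin (c * u) * Real.sin (c * v) =
      cosMode n (u - v) - cosMode n (u + v) := fun u v ↦ by
    rw [cosMode, cosMode, ← hc, mul_sub, mul_add, Real.cos_sub, Real.cos_add]; ring
  have h2 : √(2 : ℝ) * √2 = 2 := Real.mul_self_sqrt (by norm_num)
  have a1 := h (y + δ) (z + δ)
  have a2 := h (y + δ) z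
  have a3 := h y (z + δ)
  have a4 := h y z
  rw [show y + δ - (z + δ) = y - z by ring, show y + δ + (z + δ) = y + z + δ + δ by ring] at a1
  rw [show y + δ - z = y - z + δ by ring, show y + δ + z = y + z + δ by ring] at a2
  rw [show y - (z + δ) = y - z - δ by ring, show y + (z + δ) = y + z + δ by ring] at a3
  simp only [stencil]
  rw [show y + z + δ - δ = y + z by ring]
  linear_combination ε ^ 2 * a1 - ε * a2 - ε * a3 + a4 +
    (ε * Real.sin (c * (y + δ)) - Real.sin (c * y)) *
      (ε * Real.sin (c * (z + δ)) - Real.sin (c * z)) * h2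

lemma abs_one_sub_exp_neg_le {x a : ℝ} (hx : |x| ≤ a) :
    |1 - Real.exp (-x)| ≤ |x| * Real.exp a := by
  have h1 : |Real.exp (-x) - 1| ≤ |-x| * Real.exp |-x| := by
    rcases le_total 0 (-x) with h | h
    · have h2 := Real.add_one_le_exp (-x)
      rw [abs_of_nonneg h, abs_of_nonneg (by linarith)]
      have h3 := Real.add_one_le_exp x
      have h4 : Real.exp x * Real.exp (-x) = 1 := by rw [← Real.exp_add]; simp
      nlinarith [Real.exp_pos (-x)]
    · have h2 := Real.add_one_le_exp (-x)
      have h3 : Real.exp (-x) ≤ 1 := Real.exp_le_one_iff.2 h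
      rw [abs_of_nonpos h, abs_of_nonpos (by linarith), neg_neg]
      have : 1 ≤ Real.exp x := Real.one_le_exp (by linarith)
      nlinarith
  rw [abs_sub_comm]
  refine h1.trans ?_
  rw [abs_neg]
  gcongr

lemma meshSpace_nonneg (hb2 : b < 1 / 2) : 0 ≤ meshSpace b M :=
  div_nonneg (by linarith) (Nat.cast_nonneg _)

lemma meshSpace_le (hb2 : b < 1 / 2) (hM : 0 < M) : meshSpace b M ≤ 1 - 2 * b :=
  div_le_self (by linarith) (by exact_mod_cast hM)

lemma abs_one_sub_decay_le (hb : 0 < b) (hb2 : b < 1 / 2) (hM : 0 < M) :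
    |1 - decay ϑ₂ ϑ₁ b M| ≤
      |kappa ϑ₂ ϑ₁| * Real.exp |kappa ϑ₂ ϑ₁| * meshSpace b M := by
  have h0 := meshSpace_nonneg (M := M) hb2
  have h1 := meshSpace_le hb2 hM
  have h2 : |kappa ϑ₂ ϑ₁ * meshSpace b M / 2| ≤ |kappa ϑ₂ ϑ₁| * meshSpace b M := by
    rw [abs_div, abs_mul, abs_of_nonneg h0, abs_two]
    exact half_le_self (by positivity)
  have h3 : |kappa ϑ₂ ϑ₁| * meshSpace b M ≤ |kappa ϑ₂ ϑ₁| :=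
    mul_le_of_le_one_right (abs_nonneg _) (by linarith)
  refine (abs_one_sub_exp_neg_le (h2.trans h3)).trans ?_
  calc _ ≤ |kappa ϑ₂ ϑ₁| * meshSpace b M * Real.exp |kappa ϑ₂ ϑ₁| := by gcongr
    _ = _ := by ring

lemma decay_le (hb : 0 < b) (hb2 : b < 1 / 2) (hM : 0 < M) :
    decay ϑ₂ ϑ₁ b M ≤ Real.exp |kappa ϑ₂ ϑ₁| := by
  have h0 := meshSpace_nonneg (M := M) hb2
  have h1 := meshSpace_le hb2 hM
  refine Real.exp_le_exp.2 ((neg_le_abs _).trans ?_)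
  rw [abs_div, abs_mul, abs_of_nonneg h0, abs_two]
  have h3 : |kappa ϑ₂ ϑ₁| * meshSpace b M ≤ |kappa ϑ₂ ϑ₁| :=
    mul_le_of_le_one_right (abs_nonneg _) (by linarith)
  have : 0 ≤ |kappa ϑ₂ ϑ₁| * meshSpace b M := by positivity
  linarith

/-- The constant in the linear bounds for the spatial modes. -/
noncomputable def modeConst (ϑ₂ ϑ₁ : ℝ) : ℝ :=
  √2 * (|kappa ϑ₂ ϑ₁| * Real.exp |kappa ϑ₂ ϑ₁| + Real.pi + Real.exp |kappa ϑ₂ ϑ₁| + 1)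

lemma modeConst_pos : 0 < modeConst ϑ₂ ϑ₁ := by
  have := Real.pi_pos
  rw [modeConst]; positivity

/-- The factor `δ` is bought with a factor `ℓ`, through the Lipschitz bound for the sine.
`abs_spaceMode_le_const` is the alternative without growth in `ℓ`, used when `δ` is large compared
with `√Δ`. -/
lemma abs_spaceMode_le_mul (hb : 0 < b) (hb2 : b < 1 / 2) (hM : 0 < M) (n k : ℕ) :
    |spaceMode ϑ₂ ϑ₁ b M n k| ≤ modeConst ϑ₂ ϑ₁ * (((n : ℝ) + 1) * meshSpace b M) := by
  have h0 := meshSpace_nonneg (M := M) hb2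
  have hp := Real.pi_pos
  have e1 : gridSpace b M (k + 1) = gridSpace b M k + meshSpace b M := by
    simp only [gridSpace]; push_cast; ring
  have hε := abs_one_sub_decay_le (ϑ₂ := ϑ₂) (ϑ₁ := ϑ₁) hb hb2 hM
  set c : ℝ := Real.pi * ((n : ℝ) + 1) with hc
  have hc0 : 0 < c := by positivity
  rw [spaceMode_eq, ← hc, abs_mul, abs_of_nonneg (Real.sqrt_nonneg _), modeConst, mul_assoc √2]
  change √2 * |decay ϑ₂ ϑ₁ b M * _ - _| ≤ _
  refine mul_le_mul_of_nonneg_left ?_ (Real.sqrt_nonneg _)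
  set ε := decay ϑ₂ ϑ₁ b M
  set δ := meshSpace b M
  set S := Real.sin (c * gridSpace b M k)
  set S' := Real.sin (c * gridSpace b M (k + 1))
  have h1 : |S' - S| ≤ c * δ := by
    refine (Real.abs_sin_sub_sin_le _ _).trans (le_of_eq ?_)
    rw [← mul_sub, e1, add_sub_cancel_left, abs_of_nonneg (by positivity)]
  have h3 : ε * S' - S = -((1 - ε) * S') + (S' - S) := by ring
  rw [h3]
  refine (abs_add_le _ _).trans ?_
  rw [abs_neg, abs_mul]
  have h4 : |1 - ε| * |S'| ≤ |kappa ϑ₂ ϑ₁| * Real.exp |kappa ϑ₂ ϑ₁| * δ :=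
    (mul_le_of_le_one_right (abs_nonneg _) (Real.abs_sin_le_one _)).trans hε
  have h5 : (1 : ℝ) ≤ (n : ℝ) + 1 := by linarith [(Nat.cast_nonneg n : (0 : ℝ) ≤ n)]
  have h6 : δ ≤ ((n : ℝ) + 1) * δ := le_mul_of_one_le_left h0 h5
  have h7 : |kappa ϑ₂ ϑ₁| * Real.exp |kappa ϑ₂ ϑ₁| * δ ≤
      |kappa ϑ₂ ϑ₁| * Real.exp |kappa ϑ₂ ϑ₁| * (((n : ℝ) + 1) * δ) := by gcongr
  have h8 : 0 ≤ (Real.exp |kappa ϑ₂ ϑ₁| + 1) * (((n : ℝ) + 1) * δ) := by positivity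
  have h9 : c * δ = Real.pi * (((n : ℝ) + 1) * δ) := by rw [hc]; ring
  linarith

lemma abs_spaceMode_le_const (hb : 0 < b) (hb2 : b < 1 / 2) (hM : 0 < M) (n k : ℕ) :
    |spaceMode ϑ₂ ϑ₁ b M n k| ≤ modeConst ϑ₂ ϑ₁ := by
  refine (abs_spaceMode_le b M n k).trans ?_
  have h := decay_le (ϑ₂ := ϑ₂) (ϑ₁ := ϑ₁) hb hb2 hM
  have hp := Real.pi_pos
  rw [modeConst]
  have : 0 ≤ |kappa ϑ₂ ϑ₁| * Real.exp |kappa ϑ₂ ϑ₁| := by positivity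
  rw [decay] at h
  gcongr
  linarith

end Modes

lemma heatInt_scale {a : ℝ} (ha : 0 < a) (t x : ℝ) :
    heatInt (a * t) x = √a * heatInt t (x / √a) := by
  rw [heatInt, heatInt, Real.sqrt_mul ha.le, ← div_div, mul_assoc]

/-- Brownian scaling `heatInt (a t) x = √a heatInt t (x / √a)` with `a = ϑ Δ` maps the grid to
integer times and to space mesh `h = δ / √(ϑ Δ)`, where the differences are those defining `Λ`. -/
lemma gridDiff_stencil_heatInt {ϑ Δ δ : ℝ} (hϑ : 0 < ϑ) (hΔ : 0 < Δ) (hδ : 0 ≤ δ) (ε : ℝ)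
    (J L : ℤ) :
    gridDiff Δ J (fun t ↦ stencil (-ε) 0 0 δ (fun y ↦ 2 / ϑ * heatInt (ϑ * t) |y|) (L * δ)) =
      -(2 * (ε * √(ϑ * Δ) / ϑ) * Lam (δ / √(ϑ * Δ)) J L) := by
  have hs : 0 < √(ϑ * Δ) := by positivity
  have key : ∀ x y : ℝ, heatInt (ϑ * (Δ * |x|)) |y * δ| =
      √(ϑ * Δ) * heatInt |x| (δ / √(ϑ * Δ) * |y|) := by
    intro x y
    rw [← mul_assoc, heatInt_scale (by positivity), abs_mul, abs_of_nonneg hδ]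
    congr 2
    ring
  simp only [gridDiff, stencil, Lam_eq_timeDiff, timeDiff]
  rw [show (L : ℝ) * δ + δ = (L + 1) * δ by ring, show (L : ℝ) * δ - δ = (L - 1) * δ by ring]
  simp only [key]
  ring

end Decomposition

/-! ### Approximation of the covariance by `Λ` -/

section CovarianceApproximation

open SPDE

variable {σ ϑ₂ ϑ₁ ϑ₀ b T : ℝ} {M N : ℕ}

lemma eigenvalue_sub_baseEigen (n : ℕ) :
    eigenvalue ϑ₂ ϑ₁ ϑ₀ (n + 1) - baseEigen ϑ₂ n = ϑ₂ * Gam ϑ₂ ϑ₁ ϑ₀ := by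
  rw [eigenvalue, baseEigen]; push_cast; ring

lemma exists_mul_baseEigen_le (h : Admissible σ ϑ₂ ϑ₁ ϑ₀) :
    ∃ ρ : ℝ, 0 < ρ ∧ ρ ≤ 1 ∧ ∀ n, ρ * baseEigen ϑ₂ n ≤ eigenvalue ϑ₂ ϑ₁ ϑ₀ (n + 1) := by
  obtain ⟨c, hc, hle⟩ := exists_le_eigenvalue h
  have hp := Real.pi_pos
  have h2 := h.2.1
  refine ⟨min 1 (c / (Real.pi ^ 2 * ϑ₂)), lt_min one_pos (by positivity), min_le_left _ _,
    fun n ↦ le_trans ?_ (hle n)⟩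
  calc min 1 (c / (Real.pi ^ 2 * ϑ₂)) * baseEigen ϑ₂ n
      ≤ c / (Real.pi ^ 2 * ϑ₂) * baseEigen ϑ₂ n := by
        have := baseEigen_pos h2 n
        gcongr
        exact min_le_right _ _
    _ = _ := by rw [baseEigen]; field_simp

/-- The two `F` stencils reproduce the covariance exactly if every `λ_ℓ` is replaced by `π² ϑ₂ ℓ²`;
the series on the left is the only error of that replacement. -/
lemma incrementCov_eq (hadm : Admissible σ ϑ₂ ϑ₁ ϑ₀) (hT : 0 ≤ T) (i k j l : ℕ) :
    HasSum (fun n ↦ (timeKernel (eigenvalue ϑ₂ ϑ₁ ϑ₀ (n + 1)) (meshTime T N) ((i : ℤ) - j)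
        - timeKernel (baseEigen ϑ₂ n) (meshTime T N) ((i : ℤ) - j)) *
        (spaceMode ϑ₂ ϑ₁ b M n k * spaceMode ϑ₂ ϑ₁ b M n l))
      (2 / σ ^ 2 * incrementCov σ ϑ₂ ϑ₁ ϑ₀ b T M N i k j l -
        (gridDiff (meshTime T N) ((i : ℤ) - j) (fun t ↦ stencil (-decay ϑ₂ ϑ₁ b M) 0
          ((1 - decay ϑ₂ ϑ₁ b M) ^ 2) (meshSpace b M) (fun y ↦ F ϑ₂ y t)
          (((k : ℤ) - l : ℤ) * meshSpace b M)) -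
        gridDiff (meshTime T N) ((i : ℤ) - j) (fun t ↦ stencil ((1 + decay ϑ₂ ϑ₁ b M ^ 2) / 2)
          ((decay ϑ₂ ϑ₁ b M ^ 2 - 1) / 2) ((1 - decay ϑ₂ ϑ₁ b M) ^ 2) (meshSpace b M)
          (fun y ↦ F ϑ₂ y t) (gridSpace b M k + gridSpace b M l + meshSpace b M)))) := by
  have hσ := hadm.1
  have hϑ := hadm.2.1
  have hΔ : 0 ≤ meshTime T N := div_nonneg hT (Nat.cast_nonneg _)
  have h1 := ((summable_incrementCov hadm b hT M N ((i : ℝ) - j) k l).hasSum).mul_left (2 / σ ^ 2)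
  have h2 := hasSum_gridDiff_stencil_F hϑ hΔ ((i : ℤ) - j) (-decay ϑ₂ ϑ₁ b M) 0
    ((1 - decay ϑ₂ ϑ₁ b M) ^ 2) (meshSpace b M) (((k : ℤ) - l : ℤ) * meshSpace b M)
  have h3 := hasSum_gridDiff_stencil_F hϑ hΔ ((i : ℤ) - j) ((1 + decay ϑ₂ ϑ₁ b M ^ 2) / 2)
          ((decay ϑ₂ ϑ₁ b M ^ 2 - 1) / 2) ((1 - decay ϑ₂ ϑ₁ b M) ^ 2) (meshSpace b M)
          (gridSpace b M k + gridSpace b M l + meshSpace b M)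
  refine (h1.sub (h2.sub h3)).congr_fun fun n ↦ ?_
  have hl := eigenvalue_pos hadm n
  have e1 := neg_secondDiff_modeCov (σ := σ) hl.ne' (meshTime T N) ((i : ℤ) - j)
  push_cast at e1
  have e2 : ((((k : ℤ) - l : ℤ) : ℝ) * meshSpace b M) = gridSpace b M k - gridSpace b M l := by
    simp only [gridSpace]; push_cast; ring
  rw [e1, e2, ← mul_sub, ← spaceMode_mul_spaceMode]
  have : σ ≠ 0 := by rintro rfl; simp at hσ
  field_simp

/-- The bound for the part of the covariance that is summable in the time lag. -/
noncomputable def rowRemainder (ϑ₂ ϑ₁ ϑ₀ δ Δ ε : ℝ) (J : ℤ) : ℝ :=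
  ∑' n : ℕ, |timeKernel (eigenvalue ϑ₂ ϑ₁ ϑ₀ (n + 1)) Δ J - timeKernel (baseEigen ϑ₂ n) Δ J| *
      (modeConst ϑ₂ ϑ₁ * (((n : ℝ) + 1) * δ)) ^ 2
    + (1 - ε) ^ 2 * ∑' n : ℕ, |timeKernel (baseEigen ϑ₂ n) Δ J|

lemma rowRemainder_nonneg (ϑ₂ ϑ₁ ϑ₀ δ Δ ε : ℝ) (J : ℤ) :
    0 ≤ rowRemainder ϑ₂ ϑ₁ ϑ₀ δ Δ ε J :=
  add_nonneg (tsum_nonneg fun _ ↦ by positivity)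
    (mul_nonneg (sq_nonneg _) (tsum_nonneg fun _ ↦ abs_nonneg _))

/-- The gap between the eigenvalues is the constant `ϑ₂ Γ`, so the relative gap is of order `ℓ⁻²`
and pays for the factor `ℓ²` coming from `abs_spaceMode_le_mul`. The second bound uses the absolute
gap and gains `Δ` instead. -/
lemma exists_eigenvalue_correction (hadm : Admissible σ ϑ₂ ϑ₁ ϑ₀) :
    ∃ K : ℝ, 0 ≤ K ∧ (∀ (n : ℕ) (Δ : ℝ) (s : Finset ℤ), 0 < Δ →
      ∑ J ∈ s, |timeKernel (eigenvalue ϑ₂ ϑ₁ ϑ₀ (n + 1)) Δ J - timeKernel (baseEigen ϑ₂ n) Δ J| *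
        ((n : ℝ) + 1) ^ 2 ≤ K * expAvg (baseEigen ϑ₂ n) Δ) ∧
      ∀ (n : ℕ) (Δ : ℝ), 0 < Δ →
        |expAvg (eigenvalue ϑ₂ ϑ₁ ϑ₀ (n + 1)) Δ - expAvg (baseEigen ϑ₂ n) Δ| ≤
          K * (Δ * expAvg (baseEigen ϑ₂ n) Δ) := by
  obtain ⟨ρ, hρ, hρ1, hle⟩ := exists_mul_baseEigen_le hadm
  have hϑ := hadm.2.1
  have hp := Real.pi_pos
  have hd : ∀ n, |eigenvalue ϑ₂ ϑ₁ ϑ₀ (n + 1) - baseEigen ϑ₂ n| = ϑ₂ * |Gam ϑ₂ ϑ₁ ϑ₀| := fun n ↦ by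
    rw [eigenvalue_sub_baseEigen, abs_mul, abs_of_pos hϑ]
  set K₁ := 8 / ρ ^ 2 * (|Gam ϑ₂ ϑ₁ ϑ₀| / Real.pi ^ 2)
  set K₂ := ϑ₂ * |Gam ϑ₂ ϑ₁ ϑ₀| / ρ
  have hK₁ : 0 ≤ K₁ := by positivity
  have hK₂ : 0 ≤ K₂ := by positivity
  refine ⟨K₁ + K₂, by positivity, fun n Δ s hΔ ↦ ?_, fun n Δ hΔ ↦ ?_⟩
  · have hm := baseEigen_pos hϑ n
    have ha := expAvg_nonneg hm hΔ.le
    have h1 := sum_abs_timeKernel_sub_le hρ hρ1 hm (hle n) hΔ s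
    rw [hd] at h1
    rw [← Finset.sum_mul]
    calc _ ≤ 8 / ρ ^ 2 * (expAvg (baseEigen ϑ₂ n) Δ * (ϑ₂ * |Gam ϑ₂ ϑ₁ ϑ₀| / baseEigen ϑ₂ n))
          * ((n : ℝ) + 1) ^ 2 := by gcongr
      _ = K₁ * expAvg (baseEigen ϑ₂ n) Δ := by
        have : baseEigen ϑ₂ n = Real.pi ^ 2 * ϑ₂ * ((n : ℝ) + 1) ^ 2 := rfl
        rw [show ϑ₂ * |Gam ϑ₂ ϑ₁ ϑ₀| / baseEigen ϑ₂ n =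
          |Gam ϑ₂ ϑ₁ ϑ₀| / Real.pi ^ 2 / ((n : ℝ) + 1) ^ 2 by rw [this]; field_simp]
        have : (n : ℝ) + 1 ≠ 0 := by positivity
        simp only [K₁]
        field_simp
      _ ≤ _ := by gcongr; linarith
  · have hm := baseEigen_pos hϑ n
    have ha := expAvg_nonneg hm hΔ.le
    refine (abs_expAvg_sub_le hρ hρ1 hm (hle n) hΔ).trans ?_
    rw [hd]
    calc _ = K₂ * (Δ * expAvg (baseEigen ϑ₂ n) Δ) := by simp only [K₂]; ring
      _ ≤ _ := by gcongr; linarith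

/-- Summing over the lags before summing over `ℓ` reduces everything to `∑ expAvg = F(0, Δ)`, which
is of order `√Δ`. The remainder is thus small after summation over the time lags, without any
entrywise rate in the lag. -/
lemma exists_sum_rowRemainder_le (hadm : Admissible σ ϑ₂ ϑ₁ ϑ₀) :
    ∃ K : ℝ, 0 ≤ K ∧ ∀ (δ Δ ε B : ℝ), 0 < Δ → (1 - ε) ^ 2 ≤ B * δ ^ 2 →
      (∀ J, Summable fun n : ℕ ↦ |timeKernel (eigenvalue ϑ₂ ϑ₁ ϑ₀ (n + 1)) Δ J
        - timeKernel (baseEigen ϑ₂ n) Δ J| * (modeConst ϑ₂ ϑ₁ * (((n : ℝ) + 1) * δ)) ^ 2) ∧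
      (∀ J, Summable fun n : ℕ ↦ |timeKernel (baseEigen ϑ₂ n) Δ J|) ∧
      ∀ s : Finset ℤ, ∑ J ∈ s, rowRemainder ϑ₂ ϑ₁ ϑ₀ δ Δ ε J ≤ (K + 4 * B) * δ ^ 2 * F ϑ₂ 0 Δ := by
  obtain ⟨K, hK, h1, -⟩ := exists_eigenvalue_correction hadm
  have hϑ := hadm.2.1
  set m := modeConst ϑ₂ ϑ₁
  refine ⟨m ^ 2 * K, by positivity, fun δ Δ ε B hΔ hε ↦ ?_⟩
  have hF := hasSum_F_zero (t := Δ) hϑ hΔ.le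
  have hg1 : ∀ (n : ℕ) (s : Finset ℤ), ∑ J ∈ s, |timeKernel (eigenvalue ϑ₂ ϑ₁ ϑ₀ (n + 1)) Δ J
        - timeKernel (baseEigen ϑ₂ n) Δ J| * (m * (((n : ℝ) + 1) * δ)) ^ 2 ≤
        m ^ 2 * K * δ ^ 2 * expAvg (baseEigen ϑ₂ n) Δ := by
    intro n s
    have h2 := mul_le_mul_of_nonneg_left (h1 n Δ s hΔ) (by positivity : 0 ≤ m ^ 2 * δ ^ 2)
    rw [Finset.mul_sum] at h2
    refine le_trans (le_of_eq (Finset.sum_congr rfl fun J _ ↦ by ring)) (h2.trans (le_of_eq ?_))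
    ring
  have hg2 : ∀ (n : ℕ) (s : Finset ℤ), ∑ J ∈ s, |timeKernel (baseEigen ϑ₂ n) Δ J| ≤
      4 * expAvg (baseEigen ϑ₂ n) Δ := fun n s ↦
    sum_abs_timeKernel_le (baseEigen_pos hϑ n) hΔ s
  have s1 : ∀ J, Summable fun n : ℕ ↦ |timeKernel (eigenvalue ϑ₂ ϑ₁ ϑ₀ (n + 1)) Δ J
        - timeKernel (baseEigen ϑ₂ n) Δ J| * (m * (((n : ℝ) + 1) * δ)) ^ 2 := fun J ↦
    Summable.of_nonneg_of_le (fun n ↦ by positivity)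
      (fun n ↦ by simpa using hg1 n {J}) (hF.summable.mul_left _)
  have s2 : ∀ J, Summable fun n : ℕ ↦ |timeKernel (baseEigen ϑ₂ n) Δ J| := fun J ↦
    Summable.of_nonneg_of_le (fun n ↦ abs_nonneg _)
      (fun n ↦ by simpa using hg2 n {J}) (hF.summable.mul_left _)
  refine ⟨s1, s2, fun s ↦ ?_⟩
  simp only [rowRemainder]
  rw [Finset.sum_add_distrib, ← Finset.mul_sum, ← Summable.tsum_finsetSum fun J _ ↦ s1 J,
    ← Summable.tsum_finsetSum fun J _ ↦ s2 J]
  have t1 : ∑' n : ℕ, ∑ J ∈ s, |timeKernel (eigenvalue ϑ₂ ϑ₁ ϑ₀ (n + 1)) Δ J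
        - timeKernel (baseEigen ϑ₂ n) Δ J| * (m * (((n : ℝ) + 1) * δ)) ^ 2 ≤
        m ^ 2 * K * δ ^ 2 * F ϑ₂ 0 Δ := by
    rw [← hF.tsum_eq, ← tsum_mul_left]
    exact (summable_sum fun J _ ↦ s1 J).tsum_le_tsum (fun n ↦ hg1 n s) (hF.summable.mul_left _)
  have t2 : ∑' n : ℕ, ∑ J ∈ s, |timeKernel (baseEigen ϑ₂ n) Δ J| ≤ 4 * F ϑ₂ 0 Δ := by
    rw [← hF.tsum_eq, ← tsum_mul_left]
    exact (summable_sum fun J _ ↦ s2 J).tsum_le_tsum (fun n ↦ hg2 n s) (hF.summable.mul_left _)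
  have hF0 : 0 ≤ F ϑ₂ 0 Δ := hF.nonneg fun n ↦ expAvg_nonneg (baseEigen_pos hϑ n) hΔ.le
  have t3 : (1 - ε) ^ 2 * ∑' n : ℕ, ∑ J ∈ s, |timeKernel (baseEigen ϑ₂ n) Δ J| ≤
      B * δ ^ 2 * (4 * F ϑ₂ 0 Δ) := by
    refine mul_le_mul hε t2 (tsum_nonneg fun n ↦ Finset.sum_nonneg fun _ _ ↦ abs_nonneg _)
      ((sq_nonneg _).trans hε)
  linarith

end CovarianceApproximation

/-! ### Estimates for the covariances, the variances and `Φ` -/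

section CovarianceBounds

open SPDE

variable {σ ϑ₂ ϑ₁ ϑ₀ b T : ℝ} {M N : ℕ}

/-- The amplitude `exp(-κ δ / 2) √(Δ / ϑ₂)` of the main part of the covariance. -/
noncomputable def amplitude (ϑ₂ ϑ₁ b T : ℝ) (M N : ℕ) : ℝ :=
  decay ϑ₂ ϑ₁ b M * √(ϑ₂ * meshTime T N) / ϑ₂

/-- The ratio `h = δ / √(ϑ₂ Δ)`. -/
noncomputable def meshRatio (ϑ₂ b T : ℝ) (M N : ℕ) : ℝ :=
  meshSpace b M / √(ϑ₂ * meshTime T N)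

lemma meshTime_pos (hT : 0 < T) (hN : 0 < N) : 0 < meshTime T N :=
  div_pos hT (by exact_mod_cast hN)

lemma meshTime_le (hT : 0 < T) (hN : 0 < N) : meshTime T N ≤ T :=
  div_le_self hT.le (by exact_mod_cast hN)

lemma farConst_nonneg (ϑ : ℝ) {T : ℝ} (c : ℝ) : 0 ≤ farConst ϑ T c := by
  rw [farConst]
  have : 0 ≤ ∑' n : ℤ, (1 / (|(n : ℝ)| + 1)) ^ 2 := tsum_nonneg fun _ ↦ sq_nonneg _
  have h2 : 0 ≤ (c / 2) ^ 4 := by positivity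
  positivity

lemma gridDiff_zero (Δ : ℝ) (f : ℝ → ℝ) : gridDiff Δ 0 f = 2 * f Δ - 2 * f 0 := by
  simp [gridDiff]
  ring

/-- The term with `(1 - ε)²` is kept apart because it contains `F` itself, singular part included,
which is not Lipschitz in time at zero. It is put into the row-summable remainder, where its
coefficient of order `δ²` suffices. -/
lemma gridDiff_stencil_F_eq {ϑ Δ δ : ℝ} (hϑ : 0 < ϑ) (hΔ : 0 < Δ) (hδ : 0 ≤ δ) (ε : ℝ)
    (J L : ℤ) :
    gridDiff Δ J (fun t ↦ stencil (-ε) 0 ((1 - ε) ^ 2) δ (fun y ↦ F ϑ y t) (L * δ)) =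
      -(2 * (ε * √(ϑ * Δ) / ϑ) * Lam (δ / √(ϑ * Δ)) J L)
      + gridDiff Δ J (fun t ↦ stencil (-ε) 0 0 δ (smoothPart ϑ t) (L * δ))
      + (1 - ε) ^ 2 * gridDiff Δ J (fun t ↦ F ϑ (L * δ) t) := by
  rw [← gridDiff_stencil_heatInt hϑ hΔ hδ]
  simp only [gridDiff, stencil, smoothPart]
  ring

lemma abs_gridDiff_F_le {ϑ Δ : ℝ} (hϑ : 0 < ϑ) (hΔ : 0 ≤ Δ) (J : ℤ) (z : ℝ)
    (hs : Summable fun n : ℕ ↦ |timeKernel (baseEigen ϑ n) Δ J|) :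
    |gridDiff Δ J (fun t ↦ F ϑ z t)| ≤ ∑' n : ℕ, |timeKernel (baseEigen ϑ n) Δ J| := by
  have h := hasSum_gridDiff_stencil_F hϑ hΔ J 0 0 1 0 z
  simp only [stencil, zero_mul, zero_add, one_mul] at h
  rw [← h.tsum_eq, ← Real.norm_eq_abs]
  refine tsum_of_norm_bounded hs.hasSum fun n ↦ ?_
  rw [Real.norm_eq_abs, abs_mul]
  exact mul_le_of_le_one_right (abs_nonneg _) (abs_cosMode_le n z)

/-- The constant in the bounds for the stencils. -/
noncomputable def stencilConst (ϑ₂ ϑ₁ : ℝ) : ℝ :=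
  (1 + |kappa ϑ₂ ϑ₁|) ^ 2 * (2 * Real.exp |kappa ϑ₂ ϑ₁|) ^ 2

lemma stencilConst_nonneg : 0 ≤ stencilConst ϑ₂ ϑ₁ := by rw [stencilConst]; positivity

lemma sq_one_sub_decay_le (hb : 0 < b) (hb2 : b < 1 / 2) (hM : 0 < M) :
    (1 - decay ϑ₂ ϑ₁ b M) ^ 2 ≤ stencilConst ϑ₂ ϑ₁ * meshSpace b M ^ 2 := by
  have h := abs_one_sub_decay_le (ϑ₂ := ϑ₂) (ϑ₁ := ϑ₁) hb hb2 hM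
  rw [← sq_abs (1 - _)]
  refine (pow_le_pow_left₀ (abs_nonneg _) h 2).trans ?_
  rw [mul_pow, stencilConst, mul_pow, mul_pow]
  have h2 : |kappa ϑ₂ ϑ₁| ^ 2 ≤ (1 + |kappa ϑ₂ ϑ₁|) ^ 2 := by
    gcongr; linarith
  have h3 : Real.exp |kappa ϑ₂ ϑ₁| ^ 2 ≤ 2 ^ 2 * Real.exp |kappa ϑ₂ ϑ₁| ^ 2 := by
    nlinarith [sq_nonneg (Real.exp |kappa ϑ₂ ϑ₁|)]
  gcongr

lemma abs_stencil_coeff_near_le (hb : 0 < b) (hb2 : b < 1 / 2) (hM : 0 < M) :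
    |-decay ϑ₂ ϑ₁ b M| * meshSpace b M ^ 2 + |(0 : ℝ)| * meshSpace b M + |(0 : ℝ)| ≤
      3 * stencilConst ϑ₂ ϑ₁ * meshSpace b M ^ 2 := by
  have h := decay_le (ϑ₂ := ϑ₂) (ϑ₁ := ϑ₁) hb hb2 hM
  have h0 : 0 < decay ϑ₂ ϑ₁ b M := Real.exp_pos _
  rw [abs_neg, abs_of_pos h0, abs_zero, zero_mul, add_zero, add_zero]
  have h1 : 1 ≤ Real.exp |kappa ϑ₂ ϑ₁| := Real.one_le_exp (abs_nonneg _)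
  have h2 : Real.exp |kappa ϑ₂ ϑ₁| ≤ stencilConst ϑ₂ ϑ₁ := by
    rw [stencilConst]
    have h3 : 1 ≤ (1 + |kappa ϑ₂ ϑ₁|) ^ 2 := one_le_pow₀ (by linarith [abs_nonneg (kappa ϑ₂ ϑ₁)])
    have h4 : Real.exp |kappa ϑ₂ ϑ₁| ≤ (2 * Real.exp |kappa ϑ₂ ϑ₁|) ^ 2 := by nlinarith
    calc _ ≤ 1 * (2 * Real.exp |kappa ϑ₂ ϑ₁|) ^ 2 := by rw [one_mul]; exact h4
      _ ≤ _ := by gcongr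
  have h5 := stencilConst_nonneg (ϑ₂ := ϑ₂) (ϑ₁ := ϑ₁)
  gcongr
  linarith

/-- Because `1 - ε` is of order `δ`, the coefficient of the first difference is `O(δ)` and that of
the value is `O(δ²)`. -/
lemma abs_stencil_coeff_reflected_le (hb : 0 < b) (hb2 : b < 1 / 2) (hM : 0 < M) :
    |(1 + decay ϑ₂ ϑ₁ b M ^ 2) / 2| * meshSpace b M ^ 2 +
      |(decay ϑ₂ ϑ₁ b M ^ 2 - 1) / 2| * meshSpace b M + |(1 - decay ϑ₂ ϑ₁ b M) ^ 2| ≤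
      3 * stencilConst ϑ₂ ϑ₁ * meshSpace b M ^ 2 := by
  have h := decay_le (ϑ₂ := ϑ₂) (ϑ₁ := ϑ₁) hb hb2 hM
  have hd := abs_one_sub_decay_le (ϑ₂ := ϑ₂) (ϑ₁ := ϑ₁) hb hb2 hM
  have h3 := sq_one_sub_decay_le (ϑ₂ := ϑ₂) (ϑ₁ := ϑ₁) hb hb2 hM
  have h0 : 0 < decay ϑ₂ ϑ₁ b M := Real.exp_pos _
  have hδ := meshSpace_nonneg (M := M) hb2
  have h1 : 1 ≤ Real.exp |kappa ϑ₂ ϑ₁| := Real.one_le_exp (abs_nonneg _)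
  have hk := abs_nonneg (kappa ϑ₂ ϑ₁)
  set E := Real.exp |kappa ϑ₂ ϑ₁|
  set ε := decay ϑ₂ ϑ₁ b M
  set δ := meshSpace b M
  set κ := |kappa ϑ₂ ϑ₁|
  have hS : stencilConst ϑ₂ ϑ₁ = (1 + κ) ^ 2 * (2 * E) ^ 2 := rfl
  have p1 : |(1 + ε ^ 2) / 2| ≤ stencilConst ϑ₂ ϑ₁ := by
    rw [abs_of_pos (by positivity), hS]
    have : (1 + ε ^ 2) / 2 ≤ (2 * E) ^ 2 := by nlinarith
    calc _ ≤ 1 * (2 * E) ^ 2 := by rw [one_mul]; exact this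
      _ ≤ _ := by gcongr; exact one_le_pow₀ (by linarith)
  have p2 : |(ε ^ 2 - 1) / 2| ≤ stencilConst ϑ₂ ϑ₁ * δ := by
    rw [show (ε ^ 2 - 1) / 2 = -((1 - ε) * ((1 + ε) / 2)) by ring, abs_neg, abs_mul,
      abs_of_pos (by positivity : 0 < (1 + ε) / 2)]
    calc |1 - ε| * ((1 + ε) / 2) ≤ κ * E * δ * ((E + E) / 2) := by gcongr
      _ = κ * E ^ 2 * δ := by ring
      _ ≤ stencilConst ϑ₂ ϑ₁ * δ := by
        rw [hS]
        gcongr ?_ * δ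
        nlinarith [sq_nonneg E, mul_nonneg hk (sq_nonneg E), mul_nonneg (sq_nonneg κ) (sq_nonneg E)]
  rw [abs_of_nonneg (sq_nonneg (1 - ε))]
  calc _ ≤ stencilConst ϑ₂ ϑ₁ * δ ^ 2 + stencilConst ϑ₂ ϑ₁ * δ * δ
        + stencilConst ϑ₂ ϑ₁ * δ ^ 2 := by gcongr
    _ = _ := by ring

lemma abs_gridDiff_smoothPart_le (hϑ : 0 < ϑ₂) (hb : 0 < b) (hb2 : b < 1 / 2) (hT : 0 < T)
    (hM : 0 < M) (hN : 0 < N) {J L : ℤ} (hJ : |J| < N) (hL : |L| < M) :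
    |gridDiff (meshTime T N) J (fun t ↦ stencil (-decay ϑ₂ ϑ₁ b M) 0 0 (meshSpace b M)
      (smoothPart ϑ₂ t) (L * meshSpace b M))| ≤
      2 * (farConst ϑ₂ T (2 * b) * (3 * stencilConst ϑ₂ ϑ₁ * meshSpace b M ^ 2)) * meshTime T N := by
  have hδ := meshSpace_nonneg (M := M) hb2
  have hΔ := meshTime_pos hT hN
  have hC := farConst_nonneg ϑ₂ (T := T) (2 * b)
  have hM0 : (0 : ℝ) < M := by exact_mod_cast hM
  have hN0 : (0 : ℝ) < N := by exact_mod_cast hN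
  refine abs_gridDiff_le hΔ.le (T := T) (fun t₁ t₂ h0 h12 h2 ↦ ?_)
    (mul_nonneg hC (mul_nonneg (mul_nonneg (by norm_num) stencilConst_nonneg) (sq_nonneg _))) ?_
  · refine (abs_stencil_smoothPart_sub_le hϑ (by positivity : 0 < 2 * b) hδ ?_ h0 h12 h2).trans ?_
    · have h3 : |(L : ℝ)| + 1 ≤ M := by rw [← Int.cast_abs]; exact_mod_cast hL
      rw [abs_mul, abs_of_nonneg hδ]
      have h4 : (|(L : ℝ)| + 1) * meshSpace b M ≤ M * meshSpace b M := by gcongr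
      have h5 : (M : ℝ) * meshSpace b M = 1 - 2 * b := by rw [meshSpace]; field_simp
      linarith
    · have := abs_stencil_coeff_near_le (ϑ₂ := ϑ₂) (ϑ₁ := ϑ₁) hb hb2 hM
      have h12' := sub_nonneg.2 h12
      gcongr
  · have h3 : |(J : ℝ)| + 1 ≤ N := by rw [← Int.cast_abs]; exact_mod_cast hJ
    calc meshTime T N * (|(J : ℝ)| + 1) ≤ meshTime T N * N := by gcongr
      _ = T := by rw [meshTime]; field_simp

lemma abs_gridDiff_reflected_le (hϑ : 0 < ϑ₂) (hb : 0 < b) (hb2 : b < 1 / 2) (hT : 0 < T)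
    (hM : 0 < M) (hN : 0 < N) {J : ℤ} (hJ : |J| < N) {k l : ℕ} (hk : k < M) (hl : l < M) :
    |gridDiff (meshTime T N) J (fun t ↦ stencil ((1 + decay ϑ₂ ϑ₁ b M ^ 2) / 2)
        ((decay ϑ₂ ϑ₁ b M ^ 2 - 1) / 2) ((1 - decay ϑ₂ ϑ₁ b M) ^ 2) (meshSpace b M)
        (fun y ↦ F ϑ₂ y t) (gridSpace b M k + gridSpace b M l + meshSpace b M))| ≤
      2 * (farConst ϑ₂ T (2 * b) * (3 * stencilConst ϑ₂ ϑ₁ * meshSpace b M ^ 2)) * meshTime T N := by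
  have hδ := meshSpace_nonneg (M := M) hb2
  have hΔ := meshTime_pos hT hN
  have hC := farConst_nonneg ϑ₂ (T := T) (2 * b)
  have hN0 : (0 : ℝ) < N := by exact_mod_cast hN
  refine abs_gridDiff_le hΔ.le (T := T) (fun t₁ t₂ h0 h12 h2 ↦ ?_)
    (mul_nonneg hC (mul_nonneg (mul_nonneg (by norm_num) stencilConst_nonneg) (sq_nonneg _))) ?_
  · have e1 : ∀ k, gridSpace b M (k + 1) = gridSpace b M k + meshSpace b M := fun k ↦ by
      simp only [gridSpace]; push_cast; ring
    have g1 := (gridSpace_mem hb2 hk.le).1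
    have g2 := (gridSpace_mem hb2 hl.le).1
    have g3 := (gridSpace_mem hb2 (Nat.succ_le_of_lt hk)).2
    have g4 := (gridSpace_mem hb2 (Nat.succ_le_of_lt hl)).2
    rw [Nat.succ_eq_add_one, e1] at g3 g4
    refine (abs_stencil_F_sub_le hϑ (by positivity : 0 < 2 * b) hδ (by linarith) (by linarith)
      h0 h12 h2).trans ?_
    have := abs_stencil_coeff_reflected_le (ϑ₂ := ϑ₂) (ϑ₁ := ϑ₁) hb hb2 hM
    have h12' := sub_nonneg.2 h12
    gcongr
  · have h3 : |(J : ℝ)| + 1 ≤ N := by rw [← Int.cast_abs]; exact_mod_cast hJ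
    calc meshTime T N * (|(J : ℝ)| + 1) ≤ meshTime T N * N := by gcongr
      _ = T := by rw [meshTime]; field_simp

/-- `Φ` is the direct stencil at lag zero. Hence `σ² Φ` is the variance of a rescaled increment, up
to the shift of the eigenvalues and the reflected term. -/
lemma Phi_eq (ϑ₂ ϑ₁ b : ℝ) (M : ℕ) (Δ : ℝ) :
    Phi ϑ₂ ϑ₁ (meshSpace b M) Δ = stencil (-decay ϑ₂ ϑ₁ b M) 0 ((1 - decay ϑ₂ ϑ₁ b M) ^ 2)
      (meshSpace b M) (fun y ↦ F ϑ₂ y Δ) 0 := by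
  have e : Real.exp (-(kappa ϑ₂ ϑ₁ * meshSpace b M)) = decay ϑ₂ ϑ₁ b M ^ 2 := by
    rw [decay, ← Real.exp_nat_mul]; congr 1; push_cast; ring
  rw [Phi, e]
  simp only [stencil, zero_add, zero_sub, F_neg]
  change _ - 2 * F ϑ₂ (meshSpace b M) Δ * decay ϑ₂ ϑ₁ b M = _
  ring

/-- Approximation of the covariances of the double increments, of their variances, and of `Φ`. -/
theorem exists_incrementCov_bounds (hadm : Admissible σ ϑ₂ ϑ₁ ϑ₀) (hb : 0 < b) (hb2 : b < 1 / 2)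
    (hT : 0 < T) : ∃ K : ℝ, 0 ≤ K ∧ ∀ M N : ℕ, 0 < M → 0 < N →
    (∃ ρ : ℤ → ℝ, (∀ J, 0 ≤ ρ J) ∧
      (∀ s : Finset ℤ, ∑ J ∈ s, ρ J ≤ K * (meshSpace b M ^ 2 * √(meshTime T N))) ∧
      ∀ i j k l : ℕ, i < N → j < N → k < M → l < M →
        |incrementCov σ ϑ₂ ϑ₁ ϑ₀ b T M N i k j l + σ ^ 2 * (amplitude ϑ₂ ϑ₁ b T M N *
          Lam (meshRatio ϑ₂ b T M N) ((i : ℤ) - j) ((k : ℤ) - l))| ≤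
          ρ ((i : ℤ) - j) + K * (meshSpace b M ^ 2 * meshTime T N)) ∧
    (∀ i k : ℕ, i < N → k < M →
      |incrementCov σ ϑ₂ ϑ₁ ϑ₀ b T M N i k i k -
        σ ^ 2 * Phi ϑ₂ ϑ₁ (meshSpace b M) (meshTime T N)| ≤
        K * (min (meshSpace b M ^ 2 * √(meshTime T N)) (meshTime T N * √(meshTime T N))
          + meshSpace b M ^ 2 * meshTime T N)) ∧
    |Phi ϑ₂ ϑ₁ (meshSpace b M) (meshTime T N) + amplitude ϑ₂ ϑ₁ b T M N *
      Lam (meshRatio ϑ₂ b T M N) 0 0| ≤ K * (meshSpace b M ^ 2 * √(meshTime T N)) := by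
  obtain ⟨K₁, hK₁, hrow⟩ := exists_sum_rowRemainder_le hadm
  obtain ⟨K₂, hK₂, -, hdiag⟩ := exists_eigenvalue_correction hadm
  have hσ := hadm.1
  have hϑ := hadm.2.1
  set S := stencilConst ϑ₂ ϑ₁ with hS
  have hS0 : 0 ≤ S := stencilConst_nonneg
  set C := farConst ϑ₂ T (2 * b) with hC
  have hC0 : 0 ≤ C := farConst_nonneg ϑ₂ (2 * b)
  set KF := 2 / ϑ₂ * √ϑ₂ + farConst ϑ₂ T 1 * √T with hKF
  have hKF0 : 0 ≤ KF := by
    have := farConst_nonneg ϑ₂ (T := T) 1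
    positivity
  set m := modeConst ϑ₂ ϑ₁ with hm
  have hm0 : 0 < m := modeConst_pos
  -- `A₁` comes from the row-summable remainder, `A₂` from the smooth and reflected parts, `A₃` from
  -- the variance estimate with bounded modes, and `A₄` from the approximation of `Φ`.
  set A₁ := σ ^ 2 / 2 * ((K₁ + 4 * S) * KF) with hA₁
  set A₂ := σ ^ 2 * (6 * C * S) with hA₂
  set A₃ := σ ^ 2 * (K₂ * m ^ 2 * KF) with hA₃
  set A₄ := (3 * C * S) * √T * 2 + S * KF with hA₄
  have hA₁0 : 0 ≤ A₁ := by positivity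
  have hA₂0 : 0 ≤ A₂ := by positivity
  have hA₃0 : 0 ≤ A₃ := by positivity
  have hA₄0 : 0 ≤ A₄ := by positivity
  refine ⟨A₁ + A₂ + A₃ + A₄, by positivity, fun M N hM hN ↦ ?_⟩
  have hδ := meshSpace_nonneg (M := M) hb2
  have hΔ := meshTime_pos hT hN
  have hΔT := meshTime_le hT hN
  have hε := sq_one_sub_decay_le (ϑ₂ := ϑ₂) (ϑ₁ := ϑ₁) hb hb2 hM
  have hFle := F_zero_le hϑ hΔ.le hΔT
  rw [← hKF] at hFle
  obtain ⟨s1, s2, hsum⟩ := hrow (meshSpace b M) (meshTime T N) (decay ϑ₂ ϑ₁ b M) S hΔ hε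
  have hmode := fun n k ↦ abs_spaceMode_le_mul (ϑ₂ := ϑ₂) (ϑ₁ := ϑ₁) hb hb2 hM n k
  have hmode' := fun n k ↦ abs_spaceMode_le_const (ϑ₂ := ϑ₂) (ϑ₁ := ϑ₁) hb hb2 hM n k
  rw [← hm] at hmode hmode'
  have hsum' : ∀ s : Finset ℤ, ∑ J ∈ s, σ ^ 2 / 2 * rowRemainder ϑ₂ ϑ₁ ϑ₀ (meshSpace b M)
      (meshTime T N) (decay ϑ₂ ϑ₁ b M) J ≤ A₁ * (meshSpace b M ^ 2 * √(meshTime T N)) := by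
    intro s
    rw [← Finset.mul_sum]
    calc _ ≤ σ ^ 2 / 2 * ((K₁ + 4 * S) * meshSpace b M ^ 2 * F ϑ₂ 0 (meshTime T N)) := by
          gcongr
          exact hsum s
      _ ≤ σ ^ 2 / 2 * ((K₁ + 4 * S) * meshSpace b M ^ 2 * (KF * √(meshTime T N))) := by gcongr
      _ = _ := by rw [hA₁]; ring
  set δ := meshSpace b M
  set Δ := meshTime T N
  set ε := decay ϑ₂ ϑ₁ b M
  have hσ2 : 0 < σ ^ 2 / 2 := by positivity
  have hamp : amplitude ϑ₂ ϑ₁ b T M N = ε * √(ϑ₂ * Δ) / ϑ₂ := rfl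
  have hrat : meshRatio ϑ₂ b T M N = δ / √(ϑ₂ * Δ) := rfl
  have hσ0 : σ ≠ 0 := by rintro rfl; simp at hσ
  have hΔs : Δ ≤ √T * √Δ := by
    calc Δ = √Δ * √Δ := (Real.mul_self_sqrt hΔ.le).symm
      _ ≤ √T * √Δ := by gcongr
  -- The eigenvalue shift is estimated mode by mode, with both spatial modes bounded by a multiple
  -- of `ℓ δ`.
  have hcorr : ∀ i j k l : ℕ, |2 / σ ^ 2 * incrementCov σ ϑ₂ ϑ₁ ϑ₀ b T M N i k j l -
        (gridDiff Δ ((i : ℤ) - j) (fun t ↦ stencil (-ε) 0 ((1 - ε) ^ 2) δ (fun y ↦ F ϑ₂ y t)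
          (((k : ℤ) - l : ℤ) * δ)) -
        gridDiff Δ ((i : ℤ) - j) (fun t ↦ stencil ((1 + ε ^ 2) / 2)
          ((ε ^ 2 - 1) / 2) ((1 - ε) ^ 2) δ
          (fun y ↦ F ϑ₂ y t) (gridSpace b M k + gridSpace b M l + δ)))| ≤
      ∑' n : ℕ, |timeKernel (eigenvalue ϑ₂ ϑ₁ ϑ₀ (n + 1)) Δ ((i : ℤ) - j)
        - timeKernel (baseEigen ϑ₂ n) Δ ((i : ℤ) - j)| * (m * (((n : ℝ) + 1) * δ)) ^ 2 := by
    intro i j k l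
    rw [← (incrementCov_eq hadm hT.le i k j l).tsum_eq, ← Real.norm_eq_abs]
    refine tsum_of_norm_bounded (s1 ((i : ℤ) - j)).hasSum fun n ↦ ?_
    rw [Real.norm_eq_abs, abs_mul, abs_mul, sq]
    have := hmode n k
    have := hmode n l
    gcongr
  refine ⟨⟨fun J ↦ σ ^ 2 / 2 * rowRemainder ϑ₂ ϑ₁ ϑ₀ δ Δ ε J, fun J ↦ ?_, fun s ↦ ?_, ?_⟩, ?_, ?_⟩
  · exact mul_nonneg hσ2.le (rowRemainder_nonneg _ _ _ _ _ _ _)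
  · refine (hsum' s).trans ?_
    gcongr
    linarith
  · intro i j k l hi hj hk hl
    have hJ : |(i : ℤ) - j| < N := by rw [abs_lt]; omega
    have hL : |(k : ℤ) - l| < M := by rw [abs_lt]; omega
    have c1 := hcorr i j k l
    have c2 := abs_gridDiff_smoothPart_le (ϑ₁ := ϑ₁) hϑ hb hb2 hT hM hN hJ hL
    have c3 := abs_gridDiff_reflected_le (ϑ₁ := ϑ₁) hϑ hb hb2 hT hM hN hJ hk hl
    have c4 := abs_gridDiff_F_le hϑ hΔ.le ((i : ℤ) - j) (((k : ℤ) - l : ℤ) * δ)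
      (s2 ((i : ℤ) - j))
    have c4' := mul_le_mul_of_nonneg_left c4 (sq_nonneg (1 - ε))
    rw [gridDiff_stencil_F_eq hϑ hΔ hδ] at c1
    have e : incrementCov σ ϑ₂ ϑ₁ ϑ₀ b T M N i k j l + σ ^ 2 * (amplitude ϑ₂ ϑ₁ b T M N *
          Lam (meshRatio ϑ₂ b T M N) ((i : ℤ) - j) ((k : ℤ) - l)) =
        σ ^ 2 / 2 * (2 / σ ^ 2 * incrementCov σ ϑ₂ ϑ₁ ϑ₀ b T M N i k j l +
          2 * (ε * √(ϑ₂ * Δ) / ϑ₂) * Lam (δ / √(ϑ₂ * Δ)) ((i : ℤ) - j) ((k : ℤ) - l)) := by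
      rw [hamp, hrat]
      field_simp
    rw [e, abs_mul, abs_of_pos hσ2]
    set cov := incrementCov σ ϑ₂ ϑ₁ ϑ₀ b T M N i k j l
    set lamTerm := 2 * (ε * √(ϑ₂ * Δ) / ϑ₂) * Lam (δ / √(ϑ₂ * Δ)) ((i : ℤ) - j) ((k : ℤ) - l)
    have hfin : |2 / σ ^ 2 * cov + lamTerm| ≤ rowRemainder ϑ₂ ϑ₁ ϑ₀ δ Δ ε ((i : ℤ) - j)
        + 4 * (C * (3 * S * δ ^ 2)) * Δ := by
      rw [rowRemainder]
      rw [← abs_of_nonneg (sq_nonneg (1 - ε)), ← abs_mul, abs_of_nonneg (sq_nonneg (1 - ε))] at c4'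
      rw [abs_le] at c1 c2 c3 c4' ⊢
      constructor <;> linarith [c1.1, c1.2, c2.1, c2.2, c3.1, c3.2, c4'.1, c4'.2]
    calc _ ≤ σ ^ 2 / 2 * (rowRemainder ϑ₂ ϑ₁ ϑ₀ δ Δ ε ((i : ℤ) - j)
        + 4 * (C * (3 * S * δ ^ 2)) * Δ) := by gcongr
      _ = σ ^ 2 / 2 * rowRemainder ϑ₂ ϑ₁ ϑ₀ δ Δ ε ((i : ℤ) - j) + A₂ * (δ ^ 2 * Δ) := by
        rw [hA₂]; ring
      _ ≤ _ := by gcongr; linarith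
  · intro i k hi hk
    have hJ : |(0 : ℤ)| < N := by simpa using hN
    have c1 := hcorr i i k k
    have c3 := abs_gridDiff_reflected_le (ϑ₁ := ϑ₁) hϑ hb hb2 hT hM hN hJ hk hk
    have e0 : gridDiff Δ 0 (fun t ↦ stencil (-ε) 0 ((1 - ε) ^ 2) δ (fun y ↦ F ϑ₂ y t)
          (((0 : ℤ) : ℝ) * δ)) = 2 * Phi ϑ₂ ϑ₁ δ Δ := by
      rw [gridDiff_zero, Phi_eq]
      simp [stencil, F_zero_right]
      rfl
    have hex := (incrementCov_eq (b := b) (M := M) (N := N) hadm hT.le i k i k)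
    simp only [sub_self] at c1 hex
    rw [e0] at c1 hex
    -- The competing estimate on the diagonal: modes bounded by a constant and the time kernel
    -- compared through the absolute gap, giving `Δ F(0, Δ)`, that is, order `Δ^(3/2)` in place of
    -- `δ² √Δ`.
    have c5 : |2 / σ ^ 2 * incrementCov σ ϑ₂ ϑ₁ ϑ₀ b T M N i k i k - (2 * Phi ϑ₂ ϑ₁ δ Δ -
        gridDiff Δ 0 (fun t ↦ stencil ((1 + ε ^ 2) / 2)
          ((ε ^ 2 - 1) / 2) ((1 - ε) ^ 2) δ
          (fun y ↦ F ϑ₂ y t) (gridSpace b M k + gridSpace b M k + δ)))| ≤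
        2 * K₂ * m ^ 2 * Δ * F ϑ₂ 0 Δ := by
      rw [← hex.tsum_eq, ← Real.norm_eq_abs]
      refine tsum_of_norm_bounded ((hasSum_F_zero hϑ hΔ.le).mul_left (2 * K₂ * m ^ 2 * Δ))
        fun n ↦ ?_
      rw [Real.norm_eq_abs, abs_mul, abs_mul, timeKernel_zero, timeKernel_zero, ← mul_sub, abs_mul,
        abs_two]
      have h1 := hmode' n k
      have h0 := expAvg_nonneg (baseEigen_pos hϑ n) hΔ.le
      have h2 := hdiag n Δ hΔ
      calc _ ≤ 2 * (K₂ * (Δ * expAvg (baseEigen ϑ₂ n) Δ)) * (m * m) := by gcongr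
        _ = _ := by ring
    have c6 : ∑' n : ℕ, |timeKernel (eigenvalue ϑ₂ ϑ₁ ϑ₀ (n + 1)) Δ 0
        - timeKernel (baseEigen ϑ₂ n) Δ 0| * (m * (((n : ℝ) + 1) * δ)) ^ 2 ≤
        rowRemainder ϑ₂ ϑ₁ ϑ₀ δ Δ ε 0 := by
      rw [rowRemainder]
      exact le_add_of_nonneg_right (mul_nonneg (sq_nonneg _) (tsum_nonneg fun _ ↦ abs_nonneg _))
    have c7 := hsum' {0}
    rw [Finset.sum_singleton] at c7
    have e : incrementCov σ ϑ₂ ϑ₁ ϑ₀ b T M N i k i k - σ ^ 2 * Phi ϑ₂ ϑ₁ δ Δ =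
        σ ^ 2 / 2 * (2 / σ ^ 2 * incrementCov σ ϑ₂ ϑ₁ ϑ₀ b T M N i k i k
          - 2 * Phi ϑ₂ ϑ₁ δ Δ) := by
      field_simp
    rw [e, abs_mul, abs_of_pos hσ2]
    set cov := incrementCov σ ϑ₂ ϑ₁ ϑ₀ b T M N i k i k
    have f1 : |2 / σ ^ 2 * cov - 2 * Phi ϑ₂ ϑ₁ δ Δ| ≤ rowRemainder ϑ₂ ϑ₁ ϑ₀ δ Δ ε 0
        + 2 * (C * (3 * S * δ ^ 2)) * Δ := by
      rw [abs_le] at c1 c3 ⊢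
      constructor <;> linarith [c1.1, c1.2, c3.1, c3.2]
    have f2 : |2 / σ ^ 2 * cov - 2 * Phi ϑ₂ ϑ₁ δ Δ| ≤ 2 * K₂ * m ^ 2 * Δ * F ϑ₂ 0 Δ
        + 2 * (C * (3 * S * δ ^ 2)) * Δ := by
      rw [abs_le] at c5 c3 ⊢
      constructor <;> linarith [c5.1, c5.2, c3.1, c3.2]
    have hx : 0 ≤ δ ^ 2 * Δ := by positivity
    have hmin : 0 ≤ min (δ ^ 2 * √Δ) (Δ * √Δ) := by positivity
    have b2 : A₂ * (δ ^ 2 * Δ) ≤ (A₁ + A₂ + A₃ + A₄) * (δ ^ 2 * Δ) := by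
      gcongr; linarith
    rw [mul_add]
    -- Whichever of the two estimates is smaller is used; the trace would not converge in all
    -- regimes with only one of them.
    rcases le_total (δ ^ 2 * √Δ) (Δ * √Δ) with hcase | hcase
    · rw [min_eq_left hcase]
      have g1 : A₁ * (δ ^ 2 * √Δ) ≤ (A₁ + A₂ + A₃ + A₄) * (δ ^ 2 * √Δ) := by
        gcongr; linarith
      calc _ ≤ σ ^ 2 / 2 * (rowRemainder ϑ₂ ϑ₁ ϑ₀ δ Δ ε 0 + 2 * (C * (3 * S * δ ^ 2)) * Δ) := by
            gcongr
        _ = σ ^ 2 / 2 * rowRemainder ϑ₂ ϑ₁ ϑ₀ δ Δ ε 0 + A₂ * (δ ^ 2 * Δ) / 2 := by rw [hA₂]; ring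
        _ ≤ _ := by
          have : 0 ≤ A₂ * (δ ^ 2 * Δ) := by positivity
          linarith
    · rw [min_eq_right hcase]
      have g1 : A₃ * (Δ * √Δ) ≤ (A₁ + A₂ + A₃ + A₄) * (Δ * √Δ) := by
        gcongr; linarith
      calc _ ≤ σ ^ 2 / 2 * (2 * K₂ * m ^ 2 * Δ * F ϑ₂ 0 Δ + 2 * (C * (3 * S * δ ^ 2)) * Δ) := by
            gcongr
        _ ≤ σ ^ 2 / 2 * (2 * K₂ * m ^ 2 * Δ * (KF * √Δ) + 2 * (C * (3 * S * δ ^ 2)) * Δ) := by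
            gcongr
        _ = A₃ * (Δ * √Δ) + A₂ * (δ ^ 2 * Δ) / 2 := by rw [hA₂, hA₃]; ring
        _ ≤ _ := by
          have : 0 ≤ A₂ * (δ ^ 2 * Δ) := by positivity
          linarith
  · have hJ : |(0 : ℤ)| < N := by simpa using hN
    have hL : |(0 : ℤ)| < M := by simpa using hM
    have c2 : |gridDiff Δ 0 (fun t ↦ stencil (-ε) 0 0 δ (smoothPart ϑ₂ t) (((0 : ℤ) : ℝ) * δ))| ≤
        2 * (C * (3 * S * δ ^ 2)) * Δ :=
      abs_gridDiff_smoothPart_le (ϑ₁ := ϑ₁) hϑ hb hb2 hT hM hN hJ hL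
    have e0 : gridDiff Δ 0 (fun t ↦ stencil (-ε) 0 ((1 - ε) ^ 2) δ (fun y ↦ F ϑ₂ y t)
          (((0 : ℤ) : ℝ) * δ)) = 2 * Phi ϑ₂ ϑ₁ δ Δ := by
      rw [gridDiff_zero, Phi_eq]
      simp [stencil, F_zero_right]
      rfl
    have e1 := gridDiff_stencil_F_eq hϑ hΔ hδ ε 0 0
    have e2 : gridDiff Δ 0 (fun t ↦ F ϑ₂ (((0 : ℤ) : ℝ) * δ) t) = 2 * F ϑ₂ 0 Δ := by
      rw [gridDiff_zero]
      simp [F_zero_right]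
    rw [e0, e2] at e1
    have hF0 : 0 ≤ F ϑ₂ 0 Δ :=
      (hasSum_F_zero hϑ hΔ.le).nonneg fun n ↦ expAvg_nonneg (baseEigen_pos hϑ n) hΔ.le
    have hFt : (1 - ε) ^ 2 * F ϑ₂ 0 Δ ≤ S * δ ^ 2 * (KF * √Δ) := by gcongr
    have hFt0 : 0 ≤ (1 - ε) ^ 2 * F ϑ₂ 0 Δ := by positivity
    have hd : C * (3 * S * δ ^ 2) * Δ ≤ C * (3 * S * δ ^ 2) * (√T * √Δ) := by gcongr
    have hd0 : 0 ≤ C * (3 * S * δ ^ 2) * (√T * √Δ) := by positivity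
    rw [hamp, hrat]
    set lamTerm := ε * √(ϑ₂ * Δ) / ϑ₂ * Lam (δ / √(ϑ₂ * Δ)) 0 0 with hlam
    rw [show 2 * (ε * √(ϑ₂ * Δ) / ϑ₂) * Lam (δ / √(ϑ₂ * Δ)) 0 0 = 2 * lamTerm by rw [hlam]; ring] at e1
    set X := gridDiff Δ 0 (fun t ↦ stencil (-ε) 0 0 δ (smoothPart ϑ₂ t) (((0 : ℤ) : ℝ) * δ))
    have g1 : A₄ * (δ ^ 2 * √Δ) ≤ (A₁ + A₂ + A₃ + A₄) * (δ ^ 2 * √Δ) := by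
      gcongr; linarith
    have g2 : A₄ * (δ ^ 2 * √Δ) = 2 * (C * (3 * S * δ ^ 2) * (√T * √Δ)) + S * δ ^ 2 * (KF * √Δ) := by
      rw [hA₄]; ring
    rw [abs_le] at c2 ⊢
    constructor <;> linarith [c2.1, c2.2]

end CovarianceBounds

/-! ### Counting index pairs with a given lag -/

section DifferenceCount

/-- The number of pairs `(i, j)` in `{0, …, N - 1}²` with `i - j = J`. -/
def pairCount (N : ℕ) (J : ℤ) : ℕ :=
  ((Finset.range N ×ˢ Finset.range N).filter fun x ↦ (x.1 : ℤ) - x.2 = J).card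

lemma pairCount_le (N : ℕ) (J : ℤ) : pairCount N J ≤ N := by
  rw [pairCount]
  conv_rhs => rw [← Finset.card_range N]
  refine Finset.card_le_card_of_injOn Prod.fst (fun x hx ↦ ?_) fun x hx y hy hxy ↦ ?_
  · simp only [Finset.coe_filter, Finset.mem_product, Set.mem_ofPred_eq] at hx
    simpa using hx.1.1
  · simp only [Finset.coe_filter, Finset.mem_product, Set.mem_ofPred_eq] at hx hy
    ext
    · exact hxy
    · have := hx.2
      have := hy.2
      omega

lemma sub_abs_le_pairCount (N : ℕ) (J : ℤ) : (N : ℤ) - |J| ≤ pairCount N J := by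
  have h : (Finset.Ico (max 0 J) (min (N : ℤ) (N + J))).card ≤ pairCount N J := by
    refine Finset.card_le_card_of_injOn (fun i ↦ (i.toNat, (i - J).toNat)) (fun i hi ↦ ?_)
      fun i hi j hj hij ↦ ?_
    · simp only [Finset.coe_Ico, Set.mem_Ico] at hi
      simp only [Finset.coe_filter, Finset.mem_product, Finset.mem_range, Set.mem_ofPred_eq]
      omega
    · simp only [Finset.coe_Ico, Set.mem_Ico] at hi hj
      simp only [Prod.mk.injEq] at hij
      omega
  rw [Int.card_Ico] at h
  have := abs_eq_max_neg (a := J)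
  omega

/-- The count lies between `N - |J|` and `N`. -/
lemma tendsto_pairCount_div {N : ℕ → ℕ} (hN : Tendsto N atTop atTop) (J : ℤ) :
    Tendsto (fun n ↦ (pairCount (N n) J : ℝ) / N n) atTop (𝓝 1) := by
  have hN' : Tendsto (fun n ↦ (N n : ℝ)) atTop atTop := tendsto_natCast_atTop_atTop.comp hN
  have h1 : Tendsto (fun n ↦ 1 - |(J : ℝ)| / N n) atTop (𝓝 1) := by
    simpa using tendsto_const_nhds.sub (hN'.const_div_atTop |(J : ℝ)|)
  refine tendsto_of_tendsto_of_tendsto_of_le_of_le' h1 tendsto_const_nhds ?_ ?_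
  · filter_upwards [hN'.eventually_gt_atTop 0] with n hn
    rw [one_sub_div hn.ne']
    gcongr
    have := sub_abs_le_pairCount (N n) J
    exact_mod_cast this
  · filter_upwards [hN'.eventually_gt_atTop 0] with n hn
    rw [div_le_one hn]
    exact_mod_cast pairCount_le _ _

/-- The differences of pairs of elements of `{0, …, N - 1}`. -/
def diffRange (N : ℕ) : Finset ℤ :=
  (Finset.range N ×ˢ Finset.range N).image fun x ↦ (x.1 : ℤ) - x.2

lemma pairCount_eq_zero {N : ℕ} {J : ℤ} (hJ : J ∉ diffRange N) : pairCount N J = 0 := by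
  rw [pairCount, Finset.card_eq_zero, Finset.filter_eq_empty_iff]
  intro x hx h
  exact hJ (Finset.mem_image.2 ⟨x, hx, h⟩)

lemma sum_sub_eq_sum_pairCount (N : ℕ) (f : ℤ → ℝ) :
    ∑ i : Fin N, ∑ j : Fin N, f ((i : ℤ) - j) = ∑ J ∈ diffRange N, pairCount N J * f J := by
  rw [← Finset.sum_range fun i ↦ ∑ j : Fin N, f ((i : ℤ) - j)]
  rw [Finset.sum_congr rfl fun (i : ℕ) _ ↦ (Finset.sum_range fun j ↦ f ((i : ℤ) - j)).symm]
  rw [← Finset.sum_product' (Finset.range N) (Finset.range N) fun i j ↦ f ((i : ℤ) - j),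
    Finset.sum_comp f fun x : ℕ × ℕ ↦ (x.1 : ℤ) - x.2]
  simp only [nsmul_eq_mul]
  rfl

/-- A double sum over the grid of a function of the lags is a sum over lags with multiplicities. It
is written as a series over `ℤ × ℤ`, with zero multiplicity outside the range, so that dominated
convergence can be applied. -/
lemma sum_grid_sub_eq_tsum (N M : ℕ) (f : ℤ → ℤ → ℝ) :
    ∑ p : Fin N × Fin M, ∑ q : Fin N × Fin M, f ((p.1 : ℤ) - q.1) ((p.2 : ℤ) - q.2) =
      ∑' x : ℤ × ℤ, (pairCount N x.1 * pairCount M x.2) * f x.1 x.2 := by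
  rw [tsum_eq_sum (s := diffRange N ×ˢ diffRange M), Finset.sum_product]
  · have h (J : ℤ) : ∑ L ∈ diffRange M, ((pairCount N J : ℝ) * pairCount M L) * f J L =
        pairCount N J * ∑ k : Fin M, ∑ l : Fin M, f J ((k : ℤ) - l) := by
      rw [sum_sub_eq_sum_pairCount M (f J), Finset.mul_sum]
      simp only [mul_assoc]
    simp_rw [h]
    rw [← sum_sub_eq_sum_pairCount N fun J ↦ ∑ k : Fin M, ∑ l : Fin M, f J ((k : ℤ) - l)]
    simp only [Fintype.sum_prod_type]
    refine Finset.sum_congr rfl fun i _ ↦ ?_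
    rw [Finset.sum_comm]
  · intro x hx
    rw [Finset.mem_product, not_and_or] at hx
    rcases hx with h | h <;> simp [pairCount_eq_zero h]

lemma sum_sub_le_of_sum_le {f : ℤ → ℝ} {c : ℝ} (hf : ∀ s : Finset ℤ, ∑ J ∈ s, f J ≤ c) (N : ℕ)
    (i : ℤ) : ∑ j : Fin N, f (i - (j : ℕ)) ≤ c := by
  have e : ∑ j : Fin N, f (i - (j : ℕ)) = ∑ J ∈ (Finset.univ : Finset (Fin N)).image
      fun j : Fin N ↦ i - ((j : ℕ) : ℤ), f J := by
    rw [Finset.sum_image]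
    intro a _ b _ h
    ext
    simp only at h
    omega
  rw [e]
  exact hf _

lemma sum_sub_le_tsum {f : ℤ → ℝ} (hf : Summable f) (h0 : ∀ J, 0 ≤ f J) (N : ℕ) (i : ℤ) :
    ∑ j : Fin N, f (i - (j : ℕ)) ≤ ∑' J, f J :=
  sum_sub_le_of_sum_le (fun s ↦ hf.sum_le_tsum s fun J _ ↦ h0 J) N i

end DifferenceCount

/-! ### Row sums of `Λ` on finite grids -/

section RowSums

open SPDE

lemma summable_int_inv_rpow : Summable fun j : ℤ ↦ (1 / (|(j : ℝ)| + 1)) ^ (5 / 4 : ℝ) := by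
  have h : Summable fun n : ℕ ↦ (1 / ((n : ℝ) + 1)) ^ (5 / 4 : ℝ) := by
    have := (summable_nat_add_iff 1).2 (Real.summable_one_div_nat_rpow.2
      (by norm_num : (1 : ℝ) < 5 / 4))
    refine this.congr fun n ↦ ?_
    rw [Real.div_rpow zero_le_one (by positivity), Real.one_rpow]
    push_cast
    rfl
  refine (summable_int_of_natAbs h).congr fun j ↦ ?_
  rw [abs_intCast_eq]

/-- Each row contains at most three entries of order `h`; the others are at most `h² rowBound`, and
summing these over the `M` space indices gives `M h²`. Effective for `h ≤ 1`. -/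
lemma exists_sum_Lam_le : ∃ B : ℝ, 0 ≤ B ∧ ∀ (N M : ℕ) (h : ℝ), 0 ≤ h → ∀ p : Fin N × Fin M,
    ∑ q : Fin N × Fin M, |Lam h ((p.1 : ℤ) - q.1) ((p.2 : ℤ) - q.2)| ≤ B * (h + M * h ^ 2) := by
  set A : ℝ := ∑' j : ℤ, (1 / (|(j : ℝ)| + 1)) ^ 2
  set R : ℝ := ∑' j : ℤ, rowBound j
  have hA : 0 ≤ A := tsum_nonneg fun _ ↦ sq_nonneg _
  have hR : 0 ≤ R := tsum_nonneg rowBound_nonneg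
  refine ⟨R + 16 * A ^ 2, by positivity, fun N M h hh p ↦ ?_⟩
  -- For the exceptional entries `|Λ| ≤ 4 h`, while the product weight is at least `1 / 4`; hence
  -- the constant `16`.
  have key (J L : ℤ) : |Lam h J L| ≤ h ^ 2 * rowBound J +
      16 * h * ((1 / (|(J : ℝ)| + 1)) ^ 2 * (1 / (|(L : ℝ)| + 1)) ^ 2) := by
    by_cases hJL : 1 < |J| ∨ L ≠ 0
    · refine (abs_Lam_le_rowBound hh hJL).trans (le_add_of_nonneg_right (by positivity))
    · push Not at hJL
      obtain ⟨h1, rfl⟩ := hJL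
      have h2 : |Lam h J 0| ≤ 4 * h := by simpa using sum_abs_Lam_le hh J {0}
      have h3 : |(J : ℝ)| ≤ 1 := by exact_mod_cast h1
      have h4 : 1 / 2 ≤ 1 / (|(J : ℝ)| + 1) :=
        one_div_le_one_div_of_le (by positivity) (by linarith)
      have h5 : (1 / 2 : ℝ) ^ 2 ≤ (1 / (|(J : ℝ)| + 1)) ^ 2 := by gcongr
      have h6 := mul_nonneg (sq_nonneg h) (rowBound_nonneg J)
      simp only [Int.cast_zero, abs_zero, zero_add, div_one, one_pow, mul_one]
      nlinarith
  calc ∑ q : Fin N × Fin M, |Lam h ((p.1 : ℤ) - q.1) ((p.2 : ℤ) - q.2)|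
      ≤ ∑ q : Fin N × Fin M, (h ^ 2 * rowBound ((p.1 : ℤ) - q.1) + 16 * h *
        ((1 / (|(((p.1 : ℤ) - q.1 : ℤ) : ℝ)| + 1)) ^ 2 *
          (1 / (|(((p.2 : ℤ) - q.2 : ℤ) : ℝ)| + 1)) ^ 2)) := Finset.sum_le_sum fun q _ ↦ key _ _
    _ = M * (h ^ 2 * ∑ j : Fin N, rowBound ((p.1 : ℤ) - j)) + 16 * h *
        ((∑ j : Fin N, (1 / (|(((p.1 : ℤ) - j : ℤ) : ℝ)| + 1)) ^ 2) *
          ∑ l : Fin M, (1 / (|(((p.2 : ℤ) - l : ℤ) : ℝ)| + 1)) ^ 2) := by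
      rw [Finset.sum_add_distrib, ← Finset.mul_sum, Fintype.sum_mul_sum]
      simp only [Fintype.sum_prod_type, Finset.sum_const, Finset.card_univ, Fintype.card_fin,
        nsmul_eq_mul, Finset.mul_sum]
      simp only [mul_left_comm]
    _ ≤ M * (h ^ 2 * R) + 16 * h * (A * A) := by
      gcongr
      · exact sum_sub_le_tsum summable_rowBound rowBound_nonneg N _
      · exact sum_sub_le_tsum (f := fun J : ℤ ↦ (1 / (|(J : ℝ)| + 1)) ^ 2) summable_int_inv_sq
          (fun _ ↦ sq_nonneg _) N _
      · exact sum_sub_le_tsum (f := fun J : ℤ ↦ (1 / (|(J : ℝ)| + 1)) ^ 2) summable_int_inv_sq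
          (fun _ ↦ sq_nonneg _) M _
    _ ≤ (R + 16 * A ^ 2) * (h + M * h ^ 2) := by
      have h1 : 0 ≤ R * h := by positivity
      have h2 : 0 ≤ 16 * A ^ 2 * (M * h ^ 2) := by positivity
      nlinarith

/-- Lags are smaller than `N`, so raising the exponent from `1` to the summable `5 / 4` costs at
most `N^(1/4)`. A logarithm would be sharper, but any power below `1 / 2` is enough. -/
lemma sum_inv_le {N : ℕ} (i : Fin N) :
    ∑ j : Fin N, 1 / (|(((i : ℤ) - j : ℤ) : ℝ)| + 1) ≤
      (N : ℝ) ^ (1 / 4 : ℝ) * ∑' J : ℤ, (1 / (|(J : ℝ)| + 1)) ^ (5 / 4 : ℝ) := by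
  refine le_trans (Finset.sum_le_sum (g := fun j : Fin N ↦ (N : ℝ) ^ (1 / 4 : ℝ) *
    (1 / (|(((i : ℤ) - j : ℤ) : ℝ)| + 1)) ^ (5 / 4 : ℝ)) fun j _ ↦ ?_) ?_
  · set x : ℝ := |(((i : ℤ) - j : ℤ) : ℝ)| + 1 with hx
    have hx0 : 0 < x := by positivity
    have hxN : x ≤ N := by
      have h1 := i.2
      have h2 := j.2
      have : |(i : ℤ) - j| + 1 ≤ N := by
        have := abs_eq_max_neg (a := (i : ℤ) - j)
        omega
      rw [hx]
      exact_mod_cast this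
    have e : 1 / x = x ^ (1 / 4 : ℝ) * (1 / x) ^ (5 / 4 : ℝ) := by
      rw [one_div, Real.inv_rpow hx0.le, ← Real.rpow_neg hx0.le, ← Real.rpow_add hx0]
      norm_num [Real.rpow_neg_one]
    calc 1 / x = x ^ (1 / 4 : ℝ) * (1 / x) ^ (5 / 4 : ℝ) := e
      _ ≤ _ := by gcongr
  · rw [← Finset.mul_sum]
    gcongr
    exact sum_sub_le_tsum (f := fun J : ℤ ↦ (1 / (|(J : ℝ)| + 1)) ^ (5 / 4 : ℝ))
      summable_int_inv_rpow (fun _ ↦ by positivity) N _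

/-- The product decay of `Λ` and `sum_inv_le` in each direction give `(MN)^(1/4)`, which is beaten
by the normalisation `√(MN)`. -/
lemma exists_sum_Lam_le_of_one_le : ∃ B : ℝ, 0 ≤ B ∧ ∀ (N M : ℕ) (h : ℝ), 1 ≤ h →
    ∀ p : Fin N × Fin M,
    ∑ q : Fin N × Fin M, |Lam h ((p.1 : ℤ) - q.1) ((p.2 : ℤ) - q.2)| ≤
      B * √(√(M * N)) := by
  set A : ℝ := ∑' J : ℤ, (1 / (|(J : ℝ)| + 1)) ^ (5 / 4 : ℝ)
  have hA : 0 ≤ A := tsum_nonneg fun _ ↦ by positivity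
  refine ⟨128 * A ^ 2, by positivity, fun N M h hh p ↦ ?_⟩
  calc ∑ q : Fin N × Fin M, |Lam h ((p.1 : ℤ) - q.1) ((p.2 : ℤ) - q.2)|
      ≤ ∑ q : Fin N × Fin M, 128 * ((1 / (|(((p.1 : ℤ) - q.1 : ℤ) : ℝ)| + 1)) *
          (1 / (|(((p.2 : ℤ) - q.2 : ℤ) : ℝ)| + 1))) := by
        refine Finset.sum_le_sum fun q _ ↦ ?_
        simpa using abs_Lam_le one_pos hh ((p.1 : ℤ) - q.1) ((p.2 : ℤ) - q.2)
    _ = 128 * ((∑ j : Fin N, 1 / (|(((p.1 : ℤ) - j : ℤ) : ℝ)| + 1)) *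
          ∑ l : Fin M, 1 / (|(((p.2 : ℤ) - l : ℤ) : ℝ)| + 1)) := by
      rw [← Finset.mul_sum, Fintype.sum_mul_sum]
      simp only [Fintype.sum_prod_type]
    _ ≤ 128 * (((N : ℝ) ^ (1 / 4 : ℝ) * A) * ((M : ℝ) ^ (1 / 4 : ℝ) * A)) := by
      gcongr
      · exact sum_inv_le _
      · exact sum_inv_le _
    _ = 128 * A ^ 2 * √(√(M * N)) := by
      rw [Real.sqrt_eq_rpow, Real.sqrt_eq_rpow, ← Real.rpow_mul (by positivity),
        Real.mul_rpow (by positivity) (by positivity)]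
      norm_num
      ring

end RowSums

/-! ### Operator and Frobenius norms of quadratic forms -/

section QuadraticForms

variable {ι : Type*} [Fintype ι]

/-- Schur's test. -/
lemma sum_mul_mul_le_of_row_sum_le {A : ι → ι → ℝ} {ρ : ℝ} (hsymm : ∀ i j, |A i j| = |A j i|)
    (hrow : ∀ i, ∑ j, |A i j| ≤ ρ) (x : ι → ℝ) :
    ∑ i, ∑ j, x i * x j * A i j ≤ ρ * ∑ i, x i ^ 2 := by
  have h1 : ∑ i, ∑ j, x i ^ 2 * |A i j| ≤ ρ * ∑ i, x i ^ 2 := by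
    rw [Finset.mul_sum]
    refine Finset.sum_le_sum fun i _ ↦ ?_
    rw [← Finset.mul_sum, mul_comm]
    exact mul_le_mul_of_nonneg_right (hrow i) (sq_nonneg _)
  have h2 : ∑ i, ∑ j, x j ^ 2 * |A i j| = ∑ i, ∑ j, x i ^ 2 * |A i j| := by
    rw [Finset.sum_comm]
    exact Finset.sum_congr rfl fun i _ ↦ Finset.sum_congr rfl fun j _ ↦ by rw [hsymm]
  have h3 : ∑ i, ∑ j, x i * x j * A i j ≤
      ∑ i, ∑ j, (1 / 2 * (x i ^ 2 * |A i j|) + 1 / 2 * (x j ^ 2 * |A i j|)) := by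
    refine Finset.sum_le_sum fun i _ ↦ Finset.sum_le_sum fun j _ ↦ ?_
    have h4 : x i * x j * A i j ≤ |x i * x j| * |A i j| := by
      rw [← abs_mul]; exact le_abs_self _
    have h5 : |x i * x j| ≤ 1 / 2 * x i ^ 2 + 1 / 2 * x j ^ 2 := by
      rw [abs_le]
      constructor <;> nlinarith [sq_nonneg (x i + x j), sq_nonneg (x i - x j)]
    have := mul_le_mul_of_nonneg_right h5 (abs_nonneg (A i j))
    linarith
  have h4 : ∑ i, ∑ j, (1 / 2 * (x i ^ 2 * |A i j|) + 1 / 2 * (x j ^ 2 * |A i j|)) =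
      1 / 2 * ∑ i, ∑ j, x i ^ 2 * |A i j| + 1 / 2 * ∑ i, ∑ j, x j ^ 2 * |A i j| := by
    simp only [Finset.mul_sum, Finset.sum_add_distrib]
  rw [h2] at h4
  linarith

/-- Cauchy-Schwarz on pairs of indices: the operator norm is at most the Frobenius norm. -/
lemma sum_mul_mul_le_sqrt_sum_sq (A : ι → ι → ℝ) (x : ι → ℝ) :
    ∑ i, ∑ j, x i * x j * A i j ≤ √(∑ i, ∑ j, A i j ^ 2) * ∑ i, x i ^ 2 := by
  have h := Real.sum_mul_le_sqrt_mul_sqrt (Finset.univ : Finset (ι × ι))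
    (fun p ↦ x p.1 * x p.2) fun p ↦ A p.1 p.2
  simp only [Fintype.sum_prod_type] at h
  have e : ∑ i, ∑ j, (x i * x j) ^ 2 = (∑ i, x i ^ 2) ^ 2 := by
    rw [sq (∑ i, x i ^ 2), Fintype.sum_mul_sum]
    simp only [mul_pow]
  rw [e, Real.sqrt_sq (Finset.sum_nonneg fun _ _ ↦ sq_nonneg _)] at h
  linarith

/-- The cross term vanishes by Cauchy-Schwarz, so a Frobenius-negligible perturbation does not
change the limit. -/
lemma tendsto_sum_add_sq {κ : ℕ → Type*} [∀ n, Fintype (κ n)] {U V : ∀ n, κ n → κ n → ℝ} {v : ℝ}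
    (hU : Tendsto (fun n ↦ ∑ i, ∑ j, U n i j ^ 2) atTop (𝓝 v))
    (hV : Tendsto (fun n ↦ ∑ i, ∑ j, V n i j ^ 2) atTop (𝓝 0)) :
    Tendsto (fun n ↦ ∑ i, ∑ j, (U n i j + V n i j) ^ 2) atTop (𝓝 v) := by
  have hc : Tendsto (fun n ↦ ∑ i, ∑ j, U n i j * V n i j) atTop (𝓝 0) := by
    have h0 : Tendsto (fun n ↦ √(∑ i, ∑ j, U n i j ^ 2) * √(∑ i, ∑ j, V n i j ^ 2)) atTop
        (𝓝 0) := by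
      simpa using hU.sqrt.mul hV.sqrt
    refine squeeze_zero_norm (fun n ↦ ?_) h0
    rw [Real.norm_eq_abs, abs_le]
    have h1 := Real.sum_mul_le_sqrt_mul_sqrt (Finset.univ : Finset (κ n × κ n))
      (fun p ↦ U n p.1 p.2) fun p ↦ V n p.1 p.2
    have h2 := Real.sum_mul_le_sqrt_mul_sqrt (Finset.univ : Finset (κ n × κ n))
      (fun p ↦ U n p.1 p.2) fun p ↦ -V n p.1 p.2
    simp only [Fintype.sum_prod_type, neg_sq, mul_neg, Finset.sum_neg_distrib] at h1 h2
    constructor <;> linarith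
  have h := (hU.add (hc.const_mul 2)).add hV
  simp only [mul_zero, add_zero] at h
  refine h.congr fun n ↦ ?_
  simp only [Finset.mul_sum, ← Finset.sum_add_distrib]
  exact Finset.sum_congr rfl fun i _ ↦ Finset.sum_congr rfl fun j _ ↦ by ring

end QuadraticForms

/-! ### Orders of magnitude of the normalisation and of the bias -/

section Rates

open SPDE

variable {σ ϑ₂ ϑ₁ ϑ₀ b T : ℝ}

lemma meshSpace_pos (hb2 : b < 1 / 2) {M : ℕ} (hM : 0 < M) : 0 < meshSpace b M :=
  div_pos (by linarith) (by exact_mod_cast hM)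

lemma tendsto_meshSpace (b : ℝ) {M : ℕ → ℕ} (hM : Tendsto M atTop atTop) :
    Tendsto (fun n ↦ meshSpace b (M n)) atTop (𝓝 0) :=
  (tendsto_natCast_atTop_atTop.comp hM).const_div_atTop _

lemma tendsto_meshTime (T : ℝ) {N : ℕ → ℕ} (hN : Tendsto N atTop atTop) :
    Tendsto (fun n ↦ meshTime T (N n)) atTop (𝓝 0) :=
  (tendsto_natCast_atTop_atTop.comp hN).const_div_atTop _

lemma tendsto_sqrt_meshTime (T : ℝ) {N : ℕ → ℕ} (hN : Tendsto N atTop atTop) :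
    Tendsto (fun n ↦ √(meshTime T (N n))) atTop (𝓝 0) := by
  simpa using (tendsto_meshTime T hN).sqrt

lemma tendsto_max_mesh (b T : ℝ) {M N : ℕ → ℕ} (hM : Tendsto M atTop atTop)
    (hN : Tendsto N atTop atTop) :
    Tendsto (fun n ↦ max (meshSpace b (M n)) √(meshTime T (N n))) atTop (𝓝 0) := by
  simpa using (tendsto_meshSpace b hM).max (tendsto_sqrt_meshTime T hN)

lemma mul_div_min_eq_max {x y : ℝ} (hx : 0 < x) (hy : 0 < y) : x * y / min x y = max x y := by
  rw [← min_mul_max x y, mul_div_cancel_left₀ _ (lt_min hx hy).ne']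

lemma amplitude_pos (hϑ : 0 < ϑ₂) (hT : 0 < T) (M : ℕ) {N : ℕ} (hN : 0 < N) :
    0 < amplitude ϑ₂ ϑ₁ b T M N := by
  have := meshTime_pos hT hN
  rw [amplitude, decay]
  positivity

lemma meshRatio_pos (hϑ : 0 < ϑ₂) (hb2 : b < 1 / 2) (hT : 0 < T) {M N : ℕ} (hM : 0 < M)
    (hN : 0 < N) : 0 < meshRatio ϑ₂ b T M N := by
  have := meshTime_pos hT hN
  have := meshSpace_pos hb2 hM
  rw [meshRatio]
  positivity

/-- The main part of the variance of a rescaled double increment, up to the factor `σ²`. -/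
noncomputable def mainVar (ϑ₂ ϑ₁ b T : ℝ) (M N : ℕ) : ℝ :=
  -(amplitude ϑ₂ ϑ₁ b T M N * Lam (meshRatio ϑ₂ b T M N) 0 0)

/-- The amplitude is of order `√Δ` and `-Λ₀₀(h)` is at least of order `min h 1`, so the product is
at least of order `min(δ, √Δ)`. -/
lemma exists_le_mainVar (hϑ : 0 < ϑ₂) (hb : 0 < b) (hb2 : b < 1 / 2) (hT : 0 < T) :
    ∃ c : ℝ, 0 < c ∧ ∀ M N : ℕ, 0 < M → 0 < N →
      c * min (meshSpace b M) √(meshTime T N) ≤ mainVar ϑ₂ ϑ₁ b T M N := by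
  refine ⟨Real.exp (-|kappa ϑ₂ ϑ₁|) / ϑ₂ * (4 * lamConst) * min 1 √ϑ₂, ?_, fun M N hM hN ↦ ?_⟩
  · have := lamConst_pos
    have : 0 < min 1 √ϑ₂ := lt_min one_pos (Real.sqrt_pos.2 hϑ)
    positivity
  have hΔ := meshTime_pos hT hN
  have hδ := meshSpace_pos hb2 hM
  have hδ1 := meshSpace_le hb2 hM
  set δ := meshSpace b M
  set Δ := meshTime T N
  have hs : 0 < √(ϑ₂ * Δ) := by positivity
  have h1 : Real.exp (-|kappa ϑ₂ ϑ₁|) ≤ decay ϑ₂ ϑ₁ b M := by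
    rw [decay]
    gcongr
    calc kappa ϑ₂ ϑ₁ * δ / 2 ≤ |kappa ϑ₂ ϑ₁| * δ / 2 := by
          gcongr; exact le_abs_self _
      _ ≤ |kappa ϑ₂ ϑ₁| := by nlinarith [abs_nonneg (kappa ϑ₂ ϑ₁)]
  have h2 := le_neg_Lam_zero_zero (meshRatio_pos (b := b) hϑ hb2 hT hM hN).le
  have h3 : √(ϑ₂ * Δ) * min (meshRatio ϑ₂ b T M N) 1 = min δ √(ϑ₂ * Δ) := by
    rw [mul_min_of_nonneg _ _ hs.le, meshRatio, mul_div_cancel₀ _ hs.ne', mul_one]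
  have h4 : min 1 √ϑ₂ * min δ √Δ ≤ min δ √(ϑ₂ * Δ) := by
    refine le_min ?_ ?_
    · calc min 1 √ϑ₂ * min δ √Δ ≤ 1 * δ := by
            gcongr
            · exact min_le_left _ _
            · exact min_le_left _ _
        _ = δ := one_mul _
    · rw [Real.sqrt_mul hϑ.le]
      gcongr
      · exact min_le_right _ _
      · exact min_le_right _ _
  have hl := lamConst_pos
  have hdec : 0 ≤ decay ϑ₂ ϑ₁ b M := (Real.exp_pos _).le
  calc Real.exp (-|kappa ϑ₂ ϑ₁|) / ϑ₂ * (4 * lamConst) * min 1 √ϑ₂ * min δ √Δ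
      = Real.exp (-|kappa ϑ₂ ϑ₁|) / ϑ₂ * (4 * lamConst) * (min 1 √ϑ₂ * min δ √Δ) := by ring
    _ ≤ decay ϑ₂ ϑ₁ b M / ϑ₂ * (4 * lamConst) *
        (√(ϑ₂ * Δ) * min (meshRatio ϑ₂ b T M N) 1) := by
      rw [h3]
      gcongr
    _ = amplitude ϑ₂ ϑ₁ b T M N * (4 * lamConst * min (meshRatio ϑ₂ b T M N) 1) := by
      rw [amplitude]; ring
    _ ≤ amplitude ϑ₂ ϑ₁ b T M N * -Lam (meshRatio ϑ₂ b T M N) 0 0 :=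
      mul_le_mul_of_nonneg_left h2 (amplitude_pos hϑ hT M hN).le
    _ = mainVar ϑ₂ ϑ₁ b T M N := by rw [mainVar]; ring

lemma mainVar_pos (hϑ : 0 < ϑ₂) (hb : 0 < b) (hb2 : b < 1 / 2) (hT : 0 < T) {M N : ℕ}
    (hM : 0 < M) (hN : 0 < N) : 0 < mainVar ϑ₂ ϑ₁ b T M N := by
  obtain ⟨c, hc, h⟩ := exists_le_mainVar (ϑ₁ := ϑ₁) hϑ hb hb2 hT
  refine lt_of_lt_of_le (mul_pos hc (lt_min (meshSpace_pos hb2 hM) ?_)) (h M N hM hN)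
  exact Real.sqrt_pos.2 (meshTime_pos hT hN)

/-- The error `δ² √Δ` relative to `min(δ, √Δ)` is `δ max(δ, √Δ)`, which vanishes whatever the
relation between the two meshes. -/
lemma tendsto_Phi_div_mainVar (hadm : Admissible σ ϑ₂ ϑ₁ ϑ₀) (hb : 0 < b) (hb2 : b < 1 / 2)
    (hT : 0 < T) {M N : ℕ → ℕ} (hM : Tendsto M atTop atTop) (hN : Tendsto N atTop atTop) :
    Tendsto (fun n ↦ Phi ϑ₂ ϑ₁ (meshSpace b (M n)) (meshTime T (N n)) /
      mainVar ϑ₂ ϑ₁ b T (M n) (N n)) atTop (𝓝 1) := by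
  obtain ⟨K, hK, hbd⟩ := exists_incrementCov_bounds hadm hb hb2 hT
  obtain ⟨c, hc, hlow⟩ := exists_le_mainVar (ϑ₁ := ϑ₁) hadm.2.1 hb hb2 hT
  have h0 : Tendsto (fun n ↦ K / c * (meshSpace b (M n) *
      max (meshSpace b (M n)) √(meshTime T (N n)))) atTop (𝓝 0) := by
    simpa using ((tendsto_meshSpace b hM).mul (tendsto_max_mesh b T hM hN)).const_mul (K / c)
  rw [← tendsto_sub_nhds_zero_iff]
  refine squeeze_zero_norm' ?_ h0
  filter_upwards [hM.eventually_gt_atTop 0, hN.eventually_gt_atTop 0] with n hMn hNn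
  have hD := mainVar_pos (ϑ₁ := ϑ₁) hadm.2.1 hb hb2 hT hMn hNn
  have h1 := (hbd (M n) (N n) hMn hNn).2.2
  have h2 := hlow (M n) (N n) hMn hNn
  have hd := Real.sqrt_pos.2 (meshTime_pos hT hNn)
  have hδ := meshSpace_pos hb2 hMn
  have hm := lt_min hδ hd
  rw [Real.norm_eq_abs, div_sub_one hD.ne', abs_div, abs_of_pos hD, ← mul_div_min_eq_max hδ hd]
  have e : Phi ϑ₂ ϑ₁ (meshSpace b (M n)) (meshTime T (N n)) - mainVar ϑ₂ ϑ₁ b T (M n) (N n) =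
      Phi ϑ₂ ϑ₁ (meshSpace b (M n)) (meshTime T (N n)) + amplitude ϑ₂ ϑ₁ b T (M n) (N n) *
        Lam (meshRatio ϑ₂ b T (M n) (N n)) 0 0 := by rw [mainVar]; ring
  rw [e]
  calc _ ≤ K * (meshSpace b (M n) ^ 2 * √(meshTime T (N n))) /
        (c * min (meshSpace b (M n)) √(meshTime T (N n))) := by gcongr
    _ = _ := by field_simp

/-- Eventually `Φ` is bounded below by half its main part. -/
lemma eventually_le_Phi (hadm : Admissible σ ϑ₂ ϑ₁ ϑ₀) (hb : 0 < b) (hb2 : b < 1 / 2)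
    (hT : 0 < T) {M N : ℕ → ℕ} (hM : Tendsto M atTop atTop) (hN : Tendsto N atTop atTop) :
    ∀ᶠ n in atTop, mainVar ϑ₂ ϑ₁ b T (M n) (N n) / 2 ≤
      Phi ϑ₂ ϑ₁ (meshSpace b (M n)) (meshTime T (N n)) := by
  filter_upwards [(tendsto_Phi_div_mainVar hadm hb hb2 hT hM hN).eventually_const_le
    (by norm_num : (1 / 2 : ℝ) < 1), hM.eventually_gt_atTop 0, hN.eventually_gt_atTop 0]
    with n hn hMn hNn
  have hD := mainVar_pos (ϑ₁ := ϑ₁) hadm.2.1 hb hb2 hT hMn hNn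
  rw [le_div_iff₀ hD] at hn
  linarith

lemma sqrt_mul_sqrt_mesh (hb2 : b < 1 / 2) (hT : 0 < T) {M N : ℕ} (hM : 0 < M) (hN : 0 < N) :
    √((M : ℝ) * N) * (√(meshSpace b M) * √(meshTime T N)) = √((1 - 2 * b) * T) := by
  have h1 : (0 : ℝ) < M := by exact_mod_cast hM
  have h2 : (0 : ℝ) < N := by exact_mod_cast hN
  rw [← Real.sqrt_mul (meshSpace_nonneg hb2), ← Real.sqrt_mul (by positivity)]
  congr 1
  rw [meshSpace, meshTime]
  field_simp

lemma natCast_mul_meshSpace (b : ℝ) {M : ℕ} (hM : 0 < M) : (M : ℝ) * meshSpace b M = 1 - 2 * b :=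
  mul_div_cancel₀ _ (by exact_mod_cast hM.ne')

lemma natCast_mul_meshTime (T : ℝ) {N : ℕ} (hN : 0 < N) : (N : ℝ) * meshTime T N = T :=
  mul_div_cancel₀ _ (by exact_mod_cast hN.ne')

lemma tendsto_sqrt_mul_atTop {M N : ℕ → ℕ} (hM : Tendsto M atTop atTop)
    (hN : Tendsto N atTop atTop) : Tendsto (fun n ↦ √((M n : ℝ) * N n)) atTop atTop :=
  Real.tendsto_sqrt_atTop.comp ((tendsto_natCast_atTop_atTop.comp hM).atTop_mul_atTop₀
    (tendsto_natCast_atTop_atTop.comp hN))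

/-- The product `√(MN) √δ √Δ` is constant. The inner minimum equals `min(δ, √Δ)² √Δ`, so division
leaves `min(δ, √Δ) √Δ ≤ δ √Δ`, and a factor `√δ` survives the normalisation. With `δ² √Δ` alone one
would be left with `δ^(3/2) / √Δ`, which need not vanish. -/
lemma bias_rate_le (hb2 : b < 1 / 2) (hT : 0 < T) {M N : ℕ} (hM : 0 < M) (hN : 0 < N) :
    √((M : ℝ) * N) * (min (meshSpace b M ^ 2 * √(meshTime T N)) (meshTime T N * √(meshTime T N))
      + meshSpace b M ^ 2 * meshTime T N) / min (meshSpace b M) √(meshTime T N) ≤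
    √((1 - 2 * b) * T) * (√(meshSpace b M) +
      √(meshSpace b M) * max (meshSpace b M) √(meshTime T N)) := by
  have hs := sqrt_mul_sqrt_mesh hb2 hT hM hN
  have hd := Real.sqrt_pos.2 (meshTime_pos hT hN)
  have hδ := meshSpace_pos hb2 hM
  have hΔ := Real.sq_sqrt (meshTime_pos hT hN).le
  have ha := Real.sqrt_pos.2 hδ
  have hδ2 := Real.sq_sqrt hδ.le
  rw [← hs, ← mul_div_min_eq_max hδ hd]
  set q := √((M : ℝ) * N)
  have hq : 0 ≤ q := Real.sqrt_nonneg _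
  set δ := meshSpace b M
  set Δ := meshTime T N
  set d := √Δ
  set a := √δ
  have hm := lt_min hδ hd
  have e : min (δ ^ 2 * d) (Δ * d) = min δ d ^ 2 * d := by
    rw [← hΔ, ← min_mul_of_nonneg _ _ hd.le]
    congr 1
    rcases le_total δ d with h | h
    · rw [min_eq_left h, min_eq_left (by gcongr)]
    · rw [min_eq_right h, min_eq_right (by gcongr)]
  have hma : min δ d ≤ a ^ 2 := hδ2 ▸ min_le_left _ _
  rw [e, ← hΔ]
  generalize min δ d = m at *
  have e2 : q * (m ^ 2 * d + δ ^ 2 * d ^ 2) / m = q * m * d + q * (a ^ 2 * d) * (δ * d / m) := by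
    rw [hδ2]
    field_simp
  rw [e2]
  have : q * m * d ≤ q * a ^ 2 * d := by gcongr
  calc q * m * d + q * (a ^ 2 * d) * (δ * d / m)
      ≤ q * a ^ 2 * d + q * (a ^ 2 * d) * (δ * d / m) := by gcongr
    _ = _ := by ring

lemma tendsto_bias_rate (b T : ℝ) {M N : ℕ → ℕ} (hM : Tendsto M atTop atTop)
    (hN : Tendsto N atTop atTop) : Tendsto (fun n ↦ √((1 - 2 * b) * T) * (√(meshSpace b (M n)) +
      √(meshSpace b (M n)) * max (meshSpace b (M n)) √(meshTime T (N n)))) atTop (𝓝 0) := by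
  have h := (tendsto_meshSpace b hM).sqrt
  rw [Real.sqrt_zero] at h
  simpa using (h.add (h.mul (tendsto_max_mesh b T hM hN))).const_mul √((1 - 2 * b) * T)

end Rates

/-! ### The normalised covariance matrix and the limit theorem -/

section MainTheorem

open SPDE

variable {σ ϑ₂ ϑ₁ ϑ₀ b T : ℝ}

/-- The normalising factor `1 / (√(MN) Φ)`. -/
noncomputable def normFactor (ϑ₂ ϑ₁ b T : ℝ) (M N : ℕ) : ℝ :=
  1 / (√((M : ℝ) * N) * Phi ϑ₂ ϑ₁ (meshSpace b M) (meshTime T N))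

/-- The main part of the normalised covariance. -/
noncomputable def mainCov (σ ϑ₂ ϑ₁ b T : ℝ) (M N : ℕ) (p q : Fin N × Fin M) : ℝ :=
  -(normFactor ϑ₂ ϑ₁ b T M N * (σ ^ 2 * (amplitude ϑ₂ ϑ₁ b T M N *
    Lam (meshRatio ϑ₂ b T M N) ((p.1 : ℤ) - q.1) ((p.2 : ℤ) - q.2))))

/-- The remainder of the normalised covariance. -/
noncomputable def remCov (σ ϑ₂ ϑ₁ ϑ₀ b T : ℝ) (M N : ℕ) (p q : Fin N × Fin M) : ℝ :=
  normFactor ϑ₂ ϑ₁ b T M N * (incrementCov σ ϑ₂ ϑ₁ ϑ₀ b T M N p.1 p.2 q.1 q.2 +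
    σ ^ 2 * (amplitude ϑ₂ ϑ₁ b T M N *
      Lam (meshRatio ϑ₂ b T M N) ((p.1 : ℤ) - q.1) ((p.2 : ℤ) - q.2)))

lemma mainCov_add_remCov (M N : ℕ) (p q : Fin N × Fin M) :
    mainCov σ ϑ₂ ϑ₁ b T M N p q + remCov σ ϑ₂ ϑ₁ ϑ₀ b T M N p q =
      normFactor ϑ₂ ϑ₁ b T M N * incrementCov σ ϑ₂ ϑ₁ ϑ₀ b T M N p.1 p.2 q.1 q.2 := by
  rw [mainCov, remCov]; ring

/-- The factor `1 / (MN)` turns multiplicities of lags into proportions, and exchanging the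
amplitude for `mainVar` brings out the quotient by `Λ₀₀²` that defines the asymptotic variance. -/
lemma sum_sq_mainCov {M N : ℕ} (hL : Lam (meshRatio ϑ₂ b T M N) 0 0 ≠ 0) :
    2 * ∑ p, ∑ q, mainCov σ ϑ₂ ϑ₁ b T M N p q ^ 2 =
      σ ^ 4 * (mainVar ϑ₂ ϑ₁ b T M N / Phi ϑ₂ ϑ₁ (meshSpace b M) (meshTime T N)) ^ 2 *
      (2 / Lam (meshRatio ϑ₂ b T M N) 0 0 ^ 2 * ∑' x : ℤ × ℤ,
        ((pairCount N x.1 : ℝ) / N * (pairCount M x.2 / M)) *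
          Lam (meshRatio ϑ₂ b T M N) x.1 x.2 ^ 2) := by
  set A := amplitude ϑ₂ ϑ₁ b T M N
  set Φ := Phi ϑ₂ ϑ₁ (meshSpace b M) (meshTime T N) with hΦ
  have h1 (p q : Fin N × Fin M) : mainCov σ ϑ₂ ϑ₁ b T M N p q ^ 2 =
      σ ^ 4 * (A / Φ) ^ 2 / (M * N) *
        Lam (meshRatio ϑ₂ b T M N) ((p.1 : ℤ) - q.1) ((p.2 : ℤ) - q.2) ^ 2 := by
    rw [mainCov, normFactor, neg_sq, mul_pow, div_pow, mul_pow (√_), Real.sq_sqrt (by positivity)]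
    ring
  have h2 (x : ℤ × ℤ) : ((pairCount N x.1 : ℝ) / N * (pairCount M x.2 / M)) *
      Lam (meshRatio ϑ₂ b T M N) x.1 x.2 ^ 2 = 1 / (M * N) *
      ((pairCount N x.1 * pairCount M x.2) * Lam (meshRatio ϑ₂ b T M N) x.1 x.2 ^ 2) := by
    ring
  have h3 : (mainVar ϑ₂ ϑ₁ b T M N / Φ) ^ 2 =
      (A / Φ) ^ 2 * Lam (meshRatio ϑ₂ b T M N) 0 0 ^ 2 := by
    rw [mainVar]; ring
  simp_rw [h1, h2, ← Finset.mul_sum, tsum_mul_left]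
  rw [sum_grid_sub_eq_tsum N M fun J L ↦ Lam (meshRatio ϑ₂ b T M N) J L ^ 2, h3]
  field_simp

lemma tendsto_sum_sq_mainCov (hadm : Admissible σ ϑ₂ ϑ₁ ϑ₀) (hb : 0 < b) (hb2 : b < 1 / 2)
    (hT : 0 < T) {M N : ℕ → ℕ} (hM : Tendsto M atTop atTop) (hN : Tendsto N atTop atTop)
    {x₀ : ℝ≥0∞} (hx : Tendsto (fun n ↦ ENNReal.ofReal (meshRatio ϑ₂ b T (M n) (N n))) atTop
      (𝓝 x₀)) :
    Tendsto (fun n ↦ 2 * ∑ p, ∑ q, mainCov σ ϑ₂ ϑ₁ b T (M n) (N n) p q ^ 2) atTop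
      (𝓝 (asympVar x₀ * σ ^ 4)) := by
  have h1 := tendsto_weighted_asympVar hx (w := fun n x ↦
    (pairCount (N n) x.1 : ℝ) / N n * (pairCount (M n) x.2 / M n)) ?_ ?_ ?_
  · have h2 := (tendsto_Phi_div_mainVar hadm hb hb2 hT hM hN).inv₀ one_ne_zero
    have h3 := ((h2.pow 2).const_mul (σ ^ 4)).mul h1
    rw [inv_one, one_pow, mul_one, mul_comm] at h3
    refine h3.congr' ?_
    filter_upwards [hM.eventually_gt_atTop 0, hN.eventually_gt_atTop 0] with n hMn hNn
    rw [sum_sq_mainCov (Lam_zero_zero_ne_zero (meshRatio_pos (b := b) hadm.2.1 hb2 hT hMn hNn)),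
      inv_div,
      LamE_ofReal (meshRatio_pos (b := b) hadm.2.1 hb2 hT hMn hNn).le]
  · filter_upwards [hM.eventually_gt_atTop 0, hN.eventually_gt_atTop 0] with n hMn hNn
    simpa using meshRatio_pos (b := b) hadm.2.1 hb2 hT hMn hNn
  · intro n x
    have (N : ℕ) (J : ℤ) : (pairCount N J : ℝ) / N ≤ 1 :=
      div_le_one_of_le₀ (by exact_mod_cast pairCount_le N J) (Nat.cast_nonneg _)
    exact ⟨by positivity, mul_le_one₀ (this _ _) (by positivity) (this _ _)⟩
  · intro x
    simpa using (tendsto_pairCount_div hN x.1).mul (tendsto_pairCount_div hM x.2)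

/-- The row remainder `ρ` is non-negative with total mass at most `E`, so each of its entries is at
most `E` and its squares sum to at most `E²` over the time lags. Its contribution and that of the
uniform remainder are, relative to `Φ²`, of order `δ max(δ, √Δ)²`. -/
lemma tendsto_sum_sq_remCov (hadm : Admissible σ ϑ₂ ϑ₁ ϑ₀) (hb : 0 < b) (hb2 : b < 1 / 2)
    (hT : 0 < T) {M N : ℕ → ℕ} (hM : Tendsto M atTop atTop) (hN : Tendsto N atTop atTop) :
    Tendsto (fun n ↦ ∑ p, ∑ q, remCov σ ϑ₂ ϑ₁ ϑ₀ b T (M n) (N n) p q ^ 2) atTop (𝓝 0) := by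
  obtain ⟨K, hK, hbd⟩ := exists_incrementCov_bounds hadm hb hb2 hT
  obtain ⟨c, hc, hlow⟩ := exists_le_mainVar (ϑ₁ := ϑ₁) hadm.2.1 hb hb2 hT
  set C : ℝ := 8 * K ^ 2 * ((1 - 2 * b) * (1 + T)) / c ^ 2
  have h0 : Tendsto (fun n ↦ C * (meshSpace b (M n) *
      max (meshSpace b (M n)) √(meshTime T (N n)) ^ 2)) atTop (𝓝 0) := by
    simpa using ((tendsto_meshSpace b hM).mul ((tendsto_max_mesh b T hM hN).pow 2)).const_mul C
  refine squeeze_zero' (Eventually.of_forall fun n ↦ by positivity) ?_ h0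
  filter_upwards [hM.eventually_gt_atTop 0, hN.eventually_gt_atTop 0,
    eventually_le_Phi hadm hb hb2 hT hM hN] with n hMn hNn hΦ
  obtain ⟨⟨ρ, hρ0, hρ, hcov⟩, -, -⟩ := hbd (M n) (N n) hMn hNn
  have hl := hlow (M n) (N n) hMn hNn
  have hd := Real.sqrt_pos.2 (meshTime_pos hT hNn)
  have hδ := meshSpace_pos hb2 hMn
  have hΔ := meshTime_pos hT hNn
  have hΔ2 := Real.sq_sqrt hΔ.le
  have hMδ := natCast_mul_meshSpace b hMn
  have hNΔ := natCast_mul_meshTime T hNn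
  have hm := lt_min hδ hd
  have hM0 : (0 : ℝ) < M n := by exact_mod_cast hMn
  have hN0 : (0 : ℝ) < N n := by exact_mod_cast hNn
  rw [← mul_div_min_eq_max hδ hd]
  have hf : normFactor ϑ₂ ϑ₁ b T (M n) (N n) ^ 2 =
      1 / (M n * N n * Phi ϑ₂ ϑ₁ (meshSpace b (M n)) (meshTime T (N n)) ^ 2) := by
    rw [normFactor, div_pow, mul_pow, Real.sq_sqrt (by positivity), one_pow]
  set δ := meshSpace b (M n)
  set Δ := meshTime T (N n)
  set Φ := Phi ϑ₂ ϑ₁ δ Δ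
  set f := normFactor ϑ₂ ϑ₁ b T (M n) (N n)
  set E := K * (δ ^ 2 * √Δ) with hE
  have hE0 : 0 ≤ E := by positivity
  have hΦm : c / 2 * min δ √Δ ≤ Φ := by linarith
  have hΦ0 : 0 < c / 2 * min δ √Δ := by positivity
  have hρ1 (J : ℤ) : ρ J ≤ E := by simpa using hρ {J}
  have hterm (p q : Fin (N n) × Fin (M n)) : remCov σ ϑ₂ ϑ₁ ϑ₀ b T (M n) (N n) p q ^ 2 ≤
      f ^ 2 * (2 * (E * ρ ((p.1 : ℤ) - q.1)) + 2 * (K * (δ ^ 2 * Δ)) ^ 2) := by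
    rw [remCov, mul_pow]
    refine mul_le_mul_of_nonneg_left ?_ (sq_nonneg _)
    rw [← sq_abs]
    have h1 := hcov p.1 q.1 p.2 q.2 p.1.2 q.1.2 p.2.2 q.2.2
    have h2 := hρ0 ((p.1 : ℤ) - q.1)
    have h3 := hρ1 ((p.1 : ℤ) - q.1)
    refine (pow_le_pow_left₀ (abs_nonneg _) h1 2).trans ?_
    refine (add_sq_le).trans ?_
    nlinarith
  have hrow (p : Fin (N n) × Fin (M n)) :
      ∑ q : Fin (N n) × Fin (M n), (2 * (E * ρ ((p.1 : ℤ) - q.1)) + 2 * (K * (δ ^ 2 * Δ)) ^ 2) ≤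
        2 * (M n * E ^ 2) + 2 * (M n * N n) * (K * (δ ^ 2 * Δ)) ^ 2 := by
    have h1 := sum_sub_le_of_sum_le hρ (N n) p.1
    have h2 : ∑ q : Fin (N n) × Fin (M n), ρ ((p.1 : ℤ) - q.1) ≤ M n * E := by
      simp only [Fintype.sum_prod_type, Finset.sum_const, Finset.card_univ, Fintype.card_fin,
        nsmul_eq_mul, ← Finset.mul_sum]
      gcongr
    simp only [Finset.sum_add_distrib, ← Finset.mul_sum, Finset.sum_const, Finset.card_univ,
      Fintype.card_prod, Fintype.card_fin, nsmul_eq_mul]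
    push_cast
    have h3 := mul_le_mul_of_nonneg_left h2 hE0
    linarith
  calc ∑ p, ∑ q, remCov σ ϑ₂ ϑ₁ ϑ₀ b T (M n) (N n) p q ^ 2
      ≤ ∑ p : Fin (N n) × Fin (M n), f ^ 2 *
        (2 * (M n * E ^ 2) + 2 * (M n * N n) * (K * (δ ^ 2 * Δ)) ^ 2) := by
        refine Finset.sum_le_sum fun p _ ↦ ?_
        refine (Finset.sum_le_sum fun q _ ↦ hterm p q).trans ?_
        rw [← Finset.mul_sum]
        exact mul_le_mul_of_nonneg_left (hrow p) (sq_nonneg _)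
    _ = (M n * N n) * (1 / (M n * N n * Φ ^ 2)) *
        (2 * (M n * E ^ 2) + 2 * (M n * N n) * (K * (δ ^ 2 * Δ)) ^ 2) := by
      rw [hf]
      simp only [Finset.sum_const, Finset.card_univ, Fintype.card_prod, Fintype.card_fin,
        nsmul_eq_mul]
      push_cast
      ring
    _ = 2 * K ^ 2 * (δ ^ 3 * Δ) * ((M n * δ) + (M n * δ) * (N n * Δ)) / Φ ^ 2 := by
      rw [hE, mul_pow, mul_pow, hΔ2]
      field_simp
    _ ≤ 2 * K ^ 2 * (δ ^ 3 * Δ) * ((1 - 2 * b) + (1 - 2 * b) * T) / (c / 2 * min δ √Δ) ^ 2 := by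
      rw [hMδ, hNΔ]
      have : 0 ≤ 1 - 2 * b := by linarith
      gcongr
    _ = C * (δ * (δ * √Δ / min δ √Δ) ^ 2) := by
      rw [div_pow (δ * √Δ), mul_pow δ, hΔ2]
      simp only [C]
      field_simp
      ring

/-- Dividing by `Φ` costs at most a multiple of `1 / min(h, 1)`. For `h ≤ 1` the row bound `h + M
h²` leaves `1 / √(MN) + M h / √(MN)`, whose second term is a multiple of `√δ`; for `h ≥ 1` the row
bound `(MN)^(1/4)` applies. -/
lemma exists_tendsto_mainCov_row (hadm : Admissible σ ϑ₂ ϑ₁ ϑ₀) (hb : 0 < b) (hb2 : b < 1 / 2)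
    (hT : 0 < T) {M N : ℕ → ℕ} (hM : Tendsto M atTop atTop) (hN : Tendsto N atTop atTop) :
    ∃ ρ : ℕ → ℝ, Tendsto ρ atTop (𝓝 0) ∧ ∀ᶠ n in atTop, ∀ p,
      ∑ q, |mainCov σ ϑ₂ ϑ₁ b T (M n) (N n) p q| ≤ ρ n := by
  obtain ⟨B₁, hB₁, hrow₁⟩ := exists_sum_Lam_le
  obtain ⟨B₂, hB₂, hrow₂⟩ := exists_sum_Lam_le_of_one_le
  have hϑ := hadm.2.1
  have hl := lamConst_pos
  have hq := tendsto_sqrt_mul_atTop hM hN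
  set s : ℝ := √((1 - 2 * b) * T) with hs
  have hs0 : 0 < s := Real.sqrt_pos.2 (mul_pos (by linarith) hT)
  set D : ℝ := σ ^ 2 / (2 * lamConst)
  refine ⟨fun n ↦ D * (B₁ * (1 / √((M n : ℝ) * N n) +
    (1 - 2 * b) / (√ϑ₂ * s) * √(meshSpace b (M n))) + B₂ * (1 / √√((M n : ℝ) * N n))), ?_, ?_⟩
  · have h1 : Tendsto (fun n ↦ 1 / √((M n : ℝ) * N n)) atTop (𝓝 0) := hq.const_div_atTop 1
    have h2 : Tendsto (fun n ↦ 1 / √√((M n : ℝ) * N n)) atTop (𝓝 0) :=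
      (Real.tendsto_sqrt_atTop.comp hq).const_div_atTop 1
    have h3 := (tendsto_meshSpace b hM).sqrt
    simpa using (((h1.add (h3.const_mul ((1 - 2 * b) / (√ϑ₂ * s)))).const_mul B₁).add
      (h2.const_mul B₂)).const_mul D
  filter_upwards [hM.eventually_gt_atTop 0, hN.eventually_gt_atTop 0,
    eventually_le_Phi hadm hb hb2 hT hM hN] with n hMn hNn hΦ p
  have hD := mainVar_pos (ϑ₁ := ϑ₁) hϑ hb hb2 hT hMn hNn
  have hA := amplitude_pos (ϑ₁ := ϑ₁) (b := b) hϑ hT (M n) hNn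
  have hh := meshRatio_pos (b := b) hϑ hb2 hT hMn hNn
  have hM0 : (0 : ℝ) < M n := by exact_mod_cast hMn
  have hN0 : (0 : ℝ) < N n := by exact_mod_cast hNn
  have hsq := sqrt_mul_sqrt_mesh hb2 hT hMn hNn
  have hd := Real.sqrt_pos.2 (meshTime_pos hT hNn)
  have hδ := meshSpace_pos hb2 hMn
  have ha := Real.sqrt_pos.2 hδ
  have hδ2 := Real.sq_sqrt hδ.le
  have hMδ := natCast_mul_meshSpace b hMn
  have hl0 := le_neg_Lam_zero_zero hh.le
  have hrat : meshRatio ϑ₂ b T (M n) (N n) =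
      meshSpace b (M n) / (√ϑ₂ * √(meshTime T (N n))) := by
    rw [meshRatio, Real.sqrt_mul hϑ.le]
  have hr1 := hrow₁ (N n) (M n) _ hh.le p
  have hr2 := fun h ↦ hrow₂ (N n) (M n) (meshRatio ϑ₂ b T (M n) (N n)) h p
  set R := ∑ q : Fin (N n) × Fin (M n),
    |Lam (meshRatio ϑ₂ b T (M n) (N n)) ((p.1 : ℤ) - q.1) ((p.2 : ℤ) - q.2)| with hR
  have hR0 : 0 ≤ R := Finset.sum_nonneg fun _ _ ↦ abs_nonneg _
  have hq0 : 0 < √((M n : ℝ) * N n) := by positivity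
  set Φ := Phi ϑ₂ ϑ₁ (meshSpace b (M n)) (meshTime T (N n)) with hΦdef
  have hΦ0 : 0 < Φ := by linarith
  have e1 : ∑ q, |mainCov σ ϑ₂ ϑ₁ b T (M n) (N n) p q| =
      σ ^ 2 * (amplitude ϑ₂ ϑ₁ b T (M n) (N n) / Φ) * (R / √((M n : ℝ) * N n)) := by
    have (q : Fin (N n) × Fin (M n)) : |mainCov σ ϑ₂ ϑ₁ b T (M n) (N n) p q| =
        σ ^ 2 * (amplitude ϑ₂ ϑ₁ b T (M n) (N n) / Φ) / √((M n : ℝ) * N n) *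
        |Lam (meshRatio ϑ₂ b T (M n) (N n)) ((p.1 : ℤ) - q.1) ((p.2 : ℤ) - q.2)| := by
      rw [mainCov, normFactor, ← hΦdef, abs_neg, abs_mul, abs_mul, abs_mul, abs_of_pos hA,
        abs_of_nonneg (sq_nonneg σ), abs_of_pos (by positivity)]
      field_simp
    simp_rw [this, ← Finset.mul_sum]
    rw [← hR]
    ring
  set h := meshRatio ϑ₂ b T (M n) (N n)
  have hmin : 0 < min h 1 := lt_min hh one_pos
  have e2 : amplitude ϑ₂ ϑ₁ b T (M n) (N n) / Φ ≤ 1 / (2 * lamConst * min h 1) := by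
    rw [div_le_div_iff₀ hΦ0 (by positivity), one_mul]
    have h1 := mul_le_mul_of_nonneg_left hl0 hA.le
    rw [mainVar] at hΦ
    linarith
  have e3 : R / √((M n : ℝ) * N n) / min h 1 ≤ B₁ * (1 / √((M n : ℝ) * N n) +
    (1 - 2 * b) / (√ϑ₂ * s) * √(meshSpace b (M n))) + B₂ * (1 / √√((M n : ℝ) * N n)) := by
    have hb3 : 0 < 1 - 2 * b := by linarith
    rcases le_total h 1 with h1 | h1
    · rw [min_eq_left h1]
      have e4 : (M n : ℝ) * h / √((M n : ℝ) * N n) =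
          (1 - 2 * b) / (√ϑ₂ * s) * √(meshSpace b (M n)) := by
        rw [hrat, hs, ← hsq, ← hMδ]
        field_simp
      calc R / √((M n : ℝ) * N n) / h ≤ B₁ * (h + M n * h ^ 2) / √((M n : ℝ) * N n) / h := by
            gcongr
        _ = B₁ * (1 / √((M n : ℝ) * N n) + (M n : ℝ) * h / √((M n : ℝ) * N n)) := by
            field_simp
        _ = B₁ * (1 / √((M n : ℝ) * N n) +
            (1 - 2 * b) / (√ϑ₂ * s) * √(meshSpace b (M n))) := by rw [e4]
        _ ≤ _ := le_add_of_nonneg_right (by positivity)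
    · rw [min_eq_right h1, div_one]
      calc R / √((M n : ℝ) * N n) ≤ B₂ * √√((M n : ℝ) * N n) / √((M n : ℝ) * N n) := by
            gcongr
            exact hr2 h1
        _ = B₂ * (1 / √√((M n : ℝ) * N n)) := by
            have h5 := Real.sq_sqrt hq0.le
            have h6 : 0 < √√((M n : ℝ) * N n) := Real.sqrt_pos.2 hq0
            rw [mul_div_assoc]
            congr 1
            rw [div_eq_div_iff hq0.ne' h6.ne']
            linarith
        _ ≤ _ := le_add_of_nonneg_left (by positivity)
  rw [e1]
  calc σ ^ 2 * (amplitude ϑ₂ ϑ₁ b T (M n) (N n) / Φ) * (R / √((M n : ℝ) * N n))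
      ≤ σ ^ 2 * (1 / (2 * lamConst * min h 1)) * (R / √((M n : ℝ) * N n)) := by gcongr
    _ = D * (R / √((M n : ℝ) * N n) / min h 1) := by
      simp only [D]
      field_simp
    _ ≤ _ := mul_le_mul_of_nonneg_left e3 (by positivity)

lemma incrementCov_comm (M N : ℕ) (i k j l : ℕ) :
    incrementCov σ ϑ₂ ϑ₁ ϑ₀ b T M N i k j l = incrementCov σ ϑ₂ ϑ₁ ϑ₀ b T M N j l i k := by
  rw [incrementCov, incrementCov]
  refine tsum_congr fun n ↦ ?_
  congr 1
  · have h1 : |(j : ℝ) - i + 1| = |(i : ℝ) - j - 1| := by rw [← abs_neg]; ring_nf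
    have h2 : |(j : ℝ) - i - 1| = |(i : ℝ) - j + 1| := by rw [← abs_neg]; ring_nf
    simp only [secondDiff, modeCov, h1, h2, abs_sub_comm (j : ℝ) i]
    ring
  · ring

/-- The diagonal bias `K e / Φ` of each increment is multiplied by `MN / √(MN) = √(MN)`;
`bias_rate_le` was shaped for exactly this quotient. -/
lemma tendsto_trace_sub (hadm : Admissible σ ϑ₂ ϑ₁ ϑ₀) (hb : 0 < b) (hb2 : b < 1 / 2)
    (hT : 0 < T) {M N : ℕ → ℕ} (hM : Tendsto M atTop atTop) (hN : Tendsto N atTop atTop) :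
    Tendsto (fun n ↦ ∑ p : Fin (N n) × Fin (M n), normFactor ϑ₂ ϑ₁ b T (M n) (N n) *
      incrementCov σ ϑ₂ ϑ₁ ϑ₀ b T (M n) (N n) p.1 p.2 p.1 p.2 - √((M n : ℝ) * N n) * σ ^ 2)
      atTop (𝓝 0) := by
  obtain ⟨K, hK, hbd⟩ := exists_incrementCov_bounds hadm hb hb2 hT
  obtain ⟨c, hc, hlow⟩ := exists_le_mainVar (ϑ₁ := ϑ₁) hadm.2.1 hb hb2 hT
  have h0 := (tendsto_bias_rate b T hM hN).const_mul (2 * K / c)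
  rw [mul_zero] at h0
  refine squeeze_zero_norm' ?_ h0
  filter_upwards [hM.eventually_gt_atTop 0, hN.eventually_gt_atTop 0,
    eventually_le_Phi hadm hb hb2 hT hM hN] with n hMn hNn hΦ
  obtain ⟨-, hdiag, -⟩ := hbd (M n) (N n) hMn hNn
  have hl := hlow (M n) (N n) hMn hNn
  have hd := Real.sqrt_pos.2 (meshTime_pos hT hNn)
  have hδ := meshSpace_pos hb2 hMn
  have hm := lt_min hδ hd
  have hM0 : (0 : ℝ) < M n := by exact_mod_cast hMn
  have hN0 : (0 : ℝ) < N n := by exact_mod_cast hNn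
  have hq0 : 0 < √((M n : ℝ) * N n) := by positivity
  have hq2 : √((M n : ℝ) * N n) ^ 2 = M n * N n := Real.sq_sqrt (by positivity)
  have hrate := bias_rate_le hb2 hT hMn hNn
  have hΦ0 : 0 < Phi ϑ₂ ϑ₁ (meshSpace b (M n)) (meshTime T (N n)) := by
    have := mainVar_pos (ϑ₁ := ϑ₁) hadm.2.1 hb hb2 hT hMn hNn
    linarith
  set δ := meshSpace b (M n)
  set Δ := meshTime T (N n)
  set Φ := Phi ϑ₂ ϑ₁ δ Δ
  set q := √((M n : ℝ) * N n) with hq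
  set e := min (δ ^ 2 * √Δ) (Δ * √Δ) + δ ^ 2 * Δ
  have he : 0 ≤ e := by have := meshTime_pos hT hNn; positivity
  have hf : normFactor ϑ₂ ϑ₁ b T (M n) (N n) = 1 / (q * Φ) := rfl
  have e1 : ∑ p : Fin (N n) × Fin (M n), normFactor ϑ₂ ϑ₁ b T (M n) (N n) *
      incrementCov σ ϑ₂ ϑ₁ ϑ₀ b T (M n) (N n) p.1 p.2 p.1 p.2 - q * σ ^ 2 =
      ∑ p : Fin (N n) × Fin (M n), 1 / (q * Φ) *
        (incrementCov σ ϑ₂ ϑ₁ ϑ₀ b T (M n) (N n) p.1 p.2 p.1 p.2 - σ ^ 2 * Φ) := by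
    simp only [mul_sub, Finset.sum_sub_distrib, hf, Finset.sum_const, Finset.card_univ,
      Fintype.card_prod, Fintype.card_fin, nsmul_eq_mul]
    congr 1
    push_cast
    rw [mul_comm (N n : ℝ), ← hq2]
    field_simp
  rw [e1, Real.norm_eq_abs]
  calc |∑ p : Fin (N n) × Fin (M n), 1 / (q * Φ) *
        (incrementCov σ ϑ₂ ϑ₁ ϑ₀ b T (M n) (N n) p.1 p.2 p.1 p.2 - σ ^ 2 * Φ)|
      ≤ ∑ _p : Fin (N n) × Fin (M n), 1 / (q * Φ) * (K * e) := by
        refine (Finset.abs_sum_le_sum_abs _ _).trans (Finset.sum_le_sum fun p _ ↦ ?_)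
        rw [abs_mul, abs_of_pos (by positivity)]
        gcongr
        exact hdiag _ _ p.1.2 p.2.2
    _ = K * (q * e) / Φ := by
      simp only [Finset.sum_const, Finset.card_univ, Fintype.card_prod, Fintype.card_fin,
        nsmul_eq_mul]
      push_cast
      rw [mul_comm (N n : ℝ), ← hq2]
      field_simp
    _ ≤ K * (q * e) / (c / 2 * min δ √Δ) := by
      gcongr
      linarith
    _ = 2 * K / c * (q * e / min δ √Δ) := by field_simp
    _ ≤ _ := by gcongr

lemma tendsto_ofReal_meshRatio (hϑ : 0 < ϑ₂) {M N : ℕ → ℕ} {r : ℝ≥0∞}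
    (h : SamplingRegime (fun n ↦ meshSpace b (M n) / √(meshTime T (N n))) r) :
    Tendsto (fun n ↦ ENNReal.ofReal (meshRatio ϑ₂ b T (M n) (N n))) atTop
      (𝓝 (r / ENNReal.ofReal √ϑ₂)) := by
  have hs : 0 < √ϑ₂ := Real.sqrt_pos.2 hϑ
  have e (n : ℕ) : meshRatio ϑ₂ b T (M n) (N n) =
      meshSpace b (M n) / √(meshTime T (N n)) / √ϑ₂ := by
    rw [meshRatio, Real.sqrt_mul hϑ.le, div_div, mul_comm √ϑ₂]
  simp_rw [e]
  rcases h with ⟨rfl, h⟩ | ⟨rfl, h⟩ | ⟨r₀, -, rfl, h⟩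
  · simpa using ENNReal.tendsto_ofReal (h.div_const √ϑ₂)
  · rw [ENNReal.top_div_of_ne_top ENNReal.ofReal_ne_top]
    exact ENNReal.tendsto_ofReal_atTop.comp (h.atTop_div_const hs)
  · simp_rw [h, ENNReal.ofReal_div_of_pos hs]
    exact tendsto_const_nhds

/-- The factor `1 / (√(MN) Φ)` and the weight `exp(κ y_k)` enter each squared Gaussian coordinate
through their square roots, which requires `Φ > 0`. -/
lemma sqrt_mul_realizedVariation_sub {Ω : Type*} (X : ℝ≥0 → ℝ → Ω → ℝ) {M N : ℕ} (hM : 0 < M)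
    (hN : 0 < N) (hΦ : 0 < Phi ϑ₂ ϑ₁ (meshSpace b M) (meshTime T N)) (ω : Ω) :
    √((M : ℝ) * N) * (realizedVariation X ϑ₂ ϑ₁ b T M N ω - σ ^ 2) =
      ∑ p : Fin N × Fin M, (√(normFactor ϑ₂ ϑ₁ b T M N) *
        (Real.exp (kappa ϑ₂ ϑ₁ * gridSpace b M p.2 / 2) *
          doubleIncrement X b T M N p.1 p.2 ω)) ^ 2 - √((M : ℝ) * N) * σ ^ 2 := by
  have hM0 : (0 : ℝ) < M := by exact_mod_cast hM
  have hN0 : (0 : ℝ) < N := by exact_mod_cast hN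
  have hq0 : 0 < √((M : ℝ) * N) := by positivity
  have hq2 : √((M : ℝ) * N) ^ 2 = M * N := Real.sq_sqrt (by positivity)
  have hf : 0 ≤ normFactor ϑ₂ ϑ₁ b T M N := by rw [normFactor]; positivity
  have e (p : Fin N × Fin M) : (√(normFactor ϑ₂ ϑ₁ b T M N) *
        (Real.exp (kappa ϑ₂ ϑ₁ * gridSpace b M p.2 / 2) *
          doubleIncrement X b T M N p.1 p.2 ω)) ^ 2 = normFactor ϑ₂ ϑ₁ b T M N *
      (Real.exp (kappa ϑ₂ ϑ₁ * gridSpace b M p.2) * doubleIncrement X b T M N p.1 p.2 ω ^ 2) := by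
    rw [mul_pow, Real.sq_sqrt hf, mul_pow, ← Real.exp_nat_mul]
    congr 3
    push_cast
    ring
  simp_rw [e, ← Finset.mul_sum]
  rw [mul_sub, realizedVariation, Finset.sum_comm, Finset.sum_range, Fintype.sum_prod_type]
  simp_rw [Finset.sum_range]
  congr 1
  rw [← mul_assoc]
  congr 1
  have hΦ' := hΦ.ne'
  rw [normFactor, mul_one_div, div_eq_div_iff (by positivity) (by positivity), one_mul,
    ← mul_assoc, ← sq, hq2]

end MainTheorem

open SPDE in
/-- Central limit theorem for the rescaled realized space-time quadratic variation. -/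
theorem tendstoInDistribution_realizedVariation
    {Ω : Type*} [MeasurableSpace Ω] (P : Measure Ω) [IsProbabilityMeasure P]
    {σ ϑ₂ ϑ₁ ϑ₀ : ℝ} (hadm : Admissible σ ϑ₂ ϑ₁ ϑ₀)
    {β u : ℕ → ℝ≥0 → Ω → ℝ} {X : ℝ≥0 → ℝ → Ω → ℝ}
    (hX : IsStationarySolution P σ ϑ₂ ϑ₁ ϑ₀ β u X)
    {T : ℝ} (hT : 0 < T) {b : ℝ} (hb : 0 < b) (hb2 : b < 1 / 2)
    {M N : ℕ → ℕ} (hM : Tendsto M atTop atTop) (hN : Tendsto N atTop atTop) {r : ℝ≥0∞}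
    (hr : SamplingRegime (fun n ↦ meshSpace b (M n) / √(meshTime T (N n))) r) :
    TendstoInDistribution
      (fun n ω ↦ √((M n : ℝ) * N n) *
        (realizedVariation X ϑ₂ ϑ₁ b T (M n) (N n) ω - σ ^ 2))
      atTop (id : ℝ → ℝ) (fun _ ↦ P)
      (gaussianReal 0 (asympVar (r / ENNReal.ofReal √ϑ₂) * σ ^ 4).toNNReal) := by
  obtain ⟨ρ, hρ, hrow⟩ := exists_tendsto_mainCov_row hadm hb hb2 hT hM hN
  have hmain := tendsto_sum_sq_mainCov hadm hb hb2 hT hM hN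
    (tendsto_ofReal_meshRatio hadm.2.1 hr)
  have hrem := tendsto_sum_sq_remCov hadm hb hb2 hT hM hN
  have hpos : ∀ᶠ n in atTop, 0 < Phi ϑ₂ ϑ₁ (meshSpace b (M n)) (meshTime T (N n)) := by
    filter_upwards [hM.eventually_gt_atTop 0, hN.eventually_gt_atTop 0,
      eventually_le_Phi hadm hb hb2 hT hM hN] with n hMn hNn hΦ
    have := mainVar_pos (ϑ₁ := ϑ₁) hadm.2.1 hb hb2 hT hMn hNn
    linarith
  -- The coordinates carry the square root of the factor, and its square recovers the factor only
  -- once `Φ` is positive, which holds eventually.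
  have hfac : ∀ᶠ n in atTop, √(normFactor ϑ₂ ϑ₁ b T (M n) (N n)) ^ 2 =
      normFactor ϑ₂ ϑ₁ b T (M n) (N n) := by
    filter_upwards [hpos] with n hn
    exact Real.sq_sqrt (by rw [normFactor]; positivity)
  -- The operator norm is bounded by the row sums of the `Λ` part plus the Frobenius norm of the
  -- remainder; the remainder has no usable uniform row bound.
  refine tendstoInDistribution_gaussian_quadratic (κ := fun n ↦ Fin (N n) × Fin (M n))
    (ξ := fun n p ω ↦ √(normFactor ϑ₂ ϑ₁ b T (M n) (N n)) *
      (Real.exp (kappa ϑ₂ ϑ₁ * gridSpace b (M n) p.2 / 2) *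
        doubleIncrement X b T (M n) (N n) p.1 p.2 ω))
    (S := fun n ↦ Matrix.of fun p q ↦ √(normFactor ϑ₂ ϑ₁ b T (M n) (N n)) ^ 2 *
      incrementCov σ ϑ₂ ϑ₁ ϑ₀ b T (M n) (N n) p.1 p.2 q.1 q.2)
    (s := fun n ↦ √((M n : ℝ) * N n) * σ ^ 2)
    (ρ := fun n ↦ ρ n + √(∑ p, ∑ q, remCov σ ϑ₂ ϑ₁ ϑ₀ b T (M n) (N n) p q ^ 2))
    (fun n ↦ ?_) ?_ (fun n ↦ ?_) ?_ ?_ ?_ ?_ ?_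
  · refine ((AEMeasurable.const_mul ?_ _).sub_const _).const_mul _
    refine Finset.aemeasurable_fun_sum _ fun k hk ↦ Finset.aemeasurable_fun_sum _ fun i _ ↦ ?_
    exact ((hX.aemeasurable_doubleIncrement hb hb2 (Finset.mem_range.1 hk)).pow_const 2).const_mul _
  · filter_upwards [hN.eventually_gt_atTop 0] with n hNn
    exact hX.isCenteredGaussianVector hadm hb hb2 hT hNn _
  · ext p q
    simp [incrementCov_comm (M n) (N n) (p.1 : ℕ)]
  · filter_upwards [hM.eventually_gt_atTop 0, hN.eventually_gt_atTop 0, hpos] with n hMn hNn hΦ ω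
    exact sqrt_mul_realizedVariation_sub X hMn hNn hΦ ω
  · refine (tendsto_trace_sub hadm hb hb2 hT hM hN).congr' ?_
    filter_upwards [hfac] with n hn
    simp [Matrix.trace, hn]
  -- The factor `2` is removed before the remainder is added, since the perturbation lemma concerns
  -- bare Frobenius norms.
  · have h1 := (hmain.const_mul (1 / 2)).congr fun n ↦ by
      rw [← mul_assoc, one_div_mul_cancel two_ne_zero, one_mul]
    have h2 := (tendsto_sum_add_sq h1 hrem).const_mul 2
    rw [← mul_assoc, mul_one_div_cancel two_ne_zero, one_mul] at h2
    refine h2.congr' ?_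
    filter_upwards [hfac] with n hn
    simp [mainCov_add_remCov, hn]
  · simpa using hρ.add hrem.sqrt
  · filter_upwards [hfac, hrow] with n hn hr x
    simp only [Matrix.of_apply, hn, ← mainCov_add_remCov, mul_add, Finset.sum_add_distrib,
      add_mul]
    refine add_le_add (sum_mul_mul_le_of_row_sum_le (fun p q ↦ ?_) hr x)
      (sum_mul_mul_le_sqrt_sum_sq _ x)
    rw [mainCov, mainCov, ← Lam_abs, ← Lam_abs _ ((q.1 : ℤ) - p.1), abs_sub_comm (q.1 : ℤ),
      abs_sub_comm (q.2 : ℤ)]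

theorem mainTheorem1 :
    ∃ C : ℝ≥0∞ → ℝ, SPDE.IsAsymptoticVariance C ∧
      ∀ {Ω : Type*} [MeasurableSpace Ω] (P : Measure Ω) [IsProbabilityMeasure P]
        (σ ϑ₂ ϑ₁ ϑ₀ : ℝ) (_ : SPDE.Admissible σ ϑ₂ ϑ₁ ϑ₀)
        (β u : ℕ → ℝ≥0 → Ω → ℝ) (X : ℝ≥0 → ℝ → Ω → ℝ)
        (_ : SPDE.IsStationarySolution P σ ϑ₂ ϑ₁ ϑ₀ β u X)
        (T : ℝ) (_ : 0 < T) (b : ℝ) (_ : 0 < b) (_ : b < 1 / 2)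
        (M N : ℕ → ℕ) (_ : Tendsto M atTop atTop) (_ : Tendsto N atTop atTop)
        (r : ℝ≥0∞)
        (_ : SPDE.SamplingRegime
          (fun n ↦ SPDE.meshSpace b (M n) / √(SPDE.meshTime T (N n))) r),
        TendstoInDistribution
          (fun n ω ↦ √((M n : ℝ) * N n) *
            (SPDE.realizedVariation X ϑ₂ ϑ₁ b T (M n) (N n) ω - σ ^ 2))
          atTop (id : ℝ → ℝ) (fun _ ↦ P)
          (gaussianReal 0 (C (r / ENNReal.ofReal √ϑ₂) * σ ^ 4).toNNReal) := by
  exact ⟨asympVar, isAsymptoticVariance_asympVar,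
    fun P _ _ _ _ _ hadm _ _ _ hX _ hT _ hb hb2 _ _ hM hN _ hr ↦
      tendstoInDistribution_realizedVariation P hadm hX hT hb hb2 hM hN hr⟩
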